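/- **Setting.** Let $d\ge 3$ and $\mathfrak w\in\mathbb R^d\setminus\{0\}$, let $\mathbb T^d$ be the torus of side $2\pi$, $e_k(x)=(2\pi)^{-d/2}e^{\iota k\cdot x}$ (with $\iota=\sqrt{-1}$), and $\hat f(k_{1:n})=\int_{\mathbb T^{dn}} f(x_{1:n})\prod_{j} e_{-k_j}(x_j)\,dx_{1:n}$. Let $\Gamma L^2=\bigoplus_{n\ge0}\Gamma L^2_n$ be the Fock space, where $\Gamma L^2_n$ is the space of symmetric functions in $L^2(\mathbb T^{dn})$ with zero mean in each variable (i.e. $\hat f(k_{1:n})=0$ if some $k_j=0$), with norm $\|f\|^2=\sum_n n!\,\|f_n\|_{L^2(\mathbb T^{dn})}^2$. All limits $\varepsilon\to0$ are along $\varepsilon>0$ with $1/\varepsilon\in\mathbb N+\tfrac12$; put $\lambda_\varepsilon=\varepsilon^{d/2-1}$ and $$\mathbb J^\varepsilon_{\ell,m}=\mathbf 1\{0<\varepsilon|\ell|_\infty\le1,\ 0<\varepsilon|m|_\infty\le1,\ 0<\varepsilon|\ell+m|_\infty\le1\}.$$ For $f\in\Gamma L^2_n$, with $|k_{1:n}|^2=\sum_j|k_j|^2$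 (Euclidean norms), let $$\widehat{\mathcal L_0f}(k_{1:n})=-\tfrac12|k_{1:n}|^2\hat f(k_{1:n}),\qquad \widehat{\mathcal L_0^{\mathfrak w}f}(k_{1:n})=-\tfrac12\sum_{j=1}^n(\mathfrak w\cdot k_j)^2\hat f(k_{1:n}),$$ $$\widehat{\mathcal A^\varepsilon_+f}(k_{1:n+1})=-\frac{2\iota}{(2\pi)^{d/2}}\frac{\lambda_\varepsilon}{n+1}\sum_{1\le i<j\le n+1}[\mathfrak w\cdot(k_i+k_j)]\,\mathbb J^\varepsilon_{k_i,k_j}\,\hat f(k_i+k_j,k_{\{1:n+1\}\setminus\{i,j\}}),$$ and $\mathcal A^\varepsilon_-=-(\mathcal A^\varepsilon_+)^*$, that is, $$\widehat{\mathcal A^\varepsilon_-f}(k_{1:n-1})=-\frac{\iota}{(2\pi)^{d/2}}\,n\,\lambda_\varepsilon\sum_{j=1}^{n-1}(\mathfrak w\cdot k_j)\sum_{\ell+m=k_j}\mathbb J^\varepsilon_{\ell,m}\,\hat f(\ell,m,k_{\{1:n-1\}\setminus\{j\}}).$$ Let $P^n_i$ be the projection onto $\bigoplus_{j=i}^n\Gamma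 L^2_j$ and $\mathcal L^\varepsilon_{i,n}=\mathcal L_0+P^n_i(\mathcal A^\varepsilon_++\mathcal A^\varepsilon_-)P^n_i$. For smooth $\phi,\psi:\mathbb T^d\to\mathbb C$ let $f_1=\phi$ and $f_2=\tfrac12(\phi\otimes\psi+\psi\otimes\phi)$, viewed in $\Gamma L^2_1$ and $\Gamma L^2_2$ (components with a vanishing frequency are dropped). **Statement.** For $i\in\{2,3\}$, all $n\ge i$, all $\phi,\psi$ and all $\varepsilon$ as above, the equation $$-\mathcal L^\varepsilon_{i,n}v^{\varepsilon,n}=\mathcal A^\varepsilon_+f_{i-1}$$ has a unique solution $v^{\varepsilon,n}\in\bigoplus_{j=i}^n\Gamma L^2_j$; write $v^{\varepsilon,n}_i$ for its component in $\Gamma L^2_i$. There are constants $D^m>0$, $m\ge2$, which do not depend on $\phi,\psi$ or $i$, such that for $i\in\{2,3\}$, all $n\ge i$ and all $\phi,\psi$, $$\lim_{\varepsilon\to0}\big\|(-\mathcal L_0)^{-1/2}\big[\mathcal A^\varepsilon_-v^{\varepsilon,n}_i-D^{n-i+2}\mathcal L_0^{\mathfrak w}f_{i-1}\big]\big\|=0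 .$$ They are unique: for each such $i$ and $n$, $D^{n-i+2}$ is the only real number for which this limit holds for all $\phi,\psi$. Moreover, for the same $i,n,\phi,\psi$, $\|v^{\varepsilon,n}\|\to0$ as $\varepsilon\to0$. -/

import Mathlib

open Filter Topology MeasureTheory
open scoped ENNReal ContDiff

noncomputable section

namespace BurgersFock

/-! ### Frequencies, test functions, and the Fock space in Fourier coordinates -/

/-- Frequencies of the torus of side length `2π`. -/
abbrev Freq (d : ℕ) : Type := Fin d → ℤ

/-- The product `w · k` of a vector with a frequency. -/
def dot {d : ℕ} (w : Fin d → ℝ) (k : Freq d) : ℝ := ∑ a, w a * (k a : ℝ)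

/-- The squared Euclidean norm `|k_{1:n}|² = ∑ j, |k_j|²`. -/
def normSq {d n : ℕ} (k : Fin n → Freq d) : ℝ := ∑ j, ∑ a, ((k j a : ℤ) : ℝ) ^ 2

/-- The Fourier basis `e_k(x) = (2π)^{-d/2} exp(i k · x)`. -/
def fourierBasis {d : ℕ} (k : Freq d) (x : Fin d → ℝ) : ℂ :=
  (((2 * Real.pi) ^ (-(d : ℝ) / 2) : ℝ) : ℂ) *
    Complex.exp (Complex.I * ((∑ a, (k a : ℝ) * x a : ℝ) : ℂ))

/-- Smooth functions on the torus, as smooth functions on the whole space which are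
`2π`-periodic in every coordinate. -/
def IsTorusTest {d : ℕ} (φ : (Fin d → ℝ) → ℂ) : Prop :=
  ContDiff ℝ ∞ φ ∧
    ∀ (x : Fin d → ℝ) (m : Fin d → ℤ), φ (fun a => x a + 2 * Real.pi * (m a : ℝ)) = φ x

/-- Fourier coefficients of a function of `n` torus variables: its integral against
`∏ j, e_{-k_j}(x_j)` over one period. -/
def fourierCoeffs {d n : ℕ} (F : (Fin n → Fin d → ℝ) → ℂ) (k : Fin n → Freq d) : ℂ :=
  ∫ x in Set.univ.pi (fun _ : Fin n => Set.univ.pi (fun _ : Fin d => Set.Ioc 0 (2 * Real.pi))),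
    F x * ∏ j, fourierBasis (-(k j)) (x j)

/-- A sequence of kernels, one in each chaos, each given by its Fourier coefficients.
All operators below act on such sequences; the elements of the Fock space are singled out
by `IsFock`. -/
abbrev Kernels (d : ℕ) : Type := (n : ℕ) → (Fin n → Freq d) → ℂ

/-- The Fock norm, `‖f‖² = ∑ n, n! ‖f_n‖²_{L²}`, with the `L²` norm computed by Parseval. It takes
values in `[0, ∞]`, so that it is meaningful without a summability assumption. -/
def fockNorm {d : ℕ} (f : Kernels d) : ℝ≥0∞ :=
  (∑' n : ℕ, (n.factorial : ℝ≥0∞) * ∑' k : Fin n → Freq d, ‖f n k‖ₑ ^ 2) ^ (1 / 2 : ℝ)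

/-- Elements of the Fock space: every kernel is symmetric, has zero mean in each of its variables,
and the Fock norm is finite. -/
structure IsFock {d : ℕ} (f : Kernels d) : Prop where
  symm : ∀ (n : ℕ) (σ : Equiv.Perm (Fin n)) (k : Fin n → Freq d), f n (k ∘ σ) = f n k
  zero_mode : ∀ (n : ℕ) (k : Fin n → Freq d), (∃ j, k j = 0) → f n k = 0
  finite : fockNorm f ≠ ⊤

/-- The element of the `n`-th chaos with kernel `F` (its components with a vanishing frequency
are projected out). -/
def ofKernel {d : ℕ} (n : ℕ) (F : (Fin n → Fin d → ℝ) → ℂ) : Kernels d :=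
  Pi.single n (fun k => open Classical in if ∃ j, k j = 0 then 0 else fourierCoeffs F k)

/-- `f_1 = φ` in the first chaos and `f_2 = (φ ⊗ ψ + ψ ⊗ φ) / 2` in the second. -/
def seed {d : ℕ} (φ ψ : (Fin d → ℝ) → ℂ) : ℕ → Kernels d
  | 1 => ofKernel 1 (fun x => φ (x 0))
  | 2 => ofKernel 2 (fun x => (φ (x 0) * ψ (x 1) + ψ (x 0) * φ (x 1)) / 2)
  | _ => 0

/-- The component of `f` in the `i`-th chaos, as an element of the Fock space. -/
def component {d : ℕ} (i : ℕ) (f : Kernels d) : Kernels d := Pi.single i (f i)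

/-- The projection onto the chaoses of index between `i` and `n`. -/
def proj {d : ℕ} (i n : ℕ) (f : Kernels d) : Kernels d :=
  fun j => if i ≤ j ∧ j ≤ n then f j else 0

/-! ### The operators -/

/-- `𝓛₀`: the Fourier multiplier `-|k_{1:n}|² / 2`. -/
def L0 {d : ℕ} (f : Kernels d) : Kernels d :=
  fun n k => ((-(1 / 2) * normSq k : ℝ) : ℂ) * f n k

/-- The power `(-𝓛₀)^s`: the Fourier multiplier `(|k_{1:n}|² / 2)^s`. -/
def negL0Pow {d : ℕ} (s : ℝ) (f : Kernels d) : Kernels d :=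
  fun n k => (((1 / 2 * normSq k) ^ s : ℝ) : ℂ) * f n k

/-- `𝓛₀^w`: the Fourier multiplier `-(1/2) ∑ j, (w · k_j)²`. -/
def L0w {d : ℕ} (w : Fin d → ℝ) (f : Kernels d) : Kernels d :=
  fun n k => ((-(1 / 2) * ∑ j, dot w (k j) ^ 2 : ℝ) : ℂ) * f n k

/-- The coupling constant `λ_ε = ε^{d/2-1}` in dimension `d ≥ 3`. -/
def coupling (d : ℕ) (ε : ℝ) : ℝ := ε ^ ((d : ℝ) / 2 - 1)

/-- The cut-off indicator of `0 < ε|ℓ|_∞ ≤ 1`, `0 < ε|m|_∞ ≤ 1`, `0 < ε|ℓ+m|_∞ ≤ 1`;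
the norm on `Fin d → ℤ` is the sup norm. -/
def cutoff {d : ℕ} (ε : ℝ) (l m : Freq d) : ℝ :=
  if (0 < ε * ‖l‖ ∧ ε * ‖l‖ ≤ 1) ∧ (0 < ε * ‖m‖ ∧ ε * ‖m‖ ≤ 1) ∧
      (0 < ε * ‖l + m‖ ∧ ε * ‖l + m‖ ≤ 1) then 1 else 0

/-- The creation part `𝒜^ε_+`. In chaos `n + 2` the double sum is over the pairs `i < j` of
indices of `Fin (n + 2)`, and the argument of `f` is `k_i + k_j` followed by the remaining `n`
frequencies in increasing order of their indices. -/
def Aplus {d : ℕ} (w : Fin d → ℝ) (ε : ℝ) (f : Kernels d) : Kernels d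
  | 0 => 0
  | 1 => 0
  | n + 2 => fun k =>
      -(2 * Complex.I / (((2 * Real.pi) ^ ((d : ℝ) / 2) : ℝ) : ℂ)) *
        ((coupling d ε / ((n : ℝ) + 2) : ℝ) : ℂ) *
        ∑ j : Fin (n + 2), ∑ i : Fin (n + 1),
          if i.castSucc < j then
            ((dot w (k i.castSucc + k j) * cutoff ε (k i.castSucc) (k j) : ℝ) : ℂ) *
              f (n + 1) (Fin.cons (k i.castSucc + k j) fun a => k (j.succAbove (i.succAbove a)))
          else 0

/-- The annihilation part `𝒜^ε_- = -(𝒜^ε_+)^*`. The component in chaos `n + 1` comes from the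
component `f (n + 2)`; the inner sum is over `ℓ + m = k_j` and has finitely many non-zero terms
because of the cut-off. -/
def Aminus {d : ℕ} (w : Fin d → ℝ) (ε : ℝ) (f : Kernels d) : Kernels d
  | 0 => 0
  | n + 1 => fun k =>
      -(Complex.I / (((2 * Real.pi) ^ ((d : ℝ) / 2) : ℝ) : ℂ)) *
        ((((n : ℝ) + 2) * coupling d ε : ℝ) : ℂ) *
        ∑ j : Fin (n + 1), ((dot w (k j) : ℝ) : ℂ) *
          ∑' l : Freq d, ((cutoff ε l (k j - l) : ℝ) : ℂ) *
            f (n + 2) (Fin.cons l (Fin.cons (k j - l) fun a => k (j.succAbove a)))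

/-- The truncated generator `𝓛^ε_{i,n} = 𝓛₀ + P (𝒜^ε_+ + 𝒜^ε_-) P`, where `P` is the projection
onto the chaoses `i, …, n`. -/
def truncGen {d : ℕ} (w : Fin d → ℝ) (ε : ℝ) (i n : ℕ) (f : Kernels d) : Kernels d :=
  L0 f + proj i n (Aplus w ε (proj i n f) + Aminus w ε (proj i n f))

/-- `v` solves the truncated generator equation `-𝓛^ε_{i,n} v = 𝒜^ε_+ f_{i-1}` in the
direct sum of the chaoses `i, …, n`. -/
structure IsTruncSol {d : ℕ} (w : Fin d → ℝ) (ε : ℝ) (i n : ℕ) (φ ψ : (Fin d → ℝ) → ℂ)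
    (v : Kernels d) : Prop where
  isFock : IsFock v
  proj_eq : proj i n v = v
  eqn : -truncGen w ε i n v = Aplus w ε (seed φ ψ (i - 1))

/-- The scales `ε > 0` with `1 / ε ∈ ℕ + 1/2`. -/
def scales : Set ℝ := {ε | 0 < ε ∧ ∃ N : ℕ, 1 / ε = (N : ℝ) + 1 / 2}

/-- `𝒜^ε_- v_i` is asymptotically `c 𝓛₀^w f_{i-1}`: for all test functions, with `v ε` the solution
of the truncated generator equation at scale `ε`,
`‖(-𝓛₀)^{-1/2} [𝒜^ε_- v_i - c 𝓛₀^w f_{i-1}]‖ → 0` as `ε → 0`. -/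
def HasDiffusivity {d : ℕ} (w : Fin d → ℝ) (i n : ℕ) (c : ℝ) : Prop :=
  ∀ φ ψ : (Fin d → ℝ) → ℂ, IsTorusTest φ → IsTorusTest ψ →
    ∀ v : ℝ → Kernels d, (∀ ε ∈ scales, IsTruncSol w ε i n φ ψ (v ε)) →
      Tendsto (fun ε => fockNorm (negL0Pow (-(1 / 2))
          (Aminus w ε (component i (v ε)) - c • L0w w (seed φ ψ (i - 1)))))
        (𝓝[scales] 0) (𝓝 0)

end BurgersFock

end

/-!
The proof works with the frequencies themselves. Multiplying the `n`-th kernel by `iⁿ √n!` and by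
the square root of the energy `E(k) = |k_{1:n}|² / 2` turns the truncated equation into
`u = T u + g` in `ℓ²`, where `T = genOp` is skew-adjoint with real matrix elements. In dimension at
least three a lattice sum (`sum_box_inv_sq_le`) bounds the norm of `T` uniformly in `ε`. Skew-adjoint
operators satisfy `‖u‖ ≤ ‖u - T u‖`, so `1 - T` is invertible; this is well-posedness
(`isSol_iff`). The relaxed iteration `u ↦ (1 - τ) u + τ (T u + g)` converges to the solution
geometrically, at a rate that depends only on the bound for `‖T‖` (`norm_relaxIter_sub_le`), hence
uniformly in `ε`.

**First chaos.** Annihilating the solution generated by a Fourier mode `K` gives back that mode,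
times `(w · K)² / 2` times the matrix element `⟨g, (1 - T)⁻¹ g⟩`, where `g = src ε K` is the
normalised source (`effOp_deltaOne`). To see that this matrix element converges, and to a limit
that does not depend on `K`, consider the families of vectors that are, up to normalisation, the
restrictions to the lattice `ε ℤ^d` of functions converging pointwise to a profile which does not
see `K` (`IsProfile`, `Approx`). After removing a small part of the norm at low energies, `g` is of
this type (`approx_src`), and the class is stable under creation and annihilation
(`Sampled.cre`, `Sampled.ann`), because the sums in them become integrals. It is then stable under
the relaxed iteration and, since the iteration converges uniformly, under the resolvent
(`Approx.resolvent`). Inner products within the class are Riemann sums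
(`Approx.tendsto_inner_src`). The limit `D` is real because the matrix elements of `T` are, and it
is positive because `Re ⟨g, (1 - T)⁻¹ g⟩ = ‖(1 - T)⁻¹ g‖²` is bounded below by a multiple of `‖g‖²`,
which does not tend to zero (`exists_diffusivity`). Members of the class live on energies of order
`ε⁻²`, up to a small part of the norm, so the unweighted solution `E^{-1/2} u` tends to zero
(`tendsto_invSqrt_resolvent_src`).

**Second chaos.** For a symmetrised pair of modes `p, q`, let `p` evolve as in the first chaos and
attach `q` to it as a spectator (`attOp`). This commutes with the generator except for the terms in
which the spectator splits or merges with another particle (`rawGen_attOp`), and the energy `E(q)` of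
the spectator itself is a bounded perturbation. The splitting of `q`
in the presence of the single mode `p` is the source of the system in which the roles of `p` and
`q` are exchanged (`symOp_splitOp_deltaOne`); all the other terms are of the size of the first-chaos
solution in the norm without the energy weight, hence negligible. The sum of the two attached
solutions is therefore close to the solution generated by the pair
(`exists_near_solOp_pairVec`), and annihilating it produces
`((w · p)² + (w · q)²) / 2` times the constant `D` of the system truncated one chaos lower, which
explains the index `n - i + 2`.

All operators involved are bounded uniformly in `ε`, so convergence on Fourier modes implies
convergence on every source of finite energy (`tendsto_zero_of_basis`), and the Fourier coefficients
of smooth functions decay fast enough for the seeds to be such sources (`exists_isSource_one`,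
`exists_isSource_two`). The constant is unique because the seed made of a mode `K` with
`w · K ≠ 0` is not annihilated by `𝓛₀^w` (`HasDiffusivity.eq`).
-/

open Filter Topology MeasureTheory
open scoped ENNReal ContDiff

noncomputable section

namespace BurgersFock

/-! ### Weighted composition operators on `ℓ²` and resolvents of skew-adjoint operators -/

/-- The Hilbert space `ℓ²(α; ℂ)`. -/
abbrev L2 (α : Type*) : Type _ := lp (fun _ : α => ℂ) 2

/-- The squared `ℓ²` norm of an arbitrary function, with values in `[0, ∞]`. -/
def sqENorm {α : Type*} (f : α → ℂ) : ℝ≥0∞ := ∑' x, ‖f x‖ₑ ^ 2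

section Toolbox

variable {α β : Type*}

lemma memLp_iff_sqENorm {f : α → ℂ} : Memℓp (E := fun _ : α => ℂ) f 2 ↔ sqENorm f ≠ ⊤ := by
  rw [memℓp_gen_iff (by norm_num)]
  have h : sqENorm f = ∑' x, ((‖f x‖₊ ^ 2 : NNReal) : ℝ≥0∞) := by
    simp [sqENorm, enorm_eq_nnnorm]
  rw [h, ENNReal.tsum_coe_ne_top_iff_summable, ← NNReal.summable_coe]
  norm_num

lemma enorm_sq_eq (u : L2 α) : ‖u‖ₑ ^ 2 = sqENorm u := by
  have h := lp.hasSum_norm (p := 2) (by norm_num) u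
  have h2 : HasSum (fun x => ‖u x‖₊ ^ 2) (‖u‖₊ ^ 2) := by
    rw [← NNReal.hasSum_coe]; push_cast; simpa using h
  have h3 := (ENNReal.hasSum_coe.2 h2).tsum_eq
  simp only [sqENorm, enorm_eq_nnnorm]
  simpa using h3.symm

lemma sqENorm_eq_ofReal (u : L2 α) : sqENorm u = ENNReal.ofReal (‖u‖ ^ 2) := by
  rw [← enorm_sq_eq, ← ofReal_norm, ENNReal.ofReal_pow (norm_nonneg _)]

lemma sqENorm_ne_top (u : L2 α) : sqENorm u ≠ ⊤ := by
  rw [sqENorm_eq_ofReal]; exact ENNReal.ofReal_ne_top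

lemma norm_le_of_sqENorm_le {u : L2 α} {C : ℝ} (hC : 0 ≤ C)
    (h : sqENorm u ≤ ENNReal.ofReal (C ^ 2)) : ‖u‖ ≤ C := by
  rw [sqENorm_eq_ofReal] at h
  have := (ENNReal.ofReal_le_ofReal_iff (by positivity)).1 h
  exact le_of_sq_le_sq this hC |>.trans le_rfl

lemma norm_apply_le (u : L2 α) (x : α) : ‖u x‖ ≤ ‖u‖ := lp.norm_apply_le_norm (by norm_num) u x

lemma sqENorm_mono {f g : α → ℂ} (h : ∀ x, ‖f x‖ ≤ ‖g x‖) : sqENorm f ≤ sqENorm g := by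
  refine ENNReal.tsum_le_tsum fun x => ?_
  gcongr
  simpa [← ofReal_norm] using ENNReal.ofReal_le_ofReal (h x)

lemma sqENorm_const_mul (c : ℂ) (f : α → ℂ) :
    sqENorm (fun x => c * f x) = ENNReal.ofReal (‖c‖ ^ 2) * sqENorm f := by
  rw [sqENorm, sqENorm, ← ENNReal.tsum_mul_left]
  refine tsum_congr fun x => ?_
  rw [enorm_mul, mul_pow, ENNReal.ofReal_pow (norm_nonneg _), ofReal_norm]

/-- The fibres of `π` carry at most mass `C²` of the squared weight `|m|²`. -/
def FiberBound (m : β → ℂ) (π : β → α) (C : ℝ) : Prop :=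
  0 ≤ C ∧ ∀ y, ∑' x, (open Classical in if π x = y then ‖m x‖ₑ ^ 2 else 0) ≤ ENNReal.ofReal (C ^ 2)

lemma sqENorm_comp_le {m : β → ℂ} {π : β → α} {C : ℝ} (h : FiberBound m π C) (f : α → ℂ) :
    sqENorm (fun x => m x * f (π x)) ≤ ENNReal.ofReal (C ^ 2) * sqENorm f := by
  classical
  have h1 : ∀ x, ‖m x * f (π x)‖ₑ ^ 2 =
      ∑' y, (if π x = y then ‖m x‖ₑ ^ 2 else 0) * ‖f y‖ₑ ^ 2 := by
    intro x
    rw [tsum_eq_single (π x)]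
    · simp [enorm_mul, mul_pow]
    · intro y hy; simp [hy.symm]
  rw [sqENorm]
  simp_rw [h1]
  rw [ENNReal.tsum_comm, sqENorm, ← ENNReal.tsum_mul_left]
  refine ENNReal.tsum_le_tsum fun y => ?_
  rw [ENNReal.tsum_mul_right]
  gcongr
  convert h.2 y

/-- A sum whose support lies in the range of `s` is at most the sum along `s`, even if `s` is not
injective. -/
lemma tsum_le_tsum_param {γ : Type*} (F : β → ℝ≥0∞) (s : γ → β)
    (h : ∀ x, F x ≠ 0 → ∃ l, s l = x) : ∑' x, F x ≤ ∑' l, F (s l) := by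
  have h1 : ∑' x, F x = ∑' x : Set.range s, F x := by
    rw [tsum_subtype_eq_of_support_subset]
    exact fun x hx => h x hx
  rw [h1]
  let e : Set.range s → γ := fun x => x.2.choose
  have he : ∀ x, s (e x) = x := fun x => x.2.choose_spec
  have hinj : Function.Injective e := fun a b hab => by
    apply Subtype.ext; rw [← he a, ← he b, hab]
  calc ∑' x : Set.range s, F x = ∑' x : Set.range s, F (s (e x)) := by simp_rw [he]
    _ ≤ ∑' l, F (s l) := ENNReal.tsum_comp_le_tsum_of_injective hinj (fun l => F (s l))

/-- A fibre bound obtained from a parametrisation `s y` of the part of the fibre over `y` on which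
the weight does not vanish. -/
lemma FiberBound.of_param {γ : Type*} {m : β → ℂ} {π : β → α} {C : ℝ} (hC : 0 ≤ C)
    (s : α → γ → β) (hs : ∀ x, m x ≠ 0 → ∃ l, s (π x) l = x)
    (hb : ∀ y, ∑' l, ‖m (s y l)‖ₑ ^ 2 ≤ ENNReal.ofReal (C ^ 2)) : FiberBound m π C := by
  classical
  refine ⟨hC, fun y => le_trans ?_ (hb y)⟩
  refine (tsum_le_tsum_param _ (s y) fun x hx => ?_).trans (ENNReal.tsum_le_tsum fun l => ?_)
  · by_cases hπ : π x = y
    · have : m x ≠ 0 := by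
        intro h0; simp [h0] at hx
      obtain ⟨l, hl⟩ := hs x this
      exact ⟨l, by rw [← hl, hπ]⟩
    · simp [hπ] at hx
  · split_ifs <;> simp

lemma memLp_comp {m : β → ℂ} {π : β → α} {C : ℝ} (h : FiberBound m π C) (f : L2 α) :
    Memℓp (E := fun _ : β => ℂ) (fun x => m x * f (π x)) 2 := by
  rw [memLp_iff_sqENorm]
  refine ne_top_of_le_ne_top ?_ (sqENorm_comp_le h f)
  exact ENNReal.mul_ne_top ENNReal.ofReal_ne_top (sqENorm_ne_top f)

open Classical in
/-- The weighted composition operator `(W f)(x) = m x * f (π x)`; it is set to `0` when the weight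
admits no fibre bound. -/
def wcomp (m : β → ℂ) (π : β → α) : L2 α →L[ℂ] L2 β :=
  if h : ∃ C, FiberBound m π C then
    LinearMap.mkContinuous
      { toFun := fun f => ⟨fun x => m x * f (π x), memLp_comp h.choose_spec f⟩
        map_add' := fun f g => by ext x; exact mul_add _ _ _
        map_smul' := fun c f => by ext x; simp; ring }
      h.choose (fun f => by
        have hC := h.choose_spec
        refine norm_le_of_sqENorm_le (mul_nonneg hC.1 (norm_nonneg _)) ?_
        refine (sqENorm_comp_le hC f).trans ?_
        rw [sqENorm_eq_ofReal, mul_pow, ENNReal.ofReal_mul (by positivity)])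
  else 0

lemma wcomp_apply {m : β → ℂ} {π : β → α} {C : ℝ} (h : FiberBound m π C) (f : L2 α) (x : β) :
    wcomp m π f x = m x * f (π x) := by
  have h' : ∃ C, FiberBound m π C := ⟨C, h⟩
  simp only [wcomp, dif_pos h']
  rfl

lemma norm_wcomp_le {m : β → ℂ} {π : β → α} {C : ℝ} (h : FiberBound m π C) :
    ‖wcomp m π‖ ≤ C := by
  refine ContinuousLinearMap.opNorm_le_bound _ h.1 fun f => ?_
  refine norm_le_of_sqENorm_le (mul_nonneg h.1 (norm_nonneg _)) ?_
  have : (⇑(wcomp m π f) : β → ℂ) = fun x => m x * f (π x) := funext fun x => wcomp_apply h f x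
  rw [this]
  refine (sqENorm_comp_le h f).trans ?_
  rw [sqENorm_eq_ofReal, mul_pow, ENNReal.ofReal_mul (by positivity)]

lemma inner_single [DecidableEq α] (x : α) (u : L2 α) :
    inner ℂ (lp.single 2 x (1 : ℂ) : L2 α) u = u x := by
  simp [lp.inner_single_left]

/-- The adjoint of a weighted composition operator sums over the fibre. -/
lemma adjoint_wcomp_apply {γ : Type*} {m : β → ℂ} {π : β → α} {C : ℝ} (h : FiberBound m π C)
    (s : α → γ → β) (hs : ∀ x, m x ≠ 0 → ∃ l, s (π x) l = x)
    (hπ : ∀ y l, m (s y l) ≠ 0 → π (s y l) = y)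
    (hinj : ∀ y, Function.Injective (s y)) (g : L2 β) (y : α) :
    ContinuousLinearMap.adjoint (wcomp m π) g y = ∑' l, star (m (s y l)) * g (s y l) := by
  classical
  rw [← inner_single, ContinuousLinearMap.adjoint_inner_right, lp.inner_eq_tsum]
  have h1 : ∀ x, inner ℂ (wcomp m π (lp.single 2 y (1 : ℂ)) x) (g x) =
      if π x = y then star (m x) * g x else 0 := by
    intro x
    rw [wcomp_apply h]
    by_cases hx : π x = y
    · subst hx; simp [mul_comm]
    · rw [lp.single_apply_ne _ _ _ hx]; simp [hx]
  simp_rw [h1]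
  rw [← (hinj y).tsum_eq]
  · refine tsum_congr fun l => ?_
    by_cases hm : m (s y l) = 0
    · simp [hm]
    · rw [if_pos (hπ y l hm)]
  · intro x hx
    have hx' : (if π x = y then star (m x) * g x else 0) ≠ 0 := hx
    by_cases hxy : π x = y
    · have : m x ≠ 0 := by rintro h0; simp [h0] at hx'
      obtain ⟨l, hl⟩ := hs x this
      exact ⟨l, by rw [← hl, hxy]⟩
    · simp [hxy] at hx'

/-- Vectors on which a uniformly bounded family of operators tends to `0` form a closed set;
stated for the sum of a convergent series. -/
lemma tendsto_zero_of_hasSum {ι E F X : Type*} [NormedAddCommGroup E] [NormedSpace ℂ E]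
    [NormedAddCommGroup F] [NormedSpace ℂ F]
    {l : Filter X} (Y : X → E →L[ℂ] F) {C : ℝ} (hY : ∀ᶠ x in l, ‖Y x‖ ≤ C) {f : ι → E} {s : E}
    (hs : HasSum f s) (hf : ∀ i, Tendsto (fun x => ‖Y x (f i)‖) l (𝓝 0)) :
    Tendsto (fun x => ‖Y x s‖) l (𝓝 0) := by
  rw [Metric.tendsto_nhds]
  intro δ hδ
  have hC : 0 < |C| + 1 := by positivity
  have h1 := (Metric.tendsto_nhds.1 hs) (δ / 2 / (|C| + 1)) (by positivity)
  obtain ⟨t, ht⟩ := h1.exists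
  have h2 : Tendsto (fun x => ∑ i ∈ t, ‖Y x (f i)‖) l (𝓝 0) := by
    have := tendsto_finsetSum t fun i _ => hf i
    simpa using this
  filter_upwards [hY, (Metric.tendsto_nhds.1 h2) (δ / 2) (by positivity)] with x hx1 hx2
  have e : Y x s = ∑ i ∈ t, Y x (f i) + Y x (s - ∑ i ∈ t, f i) := by
    rw [map_sub, map_sum]; abel
  have n1 : ‖∑ i ∈ t, Y x (f i)‖ < δ / 2 := by
    refine lt_of_le_of_lt (norm_sum_le _ _) ?_
    rw [Real.dist_eq, sub_zero] at hx2
    exact (le_abs_self _).trans_lt hx2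
  have n2 : ‖Y x (s - ∑ i ∈ t, f i)‖ ≤ (|C| + 1) * (δ / 2 / (|C| + 1)) := by
    refine ((Y x).le_opNorm _).trans ?_
    have : ‖s - ∑ i ∈ t, f i‖ ≤ δ / 2 / (|C| + 1) := by
      rw [← dist_eq_norm, dist_comm]; exact ht.le
    have : ‖Y x‖ ≤ |C| + 1 := by linarith [le_abs_self C]
    gcongr
  rw [mul_div_cancel₀ _ hC.ne'] at n2
  rw [Real.dist_eq, sub_zero, abs_of_nonneg (norm_nonneg _), e]
  linarith [norm_add_le (∑ i ∈ t, Y x (f i)) (Y x (s - ∑ i ∈ t, f i))]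

/-! ### Resolvents of skew-adjoint operators -/

variable {E : Type*} [NormedAddCommGroup E] [InnerProductSpace ℂ E] [CompleteSpace E]

/-- The operator `(1 - T)⁻¹`. -/
def resolvent (T : E →L[ℂ] E) : E →L[ℂ] E := Ring.inverse (1 - T)

lemma re_inner_skew {T : E →L[ℂ] E} (hT : ContinuousLinearMap.adjoint T = -T) (u : E) :
    (inner ℂ u (T u)).re = 0 := by
  have h1 : inner ℂ (T u) u = -inner ℂ u (T u) := by
    rw [← ContinuousLinearMap.adjoint_inner_right, hT]; simp
  have h2 := inner_conj_symm (𝕜 := ℂ) u (T u)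
  rw [h1] at h2
  have := congrArg Complex.re h2
  rw [map_neg, Complex.neg_re, Complex.conj_re] at this
  linarith

lemma norm_sq_combination {T : E →L[ℂ] E} (hT : ContinuousLinearMap.adjoint T = -T)
    (a b : ℝ) (u : E) :
    ‖(a : ℂ) • u + (b : ℂ) • T u‖ ^ 2 = a ^ 2 * ‖u‖ ^ 2 + b ^ 2 * ‖T u‖ ^ 2 := by
  have := @norm_add_sq ℂ E _ _ _ ((a : ℂ) • u) ((b : ℂ) • T u)
  rw [this, inner_smul_left, inner_smul_right, norm_smul, norm_smul]
  simp [re_inner_skew hT, mul_pow]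

/-- The basic a priori bound: `Re ⟨u, T u⟩ = 0` for skew-adjoint `T`. -/
lemma norm_le_norm_sub_skew {T : E →L[ℂ] E} (hT : ContinuousLinearMap.adjoint T = -T) (u : E) :
    ‖u‖ ≤ ‖u - T u‖ := by
  have h := norm_sq_combination hT 1 (-1) u
  simp only [Complex.ofReal_one, one_smul, Complex.ofReal_neg, neg_smul, one_pow, one_mul,
    even_two, Even.neg_pow, ← sub_eq_add_neg] at h
  exact le_of_sq_le_sq (by rw [h]; nlinarith [sq_nonneg ‖T u‖]) (norm_nonneg _)

/-- The contraction rate of the relaxed iteration for an operator of norm at most `M`. -/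
def relaxRate (M : ℝ) : ℝ := Real.sqrt (M ^ 2 / (1 + M ^ 2))

lemma relaxRate_lt_one (M : ℝ) : relaxRate M < 1 := by
  rw [relaxRate, Real.sqrt_lt' one_pos, one_pow, div_lt_one (by positivity)]
  linarith

lemma relaxRate_nonneg (M : ℝ) : 0 ≤ relaxRate M := Real.sqrt_nonneg _

/-- With `τ = 1 / (1 + M²)`, the map `(1 - τ) + τ T` contracts: for skew-adjoint `T` the two
contributions are orthogonal. -/
lemma norm_relax_le {T : E →L[ℂ] E} (hT : ContinuousLinearMap.adjoint T = -T) {M : ℝ}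
    (hM : ‖T‖ ≤ M) (u : E) :
    ‖((1 - 1 / (1 + M ^ 2) : ℝ) : ℂ) • u + ((1 / (1 + M ^ 2) : ℝ) : ℂ) • T u‖ ≤
      relaxRate M * ‖u‖ := by
  have hM0 : 0 ≤ M := (norm_nonneg _).trans hM
  have hTu : ‖T u‖ ≤ M * ‖u‖ := (T.le_opNorm u).trans (by gcongr)
  refine le_of_sq_le_sq ?_ (mul_nonneg (relaxRate_nonneg _) (norm_nonneg _))
  rw [norm_sq_combination hT, mul_pow, relaxRate, Real.sq_sqrt (by positivity)]
  have h1 : ‖T u‖ ^ 2 ≤ M ^ 2 * ‖u‖ ^ 2 := by rw [← mul_pow]; gcongr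
  have : (1 - 1 / (1 + M ^ 2)) ^ 2 * ‖u‖ ^ 2 + (1 / (1 + M ^ 2)) ^ 2 * (M ^ 2 * ‖u‖ ^ 2) =
      M ^ 2 / (1 + M ^ 2) * ‖u‖ ^ 2 := by
    field_simp; ring
  rw [← this]
  gcongr

/-- A skew-adjoint perturbation of the identity is invertible, whatever its size: the relaxed map
`u ↦ (1 - τ) u + τ T u` contracts, so `1 - T` is `τ⁻¹` times one minus a contraction. -/
lemma isUnit_one_sub_skew {T : E →L[ℂ] E} (hT : ContinuousLinearMap.adjoint T = -T) :
    IsUnit (1 - T) := by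
  set M := ‖T‖
  set τ : ℝ := 1 / (1 + M ^ 2) with hτ
  have hτ0 : 0 < τ := by positivity
  let B : E →L[ℂ] E := ((1 - τ : ℝ) : ℂ) • (1 : E →L[ℂ] E) + (τ : ℂ) • T
  have hB : ‖B‖ < 1 := by
    refine lt_of_le_of_lt ?_ (relaxRate_lt_one M)
    exact ContinuousLinearMap.opNorm_le_bound _ (relaxRate_nonneg _) fun u =>
      norm_relax_le hT le_rfl u
  have h1 : IsUnit (1 - B) := isUnit_one_sub_of_norm_lt_one hB
  have h2 : 1 - B = (Units.mk0 (τ : ℂ) (by exact_mod_cast hτ0.ne')) • (1 - T) := by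
    ext u
    change u - (((1 - τ : ℝ) : ℂ) • u + (τ : ℂ) • T u) = (τ : ℂ) • (u - T u)
    push_cast
    module
  rw [h2] at h1
  exact (isUnit_smul_iff _ _).1 h1

lemma resolvent_sub {T : E →L[ℂ] E} (hT : ContinuousLinearMap.adjoint T = -T) (g : E) :
    resolvent T g - T (resolvent T g) = g := by
  have := Ring.mul_inverse_cancel _ (isUnit_one_sub_skew hT)
  have := DFunLike.congr_fun this g
  simpa [resolvent] using this

lemma eq_resolvent {T : E →L[ℂ] E} (hT : ContinuousLinearMap.adjoint T = -T) {u g : E}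
    (h : u - T u = g) : u = resolvent T g := by
  have := Ring.inverse_mul_cancel _ (isUnit_one_sub_skew hT)
  have := DFunLike.congr_fun this u
  simp only [mul_apply_eq_comp, sub_apply, one_apply_eq_self, h] at this
  exact this.symm

lemma norm_resolvent_apply_le {T : E →L[ℂ] E} (hT : ContinuousLinearMap.adjoint T = -T) (g : E) :
    ‖resolvent T g‖ ≤ ‖g‖ := by
  have := norm_le_norm_sub_skew hT (resolvent T g)
  rwa [resolvent_sub hT] at this

/-- The relaxed fixed point iteration for `u = T u + g`. -/
def relaxIter (T : E →L[ℂ] E) (M : ℝ) (g : E) : ℕ → E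
  | 0 => 0
  | k + 1 => ((1 - 1 / (1 + M ^ 2) : ℝ) : ℂ) • relaxIter T M g k +
      ((1 / (1 + M ^ 2) : ℝ) : ℂ) • (T (relaxIter T M g k) + g)

/-- Geometric convergence at a rate depending on `M` only. -/
lemma norm_relaxIter_sub_le {T : E →L[ℂ] E} (hT : ContinuousLinearMap.adjoint T = -T) {M : ℝ}
    (hM : ‖T‖ ≤ M) (g : E) (k : ℕ) :
    ‖relaxIter T M g k - resolvent T g‖ ≤ relaxRate M ^ k * ‖g‖ := by
  induction k with
  | zero => simpa [relaxIter] using norm_resolvent_apply_le hT g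
  | succ k ih =>
    set τ : ℝ := 1 / (1 + M ^ 2) with hτ
    set u := resolvent T g with hu
    have hg : g = u - T u := (resolvent_sub hT g).symm
    have : relaxIter T M g (k + 1) - u = ((1 - τ : ℝ) : ℂ) • (relaxIter T M g k - u) +
        (τ : ℂ) • T (relaxIter T M g k - u) := by
      have h0 : relaxIter T M g (k + 1) = ((1 - τ : ℝ) : ℂ) • relaxIter T M g k +
        (τ : ℂ) • (T (relaxIter T M g k) + g) := rfl
      rw [h0]
      generalize relaxIter T M g k = z
      rw [hg]
      simp only [map_sub]
      push_cast
      module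
    rw [this, pow_succ', mul_assoc]
    exact (norm_relax_le hT hM _).trans (by gcongr; exact relaxRate_nonneg _)

/-- The relaxed iteration converges to the resolvent, although the Neumann series of `T` need
not. -/
lemma tendsto_relaxIter {T : E →L[ℂ] E} (hT : ContinuousLinearMap.adjoint T = -T) {M : ℝ}
    (hM : ‖T‖ ≤ M) (g : E) :
    Tendsto (relaxIter T M g) atTop (𝓝 (resolvent T g)) := by
  rw [tendsto_iff_norm_sub_tendsto_zero]
  refine squeeze_zero (fun _ => norm_nonneg _) (norm_relaxIter_sub_le hT hM g) ?_
  have := (tendsto_pow_atTop_nhds_zero_of_lt_one (relaxRate_nonneg M)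
    (relaxRate_lt_one M)).mul_const ‖g‖
  simpa using this

end Toolbox

/-! ### Lattice sums -/

section Lattice

variable {d : ℕ}

/-- The frequencies of sup norm at most `N`. -/
def box (d N : ℕ) : Finset (Freq d) := Fintype.piFinset fun _ => Finset.Icc (-(N : ℤ)) N

lemma mem_box {N : ℕ} {l : Freq d} : l ∈ box d N ↔ ‖l‖ ≤ N := by
  rw [box, Fintype.mem_piFinset, pi_norm_le_iff_of_nonneg (by positivity)]
  refine forall_congr' fun a => ?_
  rw [Finset.mem_Icc, Int.norm_eq_abs, ← abs_le]
  exact_mod_cast Iff.rfl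

lemma card_box (N : ℕ) : ((box d N).card : ℝ) = (2 * N + 1) ^ d := by
  rw [box, Fintype.card_piFinset]
  have : (N + 1 + N : ℤ).toNat = 2 * N + 1 := by omega
  simp [this]

lemma mem_box_floor {r : ℝ} (hr : 0 ≤ r) {l : Freq d} : l ∈ box d ⌊r⌋₊ ↔ ‖l‖ ≤ r := by
  rw [box, Fintype.mem_piFinset, pi_norm_le_iff_of_nonneg hr]
  refine forall_congr' fun a => ?_
  rw [Finset.mem_Icc, ← abs_le, Int.norm_eq_abs]
  have : ((⌊r⌋₊ : ℕ) : ℤ) = ⌊r⌋ := Int.natCast_floor_eq_floor hr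
  rw [this, Int.le_floor]
  push_cast
  rfl

lemma pow_sub_pow_two_le {a b : ℝ} (hb : 0 ≤ b) (hab : a = b + 2) (n : ℕ) :
    a ^ n - b ^ n ≤ 2 * n * a ^ (n - 1) := by
  have ha : 0 ≤ a := by linarith
  induction n with
  | zero => simp
  | succ n ih =>
    rcases Nat.eq_zero_or_pos n with rfl | hn
    · simp [hab]
    have h1 : a ^ n = a * a ^ (n - 1) := by rw [← pow_succ', Nat.sub_add_cancel hn]
    have h2 : b ^ n ≤ a ^ n := by gcongr; linarith
    have : a ^ (n + 1) - b ^ (n + 1) = a * (a ^ n - b ^ n) + 2 * b ^ n := by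
      rw [hab]; ring
    rw [this]
    have h3 := mul_le_mul_of_nonneg_left ih ha
    simp only [Nat.add_sub_cancel]
    push_cast
    calc a * (a ^ n - b ^ n) + 2 * b ^ n ≤ a * (2 * n * a ^ (n - 1)) + 2 * a ^ n := by linarith
      _ = 2 * (n + 1) * a ^ n := by rw [h1]; ring

/-- Shell by shell, `∑_{0 < |l| ≤ N} |l|⁻²` is at most a constant times `N^{d-2}` in dimension at
least three. -/
lemma sum_box_inv_sq_le (hd : 3 ≤ d) (N : ℕ) :
    ∑ l ∈ box d N, (‖l‖ ^ 2)⁻¹ ≤ 2 * d * 3 ^ (d - 1) * (N : ℝ) ^ (d - 2) := by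
  obtain ⟨e, rfl⟩ : ∃ e, d = e + 3 := ⟨d - 3, by omega⟩
  induction N with
  | zero =>
    rw [Finset.sum_eq_zero]
    · simp
    · intro l hl
      rw [mem_box] at hl
      have : ‖l‖ = 0 := le_antisymm (by simpa using hl) (norm_nonneg _)
      simp [this]
  | succ N ih =>
    have hsub : box (e + 3) N ⊆ box (e + 3) (N + 1) := fun l hl => by
      rw [mem_box] at hl ⊢; push_cast; linarith
    -- The new shell has `O(N^{d-1})` points, each contributing `(N + 1)⁻²`.
    rw [← Finset.sum_sdiff hsub]
    have h1 : ∑ l ∈ box (e + 3) (N + 1) \ box (e + 3) N, (‖l‖ ^ 2)⁻¹ ≤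
        ∑ l ∈ box (e + 3) (N + 1) \ box (e + 3) N, (((N : ℝ) + 1) ^ 2)⁻¹ := by
      refine Finset.sum_le_sum fun l hl => ?_
      rw [Finset.mem_sdiff] at hl
      have hl2 : (N : ℝ) + 1 ≤ ‖l‖ := by
        by_contra hlt
        push Not at hlt
        apply hl.2
        rw [box, Fintype.mem_piFinset]
        intro a
        have h3 : ‖l a‖ < N + 1 := (norm_le_pi_norm l a).trans_lt hlt
        rw [Int.norm_eq_abs] at h3
        have h4 : |l a| < (N : ℤ) + 1 := by exact_mod_cast h3
        rw [Finset.mem_Icc, ← abs_le]; omega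
      gcongr
    have h2 : (((box (e + 3) (N + 1) \ box (e + 3) N).card : ℕ) : ℝ) ≤
        2 * (e + 3) * (3 * (N + 1)) ^ (e + 2) := by
      rw [Finset.card_sdiff_of_subset hsub, Nat.cast_sub (Finset.card_le_card hsub), card_box,
        card_box]
      have := pow_sub_pow_two_le (a := 2 * ((N + 1 : ℕ) : ℝ) + 1) (b := 2 * N + 1) (by positivity)
        (by push_cast; ring) (e + 3)
      refine this.trans ?_
      push_cast
      gcongr
      linarith [Nat.cast_nonneg (α := ℝ) N]
    rw [Finset.sum_const, nsmul_eq_mul] at h1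
    simp only [show e + 3 - 1 = e + 2 from rfl, show e + 3 - 2 = e + 1 from rfl] at ih ⊢
    have h3 : ((box (e + 3) (N + 1) \ box (e + 3) N).card : ℝ) * (((N : ℝ) + 1) ^ 2)⁻¹ ≤
        2 * (e + 3) * 3 ^ (e + 2) * ((N : ℝ) + 1) ^ e := by
      rw [← div_eq_mul_inv, div_le_iff₀ (by positivity)]
      refine h2.trans (le_of_eq ?_)
      rw [mul_pow]; ring
    have h4 : (N : ℝ) ^ (e + 1) + ((N : ℝ) + 1) ^ e ≤ ((N : ℝ) + 1) ^ (e + 1) := by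
      have : (N : ℝ) ^ e ≤ ((N : ℝ) + 1) ^ e := by gcongr; linarith
      rw [pow_succ, pow_succ]
      nlinarith [Nat.cast_nonneg (α := ℝ) N]
    push_cast at ih ⊢
    have h5 : (0 : ℝ) ≤ 2 * (e + 3) * 3 ^ (e + 2) := by positivity
    nlinarith [mul_le_mul_of_nonneg_left h4 h5]

/-- A function bounded by a multiple of `1 / |l|` on `0 < |l| ≤ r` and zero elsewhere. -/
lemma tsum_enorm_sq_le_of_inv (hd : 3 ≤ d) {f : Freq d → ℂ} {A r : ℝ} (hA : 0 ≤ A) (hr : 0 ≤ r)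
    (h0 : ∀ l, f l ≠ 0 → ‖l‖ ≤ r) (h1 : ∀ l, ‖f l‖ ^ 2 ≤ A * (‖l‖ ^ 2)⁻¹) :
    ∑' l, ‖f l‖ₑ ^ 2 ≤ ENNReal.ofReal (A * (2 * d * 3 ^ (d - 1) * r ^ (d - 2))) := by
  rw [tsum_eq_sum (s := box d ⌊r⌋₊)]
  · have : ∀ l, ‖f l‖ₑ ^ 2 = ENNReal.ofReal (‖f l‖ ^ 2) := fun l => by
      rw [ENNReal.ofReal_pow (norm_nonneg _), ofReal_norm]
    simp_rw [this]
    rw [← ENNReal.ofReal_sum_of_nonneg (fun _ _ => by positivity)]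
    refine ENNReal.ofReal_le_ofReal ?_
    refine (Finset.sum_le_sum fun l _ => h1 l).trans ?_
    rw [← Finset.mul_sum]
    gcongr
    refine (sum_box_inv_sq_le hd _).trans ?_
    gcongr
    exact Nat.floor_le hr
  · intro l hl
    rw [mem_box_floor hr] at hl
    have : f l = 0 := by by_contra h; exact hl (h0 l h)
    simp [this]

lemma tsum_enorm_sq_le_of_bdd {f : Freq d → ℂ} {A r : ℝ} (hA : 0 ≤ A) (hr : 0 ≤ r)
    (h0 : ∀ l, f l ≠ 0 → ‖l‖ ≤ r) (h1 : ∀ l, ‖f l‖ ^ 2 ≤ A) :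
    ∑' l, ‖f l‖ₑ ^ 2 ≤ ENNReal.ofReal (A * (2 * r + 1) ^ d) := by
  rw [tsum_eq_sum (s := box d ⌊r⌋₊)]
  · have : ∀ l, ‖f l‖ₑ ^ 2 = ENNReal.ofReal (‖f l‖ ^ 2) := fun l => by
      rw [ENNReal.ofReal_pow (norm_nonneg _), ofReal_norm]
    simp_rw [this]
    rw [← ENNReal.ofReal_sum_of_nonneg (fun _ _ => by positivity)]
    refine ENNReal.ofReal_le_ofReal ?_
    refine (Finset.sum_le_sum fun l _ => h1 l).trans ?_
    rw [Finset.sum_const, nsmul_eq_mul, card_box, mul_comm]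
    gcongr
    exact Nat.floor_le hr
  · intro l hl
    rw [mem_box_floor hr] at hl
    have : f l = 0 := by by_contra h; exact hl (h0 l h)
    simp [this]

lemma norm_tsum_le_of_bdd {f : Freq d → ℂ} {A r : ℝ} (hA : 0 ≤ A) (hr : 0 ≤ r)
    (h0 : ∀ l, f l ≠ 0 → ‖l‖ ≤ r) (h1 : ∀ l, ‖f l‖ ≤ A) :
    ‖∑' l, f l‖ ≤ A * (2 * r + 1) ^ d := by
  rw [tsum_eq_sum (s := box d ⌊r⌋₊)]
  · refine (norm_sum_le _ _).trans ((Finset.sum_le_sum fun l _ => h1 l).trans ?_)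
    rw [Finset.sum_const, nsmul_eq_mul, card_box, mul_comm]
    gcongr
    exact Nat.floor_le hr
  · intro l hl
    rw [mem_box_floor hr] at hl
    by_contra h; exact hl (h0 l h)

/-- The lattice point `⌊x / ε⌋`, taken coordinatewise. -/
def latticeFloor (ε : ℝ) (x : Fin d → ℝ) : Freq d := fun a => ⌊x a / ε⌋

lemma measurable_latticeFloor (ε : ℝ) : Measurable (latticeFloor (d := d) ε) :=
  measurable_pi_lambda _ fun a => by
    have h : Measurable fun x : Fin d → ℝ => x a := measurable_pi_apply a
    exact Int.measurable_floor.comp (h.div_const ε)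

lemma latticeFloor_preimage {ε : ℝ} (hε : 0 < ε) (l : Freq d) :
    latticeFloor ε ⁻¹' {l} =
      Set.univ.pi fun a => Set.Ico (ε * (l a : ℝ)) (ε * (l a : ℝ) + ε) := by
  ext x
  simp only [Set.mem_preimage, Set.mem_singleton_iff, Set.mem_univ_pi, Set.mem_Ico, latticeFloor,
    funext_iff]
  refine forall_congr' fun a => ?_
  rw [Int.floor_eq_iff, le_div_iff₀ hε, div_lt_iff₀ hε]
  constructor <;> rintro ⟨h1, h2⟩ <;> constructor <;> linarith

lemma volume_latticeFloor_preimage {ε : ℝ} (hε : 0 < ε) (l : Freq d) :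
    volume.real (latticeFloor ε ⁻¹' {l}) = ε ^ d := by
  rw [latticeFloor_preimage hε, measureReal_def, Real.volume_pi_Ico]
  simp [ENNReal.toReal_pow, ENNReal.toReal_ofReal hε.le]

lemma volume_latticeFloor_preimage_ne_top {ε : ℝ} (hε : 0 < ε) (l : Freq d) :
    volume (latticeFloor ε ⁻¹' {l}) ≠ ⊤ := by
  rw [latticeFloor_preimage hε, Real.volume_pi_Ico]
  simp [ENNReal.pow_eq_top_iff]

/-- A lattice sum as the integral of a function that is constant on the cells of the lattice. -/
lemma integral_latticeFloor {ε : ℝ} (hε : 0 < ε) (A : Freq d → ℂ) (S : Finset (Freq d))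
    (hS : ∀ l, A l ≠ 0 → l ∈ S) :
    ∫ x : Fin d → ℝ, A (latticeFloor ε x) = ∑' l, ((ε ^ d : ℝ) : ℂ) * A l := by
  have h1 : ∀ x : Fin d → ℝ, A (latticeFloor ε x) =
      ∑ l ∈ S, (latticeFloor ε ⁻¹' {l}).indicator (fun _ => A l) x := by
    intro x
    by_cases hx : latticeFloor ε x ∈ S
    · rw [Finset.sum_eq_single_of_mem _ hx]
      · simp
      · intro l _ hl; exact Set.indicator_of_notMem (by simpa using hl.symm) _
    · have h0 : A (latticeFloor ε x) = 0 := by by_contra h; exact hx (hS _ h)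
      rw [h0, Finset.sum_eq_zero]
      intro l hl
      refine Set.indicator_of_notMem ?_ _
      rintro rfl; exact hx hl
  simp_rw [h1]
  have hm : ∀ l : Freq d, MeasurableSet (latticeFloor ε ⁻¹' {l}) := fun l =>
    measurable_latticeFloor ε (measurableSet_singleton l)
  rw [integral_finsetSum]
  · rw [tsum_eq_sum (s := S)]
    · refine Finset.sum_congr rfl fun l _ => ?_
      rw [integral_indicator (hm l), setIntegral_const, volume_latticeFloor_preimage hε]
      simp
    · intro l hl
      have h0 : A l = 0 := by by_contra h; exact hl (hS _ h)
      simp [h0]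
  · intro l _
    rw [integrable_indicator_iff (hm l)]
    exact integrableOn_const (volume_latticeFloor_preimage_ne_top hε l)

lemma norm_le_of_latticeFloor {ε : ℝ} (hε : 0 < ε) {C : ℝ} (hC : 0 ≤ C) {x : Fin d → ℝ}
    (h : ε * ‖latticeFloor ε x‖ ≤ C) : ‖x‖ ≤ C + ε := by
  rw [pi_norm_le_iff_of_nonneg (by positivity)]
  intro a
  have h1 : ‖latticeFloor ε x a‖ ≤ ‖latticeFloor ε x‖ := norm_le_pi_norm _ a
  rw [Int.norm_eq_abs] at h1
  have h2 : ε * |((latticeFloor ε x a : ℤ) : ℝ)| ≤ C := le_trans (by gcongr) h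
  have h3 : |ε * ((latticeFloor ε x a : ℤ) : ℝ)| ≤ C := by rwa [abs_mul, abs_of_pos hε]
  have h4 : x a / ε < (latticeFloor ε x a : ℤ) + 1 := Int.lt_floor_add_one _
  have h5 : ((latticeFloor ε x a : ℤ) : ℝ) ≤ x a / ε := Int.floor_le _
  rw [div_lt_iff₀ hε] at h4
  rw [le_div_iff₀ hε] at h5
  rw [abs_le] at h3
  rw [Real.norm_eq_abs, abs_le]
  constructor <;> linarith [h3.1, h3.2]

lemma tendsto_mul_latticeFloor {Z : Type*} {L : Filter Z} {ε : Z → ℝ}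
    (hε : Tendsto ε L (𝓝[>] 0)) (x : Fin d → ℝ) :
    Tendsto (fun z a => ε z * (latticeFloor (ε z) x a : ℝ)) L (𝓝 x) := by
  rw [tendsto_pi_nhds]
  intro a
  have h0 : Tendsto ε L (𝓝 0) := hε.mono_right nhdsWithin_le_nhds
  have hpos : ∀ᶠ z in L, 0 < ε z := hε self_mem_nhdsWithin
  have h1 : Tendsto (fun z => x a - ε z) L (𝓝 (x a)) := by simpa using h0.const_sub (x a)
  refine tendsto_of_tendsto_of_tendsto_of_le_of_le' h1 tendsto_const_nhds ?_ ?_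
  · filter_upwards [hpos] with z hz
    have h4 : x a / ε z < (latticeFloor (ε z) x a : ℤ) + 1 := Int.lt_floor_add_one _
    rw [div_lt_iff₀ hz] at h4
    linarith
  · filter_upwards [hpos] with z hz
    have h5 : ((latticeFloor (ε z) x a : ℤ) : ℝ) ≤ x a / ε z := Int.floor_le _
    rw [le_div_iff₀ hz] at h5
    linarith

/-- Riemann sums of bounded, uniformly compactly supported functions that converge almost
everywhere in the continuum limit. -/
lemma tendsto_lattice_sum {Z : Type*} {L : Filter Z} [L.IsCountablyGenerated] {ε : Z → ℝ}
    (hε : Tendsto ε L (𝓝[>] 0)) {A : Z → Freq d → ℂ} {A0 : (Fin d → ℝ) → ℂ} {C : ℝ}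
    (hb : ∀ᶠ z in L, ∀ l, ‖A z l‖ ≤ C) (hs : ∀ᶠ z in L, ∀ l, A z l ≠ 0 → ε z * ‖l‖ ≤ C)
    (hc : ∀ᵐ x, Tendsto (fun z => A z (latticeFloor (ε z) x)) L (𝓝 (A0 x))) :
    Tendsto (fun z => ∑' l, ((ε z ^ d : ℝ) : ℂ) * A z l) L (𝓝 (∫ x, A0 x)) := by
  rcases L.eq_or_neBot with rfl | hne
  · exact tendsto_bot
  have hC : 0 ≤ C := by
    obtain ⟨z, hz⟩ := hb.exists
    exact (norm_nonneg _).trans (hz 0)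
  have hpos : ∀ᶠ z in L, 0 < ε z := hε self_mem_nhdsWithin
  have hone : ∀ᶠ z in L, ε z < 1 :=
    (hε.mono_right nhdsWithin_le_nhds).eventually_lt_const (by norm_num)
  have key : ∀ᶠ z in L, ∫ x, A z (latticeFloor (ε z) x) = ∑' l, ((ε z ^ d : ℝ) : ℂ) * A z l := by
    filter_upwards [hpos, hs] with z hz hzs
    refine integral_latticeFloor hz (A z) (box d ⌊C / ε z⌋₊) fun l hl => ?_
    rw [mem_box_floor (by positivity), le_div_iff₀ hz, mul_comm]
    exact hzs l hl
  refine Tendsto.congr' key ?_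
  refine tendsto_integral_filter_of_dominated_convergence
    ((Metric.closedBall (0 : Fin d → ℝ) (C + 1)).indicator fun _ => C) ?_ ?_ ?_ hc
  · refine Eventually.of_forall fun z => ?_
    exact ((measurable_of_countable (A z)).comp
      (measurable_latticeFloor (ε z))).aestronglyMeasurable
  · filter_upwards [hpos, hone, hb, hs] with z hz hz1 hzb hzs
    refine Eventually.of_forall fun x => ?_
    by_cases h0 : A z (latticeFloor (ε z) x) = 0
    · rw [h0, norm_zero]; exact Set.indicator_nonneg (fun _ _ => hC) _
    · rw [Set.indicator_of_mem]
      · exact hzb _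
      · rw [mem_closedBall_zero_iff]
        have := norm_le_of_latticeFloor hz hC (hzs _ h0)
        linarith
  · rw [integrable_indicator_iff Metric.isClosed_closedBall.measurableSet]
    exact integrableOn_const (isCompact_closedBall _ _).measure_lt_top.ne

end Lattice

/-! ### Symmetrisation and the normalised creation operator -/

/-- The index set of all Fourier coefficients of the Fock space: a chaos and its frequencies. -/
abbrev Idx (d : ℕ) : Type := Σ n : ℕ, (Fin n → Freq d)

section Operators

variable {d : ℕ}

/-- The kinetic energy `|k_{1:n}|² / 2`, the symbol of `-𝓛₀`. -/
def energy {n : ℕ} (k : Fin n → Freq d) : ℝ := 1 / 2 * normSq k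

lemma energy_nonneg {n : ℕ} (k : Fin n → Freq d) : 0 ≤ energy k := by
  unfold energy normSq; positivity

lemma sum_sq_le_energy {n : ℕ} (k : Fin n → Freq d) (j : Fin n) :
    ∑ a, ((k j a : ℤ) : ℝ) ^ 2 ≤ 2 * energy k := by
  unfold energy normSq
  have := Finset.single_le_sum (f := fun j => ∑ a, ((k j a : ℤ) : ℝ) ^ 2)
    (fun _ _ => by positivity) (Finset.mem_univ j)
  simpa using this

lemma norm_sq_le_sum_sq (l : Freq d) : ‖l‖ ^ 2 ≤ ∑ a, ((l a : ℤ) : ℝ) ^ 2 := by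
  have h0 : 0 ≤ ∑ a, ((l a : ℤ) : ℝ) ^ 2 := by positivity
  rw [← Real.sqrt_le_sqrt_iff h0, Real.sqrt_sq (norm_nonneg _), pi_norm_le_iff_of_nonneg
    (Real.sqrt_nonneg _)]
  intro a
  refine Real.le_sqrt_of_sq_le ?_
  rw [Int.norm_eq_abs, sq_abs]
  exact Finset.single_le_sum (f := fun a => ((l a : ℤ) : ℝ) ^ 2)
    (fun _ _ => by positivity) (Finset.mem_univ a)

lemma norm_sq_le_energy {n : ℕ} (k : Fin n → Freq d) (j : Fin n) : ‖k j‖ ^ 2 ≤ 2 * energy k :=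
  (norm_sq_le_sum_sq _).trans (sum_sq_le_energy k j)

lemma one_le_norm_of_ne_zero {l : Freq d} (hl : l ≠ 0) : 1 ≤ ‖l‖ := by
  obtain ⟨a, ha⟩ := Function.ne_iff.1 hl
  have h1 : 1 ≤ |l a| := Int.one_le_abs ha
  refine le_trans ?_ (norm_le_pi_norm l a)
  rw [Int.norm_eq_abs]
  exact_mod_cast h1

lemma half_le_energy {n : ℕ} {k : Fin n → Freq d} {j : Fin n} (h : k j ≠ 0) :
    1 / 2 ≤ energy k := by
  have := norm_sq_le_energy k j
  nlinarith [one_le_norm_of_ne_zero h]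

lemma energy_pos {n : ℕ} {k : Fin n → Freq d} {j : Fin n} (h : k j ≠ 0) : 0 < energy k :=
  lt_of_lt_of_le (by norm_num) (half_le_energy h)

lemma energy_perm {n : ℕ} (σ : Equiv.Perm (Fin n)) (k : Fin n → Freq d) :
    energy (k ∘ σ) = energy k := by
  unfold energy normSq
  congr 1
  exact Equiv.sum_comp σ fun j => ∑ a, ((k j a : ℤ) : ℝ) ^ 2

/-- The squared Euclidean norm of the drift vector. -/
def wSq (w : Fin d → ℝ) : ℝ := ∑ a, w a ^ 2

lemma wSq_nonneg (w : Fin d → ℝ) : 0 ≤ wSq w := by unfold wSq; positivity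

lemma dot_sq_le {n : ℕ} (w : Fin d → ℝ) (k : Fin n → Freq d) (j : Fin n) :
    dot w (k j) ^ 2 ≤ wSq w * (2 * energy k) := by
  refine (Finset.sum_mul_sq_le_sq_mul_sq _ _ _).trans ?_
  exact mul_le_mul_of_nonneg_left (sum_sq_le_energy k j) (wSq_nonneg w)

lemma dot_zero (w : Fin d → ℝ) : dot w 0 = 0 := by simp [dot]

lemma cutoff_nonneg (ε : ℝ) (l m : Freq d) : 0 ≤ cutoff ε l m := by
  unfold cutoff; split_ifs <;> norm_num

lemma cutoff_le_one (ε : ℝ) (l m : Freq d) : cutoff ε l m ≤ 1 := by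
  unfold cutoff; split_ifs <;> norm_num

lemma cutoff_comm (ε : ℝ) (l m : Freq d) : cutoff ε l m = cutoff ε m l := by
  unfold cutoff
  rw [add_comm m l]
  congr 1
  apply propext; tauto

lemma of_cutoff_ne_zero {ε : ℝ} (hε : 0 < ε) {l m : Freq d} (h : cutoff ε l m ≠ 0) :
    (l ≠ 0 ∧ m ≠ 0 ∧ l + m ≠ 0) ∧ ‖l‖ ≤ 1 / ε ∧ ‖m‖ ≤ 1 / ε ∧ ‖l + m‖ ≤ 1 / ε := by
  unfold cutoff at h
  split_ifs at h with hc
  · obtain ⟨⟨h1, h2⟩, ⟨h3, h4⟩, h5, h6⟩ := hc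
    have aux : ∀ x : Freq d, 0 < ε * ‖x‖ → x ≠ 0 := by
      rintro x hx rfl; simp at hx
    refine ⟨⟨aux _ h1, aux _ h3, aux _ h5⟩, ?_, ?_, ?_⟩ <;>
    · rw [le_div_iff₀ hε, mul_comm]; assumption
  · exact absurd rfl h

lemma coupling_sq {ε : ℝ} (hε : 0 < ε) (hd : 3 ≤ d) : coupling d ε ^ 2 = ε ^ (d - 2) := by
  rw [coupling, ← Real.rpow_natCast, ← Real.rpow_mul hε.le, ← Real.rpow_natCast]
  congr 1
  rw [Nat.cast_sub (by omega)]; push_cast; ring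

lemma coupling_nonneg {ε : ℝ} (hε : 0 < ε) : 0 ≤ coupling d ε := by
  unfold coupling; positivity

/-! #### Merging and splitting -/

/-- Replace the first two entries by their sum. -/
def merge {M : Type*} [AddCommGroup M] {n : ℕ} (k : Fin (n + 2) → M) : Fin (n + 1) → M :=
  Fin.cons (k 0 + k 1) fun a => k a.succ.succ

/-- Split the first entry `p₀` into `l` and `p₀ - l`. -/
def split {M : Type*} [AddCommGroup M] {n : ℕ} (p : Fin (n + 1) → M) (l : M) : Fin (n + 2) → M :=
  Fin.cons l (Fin.cons (p 0 - l) fun a => p a.succ)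

@[simp] lemma split_zero {M : Type*} [AddCommGroup M] {n : ℕ} (p : Fin (n + 1) → M) (l : M) :
    split p l 0 = l := rfl

@[simp] lemma split_one {M : Type*} [AddCommGroup M] {n : ℕ} (p : Fin (n + 1) → M) (l : M) :
    split p l 1 = p 0 - l := rfl

@[simp] lemma split_succ_succ {M : Type*} [AddCommGroup M] {n : ℕ} (p : Fin (n + 1) → M) (l : M)
    (a : Fin n) :
    split p l a.succ.succ = p a.succ := rfl

@[simp] lemma merge_zero {M : Type*} [AddCommGroup M] {n : ℕ} (k : Fin (n + 2) → M) :
    merge k 0 = k 0 + k 1 := rfl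

@[simp] lemma merge_succ {M : Type*} [AddCommGroup M] {n : ℕ} (k : Fin (n + 2) → M) (a : Fin n) :
    merge k a.succ = k a.succ.succ := rfl

@[simp] lemma merge_split {M : Type*} [AddCommGroup M] {n : ℕ} (p : Fin (n + 1) → M) (l : M) :
    merge (split p l) = p := by
  ext1 a
  refine Fin.cases ?_ (fun a => ?_) a <;> simp

@[simp] lemma split_merge {M : Type*} [AddCommGroup M] {n : ℕ} (k : Fin (n + 2) → M) :
    split (merge k) (k 0) = k := by
  ext1 a
  refine Fin.cases ?_ (fun a => Fin.cases ?_ (fun a => ?_) a) a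
  · simp
  · change split (merge k) (k 0) 1 = k 1
    simp
  · simp

lemma split_injective {M : Type*} [AddCommGroup M] {n : ℕ} (p : Fin (n + 1) → M) :
    Function.Injective (split p) :=
  fun l l' h => by simpa using congrFun h 0

lemma energy_eq_head {n : ℕ} (k : Fin (n + 1) → Freq d) :
    energy k = 1 / 2 * ∑ a, ((k 0 a : ℤ) : ℝ) ^ 2 + energy fun a => k a.succ := by
  unfold energy normSq
  rw [Fin.sum_univ_succ]; ring

/-- Merging at most doubles the energy. -/
lemma energy_merge_le {n : ℕ} (k : Fin (n + 2) → Freq d) : energy (merge k) ≤ 2 * energy k := by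
  rw [energy_eq_head (merge k), energy_eq_head k, energy_eq_head fun a => k a.succ]
  simp only [merge_zero, merge_succ, Fin.succ_zero_eq_one]
  have h0 : ∀ a, (((k 0 + k 1) a : ℤ) : ℝ) ^ 2 ≤ 2 * (k 0 a : ℝ) ^ 2 + 2 * (k 1 a : ℝ) ^ 2 := by
    intro a
    rw [Pi.add_apply]; push_cast
    nlinarith [sq_nonneg ((k 0 a : ℝ) - k 1 a)]
  have h1 := Finset.sum_le_sum fun a (_ : a ∈ Finset.univ) => h0 a
  rw [Finset.sum_add_distrib, ← Finset.mul_sum, ← Finset.mul_sum] at h1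
  have := energy_nonneg fun a : Fin n => k a.succ.succ
  linarith

/-- The total momentum. -/
def tot {n : ℕ} (k : Fin n → Freq d) : Freq d := ∑ j, k j

lemma tot_perm {n : ℕ} (σ : Equiv.Perm (Fin n)) (k : Fin n → Freq d) : tot (k ∘ σ) = tot k :=
  Equiv.sum_comp σ k

lemma tot_merge {n : ℕ} (k : Fin (n + 2) → Freq d) : tot (merge k) = tot k := by
  unfold tot
  rw [Fin.sum_univ_succ, Fin.sum_univ_succ, Fin.sum_univ_succ (f := fun i => k i.succ)]
  simp [add_assoc]

lemma tot_split {n : ℕ} (p : Fin (n + 1) → Freq d) (l : Freq d) : tot (split p l) = tot p := by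
  rw [← tot_merge, merge_split]

/-- `merge` on the index set of the Fock space; the chaoses `0` and `1` are left unchanged. -/
def mergeI : Idx d → Idx d
  | ⟨n + 2, k⟩ => ⟨n + 1, merge k⟩
  | x => x

/-- `split` on the index set of the Fock space. On the vacuum it takes an arbitrary injective
value, on which all weights vanish. -/
def splitI : Idx d → Freq d → Idx d
  | ⟨n + 1, p⟩, l => ⟨n + 2, split p l⟩
  | ⟨0, _⟩, l => ⟨1, fun _ => l⟩

lemma splitI_injective (y : Idx d) : Function.Injective (splitI y) := by
  rcases y with ⟨_ | n, p⟩
  · intro l l' h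
    have := congrFun (eq_of_heq (Sigma.mk.inj h).2) 0
    exact this
  · intro l l' h
    exact split_injective p (eq_of_heq (Sigma.mk.inj h).2)

/-! #### Symmetrisation -/

/-- The average of a kernel over all permutations of its variables. -/
def avg {n : ℕ} (F : (Fin n → Freq d) → ℂ) (k : Fin n → Freq d) : ℂ :=
  (n.factorial : ℂ)⁻¹ * ∑ σ : Equiv.Perm (Fin n), F (k ∘ σ)

lemma avg_perm {n : ℕ} (F : (Fin n → Freq d) → ℂ) (k : Fin n → Freq d) (τ : Equiv.Perm (Fin n)) :
    avg F (k ∘ τ) = avg F k := by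
  unfold avg
  congr 1
  exact Fintype.sum_equiv (Equiv.mulLeft τ) _ _ fun σ => by
    simp [Equiv.Perm.coe_mul, Function.comp_assoc]

lemma avg_comp_perm {n : ℕ} (F : (Fin n → Freq d) → ℂ) (τ : Equiv.Perm (Fin n))
    (k : Fin n → Freq d) : avg (fun k => F (k ∘ τ)) k = avg F k := by
  unfold avg
  congr 1
  exact Fintype.sum_equiv (Equiv.mulRight τ) _ _ fun σ => by
    simp [Equiv.Perm.coe_mul, Function.comp_assoc]

lemma avg_of_symm {n : ℕ} {F : (Fin n → Freq d) → ℂ} {k : Fin n → Freq d}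
    (h : ∀ σ : Equiv.Perm (Fin n), F (k ∘ σ) = F k) : avg F k = F k := by
  unfold avg
  simp_rw [h]
  rw [Finset.sum_const, Finset.card_univ, Fintype.card_perm, Fintype.card_fin, nsmul_eq_mul,
    inv_mul_cancel_left₀]
  exact_mod_cast Nat.factorial_ne_zero n

lemma avg_add {n : ℕ} (F G : (Fin n → Freq d) → ℂ) (k : Fin n → Freq d) :
    avg (fun k => F k + G k) k = avg F k + avg G k := by
  unfold avg; rw [Finset.sum_add_distrib, mul_add]

lemma avg_const_mul {n : ℕ} (c : ℂ) (F : (Fin n → Freq d) → ℂ) (k : Fin n → Freq d) :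
    avg (fun k => c * F k) k = c * avg F k := by
  unfold avg; rw [← Finset.mul_sum]; ring

lemma norm_avg_le {n : ℕ} {F : (Fin n → Freq d) → ℂ} {k : Fin n → Freq d} {C : ℝ}
    (h : ∀ σ : Equiv.Perm (Fin n), ‖F (k ∘ σ)‖ ≤ C) : ‖avg F k‖ ≤ C := by
  unfold avg
  rw [norm_mul, norm_inv, Complex.norm_natCast, inv_mul_le_iff₀ (by positivity)]
  refine (norm_sum_le _ _).trans ((Finset.sum_le_sum fun σ _ => h σ).trans ?_)
  rw [Finset.sum_const, Finset.card_univ, Fintype.card_perm, Fintype.card_fin, nsmul_eq_mul]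

lemma avg_eq_zero {n : ℕ} {F : (Fin n → Freq d) → ℂ} {k : Fin n → Freq d}
    (h : ∀ σ : Equiv.Perm (Fin n), F (k ∘ σ) = 0) : avg F k = 0 := by
  unfold avg; simp [h]

/-- Symmetrisation of a function on the index set of the Fock space. -/
def symF (f : Idx d → ℂ) (x : Idx d) : ℂ := avg (fun k => f ⟨x.1, k⟩) x.2

lemma sqENorm_sigma (f : Idx d → ℂ) :
    sqENorm f = ∑' n, sqENorm fun k : Fin n → Freq d => f ⟨n, k⟩ := by
  unfold sqENorm; rw [ENNReal.tsum_sigma']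

lemma sqENorm_avg_le {n : ℕ} (F : (Fin n → Freq d) → ℂ) : sqENorm (avg F) ≤ sqENorm F := by
  have hn : (n.factorial : ℝ≥0∞) ≠ 0 := by exact_mod_cast Nat.factorial_ne_zero n
  have h1 : ∀ k, ‖avg F k‖ₑ ^ 2 ≤
      (n.factorial : ℝ≥0∞)⁻¹ * ∑ σ : Equiv.Perm (Fin n), ‖F (k ∘ σ)‖ₑ ^ 2 := by
    intro k
    have h2 : ‖avg F k‖ ^ 2 ≤ (n.factorial : ℝ)⁻¹ * ∑ σ : Equiv.Perm (Fin n), ‖F (k ∘ σ)‖ ^ 2 := by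
      unfold avg
      rw [norm_mul, mul_pow, norm_inv, Complex.norm_natCast]
      have h3 : ‖∑ σ : Equiv.Perm (Fin n), F (k ∘ σ)‖ ^ 2 ≤
          n.factorial * ∑ σ : Equiv.Perm (Fin n), ‖F (k ∘ σ)‖ ^ 2 := by
        have h4 := sq_sum_le_card_mul_sum_sq (s := (Finset.univ : Finset (Equiv.Perm (Fin n))))
          (f := fun σ => ‖F (k ∘ σ)‖)
        rw [Finset.card_univ, Fintype.card_perm, Fintype.card_fin] at h4
        refine le_trans ?_ h4
        gcongr
        exact norm_sum_le _ _
      have hp : (0 : ℝ) < n.factorial := by positivity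
      calc (n.factorial : ℝ)⁻¹ ^ 2 * ‖∑ σ : Equiv.Perm (Fin n), F (k ∘ σ)‖ ^ 2
          ≤ (n.factorial : ℝ)⁻¹ ^ 2 *
            (n.factorial * ∑ σ : Equiv.Perm (Fin n), ‖F (k ∘ σ)‖ ^ 2) := by gcongr
        _ = _ := by field_simp
    have h5 := ENNReal.ofReal_le_ofReal h2
    rw [ENNReal.ofReal_mul (by positivity), ENNReal.ofReal_sum_of_nonneg
      (fun _ _ => by positivity), ENNReal.ofReal_inv_of_pos (by positivity),
      ENNReal.ofReal_natCast] at h5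
    simpa [ENNReal.ofReal_pow] using h5
  calc sqENorm (avg F) ≤ ∑' k, (n.factorial : ℝ≥0∞)⁻¹ *
        ∑ σ : Equiv.Perm (Fin n), ‖F (k ∘ σ)‖ₑ ^ 2 := ENNReal.tsum_le_tsum h1
    _ = (n.factorial : ℝ≥0∞)⁻¹ * ∑ σ : Equiv.Perm (Fin n), ∑' k, ‖F (k ∘ σ)‖ₑ ^ 2 := by
        rw [ENNReal.tsum_mul_left, Summable.tsum_finsetSum fun _ _ => ENNReal.summable]
    _ = (n.factorial : ℝ≥0∞)⁻¹ * ∑ σ : Equiv.Perm (Fin n), sqENorm F := by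
        congr 1
        refine Finset.sum_congr rfl fun σ _ => ?_
        exact (Equiv.arrowCongr σ.symm (Equiv.refl (Freq d))).tsum_eq fun k => ‖F k‖ₑ ^ 2
    _ = sqENorm F := by
        rw [Finset.sum_const, Finset.card_univ, Fintype.card_perm, Fintype.card_fin, nsmul_eq_mul,
          ← mul_assoc, ENNReal.inv_mul_cancel hn (ENNReal.natCast_ne_top _), one_mul]

lemma sqENorm_symF_le (f : Idx d → ℂ) : sqENorm (symF f) ≤ sqENorm f := by
  rw [sqENorm_sigma, sqENorm_sigma f]
  exact ENNReal.tsum_le_tsum fun n => sqENorm_avg_le fun k => f ⟨n, k⟩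

lemma symF_add (f g : Idx d → ℂ) : symF (f + g) = symF f + symF g :=
  funext fun x => avg_add (fun k => f ⟨x.1, k⟩) (fun k => g ⟨x.1, k⟩) x.2

lemma symF_smul (c : ℂ) (f : Idx d → ℂ) : symF (c • f) = c • symF f :=
  funext fun x => avg_const_mul c (fun k => f ⟨x.1, k⟩) x.2

lemma memLp_symF (f : L2 (Idx d)) : Memℓp (E := fun _ : Idx d => ℂ) (symF f) 2 :=
  memLp_iff_sqENorm.2 (ne_top_of_le_ne_top (sqENorm_ne_top f) (sqENorm_symF_le f))

/-- The orthogonal projection onto symmetric kernels, as a linear map. -/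
def symLin : L2 (Idx d) →ₗ[ℂ] L2 (Idx d) where
  toFun f := ⟨symF f, memLp_symF f⟩
  map_add' f g := Subtype.ext (symF_add f g)
  map_smul' c f := Subtype.ext (symF_smul c f)

/-- The orthogonal projection onto symmetric kernels. -/
def symOp : L2 (Idx d) →L[ℂ] L2 (Idx d) :=
  symLin.mkContinuous 1 fun f => by
    rw [one_mul]
    exact norm_le_of_sqENorm_le (norm_nonneg _)
      ((sqENorm_symF_le f).trans (sqENorm_eq_ofReal f).le)

lemma symOp_apply (f : L2 (Idx d)) (x : Idx d) : symOp f x = symF f x := rfl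

lemma norm_symOp_le : ‖(symOp : L2 (Idx d) →L[ℂ] L2 (Idx d))‖ ≤ 1 :=
  LinearMap.mkContinuous_norm_le _ zero_le_one _

/-- Invariance under permutations of the frequencies. -/
def IsSymm (f : Idx d → ℂ) : Prop :=
  ∀ (n : ℕ) (σ : Equiv.Perm (Fin n)) (k : Fin n → Freq d), f ⟨n, k ∘ σ⟩ = f ⟨n, k⟩

lemma isSymm_symF (f : Idx d → ℂ) : IsSymm (symF f) := fun _ σ k => avg_perm _ k σ

lemma symF_of_isSymm {f : Idx d → ℂ} (h : IsSymm f) : symF f = f :=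
  funext fun x => avg_of_symm fun σ => h x.1 σ x.2

lemma symOp_of_isSymm {f : L2 (Idx d)} (h : IsSymm f) : symOp f = f := by
  ext x; rw [symOp_apply, symF_of_isSymm h]

open Classical in
lemma symOp_single (n : ℕ) (k : Fin n → Freq d) :
    symOp (lp.single 2 ⟨n, k⟩ (1 : ℂ) : L2 (Idx d)) =
      (n.factorial : ℂ)⁻¹ • ∑ σ : Equiv.Perm (Fin n), lp.single 2 ⟨n, k ∘ σ⟩ (1 : ℂ) := by
  ext ⟨m, q⟩
  rw [symOp_apply, lp.coeFn_smul, Pi.smul_apply, lp.coeFn_sum, Finset.sum_apply, smul_eq_mul]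
  simp only [symF, avg, lp.single_apply]
  by_cases hm : m = n
  · subst hm
    congr 1
    refine Fintype.sum_equiv (Equiv.inv _) _ _ fun σ => ?_
    simp only [Pi.single_apply, Sigma.mk.injEq, heq_eq_eq, true_and, Equiv.inv_apply]
    congr 1
    apply propext
    constructor
    · rintro rfl; ext1 a; simp
    · rintro rfl; ext1 a; simp
  · have h1 : ∀ (q' : Fin m → Freq d) (k' : Fin n → Freq d),
        (Pi.single (M := fun _ : Idx d => ℂ) (⟨n, k'⟩ : Idx d) (1 : ℂ) : Idx d → ℂ) ⟨m, q'⟩ = 0 := by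
      intro q' k'
      exact Pi.single_eq_of_ne (fun h => hm (Sigma.mk.inj h).1) _
    simp [h1]

lemma adjoint_symOp :
    ContinuousLinearMap.adjoint (symOp : L2 (Idx d) →L[ℂ] L2 (Idx d)) = symOp := by
  classical
  ext f ⟨n, k⟩
  rw [← inner_single, ContinuousLinearMap.adjoint_inner_right, symOp_single, inner_smul_left,
    sum_inner]
  simp_rw [inner_single]
  simp [symOp_apply, symF, avg]

/-! #### The normalised creation operator -/

/-- The constant `(2π)^{-d/2}`. -/
def c0 (d : ℕ) : ℝ := ((2 * Real.pi) ^ ((d : ℝ) / 2))⁻¹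

lemma c0_pos (d : ℕ) : 0 < c0 d := by unfold c0; positivity

/-- The matrix element of the creation operator, conjugated by `(-𝓛₀)^{1/2}` and by the
normalisation of the Fock space, from `merge k` to `k`. -/
def creWeight (w : Fin d → ℝ) (ε : ℝ) {n : ℕ} (k : Fin (n + 2) → Freq d) : ℝ :=
  c0 d * coupling d ε * (n + 1) * √(n + 2) * dot w (k 0 + k 1) * cutoff ε (k 0) (k 1) /
    (√(energy k) * √(energy (merge k)))

open Classical in
/-- `creWeight` restricted to transitions between chaoses `lo, …, hi` and to non-zero
frequencies. -/
def creW (w : Fin d → ℝ) (ε : ℝ) (lo hi : ℕ) : Idx d → ℂ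
  | ⟨n + 2, k⟩ =>
      if (lo ≤ n + 1 ∧ n + 2 ≤ hi) ∧ ∀ a, k a ≠ 0 then (creWeight w ε k : ℂ) else 0
  | _ => 0

/-- A bound for the norm of the normalised creation operator, uniform in `ε`. -/
def creBound (w : Fin d → ℝ) (hi : ℕ) : ℝ :=
  √(4 * wSq w * (c0 d * (hi : ℝ) * √hi) ^ 2 * (2 * d * 3 ^ (d - 1)))

lemma creBound_sq (w : Fin d → ℝ) (hi : ℕ) : creBound w hi ^ 2 =
    4 * wSq w * (c0 d * (hi : ℝ) * √hi) ^ 2 * (2 * d * 3 ^ (d - 1)) := by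
  have := wSq_nonneg w
  exact Real.sq_sqrt (by positivity)

lemma creWeight_sq_le (w : Fin d → ℝ) {ε : ℝ} (hε : 0 < ε) {n hi : ℕ} (hn : n + 2 ≤ hi)
    (p : Fin (n + 1) → Freq d) (l : Freq d) :
    creWeight w ε (split p l) ^ 2 ≤
      (4 * wSq w * (c0 d * (hi : ℝ) * √hi) ^ 2 * coupling d ε ^ 2) * (‖l‖ ^ 2)⁻¹ := by
  have hR : 0 ≤ (4 * wSq w * (c0 d * (hi : ℝ) * √hi) ^ 2 * coupling d ε ^ 2) * (‖l‖ ^ 2)⁻¹ := by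
    have := wSq_nonneg w; positivity
  by_cases hc : cutoff ε l (p 0 - l) = 0
  · simpa [creWeight, hc] using hR
  obtain ⟨⟨hl, -, hp⟩, -⟩ := of_cutoff_ne_zero hε hc
  have hp0 : p 0 ≠ 0 := by simpa using hp
  have hE := energy_pos hp0
  have hEs : 0 < energy (split p l) := energy_pos (j := 0) (by simpa using hl)
  have hnl : 0 < ‖l‖ := norm_pos_iff.2 hl
  have hnl2 : ‖l‖ ^ 2 ≤ 2 * energy (split p l) := norm_sq_le_energy (split p l) 0
  have hd := dot_sq_le w p 0
  have hJ : cutoff ε l (p 0 - l) ^ 2 ≤ 1 := by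
    have h1 := cutoff_nonneg ε l (p 0 - l)
    have h2 := cutoff_le_one ε l (p 0 - l)
    nlinarith
  have hhi : ((n : ℝ) + 2) ≤ hi := by exact_mod_cast hn
  have hw := wSq_nonneg w
  have hc0 := c0_pos d
  have hcoup := coupling_nonneg (d := d) hε
  unfold creWeight
  rw [merge_split, split_zero, split_one, add_sub_cancel, div_pow, mul_pow (√_) (√_),
    Real.sq_sqrt hE.le, Real.sq_sqrt hEs.le, div_le_iff₀ (by positivity)]
  have h1 : (c0 d * coupling d ε * (n + 1) * √(n + 2) * dot w (p 0) * cutoff ε l (p 0 - l)) ^ 2 ≤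
      (c0 d * coupling d ε * hi * √hi) ^ 2 * (wSq w * (2 * energy p)) := by
    calc _ = (c0 d * coupling d ε * (n + 1) * √(n + 2)) ^ 2 * dot w (p 0) ^ 2 *
          cutoff ε l (p 0 - l) ^ 2 := by ring
      _ ≤ (c0 d * coupling d ε * hi * √hi) ^ 2 * (wSq w * (2 * energy p)) * 1 := by
          gcongr
          linarith
      _ = _ := by ring
  refine h1.trans ?_
  have h2 : (1 : ℝ) ≤ 2 * energy (split p l) * (‖l‖ ^ 2)⁻¹ := by
    rw [← div_eq_mul_inv, le_div_iff₀ (by positivity)]; linarith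
  calc (c0 d * coupling d ε * hi * √hi) ^ 2 * (wSq w * (2 * energy p))
      = (c0 d * coupling d ε * hi * √hi) ^ 2 * (wSq w * (2 * energy p)) * 1 := by ring
    _ ≤ (c0 d * coupling d ε * hi * √hi) ^ 2 * (wSq w * (2 * energy p)) *
        (2 * energy (split p l) * (‖l‖ ^ 2)⁻¹) := by gcongr
    _ = _ := by ring

lemma creW_split (w : Fin d → ℝ) (ε : ℝ) (lo hi : ℕ) (x : Idx d) (hx : creW w ε lo hi x ≠ 0) :
    ∃ l, splitI (mergeI x) l = x := by
  rcases x with ⟨_ | _ | n, k⟩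
  · simp [creW] at hx
  · simp [creW] at hx
  · exact ⟨k 0, by simp [mergeI, splitI]⟩

lemma creW_mergeI (w : Fin d → ℝ) (ε : ℝ) (lo hi : ℕ) (y : Idx d) (l : Freq d)
    (hy : creW w ε lo hi (splitI y l) ≠ 0) : mergeI (splitI y l) = y := by
  rcases y with ⟨_ | n, p⟩
  · simp [creW, splitI] at hy
  · simp [mergeI, splitI]

/-- The creation weights satisfy the fibre bound with a constant independent of `ε`. This is where
`d ≥ 3` and the coupling `ε^{d/2-1}` balance each other. -/
lemma fiberBound_creW (hd : 3 ≤ d) (w : Fin d → ℝ) {ε : ℝ} (hε : 0 < ε) (lo hi : ℕ) :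
    FiberBound (creW w ε lo hi) mergeI (creBound w hi) := by
  refine FiberBound.of_param (Real.sqrt_nonneg _) splitI (creW_split w ε lo hi) ?_
  rintro ⟨_ | n, p⟩
  · simp [splitI, creW]
  by_cases hn : n + 2 ≤ hi
  swap
  · simp [splitI, creW, hn]
  have hw := wSq_nonneg w
  rw [creBound_sq]
  have key := tsum_enorm_sq_le_of_inv hd (f := fun l => creW w ε lo hi (splitI ⟨n + 1, p⟩ l))
    (A := 4 * wSq w * (c0 d * (hi : ℝ) * √hi) ^ 2 * coupling d ε ^ 2) (r := 1 / ε)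
    (by positivity) (by positivity) ?_ ?_
  · refine key.trans (ENNReal.ofReal_le_ofReal (le_of_eq ?_))
    rw [coupling_sq hε hd, one_div, inv_pow]
    field_simp
  · intro l hl
    simp only [splitI, creW] at hl
    split_ifs at hl with h
    · have : cutoff ε l (p 0 - l) ≠ 0 := by
        intro h0; apply hl; simp [creWeight, h0]
      exact (of_cutoff_ne_zero hε this).2.1
    · exact absurd rfl hl
  · intro l
    simp only [splitI, creW]
    split_ifs with h
    · rw [Complex.norm_real, Real.norm_eq_abs, sq_abs]
      exact creWeight_sq_le w hε hn p l
    · rw [norm_zero, zero_pow two_ne_zero]; positivity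

/-- The normalised creation operator before symmetrisation. -/
def creOp (w : Fin d → ℝ) (ε : ℝ) (lo hi : ℕ) : L2 (Idx d) →L[ℂ] L2 (Idx d) :=
  wcomp (creW w ε lo hi) mergeI

/-- The adjoint of `creOp`, the normalised annihilation operator before symmetrisation and up to
a sign. -/
def annOp (w : Fin d → ℝ) (ε : ℝ) (lo hi : ℕ) : L2 (Idx d) →L[ℂ] L2 (Idx d) :=
  ContinuousLinearMap.adjoint (creOp w ε lo hi)

lemma norm_creOp_le (hd : 3 ≤ d) (w : Fin d → ℝ) {ε : ℝ} (hε : 0 < ε) (lo hi : ℕ) :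
    ‖creOp w ε lo hi‖ ≤ creBound w hi := norm_wcomp_le (fiberBound_creW hd w hε lo hi)

lemma norm_annOp_le (hd : 3 ≤ d) (w : Fin d → ℝ) {ε : ℝ} (hε : 0 < ε) (lo hi : ℕ) :
    ‖annOp w ε lo hi‖ ≤ creBound w hi := by
  rw [annOp, LinearIsometryEquiv.norm_map]; exact norm_creOp_le hd w hε lo hi

lemma creOp_apply (hd : 3 ≤ d) (w : Fin d → ℝ) {ε : ℝ} (hε : 0 < ε) (lo hi : ℕ)
    (f : L2 (Idx d)) (x : Idx d) :
    creOp w ε lo hi f x = creW w ε lo hi x * f (mergeI x) :=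
  wcomp_apply (fiberBound_creW hd w hε lo hi) f x

lemma annOp_apply (hd : 3 ≤ d) (w : Fin d → ℝ) {ε : ℝ} (hε : 0 < ε) (lo hi : ℕ)
    (f : L2 (Idx d)) (y : Idx d) :
    annOp w ε lo hi f y = ∑' l, creW w ε lo hi (splitI y l) * f (splitI y l) := by
  rw [annOp, creOp, adjoint_wcomp_apply (fiberBound_creW hd w hε lo hi) splitI
    (creW_split w ε lo hi) (creW_mergeI w ε lo hi) splitI_injective]
  refine tsum_congr fun l => ?_
  congr 1
  rcases splitI y l with ⟨_ | _ | n, k⟩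
  · simp [creW]
  · simp [creW]
  · simp only [creW]; split_ifs <;> simp

/-- The operator `(-𝓛₀)^{-1/2} P (𝒜₊ + 𝒜₋) P (-𝓛₀)^{-1/2}` in normalised coordinates, with `P`
the projection onto the chaoses `lo, …, hi`. -/
def genOp (w : Fin d → ℝ) (ε : ℝ) (lo hi : ℕ) : L2 (Idx d) →L[ℂ] L2 (Idx d) :=
  symOp ∘L creOp w ε lo hi ∘L symOp - symOp ∘L annOp w ε lo hi ∘L symOp

lemma adjoint_genOp (w : Fin d → ℝ) (ε : ℝ) (lo hi : ℕ) :
    ContinuousLinearMap.adjoint (genOp w ε lo hi) = -genOp w ε lo hi := by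
  simp only [genOp, annOp, map_sub, ContinuousLinearMap.adjoint_comp, adjoint_symOp,
    ContinuousLinearMap.adjoint_adjoint, ContinuousLinearMap.comp_assoc]
  abel

lemma genOp_apply (w : Fin d → ℝ) (ε : ℝ) (lo hi : ℕ) (f : L2 (Idx d)) :
    genOp w ε lo hi f =
      symOp (creOp w ε lo hi (symOp f)) - symOp (annOp w ε lo hi (symOp f)) := rfl

lemma norm_symOp_apply_le (f : L2 (Idx d)) : ‖symOp f‖ ≤ ‖f‖ := by
  simpa using (symOp.le_opNorm f).trans (mul_le_mul_of_nonneg_right norm_symOp_le (norm_nonneg f))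

lemma norm_symOp_comp_le (A : L2 (Idx d) →L[ℂ] L2 (Idx d)) : ‖symOp ∘L A‖ ≤ ‖A‖ :=
  ContinuousLinearMap.opNorm_le_bound _ (norm_nonneg _) fun f =>
    (norm_symOp_apply_le _).trans (A.le_opNorm f)

lemma norm_comp_symOp_le (A : L2 (Idx d) →L[ℂ] L2 (Idx d)) : ‖A ∘L symOp‖ ≤ ‖A‖ :=
  ContinuousLinearMap.opNorm_le_bound _ (norm_nonneg _) fun f =>
    (A.le_opNorm _).trans (by gcongr; exact norm_symOp_apply_le f)

lemma norm_genOp_le (hd : 3 ≤ d) (w : Fin d → ℝ) {ε : ℝ} (hε : 0 < ε) (lo hi : ℕ) :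
    ‖genOp w ε lo hi‖ ≤ 2 * creBound w hi := by
  have h1 := (norm_symOp_comp_le (creOp w ε lo hi ∘L symOp)).trans
    ((norm_comp_symOp_le _).trans (norm_creOp_le hd w hε lo hi))
  have h2 := (norm_symOp_comp_le (annOp w ε lo hi ∘L symOp)).trans
    ((norm_comp_symOp_le _).trans (norm_annOp_le hd w hε lo hi))
  unfold genOp
  refine (norm_sub_le _ _).trans ?_
  linarith

end Operators

/-! ### Scales and macroscopic frequencies -/

section Scaling

variable {d : ℕ}

lemma scales_pos {ε : ℝ} (h : ε ∈ scales) : 0 < ε := h.1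

lemma scales_le_two {ε : ℝ} (h : ε ∈ scales) : ε ≤ 2 := by
  obtain ⟨h0, N, hN⟩ := h
  have h1 : (1 : ℝ) / 2 ≤ 1 / ε := by rw [hN]; linarith [Nat.cast_nonneg (α := ℝ) N]
  rw [div_le_div_iff₀ (by norm_num) h0] at h1
  linarith

instance neBot_scales : (𝓝[scales] (0 : ℝ)).NeBot := by
  rw [← mem_closure_iff_nhdsWithin_neBot]
  refine mem_closure_of_tendsto (f := fun N : ℕ => 1 / ((N : ℝ) + 1 / 2)) (b := atTop) ?_ ?_
  · simp only [one_div]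
    exact tendsto_inv_atTop_zero.comp
      (tendsto_atTop_add_const_right _ _ tendsto_natCast_atTop_atTop)
  · exact Eventually.of_forall fun N => ⟨by positivity, N, by rw [one_div_one_div]⟩

lemma eventually_scales : ∀ᶠ ε in 𝓝[scales] (0 : ℝ), ε ∈ scales := self_mem_nhdsWithin

lemma tendsto_scales : Tendsto (fun ε : ℝ => ε) (𝓝[scales] 0) (𝓝[>] 0) :=
  tendsto_id.mono_right (nhdsWithin_mono _ fun _ h => h.1)

lemma eventually_scales_lt {δ : ℝ} (hδ : 0 < δ) : ∀ᶠ ε in 𝓝[scales] (0 : ℝ), ε < δ :=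
  (tendsto_id.mono_right nhdsWithin_le_nhds : Tendsto (fun ε : ℝ => ε) (𝓝[scales] 0)
    (𝓝 0)).eventually_lt_const hδ

/-- The macroscopic frequencies `ε k`. -/
def scale (ε : ℝ) {n : ℕ} (k : Fin n → Freq d) : Fin n → Fin d → ℝ := fun j a => ε * (k j a : ℝ)

lemma norm_mul_cast {ε : ℝ} (hε : 0 ≤ ε) (l : Freq d) :
    ‖(fun a => ε * (l a : ℝ) : Fin d → ℝ)‖ = ε * ‖l‖ := by
  have h1 : (fun a => ε * (l a : ℝ) : Fin d → ℝ) = ε • fun a => (l a : ℝ) := rfl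
  have h2 : ‖(fun a => (l a : ℝ) : Fin d → ℝ)‖ = ‖l‖ := by
    refine le_antisymm ?_ ?_
    · rw [pi_norm_le_iff_of_nonneg (norm_nonneg _)]
      intro a
      rw [Real.norm_eq_abs, ← Int.norm_eq_abs]
      exact norm_le_pi_norm l a
    · rw [pi_norm_le_iff_of_nonneg (norm_nonneg _)]
      intro a
      rw [Int.norm_eq_abs, ← Real.norm_eq_abs]
      exact norm_le_pi_norm (fun a => (l a : ℝ)) a
  rw [h1, norm_smul, h2, Real.norm_eq_abs, abs_of_nonneg hε]

lemma norm_scale {ε : ℝ} (hε : 0 ≤ ε) {n : ℕ} (k : Fin n → Freq d) (j : Fin n) :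
    ‖scale ε k j‖ = ε * ‖k j‖ := norm_mul_cast hε (k j)

lemma norm_scale_add {ε : ℝ} (hε : 0 ≤ ε) {n : ℕ} (k : Fin n → Freq d) (i j : Fin n) :
    ‖scale ε k i + scale ε k j‖ = ε * ‖k i + k j‖ := by
  rw [← norm_mul_cast hε]
  congr 1
  ext a
  simp only [scale, Pi.add_apply]; push_cast; ring

lemma scale_merge (ε : ℝ) {n : ℕ} (k : Fin (n + 2) → Freq d) :
    scale ε (merge k) = merge (scale ε k) := by
  ext j a
  refine Fin.cases ?_ (fun j => ?_) j
  · simp only [scale, merge_zero, Pi.add_apply]; push_cast; ring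
  · rfl

/-- The energy of macroscopic frequencies. -/
def energyR {n : ℕ} (x : Fin n → Fin d → ℝ) : ℝ := 1 / 2 * ∑ j, ∑ a, x j a ^ 2

lemma energyR_scale (ε : ℝ) {n : ℕ} (k : Fin n → Freq d) :
    energyR (scale ε k) = ε ^ 2 * energy k := by
  simp only [energyR, scale, energy, normSq, mul_pow, ← Finset.mul_sum]
  ring

lemma continuous_energyR {n : ℕ} : Continuous (energyR : (Fin n → Fin d → ℝ) → ℝ) := by
  unfold energyR; fun_prop

lemma energyR_pos {n : ℕ} {x : Fin n → Fin d → ℝ} {j : Fin n} (h : x j ≠ 0) : 0 < energyR x := by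
  obtain ⟨a, ha⟩ := Function.ne_iff.1 h
  have h1 : 0 < x j a ^ 2 := by have : x j a ≠ 0 := ha; positivity
  have h2 : x j a ^ 2 ≤ ∑ a, x j a ^ 2 :=
    Finset.single_le_sum (f := fun a => x j a ^ 2) (fun _ _ => by positivity) (Finset.mem_univ a)
  have h3 : ∑ a, x j a ^ 2 ≤ ∑ j, ∑ a, x j a ^ 2 :=
    Finset.single_le_sum (f := fun j => ∑ a, x j a ^ 2) (fun _ _ => by positivity)
      (Finset.mem_univ j)
  unfold energyR
  linarith

/-- Points away from the discontinuities of all the cut-offs: no partial sum of the frequencies has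
sup norm `0` or `1`. -/
def Generic {n : ℕ} (x : Fin n → Fin d → ℝ) : Prop :=
  ∀ A : Finset (Fin n), A.Nonempty → A ≠ Finset.univ → ‖∑ j ∈ A, x j‖ ≠ 0 ∧ ‖∑ j ∈ A, x j‖ ≠ 1

lemma Generic.perm {n : ℕ} {x : Fin n → Fin d → ℝ} (h : Generic x) (σ : Equiv.Perm (Fin n)) :
    Generic (x ∘ σ) := by
  intro A hA hA'
  have := h (A.map σ.toEmbedding) (by simpa using hA) (fun h' => hA' (by
    ext j
    have := (Finset.ext_iff.1 h' (σ j))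
    simpa using this))
  simpa using this

lemma Generic.single {n : ℕ} {x : Fin (n + 2) → Fin d → ℝ} (h : Generic x) (j : Fin (n + 2)) :
    ‖x j‖ ≠ 0 ∧ ‖x j‖ ≠ 1 := by
  have := h {j} (Finset.singleton_nonempty j) (fun h' => by
    have := congrArg Finset.card h'
    simp at this)
  simpa using this

lemma Generic.pair {n : ℕ} {x : Fin (n + 3) → Fin d → ℝ} (h : Generic x) :
    ‖x 0 + x 1‖ ≠ 0 ∧ ‖x 0 + x 1‖ ≠ 1 := by
  have h01 : (0 : Fin (n + 3)) ≠ 1 := by simp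
  have := h {0, 1} ⟨0, by simp⟩ (fun h' => by
    have := congrArg Finset.card h'
    rw [Finset.card_pair h01] at this
    simp at this)
  rwa [Finset.sum_pair h01] at this

/-- Sums over a subset of the entries, written with indicators. -/
lemma sum_split {n : ℕ} (y : Fin (n + 1) → Fin d → ℝ) (z : Fin d → ℝ) (A : Finset (Fin (n + 2))) :
    ∑ j ∈ A, split y z j = (if (0 : Fin (n + 2)) ∈ A then z else 0) +
      ((if (1 : Fin (n + 2)) ∈ A then y 0 - z else 0) +
        ∑ a : Fin n, if a.succ.succ ∈ A then y a.succ else 0) := by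
  rw [← Finset.sum_ite_mem_eq, Fin.sum_univ_succ, Fin.sum_univ_succ]
  rfl

lemma Generic.merge {n : ℕ} {x : Fin (n + 2) → Fin d → ℝ} (h : Generic x) :
    Generic (merge x) := by
  classical
  intro A hA hA'
  let P : Fin (n + 2) → Prop :=
    Fin.cases ((0 : Fin (n + 1)) ∈ A) (Fin.cases ((0 : Fin (n + 1)) ∈ A) fun a => a.succ ∈ A)
  let B : Finset (Fin (n + 2)) := Finset.univ.filter P
  have h0 : (0 : Fin (n + 2)) ∈ B ↔ (0 : Fin (n + 1)) ∈ A := by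
    simp only [B, Finset.mem_filter, Finset.mem_univ, true_and]; rfl
  have h1 : (1 : Fin (n + 2)) ∈ B ↔ (0 : Fin (n + 1)) ∈ A := by
    simp only [B, Finset.mem_filter, Finset.mem_univ, true_and]; rfl
  have h2 : ∀ a : Fin n, a.succ.succ ∈ B ↔ a.succ ∈ A := fun a => by
    simp only [B, Finset.mem_filter, Finset.mem_univ, true_and]; rfl
  have hsum : ∑ j ∈ B, x j = ∑ j ∈ A, BurgersFock.merge x j := by
    have e := sum_split (BurgersFock.merge x) (x 0) B
    rw [split_merge] at e
    rw [e]
    simp only [h0, h1, h2]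
    rw [← Finset.sum_ite_mem_eq A, Fin.sum_univ_succ]
    by_cases hA0 : (0 : Fin (n + 1)) ∈ A
    · simp only [hA0, if_true]; abel
    · simp [hA0]
  rw [← hsum]
  refine h B ?_ ?_
  · obtain ⟨j, hj⟩ := hA
    revert hj
    refine Fin.cases (fun hj => ⟨0, h0.2 hj⟩) (fun a hj => ⟨a.succ.succ, (h2 a).2 hj⟩) j
  · intro hB
    apply hA'
    ext j
    refine Fin.cases ?_ (fun a => ?_) j
    · rw [← h0, hB]; simp
    · rw [← h2, hB]; simp

lemma ae_norm_add_ne [NeZero d] (c : Fin d → ℝ) (t : ℝ) :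
    ∀ᵐ z : Fin d → ℝ, ‖z + c‖ ≠ t := by
  have h := Measure.addHaar_sphere (volume : Measure (Fin d → ℝ)) (-c) t
  rw [← compl_mem_ae_iff] at h
  filter_upwards [h] with z hz h'
  apply hz
  rw [mem_sphere_iff_norm, sub_neg_eq_add, h']

/-- Splitting the first entry of a generic point is generic for almost every value of the new
entry. -/
lemma ae_generic_split [NeZero d] {n : ℕ} {y : Fin (n + 1) → Fin d → ℝ} (hy : Generic y) :
    ∀ᵐ z : Fin d → ℝ, Generic (split y z) := by
  classical
  unfold Generic
  rw [ae_all_iff]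
  intro A
  by_cases hne : A.Nonempty ∧ A ≠ Finset.univ
  swap
  · exact Eventually.of_forall fun z h1 h2 => absurd ⟨h1, h2⟩ hne
  set b : Fin d → ℝ := ∑ a : Fin n, if a.succ.succ ∈ A then y a.succ else 0 with hb
  by_cases h0 : (0 : Fin (n + 2)) ∈ A <;> by_cases h1 : (1 : Fin (n + 2)) ∈ A
  rotate_left
  · filter_upwards [ae_norm_add_ne b 0, ae_norm_add_ne b 1] with z hz0 hz1 _ _
    rw [sum_split, if_pos h0, if_neg h1, zero_add]
    exact ⟨hz0, hz1⟩
  · filter_upwards [ae_norm_add_ne (-(y 0 + b)) 0, ae_norm_add_ne (-(y 0 + b)) 1] with z hz0 hz1 _ _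
    rw [sum_split, if_neg h0, if_pos h1, zero_add]
    have : y 0 - z + b = -(z + -(y 0 + b)) := by abel
    rw [← hb, this, norm_neg]
    exact ⟨hz0, hz1⟩
  all_goals
    refine Eventually.of_forall fun z hA hA' => ?_
    let P : Fin (n + 1) → Prop := Fin.cases ((0 : Fin (n + 2)) ∈ A) fun a => a.succ.succ ∈ A
    let B : Finset (Fin (n + 1)) := Finset.univ.filter P
    have hB0 : (0 : Fin (n + 1)) ∈ B ↔ (0 : Fin (n + 2)) ∈ A := by
      simp only [B, Finset.mem_filter, Finset.mem_univ, true_and]; rfl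
    have hB2 : ∀ a : Fin n, a.succ ∈ B ↔ a.succ.succ ∈ A := fun a => by
      simp only [B, Finset.mem_filter, Finset.mem_univ, true_and]; rfl
    have hsum : ∑ j ∈ A, split y z j = ∑ j ∈ B, y j := by
      rw [sum_split, ← Finset.sum_ite_mem_eq B, Fin.sum_univ_succ]
      simp [hB0, hB2, h0, h1]
      try abel
    rw [hsum]
    refine hy B ?_ ?_
    · obtain ⟨j, hj⟩ := hA
      revert hj
      refine Fin.cases (fun hj => ⟨0, hB0.2 hj⟩) (Fin.cases (fun hj => ⟨0, hB0.2 ?_⟩)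
        (fun a hj => ⟨a.succ, (hB2 a).2 hj⟩)) j
      first | exact h0 | exact absurd hj h1
    · intro hB
      apply hA'
      ext j
      refine Fin.cases ?_ (Fin.cases ?_ (fun a => ?_)) j
      · rw [← hB0, hB]; simp
      · have h0' : (0 : Fin (n + 2)) ∈ A := by rw [← hB0, hB]; simp
        first | exact iff_of_true h1 (Finset.mem_univ _) | exact absurd h0' h0
      · rw [← hB2, hB]; simp

/-! ### The scaling filter -/

/-- The filter of pairs `(ε, k)` with total momentum `K` such that `ε → 0` along the scales and
`ε k → x`. -/
def scaling {n : ℕ} (K : Freq d) (x : Fin n → Fin d → ℝ) : Filter (ℝ × (Fin n → Freq d)) :=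
  comap Prod.fst (𝓝[scales] 0) ⊓ comap (fun z => scale z.1 z.2) (𝓝 x) ⊓ 𝓟 {z | tot z.2 = K}

instance {n : ℕ} (K : Freq d) (x : Fin n → Fin d → ℝ) : (scaling K x).IsCountablyGenerated := by
  unfold scaling; infer_instance

lemma tendsto_scaling {n : ℕ} {Z : Type*} {L : Filter Z} {K : Freq d} {x : Fin n → Fin d → ℝ}
    {ε : Z → ℝ} {k : Z → Fin n → Freq d} (h1 : Tendsto ε L (𝓝[scales] 0))
    (h2 : Tendsto (fun z => scale (ε z) (k z)) L (𝓝 x)) (h3 : ∀ᶠ z in L, tot (k z) = K) :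
    Tendsto (fun z => (ε z, k z)) L (scaling K x) := by
  unfold scaling
  rw [tendsto_inf, tendsto_inf, tendsto_comap_iff, tendsto_comap_iff, tendsto_principal]
  exact ⟨⟨h1, h2⟩, h3⟩

lemma scaling_fst {n : ℕ} (K : Freq d) (x : Fin n → Fin d → ℝ) :
    Tendsto Prod.fst (scaling K x) (𝓝[scales] 0) :=
  tendsto_comap.mono_left (inf_le_left.trans inf_le_left)

lemma scaling_snd {n : ℕ} (K : Freq d) (x : Fin n → Fin d → ℝ) :
    Tendsto (fun z : ℝ × (Fin n → Freq d) => scale z.1 z.2) (scaling K x) (𝓝 x) :=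
  tendsto_comap.mono_left (inf_le_left.trans inf_le_right)

lemma scaling_tot {n : ℕ} (K : Freq d) (x : Fin n → Fin d → ℝ) :
    ∀ᶠ z in scaling K x, tot z.2 = K :=
  (inf_le_right : scaling K x ≤ _) (mem_principal_self _)

lemma scaling_merge {n : ℕ} (K : Freq d) (x : Fin (n + 2) → Fin d → ℝ) :
    Tendsto (fun z : ℝ × (Fin (n + 2) → Freq d) => (z.1, merge z.2)) (scaling K x)
      (scaling K (merge x)) := by
  refine tendsto_scaling (scaling_fst K x) ?_ ?_
  · simp_rw [scale_merge]
    have hc : Continuous (merge : (Fin (n + 2) → Fin d → ℝ) → _) := by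
      refine continuous_pi fun j => Fin.cases ?_ (fun a => ?_) j
      · simp only [merge_zero]; fun_prop
      · simp only [merge_succ]; fun_prop
    exact (hc.tendsto x).comp (scaling_snd K x)
  · filter_upwards [scaling_tot K x] with z hz
    rw [tot_merge, hz]

lemma scaling_perm {n : ℕ} (K : Freq d) (x : Fin n → Fin d → ℝ) (σ : Equiv.Perm (Fin n)) :
    Tendsto (fun z : ℝ × (Fin n → Freq d) => (z.1, z.2 ∘ σ)) (scaling K x)
      (scaling K (x ∘ σ)) := by
  refine tendsto_scaling (scaling_fst K x) ?_ ?_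
  · have hc : Continuous (fun y : Fin n → Fin d → ℝ => y ∘ σ) :=
      continuous_pi fun j => continuous_apply (σ j)
    exact (hc.tendsto x).comp (scaling_snd K x)
  · filter_upwards [scaling_tot K x] with z hz
    rw [tot_perm, hz]

lemma scaling_split {n : ℕ} (K : Freq d) (y : Fin (n + 1) → Fin d → ℝ) (x : Fin d → ℝ) :
    Tendsto (fun z : ℝ × (Fin (n + 1) → Freq d) => (z.1, split z.2 (latticeFloor z.1 x)))
      (scaling K y) (scaling K (split y x)) := by
  have hf := tendsto_mul_latticeFloor (tendsto_scales.comp (scaling_fst K y)) x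
  refine tendsto_scaling (scaling_fst K y) ?_ ?_
  · rw [tendsto_pi_nhds]
    have hs := tendsto_pi_nhds.1 (scaling_snd K y)
    intro j
    refine Fin.cases ?_ (Fin.cases ?_ (fun a => ?_)) j
    · exact hf
    · change Tendsto _ _ (𝓝 (split y x 1))
      rw [split_one]
      refine ((hs 0).sub hf).congr fun z => ?_
      ext a
      change _ = z.1 * (((split z.2 (latticeFloor z.1 x) 1 : Freq d) a : ℤ) : ℝ)
      rw [split_one]
      simp only [Pi.sub_apply, scale, Function.comp]; push_cast; ring
    · exact hs a.succ
  · filter_upwards [scaling_tot K y] with z hz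
    rw [tot_split, hz]

end Scaling

/-! ### Weights in the scaling limit -/

section Families

variable {d : ℕ}

/-- The indicator of the macroscopic cut-off. -/
def cutLim (x y : Fin d → ℝ) : ℝ := if ‖x‖ ≤ 1 ∧ ‖y‖ ≤ 1 ∧ ‖x + y‖ ≤ 1 then 1 else 0

lemma eventually_le_one_iff {Z : Type*} {L : Filter Z} {f : Z → ℝ} {t : ℝ}
    (hf : Tendsto f L (𝓝 t)) (ht : 0 < t) (ht1 : t ≠ 1) :
    ∀ᶠ z in L, (0 < f z ∧ f z ≤ 1) ↔ t ≤ 1 := by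
  rcases lt_or_gt_of_ne ht1 with h | h
  · filter_upwards [hf.eventually_const_lt ht, hf.eventually_lt_const h] with z h1 h2
    exact iff_of_true ⟨h1, h2.le⟩ h.le
  · filter_upwards [hf.eventually_const_lt h] with z h1
    exact iff_of_false (fun h' => absurd h'.2 (not_le.2 h1)) (not_le.2 h)

lemma norm_pos_of_ne {x : Fin d → ℝ} (h : ‖x‖ ≠ 0) : 0 < ‖x‖ :=
  lt_of_le_of_ne (norm_nonneg _) h.symm

lemma scaling_pos {n : ℕ} (K : Freq d) (x : Fin n → Fin d → ℝ) :
    ∀ᶠ z in scaling K x, 0 < z.1 := by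
  filter_upwards [(scaling_fst K x) eventually_scales] with z hz using scales_pos hz

lemma scaling_cutoff {n : ℕ} (K : Freq d) {x : Fin (n + 3) → Fin d → ℝ} (hx : Generic x) :
    ∀ᶠ z in scaling K x, cutoff z.1 (z.2 0) (z.2 1) = cutLim (x 0) (x 1) := by
  have hs := tendsto_pi_nhds.1 (scaling_snd K x)
  have h0 := eventually_le_one_iff (hs 0).norm (norm_pos_of_ne (hx.single 0).1) (hx.single 0).2
  have h1 := eventually_le_one_iff (hs 1).norm (norm_pos_of_ne (hx.single 1).1) (hx.single 1).2
  have h2 := eventually_le_one_iff ((hs 0).add (hs 1)).norm (norm_pos_of_ne hx.pair.1) hx.pair.2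
  filter_upwards [h0, h1, h2, scaling_pos K x] with z e0 e1 e2 hz
  rw [norm_scale hz.le] at e0 e1
  rw [norm_scale_add hz.le] at e2
  unfold cutoff cutLim
  simp only [e0, e1, e2]

lemma scaling_nonzero {n : ℕ} (K : Freq d) {x : Fin (n + 2) → Fin d → ℝ} (hx : Generic x) :
    ∀ᶠ z in scaling K x, ∀ a, z.2 a ≠ 0 := by
  have hs := tendsto_pi_nhds.1 (scaling_snd K x)
  rw [eventually_all]
  intro a
  filter_upwards [(hs a).norm.eventually_const_lt (norm_pos_of_ne (hx.single a).1),
    scaling_pos K x] with z hz hp h0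
  rw [norm_scale hp.le, h0] at hz
  simp at hz

/-- The macroscopic limit of `ε^{-d/2} creWeight`. -/
def creLim (w : Fin d → ℝ) {n : ℕ} (x : Fin (n + 2) → Fin d → ℝ) : ℝ :=
  c0 d * (n + 1) * √(n + 2) * (∑ a, w a * (x 0 + x 1) a) * cutLim (x 0) (x 1) /
    (√(energyR x) * √(energyR (merge x)))

lemma coupling_eq {ε : ℝ} (hε : 0 < ε) : coupling d ε = ε ^ ((d : ℝ) / 2) * ε⁻¹ := by
  rw [coupling, Real.rpow_sub hε, Real.rpow_one, div_eq_mul_inv]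

/-- The exact scaling of the weight of the creation operator. -/
lemma creWeight_scale (w : Fin d → ℝ) {ε : ℝ} (hε : 0 < ε) {n : ℕ} (k : Fin (n + 2) → Freq d) :
    (ε ^ ((d : ℝ) / 2))⁻¹ * creWeight w ε k =
      c0 d * (n + 1) * √(n + 2) * (∑ a, w a * (scale ε k 0 + scale ε k 1) a) *
        cutoff ε (k 0) (k 1) / (√(energyR (scale ε k)) * √(energyR (merge (scale ε k)))) := by
  rw [← scale_merge, energyR_scale, energyR_scale, Real.sqrt_mul (by positivity),
    Real.sqrt_mul (by positivity), Real.sqrt_sq hε.le]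
  have hdot : ∑ a, w a * (scale ε k 0 + scale ε k 1) a = ε * dot w (k 0 + k 1) := by
    rw [dot, Finset.mul_sum]
    refine Finset.sum_congr rfl fun a _ => ?_
    simp only [Pi.add_apply, scale]; push_cast; ring
  rw [hdot, creWeight, coupling_eq hε]
  have h1 : ε ^ ((d : ℝ) / 2) ≠ 0 := (Real.rpow_pos_of_pos hε _).ne'
  have h2 : (ε * √(energy k) * (ε * √(energy (merge k)))) =
    ε ^ 2 * (√(energy k) * √(energy (merge k))) := by ring
  rw [h2]
  generalize √(energy k) * √(energy (merge k)) = s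
  rw [mul_div_assoc', div_mul_eq_div_div]
  congr 1
  field_simp

/-- The creation weight is of order `ε^{d/2}`, with a limit that depends only on the macroscopic
frequencies. -/
lemma tendsto_creWeight (w : Fin d → ℝ) {n : ℕ} (K : Freq d) {x : Fin (n + 3) → Fin d → ℝ}
    (hx : Generic x) :
    Tendsto (fun z : ℝ × (Fin (n + 3) → Freq d) => (z.1 ^ ((d : ℝ) / 2))⁻¹ * creWeight w z.1 z.2)
      (scaling K x) (𝓝 (creLim w x)) := by
  have hs := tendsto_pi_nhds.1 (scaling_snd K x)
  have hm := (continuous_energyR.tendsto _).comp (scaling_snd K (merge x) |>.comp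
    (scaling_merge K x))
  have hE := (continuous_energyR.tendsto _).comp (scaling_snd K x)
  have hx0 : 0 < energyR x := energyR_pos (j := 0) (norm_ne_zero_iff.1 (hx.single 0).1)
  have hm0 : 0 < energyR (merge x) :=
    energyR_pos (j := 0) (norm_ne_zero_iff.1 (by rw [merge_zero]; exact hx.pair.1))
  have hc : Tendsto (fun z : ℝ × (Fin (n + 3) → Freq d) => cutoff z.1 (z.2 0) (z.2 1))
      (scaling K x) (𝓝 (cutLim (x 0) (x 1))) :=
    tendsto_const_nhds.congr' (by
      filter_upwards [scaling_cutoff K hx] with z hz using hz.symm)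
  have hd : Tendsto (fun z : ℝ × (Fin (n + 3) → Freq d) =>
      ∑ a, w a * (scale z.1 z.2 0 + scale z.1 z.2 1) a) (scaling K x)
      (𝓝 (∑ a, w a * (x 0 + x 1) a)) := by
    refine tendsto_finsetSum _ fun a _ => Tendsto.const_mul _ ?_
    exact (tendsto_pi_nhds.1 (hs 0) a).add (tendsto_pi_nhds.1 (hs 1) a)
  have key := ((hd.const_mul (c0 d * ((n + 1 : ℕ) + 1) * √((n + 1 : ℕ) + 2))).mul hc).div
    ((hE.sqrt).mul hm.sqrt) (by positivity)
  refine Tendsto.congr' ?_ key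
  filter_upwards [scaling_pos K x] with z hz
  rw [creWeight_scale w hz]
  simp only [Function.comp, scale_merge]
  rfl

/-- The limit of the restricted weight `creW`. -/
def creWLim (w : Fin d → ℝ) (lo hi : ℕ) {n : ℕ} (x : Fin (n + 2) → Fin d → ℝ) : ℂ :=
  if lo ≤ n + 1 ∧ n + 2 ≤ hi then (creLim w x : ℂ) else 0

lemma tendsto_creW (w : Fin d → ℝ) (lo hi : ℕ) {n : ℕ} (K : Freq d)
    {x : Fin (n + 3) → Fin d → ℝ} (hx : Generic x) :
    Tendsto (fun z : ℝ × (Fin (n + 3) → Freq d) =>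
        ((z.1 ^ ((d : ℝ) / 2))⁻¹ : ℝ) * creW w z.1 lo hi ⟨n + 3, z.2⟩)
      (scaling K x) (𝓝 (creWLim w lo hi x)) := by
  unfold creWLim
  split_ifs with h
  · have := (Complex.continuous_ofReal.tendsto _).comp (tendsto_creWeight w K hx)
    refine this.congr' ?_
    filter_upwards [scaling_nonzero K hx] with z hz
    simp only [creW, Function.comp]
    rw [if_pos ⟨h, hz⟩]
    push_cast; rfl
  · refine tendsto_const_nhds.congr fun z => ?_
    simp only [creW]
    rw [if_neg (fun h' => h h'.1), mul_zero]

/-- A bound for the scaled weight on frequencies of macroscopic energy at least `c`. -/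
def weightBound (w : Fin d → ℝ) (hi : ℕ) (c : ℝ) : ℝ :=
  c0 d * hi * √hi * √(2 * wSq w) * (√c)⁻¹

lemma weightBound_nonneg (w : Fin d → ℝ) (hi : ℕ) (c : ℝ) : 0 ≤ weightBound w hi c := by
  have := c0_pos d
  unfold weightBound; positivity

lemma abs_creWeight_le (w : Fin d → ℝ) {ε c : ℝ} (hε : 0 < ε) (hc : 0 < c) {n hi : ℕ}
    (hn : n + 2 ≤ hi) (k : Fin (n + 2) → Freq d) (hk : c ≤ ε ^ 2 * energy k) :
    |creWeight w ε k| ≤ weightBound w hi c * ε ^ ((d : ℝ) / 2) := by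
  have hr : 0 < ε ^ ((d : ℝ) / 2) := Real.rpow_pos_of_pos hε _
  have hB := weightBound_nonneg w hi c
  have hc0 := c0_pos d
  by_cases hE : energy (merge k) = 0
  · simp only [creWeight, hE, Real.sqrt_zero, mul_zero, div_zero, abs_zero]; positivity
  have hE0 : 0 < energy (merge k) := lt_of_le_of_ne (energy_nonneg _) (Ne.symm hE)
  have hEk : 0 < energy k := by
    by_contra h
    have h0 : energy k = 0 := le_antisymm (not_lt.1 h) (energy_nonneg _)
    rw [h0, mul_zero] at hk
    linarith
  have h1 : |dot w (k 0 + k 1)| ≤ √(2 * wSq w) * √(energy (merge k)) := by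
    rw [← Real.sqrt_mul (by have := wSq_nonneg w; positivity)]
    refine Real.abs_le_sqrt ?_
    have := dot_sq_le w (merge k) 0
    rw [merge_zero] at this
    linarith
  have h2 : √c ≤ ε * √(energy k) := by
    refine (Real.sqrt_le_sqrt hk).trans (le_of_eq ?_)
    rw [Real.sqrt_mul (by positivity), Real.sqrt_sq hε.le]
  have hhi : ((n : ℝ) + 2) ≤ hi := by exact_mod_cast hn
  have hcp : 0 ≤ coupling d ε := coupling_nonneg hε
  have hJ := cutoff_le_one ε (k 0) (k 1)
  have hJ0 := cutoff_nonneg ε (k 0) (k 1)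
  have hsc : 0 < √c := Real.sqrt_pos.2 hc
  unfold creWeight
  rw [abs_div, abs_mul, abs_mul, abs_mul, abs_mul, abs_mul, abs_of_pos hc0, abs_of_nonneg hcp,
    abs_of_nonneg hJ0, abs_of_nonneg (by positivity : (0 : ℝ) ≤ (n : ℝ) + 1),
    abs_of_nonneg (Real.sqrt_nonneg _), abs_of_nonneg (by positivity :
      (0 : ℝ) ≤ √(energy k) * √(energy (merge k))), div_le_iff₀ (by positivity), coupling_eq hε]
  calc c0 d * (ε ^ ((d : ℝ) / 2) * ε⁻¹) * (n + 1) * √(n + 2) * |dot w (k 0 + k 1)| *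
        cutoff ε (k 0) (k 1)
      ≤ c0 d * (ε ^ ((d : ℝ) / 2) * ε⁻¹) * hi * √hi *
        (√(2 * wSq w) * √(energy (merge k))) * 1 := by
        gcongr
        linarith
    _ = c0 d * hi * √hi * √(2 * wSq w) * ε ^ ((d : ℝ) / 2) * √(energy (merge k)) * ε⁻¹ := by ring
    _ ≤ c0 d * hi * √hi * √(2 * wSq w) * ε ^ ((d : ℝ) / 2) * √(energy (merge k)) *
        ((√c)⁻¹ * √(energy k)) := by
        gcongr
        rw [← div_eq_inv_mul, le_div_iff₀ hsc, ← div_eq_inv_mul, div_le_iff₀ hε]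
        linarith
    _ = weightBound w hi c * ε ^ ((d : ℝ) / 2) * (√(energy k) * √(energy (merge k))) := by
        unfold weightBound; ring

lemma norm_creW_le (w : Fin d → ℝ) {ε c : ℝ} (hε : 0 < ε) (hc : 0 < c) {lo hi : ℕ} {n : ℕ}
    (k : Fin (n + 2) → Freq d) (hk : c ≤ ε ^ 2 * energy k) :
    ‖creW w ε lo hi ⟨n + 2, k⟩‖ ≤ weightBound w hi c * ε ^ ((d : ℝ) / 2) := by
  simp only [creW]
  split_ifs with h
  · rw [Complex.norm_real, Real.norm_eq_abs]
    exact abs_creWeight_le w hε hc h.1.2 k hk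
  · rw [norm_zero]
    exact mul_nonneg (weightBound_nonneg _ _ _) (Real.rpow_nonneg hε.le _)

lemma of_creW_ne_zero {w : Fin d → ℝ} {ε : ℝ} (hε : 0 < ε) {lo hi n : ℕ}
    {k : Fin (n + 2) → Freq d} (h : creW w ε lo hi ⟨n + 2, k⟩ ≠ 0) :
    (lo ≤ n + 1 ∧ n + 2 ≤ hi) ∧ (∀ a, k a ≠ 0) ∧ (k 0 + k 1 ≠ 0) ∧
      ε * ‖k 0‖ ≤ 1 ∧ ε * ‖k 1‖ ≤ 1 := by
  simp only [creW] at h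
  split_ifs at h with h'
  · have hc : cutoff ε (k 0) (k 1) ≠ 0 := by
      intro h0; apply h; simp [creWeight, h0]
    obtain ⟨⟨-, -, h3⟩, h4, h5, -⟩ := of_cutoff_ne_zero hε hc
    rw [le_div_iff₀ hε, mul_comm] at h4 h5
    exact ⟨h'.1, h'.2, h3, h4, h5⟩
  · exact absurd rfl h

end Families

/-! ### Families with a scaling limit -/

section Sampled

variable {d : ℕ}

/-- The natural size `ε^{d(n-1)/2}` of a coefficient in chaos `n` at fixed total momentum. -/
def amp (d : ℕ) (ε : ℝ) (n : ℕ) : ℝ := ε ^ ((d : ℝ) * ((n : ℝ) - 1) / 2)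

lemma amp_pos {ε : ℝ} (hε : 0 < ε) (n : ℕ) : 0 < amp d ε n := Real.rpow_pos_of_pos hε _

lemma amp_succ {ε : ℝ} (hε : 0 < ε) (n : ℕ) :
    amp d ε (n + 1) = amp d ε n * ε ^ ((d : ℝ) / 2) := by
  rw [amp, amp, ← Real.rpow_add hε]
  congr 1
  push_cast; ring

lemma amp_sq {ε : ℝ} (hε : 0 < ε) (n : ℕ) : amp d ε (n + 1) ^ 2 = (ε ^ d) ^ n := by
  rw [amp, ← Real.rpow_natCast, ← Real.rpow_mul hε.le, ← pow_mul, ← Real.rpow_natCast]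
  congr 1
  push_cast; ring

lemma rpow_half_mul_self {ε : ℝ} (hε : 0 < ε) :
    ε ^ ((d : ℝ) / 2) * ε ^ ((d : ℝ) / 2) = ε ^ d := by
  rw [← Real.rpow_add hε, ← Real.rpow_natCast]
  congr 1
  ring

/-- A family of vectors of the Fock space, indexed by the scale `ε` and the total momentum `K`. -/
abbrev Fam (d : ℕ) : Type := ℝ → Freq d → L2 (Idx d)

/-- The family `u` is, up to the factor `amp`, the restriction to the lattice `ε ℤ^d` of functions
that are bounded by `C`, live on frequencies of size at most `C` and energy at least `c`, and
converge at generic points to a profile `U` that does not depend on the total momentum. -/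
structure IsProfile (N : ℕ) (C c : ℝ) (U : (n : ℕ) → (Fin n → Fin d → ℝ) → ℂ) (u : Fam d) :
    Prop where
  nonneg : 0 ≤ C
  pos : 0 < c
  supp : ∀ ε ∈ scales, ∀ (K : Freq d) (n : ℕ) (k : Fin n → Freq d), u ε K ⟨n, k⟩ ≠ 0 →
    tot k = K ∧ 2 ≤ n ∧ n ≤ N ∧ (∀ j, ε * ‖k j‖ ≤ C) ∧ c ≤ ε ^ 2 * energy k
  bound : ∀ ε ∈ scales, ∀ (K : Freq d) (n : ℕ) (k : Fin n → Freq d),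
    ‖u ε K ⟨n, k⟩‖ ≤ C * amp d ε n
  conv : ∀ (K : Freq d), K ≠ 0 → ∀ (n : ℕ), ∀ x : Fin (n + 2) → Fin d → ℝ, Generic x →
    Tendsto (fun z : ℝ × (Fin (n + 2) → Freq d) =>
      (((amp d z.1 (n + 2))⁻¹ : ℝ) : ℂ) * u z.1 K ⟨n + 2, z.2⟩) (scaling K x) (𝓝 (U (n + 2) x))

/-- Families with a bounded profile. -/
def Sampled (N : ℕ) (u : Fam d) : Prop := ∃ C c U, IsProfile N C c U u

/-- Families that are approximated in norm, as `ε → 0` at each fixed non-zero total momentum, by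
families with a bounded profile. -/
def Approx (N : ℕ) (u : Fam d) : Prop :=
  ∀ δ > 0, ∃ v : Fam d, Sampled N v ∧ ∀ K : Freq d, K ≠ 0 →
    ∀ᶠ ε in 𝓝[scales] 0, ‖u ε K - v ε K‖ ≤ δ

lemma Sampled.approx {N : ℕ} {u : Fam d} (h : Sampled N u) : Approx N u := fun δ hδ =>
  ⟨u, h, fun K _ => Eventually.of_forall fun ε => by simpa using hδ.le⟩

lemma IsProfile.mono {N : ℕ} {C c C' c' : ℝ} {U : (n : ℕ) → (Fin n → Fin d → ℝ) → ℂ} {u : Fam d}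
    (h : IsProfile N C c U u) (hC : C ≤ C') (hc : c' ≤ c) (hc' : 0 < c') :
    IsProfile N C' c' U u where
  nonneg := h.nonneg.trans hC
  pos := hc'
  supp ε hε K n k hk := by
    obtain ⟨h1, h2, h3, h4, h5⟩ := h.supp ε hε K n k hk
    exact ⟨h1, h2, h3, fun j => (h4 j).trans hC, hc.trans h5⟩
  bound ε hε K n k := (h.bound ε hε K n k).trans
    (mul_le_mul_of_nonneg_right hC (amp_pos (scales_pos hε) n).le)
  conv := h.conv

lemma Sampled.add {N : ℕ} {u v : Fam d} (hu : Sampled N u) (hv : Sampled N v) :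
    Sampled N fun ε K => u ε K + v ε K := by
  obtain ⟨C, c, U, hu⟩ := hu
  obtain ⟨C', c', V, hv⟩ := hv
  refine ⟨C + C', min c c', fun n x => U n x + V n x, ?_⟩
  have hu' := hu.mono (C' := C + C') (c' := min c c') (by linarith [hv.nonneg]) (min_le_left _ _)
    (lt_min hu.pos hv.pos)
  have hv' := hv.mono (C' := C + C') (c' := min c c') (by linarith [hu.nonneg]) (min_le_right _ _)
    (lt_min hu.pos hv.pos)
  refine ⟨hu'.nonneg, hu'.pos, fun ε hε K n k hk => ?_, fun ε hε K n k => ?_,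
    fun K hK n x hx => ?_⟩
  · by_cases h0 : u ε K ⟨n, k⟩ = 0
    · refine hv'.supp ε hε K n k fun h1 => hk ?_
      rw [lp.coeFn_add, Pi.add_apply, h0, h1, add_zero]
    · exact hu'.supp ε hε K n k h0
  · rw [lp.coeFn_add, Pi.add_apply, add_mul]
    exact (norm_add_le _ _).trans (add_le_add (hu.bound ε hε K n k) (hv.bound ε hε K n k))
  · refine ((hu.conv K hK n x hx).add (hv.conv K hK n x hx)).congr fun z => ?_
    rw [lp.coeFn_add, Pi.add_apply, mul_add]

lemma Sampled.smul {N : ℕ} {u : Fam d} (a : ℂ) (hu : Sampled N u) :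
    Sampled N fun ε K => a • u ε K := by
  obtain ⟨C, c, U, hu⟩ := hu
  refine ⟨(1 + ‖a‖) * C, c, fun n x => a * U n x, ?_⟩
  have hu' := hu.mono (C' := (1 + ‖a‖) * C) (c' := c)
    (by nlinarith [hu.nonneg, norm_nonneg a]) le_rfl hu.pos
  refine ⟨hu'.nonneg, hu'.pos, fun ε hε K n k hk => ?_, fun ε hε K n k => ?_,
    fun K hK n x hx => ?_⟩
  · refine hu'.supp ε hε K n k fun h1 => hk ?_
    rw [lp.coeFn_smul, Pi.smul_apply, h1, smul_zero]
  · rw [lp.coeFn_smul, Pi.smul_apply, norm_smul, mul_assoc]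
    have := hu.bound ε hε K n k
    nlinarith [norm_nonneg a, norm_nonneg (u ε K ⟨n, k⟩)]
  · refine ((hu.conv K hK n x hx).const_mul a).congr fun z => ?_
    rw [lp.coeFn_smul, Pi.smul_apply, smul_eq_mul]; ring

lemma tot_of_symF {n : ℕ} {f : (Fin n → Freq d) → ℂ} {k : Fin n → Freq d} (h : avg f k ≠ 0) :
    ∃ σ : Equiv.Perm (Fin n), f (k ∘ σ) ≠ 0 := by
  by_contra hne
  push Not at hne
  exact h (avg_eq_zero hne)

lemma Sampled.sym {N : ℕ} {u : Fam d} (hu : Sampled N u) :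
    Sampled N fun ε K => symOp (u ε K) := by
  obtain ⟨C, c, U, hu⟩ := hu
  refine ⟨C, c, fun n x => (n.factorial : ℂ)⁻¹ * ∑ σ : Equiv.Perm (Fin n), U n (x ∘ σ),
    hu.nonneg, hu.pos, fun ε hε K n k hk => ?_, fun ε hε K n k => ?_, fun K hK n x hx => ?_⟩
  · obtain ⟨σ, hσ⟩ := tot_of_symF (by simpa [symOp_apply, symF] using hk)
    obtain ⟨h1, h2, h3, h4, h5⟩ := hu.supp ε hε K n _ hσ
    rw [tot_perm] at h1
    rw [energy_perm] at h5
    exact ⟨h1, h2, h3, fun j => by simpa using h4 (σ.symm j), h5⟩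
  · exact norm_avg_le fun σ => hu.bound ε hε K n _
  · have h1 : ∀ σ : Equiv.Perm (Fin (n + 2)), Tendsto (fun z : ℝ × (Fin (n + 2) → Freq d) =>
        (((amp d z.1 (n + 2))⁻¹ : ℝ) : ℂ) * u z.1 K ⟨n + 2, z.2 ∘ σ⟩) (scaling K x)
        (𝓝 (U (n + 2) (x ∘ σ))) := fun σ =>
      (hu.conv K hK n _ (hx.perm σ)).comp (scaling_perm K x σ)
    have h2 := (tendsto_finsetSum Finset.univ fun σ _ => h1 σ).const_mul
      ((n + 2).factorial : ℂ)⁻¹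
    refine h2.congr fun z => ?_
    rw [symOp_apply, symF, avg, ← Finset.mul_sum]
    ring

/-- Creation is a local operation on the profile. -/
lemma Sampled.cre (hd : 3 ≤ d) (w : Fin d → ℝ) {N lo hi : ℕ} (hlo : 2 ≤ lo) (hhi : hi ≤ N)
    {u : Fam d} (hu : Sampled N u) : Sampled N fun ε K => creOp w ε lo hi (u ε K) := by
  obtain ⟨C, c, U, hu⟩ := hu
  have hB := weightBound_nonneg w hi (c / 2)
  have hC := hu.nonneg
  have hc := hu.pos
  -- merging at most doubles the energy, so that the energy stays bounded below
  have hen : ∀ (ε : ℝ) (n : ℕ) (k : Fin (n + 2) → Freq d), c ≤ ε ^ 2 * energy (merge k) →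
      c / 2 ≤ ε ^ 2 * energy k := fun ε n k h => by
    nlinarith [energy_merge_le k, sq_nonneg ε]
  refine ⟨max C 1 + weightBound w hi (c / 2) * C, c / 2, fun n => match n with
    | n + 2 => fun x => creWLim w lo hi x * U (n + 1) (merge x)
    | _ => 0, by positivity, by positivity, fun ε hε K n k hk => ?_, fun ε hε K n k => ?_,
    fun K hK n x hx => ?_⟩
  · have hε0 := scales_pos hε
    rw [creOp_apply hd w hε0] at hk
    obtain ⟨h1, h2⟩ := mul_ne_zero_iff.1 hk
    match n, k with
    | 0, k => simp [creW] at h1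
    | 1, k => simp [creW] at h1
    | n + 2, k =>
      obtain ⟨⟨e1, e2⟩, e3, e4, e5, e6⟩ := of_creW_ne_zero hε0 h1
      obtain ⟨g1, g2, g3, g4, g5⟩ := hu.supp ε hε K (n + 1) (merge k) h2
      refine ⟨by rw [← tot_merge, g1], by omega, by omega, ?_, hen ε n k g5⟩
      have hm : max C 1 ≤ max C 1 + weightBound w hi (c / 2) * C := by
        have := mul_nonneg hB hC; linarith
      refine fun j => le_trans ?_ hm
      refine Fin.cases (e5.trans (le_max_right _ _)) (Fin.cases (e6.trans (le_max_right _ _))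
        fun a => ?_) j
      exact (g4 a.succ).trans (le_max_left _ _)
  · have hε0 := scales_pos hε
    have hR : 0 ≤ (max C 1 + weightBound w hi (c / 2) * C) * amp d ε n :=
      mul_nonneg (by positivity) (amp_pos hε0 n).le
    rw [creOp_apply hd w hε0]
    match n, k with
    | 0, k => simpa [creW] using hR
    | 1, k => simpa [creW] using hR
    | n + 2, k =>
      by_cases h0 : u ε K (mergeI ⟨n + 2, k⟩) = 0
      · rw [h0, mul_zero, norm_zero]; exact hR
      obtain ⟨g1, g2, g3, g4, g5⟩ := hu.supp ε hε K (n + 1) (merge k) h0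
      have b1 := norm_creW_le w hε0 (c := c / 2) (lo := lo) (hi := hi) (by positivity) k
        (hen ε n k g5)
      have b2 := hu.bound ε hε K (n + 1) (merge k)
      rw [norm_mul, amp_succ hε0]
      have hr : 0 ≤ ε ^ ((d : ℝ) / 2) := Real.rpow_nonneg hε0.le _
      have ha := (amp_pos (d := d) hε0 (n + 1)).le
      calc ‖creW w ε lo hi ⟨n + 2, k⟩‖ * ‖u ε K (mergeI ⟨n + 2, k⟩)‖
          ≤ (weightBound w hi (c / 2) * ε ^ ((d : ℝ) / 2)) * (C * amp d ε (n + 1)) :=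
            mul_le_mul b1 b2 (norm_nonneg _) (mul_nonneg hB hr)
        _ = (weightBound w hi (c / 2) * C) * (amp d ε (n + 1) * ε ^ ((d : ℝ) / 2)) := by ring
        _ ≤ _ := by
            gcongr
            have : 0 ≤ max C 1 := by positivity
            linarith
  · match n, x, hx with
    | 0, x, hx =>
      -- chaos two is not reached, since the window starts at `lo ≥ 2`
      have : creWLim w lo hi x = 0 := by
        unfold creWLim; rw [if_neg]; omega
      simp only [this, zero_mul]
      refine tendsto_const_nhds.congr' ?_
      filter_upwards [scaling_pos K x] with z hz
      rw [creOp_apply hd w hz]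
      have : creW w z.1 lo hi ⟨0 + 2, z.2⟩ = 0 := by
        simp only [creW]; rw [if_neg]; omega
      rw [this]; simp
    | n + 1, x, hx =>
      have h1 := tendsto_creW w lo hi K hx
      have h2 := (hu.conv K hK n _ hx.merge).comp (scaling_merge K x)
      refine (h1.mul h2).congr' ?_
      filter_upwards [scaling_pos K x] with z hz
      rw [creOp_apply hd w hz]
      simp only [Function.comp, mergeI]
      rw [amp_succ hz (n + 2), mul_inv]
      push_cast
      ring

/-! ### Annihilation in the scaling limit -/

/-- The continuous cut-off of low energies. -/
def chopW (η : ℝ) (ε : ℝ) (x : Idx d) : ℝ := max 0 (min 1 (ε ^ 2 * energy x.2 / η - 1))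

lemma chopW_nonneg (η ε : ℝ) (x : Idx d) : 0 ≤ chopW η ε x := le_max_left _ _

lemma chopW_le_one (η ε : ℝ) (x : Idx d) : chopW η ε x ≤ 1 :=
  max_le zero_le_one (min_le_left _ _)

lemma chopW_ne_zero {η ε : ℝ} (hη : 0 < η) {x : Idx d} (h : chopW η ε x ≠ 0) :
    η ≤ ε ^ 2 * energy x.2 := by
  by_contra hlt
  push Not at hlt
  apply h
  have : ε ^ 2 * energy x.2 / η < 1 := by rwa [div_lt_one hη]
  exact max_eq_left ((min_le_right _ _).trans (by linarith))

lemma chopW_ne_one {η ε : ℝ} (hη : 0 < η) {x : Idx d} (h : chopW η ε x ≠ 1) :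
    ε ^ 2 * energy x.2 ≤ 2 * η := by
  by_contra hlt
  push Not at hlt
  apply h
  have : 2 < ε ^ 2 * energy x.2 / η := by rwa [lt_div_iff₀ hη]
  rw [chopW, min_eq_left (by linarith)]
  simp

lemma fiberBound_diag {α : Type*} {m : α → ℂ} {C : ℝ} (hC : 0 ≤ C) (h : ∀ x, ‖m x‖ ≤ C) :
    FiberBound m id C := by
  refine FiberBound.of_param (γ := Unit) hC (fun y _ => y) (fun x _ => ⟨(), rfl⟩) fun y => ?_
  rw [tsum_fintype]
  simp only [Finset.univ_unique, Finset.sum_const, Finset.card_singleton, one_smul]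
  rw [← ofReal_norm, ← ENNReal.ofReal_pow (norm_nonneg _)]
  exact ENNReal.ofReal_le_ofReal (by gcongr; exact h y)

/-- Multiplication by the low-energy cut-off. -/
def chopOp (η ε : ℝ) : L2 (Idx d) →L[ℂ] L2 (Idx d) := wcomp (fun x => (chopW η ε x : ℂ)) id

lemma chopOp_apply (η ε : ℝ) (f : L2 (Idx d)) (x : Idx d) :
    chopOp η ε f x = chopW η ε x * f x :=
  wcomp_apply (fiberBound_diag zero_le_one fun x => by
    rw [Complex.norm_real, Real.norm_eq_abs, abs_of_nonneg (chopW_nonneg _ _ _)]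
    exact chopW_le_one _ _ _) f x

lemma sub_chopOp_apply (η ε : ℝ) (f : L2 (Idx d)) (x : Idx d) :
    (f - chopOp η ε f) x = (1 - chopW η ε x : ℝ) * f x := by
  rw [lp.coeFn_sub, Pi.sub_apply, chopOp_apply]; push_cast; ring

lemma norm_sub_chopOp_apply_le (η ε : ℝ) (f : L2 (Idx d)) (x : Idx d) :
    ‖(f - chopOp η ε f) x‖ ≤ ‖f x‖ := by
  rw [sub_chopOp_apply, norm_mul, Complex.norm_real, Real.norm_eq_abs,
    abs_of_nonneg (by linarith [chopW_le_one η ε x])]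
  have := chopW_nonneg η ε x
  have := norm_nonneg (f x)
  nlinarith

lemma tendsto_chopW (η : ℝ) {n : ℕ} (K : Freq d) (x : Fin n → Fin d → ℝ) :
    Tendsto (fun z : ℝ × (Fin n → Freq d) => chopW η z.1 ⟨n, z.2⟩) (scaling K x)
      (𝓝 (max 0 (min 1 (energyR x / η - 1)))) := by
  have h1 := (continuous_energyR.tendsto _).comp (scaling_snd K x)
  have h2 : Continuous fun t : ℝ => max 0 (min 1 (t / η - 1)) := by fun_prop
  refine ((h2.tendsto _).comp h1).congr fun z => ?_
  simp only [Function.comp, energyR_scale, chopW]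

/-- Vectors of bounded profile living on small macroscopic frequencies are small. -/
lemma norm_sq_le_of_small (hd : 3 ≤ d) {N : ℕ} {f : L2 (Idx d)} {K : Freq d} {C s ε : ℝ}
    (hε : 0 < ε) (hs : 0 ≤ s) (hsε : 2 * s + ε ≤ 1)
    (hsupp : ∀ n k, f ⟨n, k⟩ ≠ 0 → tot k = K ∧ 2 ≤ n ∧ n ≤ N ∧ ∀ j, ε * ‖k j‖ ≤ s)
    (hb : ∀ n k, ‖f ⟨n, k⟩‖ ≤ C * amp d ε n) :
    ‖f‖ ^ 2 ≤ C ^ 2 * (2 * s + ε) * N := by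
  have hlevel : ∀ n ∈ Finset.Icc 2 N, sqENorm (fun k : Fin n → Freq d => f ⟨n, k⟩) ≤
      ENNReal.ofReal (C ^ 2 * (2 * s + ε)) := by
    intro n hn
    rw [Finset.mem_Icc] at hn
    obtain ⟨m, rfl⟩ : ∃ m, n = m + 1 + 1 := ⟨n - 2, by omega⟩
    have hr : 0 ≤ s / ε := by positivity
    -- Momentum conservation determines the first frequency from the others.
    let par : (Fin (m + 1) → Freq d) → (Fin (m + 1 + 1) → Freq d) := fun q => Fin.cons (K - tot q) q
    have h1 : sqENorm (fun k : Fin (m + 1 + 1) → Freq d => f ⟨m + 1 + 1, k⟩) ≤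
        ∑' q, ‖f ⟨m + 1 + 1, par q⟩‖ₑ ^ 2 := by
      refine tsum_le_tsum_param (fun k => ‖f ⟨m + 1 + 1, k⟩‖ₑ ^ 2) par fun k hk => ?_
      have hk' : f ⟨m + 1 + 1, k⟩ ≠ 0 := by
        intro h0; simp [h0] at hk
      refine ⟨Fin.tail k, ?_⟩
      have ht := (hsupp _ _ hk').1
      have : K - tot (Fin.tail k) = k 0 := by
        rw [← ht, tot, Fin.sum_univ_succ]; simp [tot, Fin.tail]
      simp only [par, this, Fin.cons_self_tail]
    refine h1.trans ?_
    let S : Finset (Fin (m + 1) → Freq d) := Fintype.piFinset fun _ => box d ⌊s / ε⌋₊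
    have hS : ∀ q ∉ S, ‖f ⟨m + 1 + 1, par q⟩‖ₑ ^ 2 = 0 := by
      intro q hq
      have : f ⟨m + 1 + 1, par q⟩ = 0 := by
        by_contra h0
        apply hq
        rw [Fintype.mem_piFinset]
        intro j
        have := (hsupp _ _ h0).2.2.2 j.succ
        rw [mem_box_floor hr, le_div_iff₀ hε, mul_comm]
        simpa [par] using this
      simp [this]
    rw [tsum_eq_sum hS]
    have h2 : ∀ q ∈ S, ‖f ⟨m + 1 + 1, par q⟩‖ₑ ^ 2 ≤
        ENNReal.ofReal (C ^ 2 * (ε ^ d) ^ (m + 1)) := by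
      intro q _
      rw [← ofReal_norm, ← ENNReal.ofReal_pow (norm_nonneg _), ← amp_sq hε (m + 1), ← mul_pow]
      exact ENNReal.ofReal_le_ofReal (by gcongr; exact hb _ _)
    refine (Finset.sum_le_sum h2).trans ?_
    rw [Finset.sum_const, nsmul_eq_mul, ← ENNReal.ofReal_natCast, ← ENNReal.ofReal_mul
      (Nat.cast_nonneg _)]
    refine ENNReal.ofReal_le_ofReal ?_
    have hcard : (S.card : ℝ) ≤ ((2 * (s / ε) + 1) ^ d) ^ (m + 1) := by
      rw [Fintype.card_piFinset]
      push_cast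
      rw [Finset.prod_const, card_box, Finset.card_univ, Fintype.card_fin]
      gcongr
      exact Nat.floor_le hr
    have h3 : ((2 * (s / ε) + 1) ^ d) ^ (m + 1) * (ε ^ d) ^ (m + 1) =
        (2 * s + ε) ^ (d * (m + 1)) := by
      rw [← mul_pow, ← mul_pow, ← pow_mul]
      congr 1
      field_simp
    have h4 : (2 * s + ε) ^ (d * (m + 1)) ≤ 2 * s + ε := by
      refine pow_le_of_le_one (by positivity) hsε ?_
      have : 0 < d * (m + 1) := by positivity
      omega
    calc (S.card : ℝ) * (C ^ 2 * (ε ^ d) ^ (m + 1))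
        ≤ ((2 * (s / ε) + 1) ^ d) ^ (m + 1) * (C ^ 2 * (ε ^ d) ^ (m + 1)) := by gcongr
      _ = C ^ 2 * (2 * s + ε) ^ (d * (m + 1)) := by rw [← h3]; ring
      _ ≤ C ^ 2 * (2 * s + ε) := by gcongr
  have h5 : sqENorm f ≤ ENNReal.ofReal (C ^ 2 * (2 * s + ε) * N) := by
    rw [sqENorm_sigma, tsum_eq_sum (s := Finset.Icc 2 N)]
    · refine (Finset.sum_le_sum hlevel).trans ?_
      rw [Finset.sum_const, nsmul_eq_mul, mul_comm,
        ENNReal.ofReal_mul (p := C ^ 2 * (2 * s + ε)) (by positivity), ENNReal.ofReal_natCast]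
      gcongr
      rw [Nat.card_Icc]; omega
    · intro n hn
      have : ∀ k : Fin n → Freq d, f ⟨n, k⟩ = 0 := by
        intro k
        by_contra h0
        have := hsupp n k h0
        exact hn (Finset.mem_Icc.2 ⟨this.2.1, this.2.2.1⟩)
      simp [sqENorm, this]
  rw [sqENorm_eq_ofReal] at h5
  exact (ENNReal.ofReal_le_ofReal_iff (by positivity)).1 h5

end Sampled

section Annihilation

variable {d : ℕ}

lemma amp_inv_eq {ε : ℝ} (hε : 0 < ε) (n : ℕ) :
    (amp d ε (n + 1))⁻¹ = ε ^ d * ((ε ^ ((d : ℝ) / 2))⁻¹ * (amp d ε (n + 2))⁻¹) := by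
  have h := amp_succ (d := d) hε (n + 1)
  rw [h, ← rpow_half_mul_self hε]
  have := (amp_pos (d := d) hε (n + 1)).ne'
  have : ε ^ ((d : ℝ) / 2) ≠ 0 := (Real.rpow_pos_of_pos hε _).ne'
  field_simp

lemma annOp_succ (hd : 3 ≤ d) (w : Fin d → ℝ) {ε : ℝ} (hε : 0 < ε) (lo hi : ℕ) (f : L2 (Idx d))
    {n : ℕ} (p : Fin (n + 1) → Freq d) :
    annOp w ε lo hi f ⟨n + 1, p⟩ =
      ∑' l, creW w ε lo hi ⟨n + 2, split p l⟩ * f ⟨n + 2, split p l⟩ :=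
  annOp_apply hd w hε lo hi f ⟨n + 1, p⟩

lemma annOp_zero (hd : 3 ≤ d) (w : Fin d → ℝ) {ε : ℝ} (hε : 0 < ε) (lo hi : ℕ) (f : L2 (Idx d))
    (p : Fin 0 → Freq d) : annOp w ε lo hi f ⟨0, p⟩ = 0 := by
  rw [annOp_apply hd w hε lo hi]
  simp [splitI, creW]

lemma exists_of_annOp_ne_zero (hd : 3 ≤ d) (w : Fin d → ℝ) {ε : ℝ} (hε : 0 < ε) {lo hi : ℕ}
    {f : L2 (Idx d)} {n : ℕ} {p : Fin (n + 1) → Freq d} (h : annOp w ε lo hi f ⟨n + 1, p⟩ ≠ 0) :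
    ∃ l, creW w ε lo hi ⟨n + 2, split p l⟩ ≠ 0 ∧ f ⟨n + 2, split p l⟩ ≠ 0 := by
  by_contra hne
  push Not at hne
  apply h
  rw [annOp_succ hd w hε]
  have : ∀ l, creW w ε lo hi ⟨n + 2, split p l⟩ * f ⟨n + 2, split p l⟩ = 0 := fun l => by
    by_cases h0 : creW w ε lo hi ⟨n + 2, split p l⟩ = 0
    · rw [h0, zero_mul]
    · rw [hne l h0, mul_zero]
  simp [this]

/-- The size of `annOp u` for a family with bounded profile: the sum over the split frequency has
`O(ε^{-d})` terms. -/
lemma IsProfile.norm_ann_le (hd : 3 ≤ d) (w : Fin d → ℝ) {N lo hi : ℕ} {C c : ℝ}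
    {U : (n : ℕ) → (Fin n → Fin d → ℝ) → ℂ} {u : Fam d} (hu : IsProfile N C c U u)
    {ε : ℝ} (hε : ε ∈ scales) (K : Freq d) (n : ℕ) (p : Fin n → Freq d) :
    ‖annOp w ε lo hi (u ε K) ⟨n, p⟩‖ ≤
      (weightBound w hi c * C * (2 * C + 2) ^ d) * amp d ε n := by
  have hε0 := scales_pos hε
  have hB := weightBound_nonneg w hi c
  have hC := hu.nonneg
  match n, p with
  | 0, p =>
    rw [annOp_zero hd w hε0, norm_zero]
    exact mul_nonneg (by positivity) (amp_pos hε0 0).le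
  | n + 1, p =>
    rw [annOp_succ hd w hε0]
    have hr : 0 < ε ^ ((d : ℝ) / 2) := Real.rpow_pos_of_pos hε0 _
    have ha := amp_pos (d := d) hε0 (n + 2)
    have key := norm_tsum_le_of_bdd (d := d)
      (f := fun l => creW w ε lo hi ⟨n + 2, split p l⟩ * u ε K ⟨n + 2, split p l⟩)
      (A := (weightBound w hi c * ε ^ ((d : ℝ) / 2)) * (C * amp d ε (n + 2))) (r := C / ε)
      (by positivity) (by positivity) ?_ ?_
    · refine key.trans ?_
      have h1 : 2 * (C / ε) + 1 ≤ (2 * C + 2) * ε⁻¹ := by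
        rw [← div_eq_mul_inv, le_div_iff₀ hε0, add_mul, mul_assoc, div_mul_cancel₀ _ hε0.ne']
        linarith [scales_le_two hε]
      have h2 : (2 * (C / ε) + 1) ^ d ≤ (2 * C + 2) ^ d * (ε ^ d)⁻¹ := by
        rw [← inv_pow, ← mul_pow]
        gcongr
      have h3 : amp d ε (n + 2) * (ε ^ ((d : ℝ) / 2) * (ε ^ d)⁻¹) = amp d ε (n + 1) := by
        rw [amp_succ hε0 (n + 1), ← rpow_half_mul_self hε0]
        field_simp
      calc _ ≤ (weightBound w hi c * ε ^ ((d : ℝ) / 2)) * (C * amp d ε (n + 2)) *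
            ((2 * C + 2) ^ d * (ε ^ d)⁻¹) := by gcongr
        _ = (weightBound w hi c * C * (2 * C + 2) ^ d) *
            (amp d ε (n + 2) * (ε ^ ((d : ℝ) / 2) * (ε ^ d)⁻¹)) := by ring
        _ = _ := by rw [h3]
    · intro l hl
      obtain ⟨-, -, -, h4, -⟩ := hu.supp ε hε K _ _ (right_ne_zero_of_mul hl)
      have := h4 0
      rwa [split_zero, mul_comm, ← le_div_iff₀ hε0] at this
    · intro l
      by_cases h0 : u ε K ⟨n + 2, split p l⟩ = 0
      · rw [h0, mul_zero, norm_zero]; positivity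
      · obtain ⟨-, -, -, -, h5⟩ := hu.supp ε hε K _ _ h0
        rw [norm_mul]
        exact mul_le_mul (norm_creW_le w hε0 hu.pos _ h5) (hu.bound ε hε K _ _) (norm_nonneg _)
          (by positivity)

/-- The scaling limit of a sum over the split frequency, as an integral. -/
lemma tendsto_sum_split [NeZero d] {n : ℕ} {K : Freq d} {y : Fin (n + 1) → Fin d → ℝ}
    (hy : Generic y) {F G : ℝ → (Fin (n + 2) → Freq d) → ℂ}
    {F0 G0 : (Fin (n + 2) → Fin d → ℝ) → ℂ} {C : ℝ}
    (hF : ∀ x, Generic x → Tendsto (fun z : ℝ × (Fin (n + 2) → Freq d) =>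
      (((z.1 ^ ((d : ℝ) / 2))⁻¹ : ℝ) : ℂ) * F z.1 z.2) (scaling K x) (𝓝 (F0 x)))
    (hG : ∀ x, Generic x → Tendsto (fun z : ℝ × (Fin (n + 2) → Freq d) =>
      (((amp d z.1 (n + 2))⁻¹ : ℝ) : ℂ) * G z.1 z.2) (scaling K x) (𝓝 (G0 x)))
    (hb : ∀ ε ∈ scales, ∀ k, ‖F ε k * G ε k‖ ≤ C * (ε ^ ((d : ℝ) / 2) * amp d ε (n + 2)))
    (hs : ∀ ε ∈ scales, ∀ k, F ε k * G ε k ≠ 0 → ε * ‖k 0‖ ≤ C) :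
    Tendsto (fun z : ℝ × (Fin (n + 1) → Freq d) => (((amp d z.1 (n + 1))⁻¹ : ℝ) : ℂ) *
        ∑' l, F z.1 (split z.2 l) * G z.1 (split z.2 l)) (scaling K y)
      (𝓝 (∫ x, F0 (split y x) * G0 (split y x))) := by
  have hsc : ∀ᶠ z in scaling K y, z.1 ∈ scales := (scaling_fst K y) eventually_scales
  have key := tendsto_lattice_sum (L := scaling K y) (ε := Prod.fst) (C := C)
    (tendsto_scales.comp (scaling_fst K y))
    (A := fun z l => ((((z.1 ^ ((d : ℝ) / 2))⁻¹ : ℝ) : ℂ) * F z.1 (split z.2 l)) *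
      ((((amp d z.1 (n + 2))⁻¹ : ℝ) : ℂ) * G z.1 (split z.2 l)))
    (A0 := fun x => F0 (split y x) * G0 (split y x)) ?_ ?_ ?_
  · refine key.congr' ?_
    filter_upwards [hsc] with z hz
    rw [amp_inv_eq (scales_pos hz) n, ← tsum_mul_left]
    refine tsum_congr fun l => ?_
    push_cast; ring
  · filter_upwards [hsc] with z hz l
    have hr : 0 < z.1 ^ ((d : ℝ) / 2) := Real.rpow_pos_of_pos (scales_pos hz) _
    have ha := amp_pos (d := d) (scales_pos hz) (n + 2)
    have e : ((((z.1 ^ ((d : ℝ) / 2))⁻¹ : ℝ) : ℂ) * F z.1 (split z.2 l)) *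
      ((((amp d z.1 (n + 2))⁻¹ : ℝ) : ℂ) * G z.1 (split z.2 l)) =
      (((z.1 ^ ((d : ℝ) / 2) * amp d z.1 (n + 2))⁻¹ : ℝ) : ℂ) *
        (F z.1 (split z.2 l) * G z.1 (split z.2 l)) := by
      rw [mul_inv]; push_cast; ring
    rw [e, norm_mul, Complex.norm_real, Real.norm_eq_abs, abs_of_pos (by positivity),
      inv_mul_le_iff₀ (by positivity), mul_comm _ C]
    exact hb _ hz _
  · filter_upwards [hsc] with z hz l hl
    refine hs _ hz (split z.2 l) fun h0 => hl ?_
    rcases mul_eq_zero.1 h0 with h | h <;> simp [h]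
  · filter_upwards [ae_generic_split hy] with x hx
    have e1 := (hF (split y x) hx).comp (scaling_split K y x)
    have e2 := (hG (split y x) hx).comp (scaling_split K y x)
    exact (e1.mul e2).congr fun z => rfl

/-- Annihilation integrates the profile over the splittings of one particle. The result has a
profile once the low energies, where it is unbounded, are cut off. -/
lemma IsProfile.chop_ann (hd : 3 ≤ d) (w : Fin d → ℝ) {N lo hi : ℕ} (hlo : 2 ≤ lo) {C c : ℝ}
    {U : (n : ℕ) → (Fin n → Fin d → ℝ) → ℂ} {u : Fam d} (hu : IsProfile N C c U u) {η : ℝ}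
    (hη : 0 < η) : Sampled N fun ε K => chopOp η ε (annOp w ε lo hi (u ε K)) := by
  have : NeZero d := ⟨by omega⟩
  have hB := weightBound_nonneg w hi c
  have hC := hu.nonneg
  set C' := weightBound w hi c * C * (2 * C + 2) ^ d with hC'
  have hC'0 : 0 ≤ C' := by positivity
  refine ⟨2 * C + C', η, fun n => match n with
    | n + 2 => fun y => ((max 0 (min 1 (energyR y / η - 1)) : ℝ) : ℂ) *
        ∫ x, creWLim w lo hi (split y x) * U (n + 3) (split y x)
    | _ => 0, by positivity, hη, fun ε hε K n p hp => ?_, fun ε hε K n p => ?_,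
    fun K hK n y hy => ?_⟩
  · have hε0 := scales_pos hε
    rw [chopOp_apply] at hp
    have h0 : chopW η ε ⟨n, p⟩ ≠ 0 := fun h => by simp [h] at hp
    have h1 := chopW_ne_zero hη h0
    have h2 := right_ne_zero_of_mul hp
    match n, p with
    | 0, p => exact absurd (annOp_zero hd w hε0 lo hi _ p) h2
    | n + 1, p =>
      obtain ⟨l, e1, e2⟩ := exists_of_annOp_ne_zero hd w hε0 h2
      obtain ⟨⟨f1, f2⟩, -⟩ := of_creW_ne_zero hε0 e1
      obtain ⟨g1, g2, g3, g4, g5⟩ := hu.supp ε hε K _ _ e2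
      refine ⟨by rw [← tot_split p l, g1], by omega, by omega, ?_, h1⟩
      refine Fin.cases ?_ (fun a => ?_)
      · have h3 := g4 0
        have h4 := g4 1
        rw [split_zero] at h3
        rw [split_one] at h4
        have h5 : ‖p 0‖ ≤ ‖l‖ + ‖p 0 - l‖ := by
          simpa using norm_add_le l (p 0 - l)
        have := mul_le_mul_of_nonneg_left h5 hε0.le
        rw [mul_add] at this
        linarith
      · have := g4 a.succ.succ
        rw [split_succ_succ] at this
        linarith
  · have h1 := hu.norm_ann_le hd w (lo := lo) (hi := hi) hε K n p
    rw [chopOp_apply, norm_mul, Complex.norm_real, Real.norm_eq_abs,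
      abs_of_nonneg (chopW_nonneg _ _ _)]
    have ha := amp_pos (d := d) (scales_pos hε) n
    calc _ ≤ 1 * (C' * amp d ε n) := by gcongr; exact chopW_le_one _ _ _
      _ ≤ _ := by rw [one_mul]; gcongr; linarith
  · have h1 := (Complex.continuous_ofReal.tendsto _).comp (tendsto_chopW η K y)
    have h2 := tendsto_sum_split (C := C + weightBound w hi c * C) hy
      (F := fun ε k => creW w ε lo hi ⟨n + 1 + 2, k⟩) (G := fun ε k => u ε K ⟨n + 1 + 2, k⟩)
      (F0 := creWLim w lo hi) (G0 := U (n + 3))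
      (fun x hx => tendsto_creW w lo hi K hx) (fun x hx => hu.conv K hK (n + 1) x hx) ?_ ?_
    · refine (h1.mul h2).congr' ?_
      filter_upwards [scaling_pos K y] with z hz
      rw [chopOp_apply, annOp_succ hd w hz]
      simp only [Function.comp]
      ring
    · intro ε hε k
      have hε0 := scales_pos hε
      have hr : 0 < ε ^ ((d : ℝ) / 2) := Real.rpow_pos_of_pos hε0 _
      have ha := amp_pos (d := d) hε0 (n + 1 + 2)
      by_cases h0 : u ε K ⟨n + 1 + 2, k⟩ = 0
      · rw [h0, mul_zero, norm_zero]; positivity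
      · obtain ⟨-, -, -, -, h5⟩ := hu.supp ε hε K _ _ h0
        rw [norm_mul]
        calc _ ≤ (weightBound w hi c * ε ^ ((d : ℝ) / 2)) * (C * amp d ε (n + 1 + 2)) :=
              mul_le_mul (norm_creW_le w hε0 hu.pos _ h5) (hu.bound ε hε K _ _) (norm_nonneg _)
                (by positivity)
          _ = weightBound w hi c * C * (ε ^ ((d : ℝ) / 2) * amp d ε (n + 1 + 2)) := by ring
          _ ≤ _ := by gcongr; linarith
    · intro ε hε k hk
      obtain ⟨-, -, -, h4, -⟩ := hu.supp ε hε K _ _ (right_ne_zero_of_mul hk)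
      have := h4 0
      have : 0 ≤ weightBound w hi c * C := by positivity
      linarith

/-- The part of an annihilated family at low energies is small in norm, uniformly in `ε`, so that
annihilation takes sampled families to approximable ones. -/
lemma Sampled.ann (hd : 3 ≤ d) (w : Fin d → ℝ) {N lo hi : ℕ} (hlo : 2 ≤ lo) {u : Fam d}
    (hu : Sampled N u) : Approx N fun ε K => annOp w ε lo hi (u ε K) := by
  obtain ⟨C, c, U, hu⟩ := hu
  intro δ hδ
  have hB := weightBound_nonneg w hi c
  have hC := hu.nonneg
  set C' := weightBound w hi c * C * (2 * C + 2) ^ d with hC'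
  have hC'0 : 0 ≤ C' := by positivity
  -- `t` bounds the macroscopic size of the frequencies removed by the cut-off
  obtain ⟨t, ht0, ht1, ht2⟩ : ∃ t : ℝ, 0 < t ∧ 3 * t ≤ 1 ∧ C' ^ 2 * (3 * t) * N ≤ δ ^ 2 := by
    refine ⟨min (1 / 3) (δ ^ 2 / (C' ^ 2 * 3 * N + 1)), by positivity, ?_, ?_⟩
    · linarith [min_le_left (1 / 3 : ℝ) (δ ^ 2 / (C' ^ 2 * 3 * N + 1))]
    · have h1 := min_le_right (1 / 3 : ℝ) (δ ^ 2 / (C' ^ 2 * 3 * N + 1))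
      rw [le_div_iff₀ (by positivity)] at h1
      have h0 : 0 < min (1 / 3 : ℝ) (δ ^ 2 / (C' ^ 2 * 3 * N + 1)) := by positivity
      nlinarith
  refine ⟨_, hu.chop_ann hd w (hi := hi) hlo (η := t ^ 2 / 4) (by positivity), fun K hK => ?_⟩
  filter_upwards [eventually_scales, eventually_scales_lt ht0] with ε hε hεt
  have hε0 := scales_pos hε
  refine abs_le_of_sq_le_sq' ?_ hδ.le |>.2
  refine (norm_sq_le_of_small (K := K) (C := C') (s := t) (N := N) hd hε0 ht0.le (by linarith)
    ?_ ?_).trans ?_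
  · intro n p hp
    rw [sub_chopOp_apply] at hp
    have h1 : chopW (t ^ 2 / 4) ε ⟨n, p⟩ ≠ 1 := by
      intro h; simp [h] at hp
    have h1' := chopW_ne_one (by positivity) h1
    have h2 := right_ne_zero_of_mul hp
    match n, p with
    | 0, p => exact absurd (annOp_zero hd w hε0 lo hi _ p) h2
    | n + 1, p =>
      obtain ⟨l, e1, e2⟩ := exists_of_annOp_ne_zero hd w hε0 h2
      obtain ⟨⟨f1, f2⟩, -⟩ := of_creW_ne_zero hε0 e1
      obtain ⟨g1, g2, g3, g4, g5⟩ := hu.supp ε hε K _ _ e2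
      refine ⟨by rw [← tot_split p l, g1], by omega, by omega, fun j => ?_⟩
      refine abs_le_of_sq_le_sq' ?_ ht0.le |>.2
      rw [mul_pow]
      have := norm_sq_le_energy p j
      simp only at h1'
      nlinarith [sq_nonneg ε]
  · exact fun n p => (norm_sub_chopOp_apply_le _ _ _ _).trans
      (hu.norm_ann_le hd w (lo := lo) (hi := hi) hε K n p)
  · refine le_trans ?_ ht2
    gcongr
    linarith

/-! ### Closure properties of approximable families -/

lemma Approx.add {N : ℕ} {u v : Fam d} (hu : Approx N u) (hv : Approx N v) :
    Approx N fun ε K => u ε K + v ε K := by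
  intro δ hδ
  obtain ⟨u', h1, h2⟩ := hu (δ / 2) (by positivity)
  obtain ⟨v', h3, h4⟩ := hv (δ / 2) (by positivity)
  refine ⟨_, h1.add h3, fun K hK => ?_⟩
  filter_upwards [h2 K hK, h4 K hK] with ε e1 e2
  rw [add_sub_add_comm]
  linarith [norm_add_le (u ε K - u' ε K) (v ε K - v' ε K)]

/-- Uniformly bounded operators that map sampled families to approximable ones preserve
approximability. -/
lemma Approx.map {N : ℕ} {u : Fam d} (hu : Approx N u) (A : ℝ → L2 (Idx d) →L[ℂ] L2 (Idx d))
    {M : ℝ} (hM : ∀ ε ∈ scales, ‖A ε‖ ≤ M)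
    (hA : ∀ v : Fam d, Sampled N v → Approx N fun ε K => A ε (v ε K)) :
    Approx N fun ε K => A ε (u ε K) := by
  intro δ hδ
  have hM' : 0 < |M| + 1 := by positivity
  obtain ⟨u', h1, h2⟩ := hu (δ / 2 / (|M| + 1)) (by positivity)
  obtain ⟨v, h3, h4⟩ := hA u' h1 (δ / 2) (by positivity)
  refine ⟨v, h3, fun K hK => ?_⟩
  filter_upwards [h2 K hK, h4 K hK, eventually_scales] with ε e1 e2 hε
  have e3 : ‖A ε (u ε K - u' ε K)‖ ≤ (|M| + 1) * (δ / 2 / (|M| + 1)) := by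
    refine ((A ε).le_opNorm _).trans ?_
    have : ‖A ε‖ ≤ |M| + 1 := by linarith [hM ε hε, le_abs_self M]
    gcongr
  rw [mul_div_cancel₀ _ hM'.ne'] at e3
  have e4 : A ε (u ε K) - v ε K = A ε (u ε K - u' ε K) + (A ε (u' ε K) - v ε K) := by
    rw [map_sub]; abel
  rw [e4]
  linarith [norm_add_le (A ε (u ε K - u' ε K)) (A ε (u' ε K) - v ε K)]

lemma Approx.smul {N : ℕ} {u : Fam d} (a : ℂ) (hu : Approx N u) :
    Approx N fun ε K => a • u ε K := by
  intro δ hδ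
  obtain ⟨v, h1, h2⟩ := hu (δ / (‖a‖ + 1)) (by positivity)
  refine ⟨_, h1.smul a, fun K hK => ?_⟩
  filter_upwards [h2 K hK] with ε e
  rw [← smul_sub, norm_smul]
  rw [le_div_iff₀ (by positivity)] at e
  nlinarith [norm_nonneg (u ε K - v ε K)]

lemma Approx.sym {N : ℕ} {u : Fam d} (hu : Approx N u) : Approx N fun ε K => symOp (u ε K) :=
  hu.map (fun _ => symOp) (fun _ _ => norm_symOp_le) fun _ hv => hv.sym.approx

/-- The class of approximable families is invariant under the generator. -/
lemma Approx.gen (hd : 3 ≤ d) (w : Fin d → ℝ) {N lo hi : ℕ} (hlo : 2 ≤ lo) (hhi : hi ≤ N)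
    {u : Fam d} (hu : Approx N u) : Approx N fun ε K => genOp w ε lo hi (u ε K) := by
  have h1 := (hu.sym.map (fun ε => creOp w ε lo hi)
    (fun ε hε => norm_creOp_le hd w (scales_pos hε) lo hi)
    fun v hv => (hv.cre hd w hlo hhi).approx).sym
  have h2 := ((hu.sym.map (fun ε => annOp w ε lo hi)
    (fun ε hε => norm_annOp_le hd w (scales_pos hε) lo hi)
    fun v hv => hv.ann hd w hlo).sym).smul (-1)
  have e : (fun ε K => genOp w ε lo hi (u ε K)) = fun ε K =>
      symOp (creOp w ε lo hi (symOp (u ε K))) +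
        (-1 : ℂ) • symOp (annOp w ε lo hi (symOp (u ε K))) := by
    funext ε K
    rw [genOp_apply, neg_one_smul, sub_eq_add_neg]
  rw [e]
  exact h1.add h2

end Annihilation

section Diffusivity

variable {d : ℕ}

/-! ### The resolvent of an approximable family -/

lemma Sampled.zero (N : ℕ) : Sampled N (fun _ _ => 0 : Fam d) :=
  ⟨0, 1, fun _ _ => 0, le_rfl, one_pos, fun _ _ _ _ _ h => absurd rfl h,
    fun ε hε _ n _ => by
      simp,
    fun _ _ _ _ _ => by simpa using tendsto_const_nhds⟩

lemma Approx.relaxIter (hd : 3 ≤ d) (w : Fin d → ℝ) {N lo hi : ℕ} (hlo : 2 ≤ lo) (hhi : hi ≤ N)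
    {g : Fam d} (hg : Approx N g) (M : ℝ) (k : ℕ) :
    Approx N fun ε K => relaxIter (genOp w ε lo hi) M (g ε K) k := by
  induction k with
  | zero => exact (Sampled.zero N).approx
  | succ k ih => exact (ih.smul _).add (((ih.gen hd w hlo hhi).add hg).smul _)

/-- The resolvent is approximated by finitely many steps of the relaxed iteration, uniformly in
`ε`, because the generator is bounded uniformly in `ε`. -/
lemma Approx.resolvent (hd : 3 ≤ d) (w : Fin d → ℝ) {N lo hi : ℕ} (hlo : 2 ≤ lo) (hhi : hi ≤ N)
    {g : Fam d} (hg : Approx N g) {B : ℝ} (hB : ∀ ε ∈ scales, ∀ K, ‖g ε K‖ ≤ B) :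
    Approx N fun ε K => resolvent (genOp w ε lo hi) (g ε K) := by
  intro δ hδ
  have h1 : Tendsto (fun k => relaxRate (2 * creBound w hi) ^ k * |B|) atTop (𝓝 (0 * |B|)) :=
    (tendsto_pow_atTop_nhds_zero_of_lt_one (relaxRate_nonneg _) (relaxRate_lt_one _)).mul_const _
  rw [zero_mul] at h1
  -- The number of iterations is fixed before `ε` tends to zero.
  obtain ⟨k, hk⟩ := (h1.eventually_lt_const (show 0 < δ / 2 by positivity)).exists
  obtain ⟨v, h2, h3⟩ := hg.relaxIter hd w hlo hhi (2 * creBound w hi) k (δ / 2) (by positivity)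
  refine ⟨v, h2, fun K hK => ?_⟩
  filter_upwards [h3 K hK, eventually_scales] with ε e1 hε
  have e2 := norm_relaxIter_sub_le (adjoint_genOp w ε lo hi)
    (norm_genOp_le hd w (scales_pos hε) lo hi) (g ε K) k
  have e3 : relaxRate (2 * creBound w hi) ^ k * ‖g ε K‖ ≤
      relaxRate (2 * creBound w hi) ^ k * |B| := by
    have := relaxRate_nonneg (2 * creBound w hi)
    gcongr
    exact (hB ε hε K).trans (le_abs_self B)
  rw [norm_sub_rev] at e2
  refine (norm_sub_le_norm_sub_add_norm_sub _ (BurgersFock.relaxIter (genOp w ε lo hi)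
    (2 * creBound w hi) (g ε K) k) _).trans ?_
  linarith

/-- Multiplication by `(-𝓛₀)^{-1/2}`. -/
def invSqrtOp (d : ℕ) : L2 (Idx d) →L[ℂ] L2 (Idx d) :=
  wcomp (fun x => (((√(energy x.2))⁻¹ : ℝ) : ℂ)) id

lemma inv_sqrt_energy_le {n : ℕ} (k : Fin n → Freq d) : (√(energy k))⁻¹ ≤ 2 := by
  by_cases h : ∃ j, k j ≠ 0
  · obtain ⟨j, hj⟩ := h
    have h1 := half_le_energy hj
    have h2 : 1 / 2 ≤ √(energy k) := Real.le_sqrt_of_sq_le (by norm_num; linarith)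
    rw [inv_le_comm₀ (by linarith) (by norm_num)]
    linarith
  · push Not at h
    have : energy k = 0 := by simp [energy, normSq, h]
    simp [this]

lemma fiberBound_invSqrt :
    FiberBound (fun x : Idx d => (((√(energy x.2))⁻¹ : ℝ) : ℂ)) id 2 :=
  fiberBound_diag zero_le_two fun x => by
    rw [Complex.norm_real, Real.norm_eq_abs, abs_of_nonneg (by positivity)]
    exact inv_sqrt_energy_le _

lemma invSqrtOp_apply (f : L2 (Idx d)) (x : Idx d) :
    invSqrtOp d f x = (((√(energy x.2))⁻¹ : ℝ) : ℂ) * f x := wcomp_apply fiberBound_invSqrt f x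

lemma norm_invSqrtOp_le : ‖invSqrtOp d‖ ≤ 2 := norm_wcomp_le fiberBound_invSqrt

/-- Approximable families live at high energies. -/
lemma Approx.tendsto_invSqrt {N : ℕ} {u : Fam d} (hu : Approx N u) {B : ℝ}
    (hB : ∀ ε ∈ scales, ∀ K, ‖u ε K‖ ≤ B) {K : Freq d} (hK : K ≠ 0) :
    Tendsto (fun ε => ‖invSqrtOp d (u ε K)‖) (𝓝[scales] 0) (𝓝 0) := by
  rw [Metric.tendsto_nhds]
  intro δ hδ
  obtain ⟨v, ⟨C, c, U, hv⟩, h2⟩ := hu (min 1 (δ / 8)) (by positivity)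
  have hc := hv.pos
  have hB1 : 0 < |B| + 1 := by positivity
  filter_upwards [h2 K hK, eventually_scales,
    eventually_scales_lt (show 0 < √c * (δ / 2) / (|B| + 1) by positivity)] with ε e1 hε e2
  have hε0 := scales_pos hε
  have hv1 : ‖v ε K‖ ≤ |B| + 1 := by
    have e3 : ‖v ε K‖ ≤ ‖u ε K‖ + ‖u ε K - v ε K‖ := by
      have := norm_sub_le (u ε K) (u ε K - v ε K)
      simpa using this
    linarith [hB ε hε K, le_abs_self B, e1.trans (min_le_left _ _)]
  have h3 : ‖invSqrtOp d (v ε K)‖ ≤ ε / √c * ‖v ε K‖ := by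
    refine norm_le_of_sqENorm_le (by positivity) ?_
    have h4 : sqENorm (invSqrtOp d (v ε K)) ≤
        sqENorm (fun x => ((ε / √c : ℝ) : ℂ) * v ε K x) := by
      refine sqENorm_mono fun x => ?_
      rw [invSqrtOp_apply]
      by_cases h0 : v ε K x = 0
      · simp [h0]
      · obtain ⟨-, -, -, -, h5⟩ := hv.supp ε hε K x.1 x.2 h0
        rw [norm_mul, norm_mul, Complex.norm_real, Complex.norm_real, Real.norm_eq_abs,
          Real.norm_eq_abs, abs_of_nonneg (by positivity), abs_of_nonneg (by positivity)]
        gcongr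
        have h6 : √c ≤ ε * √(energy x.2) := by
          refine (Real.sqrt_le_sqrt h5).trans (le_of_eq ?_)
          rw [Real.sqrt_mul (by positivity), Real.sqrt_sq hε0.le]
        have h7 : 0 < √c := Real.sqrt_pos.2 hc
        have h8 : 0 < √(energy x.2) := by
          by_contra h
          have h9 : √(energy x.2) = 0 := le_antisymm (not_lt.1 h) (Real.sqrt_nonneg _)
          rw [h9] at h6; linarith
        rw [le_div_iff₀ h7, inv_mul_le_iff₀ h8, mul_comm]
        exact h6
    refine h4.trans (le_of_eq ?_)
    rw [sqENorm_const_mul, sqENorm_eq_ofReal, ← ENNReal.ofReal_mul (by positivity), mul_pow,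
      Complex.norm_real, Real.norm_eq_abs, sq_abs]
  have h4 : ε / √c * ‖v ε K‖ < δ / 2 := by
    have h5 : ε / √c * (|B| + 1) < δ / 2 := by
      rw [lt_div_iff₀ hB1] at e2
      rw [div_mul_eq_mul_div, div_lt_iff₀ (Real.sqrt_pos.2 hc)]
      linarith
    refine lt_of_le_of_lt ?_ h5
    gcongr
  have h5 : ‖invSqrtOp d (u ε K - v ε K)‖ ≤ 2 * (δ / 8) := by
    refine ((invSqrtOp d).le_opNorm _).trans ?_
    have := norm_invSqrtOp_le (d := d)
    have := e1.trans (min_le_right _ _)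
    gcongr
  have h6 : invSqrtOp d (u ε K) = invSqrtOp d (v ε K) + invSqrtOp d (u ε K - v ε K) := by
    rw [map_sub]; abel
  rw [Real.dist_eq, sub_zero, abs_of_nonneg (norm_nonneg _), h6]
  linarith [norm_add_le (invSqrtOp d (v ε K)) (invSqrtOp d (u ε K - v ε K))]

/-! ### The source at a fixed momentum -/

/-- The pair `(l, K - l)` in the second chaos. -/
def pairIdx (K l : Freq d) : Idx d := ⟨2, split (fun _ : Fin 1 => K) l⟩

lemma pairIdx_injective (K : Freq d) : Function.Injective (pairIdx K) := fun l l' h => by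
  have := congrFun (eq_of_heq (Sigma.mk.inj h).2) 0
  simpa using this

lemma eq_pairIdx {K : Freq d} {k : Fin 2 → Freq d} (h : tot k = K) :
    (⟨2, k⟩ : Idx d) = pairIdx K (k 0) := by
  unfold pairIdx
  congr 1
  have h1 : merge k = fun _ : Fin 1 => K := by
    ext1 j
    obtain rfl : j = 0 := Fin.fin_one_eq_zero j
    rw [merge_zero, ← h, tot, Fin.sum_univ_two]
  rw [← h1, split_merge]

open Classical in
/-- The kernel in the second chaos obtained by splitting a particle of momentum `K`, without the
factor `(w · K) / |K|`. -/
def srcF (ε : ℝ) (K : Freq d) : Idx d → ℂ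
  | ⟨2, k⟩ => if tot k = K then
      ((2 * c0 d * coupling d ε * cutoff ε (k 0) (k 1) / √(energy k) : ℝ) : ℂ) else 0
  | _ => 0

lemma srcF_support {ε : ℝ} {K : Freq d} {x : Idx d} (h : srcF ε K x ≠ 0) :
    x.1 = 2 ∧ tot x.2 = K ∧ ∃ l, pairIdx K l = x := by
  match x, h with
  | ⟨0, k⟩, h => simp [srcF] at h
  | ⟨1, k⟩, h => simp [srcF] at h
  | ⟨2, k⟩, h =>
    simp only [srcF] at h
    split_ifs at h with h'
    · exact ⟨rfl, h', k 0, (eq_pairIdx h').symm⟩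
    · exact absurd rfl h
  | ⟨n + 3, k⟩, h => simp [srcF] at h

lemma srcF_pairIdx (ε : ℝ) (K l : Freq d) : srcF ε K (pairIdx K l) =
    ((2 * c0 d * coupling d ε * cutoff ε l (K - l) / √(energy (pairIdx K l).2) : ℝ) : ℂ) := by
  have : tot (split (fun _ : Fin 1 => K) l) = K := by rw [tot_split]; simp [tot]
  simp only [pairIdx, srcF]
  rw [if_pos this]
  rfl

lemma norm_srcF_sq_le {ε : ℝ} (hε : 0 < ε) (K l : Freq d) :
    ‖srcF ε K (pairIdx K l)‖ ^ 2 ≤ (8 * c0 d ^ 2 * coupling d ε ^ 2) * (‖l‖ ^ 2)⁻¹ := by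
  have hc0 := c0_pos d
  have hR : 0 ≤ (8 * c0 d ^ 2 * coupling d ε ^ 2) * (‖l‖ ^ 2)⁻¹ := by positivity
  rw [srcF_pairIdx, Complex.norm_real, Real.norm_eq_abs, sq_abs]
  by_cases hc : cutoff ε l (K - l) = 0
  · simpa [hc] using hR
  obtain ⟨⟨hl, -⟩, -⟩ := of_cutoff_ne_zero hε hc
  have hE : 0 < energy (pairIdx K l).2 :=
    energy_pos (j := (0 : Fin 2)) (by simpa [pairIdx] using hl)
  have h1 : ‖l‖ ^ 2 ≤ 2 * energy (pairIdx K l).2 := norm_sq_le_energy (pairIdx K l).2 (0 : Fin 2)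
  have hJ : cutoff ε l (K - l) ^ 2 ≤ 1 := by
    have h1 := cutoff_nonneg ε l (K - l)
    have h2 := cutoff_le_one ε l (K - l)
    nlinarith
  have hnl : 0 < ‖l‖ := norm_pos_iff.2 hl
  rw [div_pow, Real.sq_sqrt hE.le, ← div_eq_mul_inv, div_le_div_iff₀ hE (by positivity)]
  calc (2 * c0 d * coupling d ε * cutoff ε l (K - l)) ^ 2 * ‖l‖ ^ 2
      = 4 * c0 d ^ 2 * coupling d ε ^ 2 * (cutoff ε l (K - l) ^ 2 * ‖l‖ ^ 2) := by ring
    _ ≤ 4 * c0 d ^ 2 * coupling d ε ^ 2 * (1 * (2 * energy (pairIdx K l).2)) := by gcongr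
    _ = _ := by ring

lemma sqENorm_le_pairIdx {f : Idx d → ℂ} {K : Freq d} (h : ∀ x, f x ≠ 0 → ∃ l, pairIdx K l = x) :
    sqENorm f ≤ ∑' l, ‖f (pairIdx K l)‖ₑ ^ 2 :=
  tsum_le_tsum_param (fun x => ‖f x‖ₑ ^ 2) (pairIdx K) fun x hx => h x fun h0 => by
    simp [h0] at hx

/-- A bound for the squared norm of the source, uniform in `ε` and `K`. -/
def srcBound (d : ℕ) : ℝ := 8 * c0 d ^ 2 * (2 * d * 3 ^ (d - 1))

lemma srcBound_nonneg (d : ℕ) : 0 ≤ srcBound d := by unfold srcBound; positivity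

/-- The part of the source on frequencies `|l| ≤ t / ε`. -/
lemma sqENorm_src_part_le (hd : 3 ≤ d) {ε t : ℝ} (hε : 0 < ε) (ht : 0 ≤ t) {f : Idx d → ℂ}
    {K : Freq d} (hf : ∀ x, ‖f x‖ ≤ ‖srcF ε K x‖)
    (hs : ∀ l, f (pairIdx K l) ≠ 0 → ‖l‖ ≤ t / ε) :
    sqENorm f ≤ ENNReal.ofReal (srcBound d * t ^ (d - 2)) := by
  refine (sqENorm_le_pairIdx (K := K) fun x hx => (srcF_support (ε := ε) (K := K) fun h0 => hx ?_).2.2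
    ).trans ?_
  · have := hf x
    rw [h0, norm_zero] at this
    exact norm_le_zero_iff.1 this
  refine (tsum_enorm_sq_le_of_inv hd (A := 8 * c0 d ^ 2 * coupling d ε ^ 2) (r := t / ε)
    (by positivity) (by positivity) hs fun l => ?_).trans (ENNReal.ofReal_le_ofReal (le_of_eq ?_))
  · refine le_trans ?_ (norm_srcF_sq_le hε K l)
    gcongr
    exact hf _
  · rw [coupling_sq hε hd, div_pow, srcBound]
    field_simp

lemma sqENorm_srcF_le (hd : 3 ≤ d) {ε : ℝ} (hε : 0 < ε) (K : Freq d) :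
    sqENorm (srcF ε K) ≤ ENNReal.ofReal (srcBound d) := by
  have := sqENorm_src_part_le hd hε zero_le_one (f := srcF ε K) (K := K) (fun _ => le_rfl) ?_
  · simpa using this
  · intro l hl
    rw [srcF_pairIdx] at hl
    refine (of_cutoff_ne_zero hε (l := l) (m := K - l) fun h0 => hl ?_).2.1
    simp [h0]

open Classical in
/-- The source at momentum `K` as a vector of the Fock space. -/
def src (ε : ℝ) (K : Freq d) : L2 (Idx d) :=
  if h : Memℓp (E := fun _ : Idx d => ℂ) (srcF ε K) 2 then ⟨srcF ε K, h⟩ else 0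

lemma src_coe (hd : 3 ≤ d) {ε : ℝ} (hε : 0 < ε) (K : Freq d) :
    (⇑(src ε K) : Idx d → ℂ) = srcF ε K := by
  have h : Memℓp (E := fun _ : Idx d => ℂ) (srcF ε K) 2 := by
    rw [memLp_iff_sqENorm]
    exact ne_top_of_le_ne_top ENNReal.ofReal_ne_top (sqENorm_srcF_le hd hε K)
  unfold src
  rw [dif_pos h]

lemma norm_src_le (hd : 3 ≤ d) {ε : ℝ} (hε : 0 < ε) (K : Freq d) : ‖src ε K‖ ≤ √(srcBound d) := by
  refine norm_le_of_sqENorm_le (Real.sqrt_nonneg _) ?_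
  rw [Real.sq_sqrt (srcBound_nonneg d), src_coe hd hε]
  exact sqENorm_srcF_le hd hε K

lemma amp_two (ε : ℝ) : amp d ε 2 = ε ^ ((d : ℝ) / 2) := by
  unfold amp; norm_num

/-- The limiting profile of the source, with the low-energy cut-off. -/
def srcLim (d : ℕ) (η : ℝ) : (n : ℕ) → (Fin n → Fin d → ℝ) → ℂ
  | 2, x => ((max 0 (min 1 (energyR x / η - 1)) : ℝ) : ℂ) *
      ((2 * c0 d * (if ‖x 0‖ ≤ 1 ∧ ‖x 1‖ ≤ 1 then 1 else 0) / √(energyR x) : ℝ) : ℂ)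
  | _, _ => 0

lemma scaling_cutoff_two {K : Freq d} (hK : K ≠ 0) {x : Fin 2 → Fin d → ℝ} (hx : Generic x) :
    ∀ᶠ z in scaling K x, cutoff z.1 (z.2 0) (z.2 1) =
      if ‖x 0‖ ≤ 1 ∧ ‖x 1‖ ≤ 1 then 1 else 0 := by
  have hs := tendsto_pi_nhds.1 (scaling_snd K x)
  have h0 := eventually_le_one_iff (hs 0).norm (norm_pos_of_ne (hx.single 0).1) (hx.single 0).2
  have h1 := eventually_le_one_iff (hs 1).norm (norm_pos_of_ne (hx.single 1).1) (hx.single 1).2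
  have hKn : 0 < ‖K‖ := norm_pos_iff.2 hK
  have h2 := (scaling_fst K x) (eventually_scales_lt (show 0 < ‖K‖⁻¹ by positivity))
  filter_upwards [h0, h1, h2, scaling_pos K x, scaling_tot K x] with z e0 e1 e2 hz ht
  rw [norm_scale hz.le] at e0 e1
  have hsum : z.2 0 + z.2 1 = K := by rw [← ht, tot, Fin.sum_univ_two]
  have e2' : z.1 < ‖K‖⁻¹ := e2
  have h3 : 0 < z.1 * ‖K‖ ∧ z.1 * ‖K‖ ≤ 1 := by
    refine ⟨by positivity, ?_⟩
    have := mul_le_mul_of_nonneg_right e2'.le hKn.le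
    rwa [inv_mul_cancel₀ hKn.ne'] at this
  unfold cutoff
  rw [hsum]
  simp only [e0, e1, h3, and_true, and_self]

/-- Away from low energies the source has a profile. The total momentum `ε K` of the pair
disappears in the limit, and with it the dependence on `K`. -/
lemma isProfile_chop_src (hd : 3 ≤ d) {N : ℕ} (hN : 2 ≤ N) {η : ℝ} (hη : 0 < η) :
    IsProfile N (1 + 2 * c0 d / √η) η (srcLim d η) fun ε K => chopOp η ε (src ε K) := by
  have hc0 := c0_pos d
  have hsη : 0 < √η := Real.sqrt_pos.2 hη
  have hC : 0 ≤ 2 * c0 d / √η := by positivity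
  refine ⟨by positivity, hη, fun ε hε K n k hk => ?_, fun ε hε K n k => ?_,
    fun K hK n x hx => ?_⟩
  · have hε0 := scales_pos hε
    rw [chopOp_apply, src_coe hd hε0] at hk
    have h0 : chopW η ε ⟨n, k⟩ ≠ 0 := fun h => by simp [h] at hk
    have h1 := chopW_ne_zero hη h0
    have h2 := right_ne_zero_of_mul hk
    obtain ⟨h3, h4, -⟩ := srcF_support h2
    simp only at h3 h4
    subst h3
    refine ⟨h4, le_rfl, hN, ?_, h1⟩
    simp only [srcF] at h2
    rw [if_pos h4] at h2
    have hcut : cutoff ε (k 0) (k 1) ≠ 0 := fun h0 => h2 (by simp [h0])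
    obtain ⟨-, h5, h6, -⟩ := of_cutoff_ne_zero hε0 hcut
    rw [le_div_iff₀ hε0, mul_comm] at h5 h6
    intro j
    fin_cases j
    · exact h5.trans (by linarith)
    · exact h6.trans (by linarith)
  · have hε0 := scales_pos hε
    have ha := amp_pos (d := d) hε0 n
    have hR : 0 ≤ (1 + 2 * c0 d / √η) * amp d ε n := by positivity
    by_cases hk : chopOp η ε (src ε K) ⟨n, k⟩ = 0
    · rw [hk, norm_zero]; exact hR
    rw [chopOp_apply, src_coe hd hε0] at hk ⊢
    have h0 : chopW η ε ⟨n, k⟩ ≠ 0 := fun h => by simp [h] at hk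
    have h1 := chopW_ne_zero hη h0
    obtain ⟨h3, h4, -⟩ := srcF_support (right_ne_zero_of_mul hk)
    simp only at h3 h4
    subst h3
    have hcp := coupling_nonneg (d := d) hε0
    have hJ := cutoff_le_one ε (k 0) (k 1)
    have hJ0 := cutoff_nonneg ε (k 0) (k 1)
    have hr : 0 < ε ^ ((d : ℝ) / 2) := Real.rpow_pos_of_pos hε0 _
    have h6 : √η ≤ ε * √(energy k) := by
      refine (Real.sqrt_le_sqrt h1).trans (le_of_eq ?_)
      rw [Real.sqrt_mul (by positivity), Real.sqrt_sq hε0.le]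
    have h8 : 0 < √(energy k) := by
      by_contra h
      have h9 : √(energy k) = 0 := le_antisymm (not_lt.1 h) (Real.sqrt_nonneg _)
      rw [h9] at h6; linarith
    simp only [srcF]
    rw [if_pos h4, norm_mul, Complex.norm_real, Complex.norm_real, Real.norm_eq_abs,
      Real.norm_eq_abs, abs_of_nonneg (chopW_nonneg _ _ _), abs_of_nonneg (by positivity), amp_two]
    calc chopW η ε ⟨2, k⟩ * (2 * c0 d * coupling d ε * cutoff ε (k 0) (k 1) / √(energy k))
        ≤ 1 * (2 * c0 d * coupling d ε * 1 / √(energy k)) := by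
          gcongr
          exact chopW_le_one _ _ _
      _ = 2 * c0 d * ε ^ ((d : ℝ) / 2) * (ε * √(energy k))⁻¹ := by
          rw [coupling_eq hε0, mul_inv]; ring
      _ ≤ 2 * c0 d * ε ^ ((d : ℝ) / 2) * (√η)⁻¹ := by gcongr
      _ = 2 * c0 d / √η * ε ^ ((d : ℝ) / 2) := by ring
      _ ≤ _ := by gcongr; linarith
  · match n, x, hx with
    | 0, x, hx =>
      have h1 := (Complex.continuous_ofReal.tendsto _).comp (tendsto_chopW η K x)
      have hE := (continuous_energyR.tendsto _).comp (scaling_snd K x)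
      have hx0 : 0 < energyR x := energyR_pos (j := 0) (norm_ne_zero_iff.1 (hx.single 0).1)
      have hc : Tendsto (fun z : ℝ × (Fin 2 → Freq d) => cutoff z.1 (z.2 0) (z.2 1))
          (scaling K x) (𝓝 (if ‖x 0‖ ≤ 1 ∧ ‖x 1‖ ≤ 1 then 1 else 0)) :=
        tendsto_const_nhds.congr' (by
          filter_upwards [scaling_cutoff_two hK hx] with z hz using hz.symm)
      have h2 := (hc.const_mul (2 * c0 d)).div hE.sqrt (by positivity)
      have h3 := h1.mul ((Complex.continuous_ofReal.tendsto _).comp h2)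
      refine h3.congr' ?_
      filter_upwards [scaling_pos K x, scaling_tot K x] with z hz ht
      rw [chopOp_apply, src_coe hd hz]
      have hr : z.1 ^ ((d : ℝ) / 2) ≠ 0 := (Real.rpow_pos_of_pos hz _).ne'
      have e : (2 * c0 d * cutoff z.1 (z.2 0) (z.2 1)) / √(energyR (scale z.1 z.2)) =
          (amp d z.1 2)⁻¹ * (2 * c0 d * coupling d z.1 * cutoff z.1 (z.2 0) (z.2 1) /
            √(energy z.2)) := by
        rw [energyR_scale, Real.sqrt_mul (by positivity), Real.sqrt_sq hz.le, amp_two,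
          coupling_eq hz, div_mul_eq_div_div, mul_div_assoc']
        congr 1
        field_simp
      have e2 : srcF z.1 K ⟨0 + 2, z.2⟩ = ((2 * c0 d * coupling d z.1 *
          cutoff z.1 (z.2 0) (z.2 1) / √(energy z.2) : ℝ) : ℂ) := by
        simp only [srcF]; rw [if_pos ht]
      rw [e2]
      simp only [Function.comp, Pi.div_apply]
      rw [e]
      push_cast
      ring
    | n + 1, x, hx =>
      refine tendsto_const_nhds.congr' ?_
      filter_upwards [scaling_pos K x] with z hz
      rw [chopOp_apply, src_coe hd hz]
      simp [srcF, srcLim]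

/-- Little of the norm of the source comes from low energies. -/
lemma exists_chop_src (hd : 3 ≤ d) {δ : ℝ} (hδ : 0 < δ) : ∃ η > 0, ∀ ε ∈ scales, ∀ K : Freq d,
    ‖src ε K - chopOp η ε (src ε K)‖ ≤ δ := by
  have hB := srcBound_nonneg d
  obtain ⟨t, ht0, ht1, ht2⟩ : ∃ t : ℝ, 0 < t ∧ t ≤ 1 ∧ srcBound d * t ≤ δ ^ 2 := by
    refine ⟨min 1 (δ ^ 2 / (srcBound d + 1)), by positivity, min_le_left _ _, ?_⟩
    have h1 := min_le_right (1 : ℝ) (δ ^ 2 / (srcBound d + 1))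
    rw [le_div_iff₀ (by positivity)] at h1
    have h0 : 0 < min (1 : ℝ) (δ ^ 2 / (srcBound d + 1)) := by positivity
    nlinarith
  refine ⟨t ^ 2 / 4, by positivity, fun ε hε K => ?_⟩
  have hε0 := scales_pos hε
  refine norm_le_of_sqENorm_le hδ.le ?_
  refine (sqENorm_src_part_le hd hε0 ht0.le (K := K) ?_ ?_).trans
    (ENNReal.ofReal_le_ofReal (le_trans ?_ ht2))
  · intro x
    refine (norm_sub_chopOp_apply_le _ _ _ _).trans ?_
    rw [src_coe hd hε0]
  · intro l hl
    rw [sub_chopOp_apply] at hl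
    have h1 : chopW (t ^ 2 / 4) ε (pairIdx K l) ≠ 1 := by
      intro h; simp [h] at hl
    have h1' := chopW_ne_one (by positivity) h1
    have h2 : ‖l‖ ^ 2 ≤ 2 * energy (pairIdx K l).2 := norm_sq_le_energy (pairIdx K l).2 (0 : Fin 2)
    rw [le_div_iff₀ hε0, mul_comm]
    refine abs_le_of_sq_le_sq' ?_ ht0.le |>.2
    rw [mul_pow]
    nlinarith [sq_nonneg ε]
  · gcongr
    exact pow_le_of_le_one ht0.le ht1 (by omega)

/-- The source is approximable. -/
lemma approx_src (hd : 3 ≤ d) {N : ℕ} (hN : 2 ≤ N) : Approx N (fun ε K => src ε K : Fam d) := by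
  intro δ hδ
  obtain ⟨η, hη, h⟩ := exists_chop_src (d := d) hd hδ
  refine ⟨_, ⟨_, _, _, isProfile_chop_src hd hN hη⟩, fun K _ => ?_⟩
  filter_upwards [eventually_scales] with ε hε using h ε hε K

end Diffusivity

section Limit

variable {d : ℕ}

/-! ### Existence and positivity of the diffusivity -/

lemma inner_eq_tsum_pairIdx {f g : L2 (Idx d)} {K : Freq d}
    (h : ∀ x, f x ≠ 0 → ∃ l, pairIdx K l = x) :
    inner ℂ f g = ∑' l, star (f (pairIdx K l)) * g (pairIdx K l) := by
  have h1 : inner ℂ f g = ∑' x, star (f x) * g x := by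
    rw [lp.inner_eq_tsum]
    refine tsum_congr fun x => ?_
    rw [RCLike.inner_apply, mul_comm]; rfl
  rw [h1, ← (pairIdx_injective K).tsum_eq (f := fun x => star (f x) * g x)]
  intro x hx
  exact h x fun h0 => hx (by simp [h0])

lemma generic_one (y : Fin 1 → Fin d → ℝ) : Generic y := by
  intro A hA hA'
  obtain ⟨j, hj⟩ := hA
  exact absurd (Finset.eq_univ_of_forall fun i => by rwa [Subsingleton.elim i j]) hA'

lemma amp_one (ε : ℝ) : amp d ε 1 = 1 := by simp [amp]

/-- The inner product of two families with a profile is a Riemann sum over the relative frequency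
of a pair, when one of them lives in the second chaos. The limit does not depend on `K`. -/
lemma IsProfile.tendsto_inner (hd : 3 ≤ d) {N : ℕ} {C C' c c' : ℝ}
    {U V : (n : ℕ) → (Fin n → Fin d → ℝ) → ℂ} {u v : Fam d}
    (hu : IsProfile N C c U u) (hv : IsProfile N C' c' V v)
    (h2 : ∀ ε ∈ scales, ∀ K x, v ε K x ≠ 0 → x.1 = 2) :
    ∃ l : ℂ, ∀ K : Freq d, K ≠ 0 →
      Tendsto (fun ε => inner ℂ (v ε K) (u ε K)) (𝓝[scales] 0) (𝓝 l) := by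
  have : NeZero d := ⟨by omega⟩
  have hC := hu.nonneg
  have hC' := hv.nonneg
  -- The frequencies of a pair of total momentum `K` are `ε l` and `ε K - ε l`, that is `x` and `-x`
  -- in the limit.
  refine ⟨∫ x, star (V 2 (split (fun _ : Fin 1 => 0) x)) * U 2 (split (fun _ : Fin 1 => 0) x),
    fun K hK => ?_⟩
  have key := tendsto_sum_split (n := 0) (K := K) (generic_one (fun _ : Fin 1 => 0))
    (F := fun ε k => star (v ε K ⟨2, k⟩)) (G := fun ε k => u ε K ⟨2, k⟩)
    (F0 := fun x => star (V 2 x)) (G0 := U 2) (C := C' * C + C) ?_ (hu.conv K hK 0) ?_ ?_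
  · have hsc : Tendsto (fun ε : ℝ => (ε, fun _ : Fin 1 => K)) (𝓝[scales] 0)
        (scaling K (fun _ : Fin 1 => (0 : Fin d → ℝ))) := by
      refine tendsto_scaling tendsto_id ?_ (Eventually.of_forall fun ε => by simp [tot])
      refine tendsto_pi_nhds.2 fun j => tendsto_pi_nhds.2 fun a => ?_
      have h0 : Tendsto (fun ε : ℝ => ε) (𝓝[scales] 0) (𝓝 0) :=
        tendsto_id.mono_right nhdsWithin_le_nhds
      simpa [scale] using h0.mul_const ((K a : ℤ) : ℝ)
    refine (key.comp hsc).congr' ?_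
    filter_upwards [eventually_scales] with ε hε
    rw [inner_eq_tsum_pairIdx (K := K)]
    · simp only [Function.comp, zero_add]
      rw [amp_one, inv_one, Complex.ofReal_one, one_mul]
      rfl
    · rintro ⟨n, k⟩ hk
      obtain rfl : n = 2 := h2 ε hε K _ hk
      exact ⟨k 0, (eq_pairIdx (hv.supp ε hε K 2 k hk).1).symm⟩
  · intro x hx
    have h := (Complex.continuous_conj.tendsto _).comp (hv.conv K hK 0 x hx)
    refine h.congr fun z => ?_
    simp only [Function.comp, zero_add]
    rw [map_mul, Complex.conj_ofReal, amp_two]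
    rfl
  · intro ε hε k
    have ha := amp_pos (d := d) (scales_pos hε) 2
    rw [norm_mul, norm_star, ← amp_two, zero_add]
    calc _ ≤ (C' * amp d ε 2) * (C * amp d ε 2) :=
          mul_le_mul (hv.bound ε hε K _ _) (hu.bound ε hε K _ _) (norm_nonneg _) (by positivity)
      _ = C' * C * (amp d ε 2 * amp d ε 2) := by ring
      _ ≤ _ := by gcongr; linarith
  · intro ε hε k hk
    obtain ⟨-, -, -, h4, -⟩ := hu.supp ε hε K _ _ (right_ne_zero_of_mul hk)
    exact (h4 0).trans (by nlinarith)

/-- If `a ε K` is, for every `δ`, eventually `δ`-close to a number independent of `K`, then it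
converges to a limit independent of `K`. -/
lemma exists_tendsto_of_approx (hd : 3 ≤ d) {a : ℝ → Freq d → ℂ}
    (h : ∀ δ > 0, ∃ l : ℂ, ∀ K : Freq d, K ≠ 0 → ∀ᶠ ε in 𝓝[scales] 0, ‖a ε K - l‖ ≤ δ) :
    ∃ l : ℂ, ∀ K : Freq d, K ≠ 0 → Tendsto (fun ε => a ε K) (𝓝[scales] 0) (𝓝 l) := by
  obtain ⟨K₀, hK₀⟩ : ∃ K₀ : Freq d, K₀ ≠ 0 :=
    ⟨fun _ => 1, fun h0 => by simpa using congrFun h0 ⟨0, by omega⟩⟩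
  have hc : Cauchy (map (fun ε => a ε K₀) (𝓝[scales] 0)) := by
    rw [Metric.cauchy_iff]
    refine ⟨inferInstance, fun δ hδ => ?_⟩
    obtain ⟨l, hl⟩ := h (δ / 3) (by positivity)
    refine ⟨{z | ‖z - l‖ ≤ δ / 3}, hl K₀ hK₀, fun x hx y hy => ?_⟩
    have : dist x y ≤ dist x l + dist y l := dist_triangle_right _ _ _
    rw [dist_eq_norm x l, dist_eq_norm y l] at this
    have hx' : ‖x - l‖ ≤ δ / 3 := hx
    have hy' : ‖y - l‖ ≤ δ / 3 := hy
    linarith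
  obtain ⟨L, hL⟩ := cauchy_map_iff_exists_tendsto.1 hc
  refine ⟨L, fun K hK => Metric.tendsto_nhds.2 fun δ hδ => ?_⟩
  obtain ⟨l, hl⟩ := h (δ / 3) (by positivity)
  have h1 : ‖L - l‖ ≤ δ / 3 := le_of_tendsto (hL.sub_const l).norm (hl K₀ hK₀)
  filter_upwards [hl K hK] with ε hε
  have : dist (a ε K) L ≤ dist (a ε K) l + dist L l := dist_triangle_right _ _ _
  rw [dist_eq_norm _ l, dist_eq_norm L l] at this
  linarith

/-- Matrix elements between the source and a bounded approximable family converge. -/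
lemma Approx.tendsto_inner_src (hd : 3 ≤ d) {N : ℕ} (hN : 2 ≤ N) {u : Fam d} (hu : Approx N u)
    {B : ℝ} (hB : ∀ ε ∈ scales, ∀ K, ‖u ε K‖ ≤ B) :
    ∃ l : ℂ, ∀ K : Freq d, K ≠ 0 →
      Tendsto (fun ε => inner ℂ (src ε K) (u ε K)) (𝓝[scales] 0) (𝓝 l) := by
  refine exists_tendsto_of_approx hd fun δ hδ => ?_
  have hS := Real.sqrt_nonneg (srcBound d)
  set S := √(srcBound d)
  obtain ⟨η, hη, h1⟩ := exists_chop_src (d := d) hd (δ := δ / (3 * (|B| + 1))) (by positivity)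
  obtain ⟨v, ⟨C, c, U, hv⟩, h2⟩ := hu (δ / (3 * (S + δ / (3 * (|B| + 1)) + 1))) (by positivity)
  obtain ⟨l, hl⟩ := hv.tendsto_inner hd (isProfile_chop_src hd hN hη) fun ε hε K x hx => by
    rw [chopOp_apply, src_coe hd (scales_pos hε)] at hx
    exact (srcF_support (right_ne_zero_of_mul hx)).1
  refine ⟨l, fun K hK => ?_⟩
  filter_upwards [h2 K hK, eventually_scales,
    Metric.tendsto_nhds.1 (hl K hK) (δ / 3) (by positivity)] with ε e2 hε e3
  have e1 := h1 ε hε K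
  have e4 := norm_src_le (d := d) hd (scales_pos hε) K
  set s := src ε K
  set s' := chopOp η ε s
  have e5 : ‖s'‖ ≤ S + δ / (3 * (|B| + 1)) := by
    have := norm_sub_le s (s - s')
    rw [sub_sub_cancel] at this
    linarith
  have e6 : ‖inner ℂ (s - s') (u ε K)‖ ≤ δ / 3 := by
    refine (norm_inner_le_norm _ _).trans ?_
    calc _ ≤ δ / (3 * (|B| + 1)) * (|B| + 1) := by
          gcongr
          linarith [hB ε hε K, le_abs_self B]
      _ = δ / 3 := by field_simp
  have e7 : ‖inner ℂ s' (u ε K - v ε K)‖ ≤ δ / 3 := by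
    refine (norm_inner_le_norm _ _).trans ?_
    calc _ ≤ (S + δ / (3 * (|B| + 1)) + 1) * (δ / (3 * (S + δ / (3 * (|B| + 1)) + 1))) := by
          gcongr; linarith
      _ = δ / 3 := by field_simp
  rw [dist_eq_norm] at e3
  -- Only the chopped source and the approximating family have profiles; the other two terms are
  -- small by the uniform bounds.
  have e8 : inner ℂ s (u ε K) - l = inner ℂ (s - s') (u ε K) + inner ℂ s' (u ε K - v ε K) +
      (inner ℂ s' (v ε K) - l) := by
    rw [inner_sub_left, inner_sub_right]; ring
  rw [e8]
  refine (norm_add₃_le).trans ?_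
  linarith

/-! #### Invariant real subspaces -/

/-- A closed real subspace that is invariant under `T` is invariant under its resolvent, being
invariant under the relaxed iteration. -/
lemma resolvent_mem {E : Type*} [NormedAddCommGroup E] [InnerProductSpace ℂ E] [CompleteSpace E]
    {T : E →L[ℂ] E} (hT : ContinuousLinearMap.adjoint T = -T) {S : Set E} (hS : IsClosed S)
    (hadd : ∀ u ∈ S, ∀ v ∈ S, u + v ∈ S) (hsmul : ∀ (r : ℝ), ∀ u ∈ S, (r : ℂ) • u ∈ S)
    (hTS : ∀ u ∈ S, T u ∈ S) {g : E} (hg : g ∈ S) : resolvent T g ∈ S := by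
  have h : ∀ k, relaxIter T ‖T‖ g k ∈ S := by
    intro k
    induction k with
    | zero => simpa [relaxIter] using hsmul 0 g hg
    | succ k ih => exact hadd _ (hsmul _ _ ih) _ (hsmul _ _ (hadd _ (hTS _ ih) _ hg))
  exact hS.mem_of_tendsto (tendsto_relaxIter hT le_rfl g) (Eventually.of_forall h)

lemma continuous_apply_L2 {α : Type*} (x : α) : Continuous fun f : L2 α => f x := by
  refine (LipschitzWith.of_dist_le_mul (K := 1) fun f g => ?_).continuous
  rw [dist_eq_norm, dist_eq_norm, NNReal.coe_one, one_mul]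
  exact norm_apply_le (f - g) x

/-- Vectors with real coefficients and total momentum `K`. -/
def realMomentum (K : Freq d) : Set (L2 (Idx d)) :=
  {f | ∀ x, (f x).im = 0 ∧ (tot x.2 ≠ K → f x = 0)}

lemma isClosed_realMomentum (K : Freq d) : IsClosed (realMomentum K) := by
  have : realMomentum K = ⋂ x : Idx d, ({f : L2 (Idx d) | (f x).im = 0} ∩
      {f : L2 (Idx d) | tot x.2 ≠ K → f x = 0}) := by
    ext f; simp [realMomentum]
  rw [this]
  refine isClosed_iInter fun x => IsClosed.inter ?_ ?_
  · exact isClosed_eq (Complex.continuous_im.comp (continuous_apply_L2 x)) continuous_const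
  · by_cases h : tot x.2 = K
    · simp [h]
    · simpa [h] using isClosed_eq (continuous_apply_L2 x) continuous_const

lemma add_mem_realMomentum {K : Freq d} {f g : L2 (Idx d)} (hf : f ∈ realMomentum K)
    (hg : g ∈ realMomentum K) : f + g ∈ realMomentum K := fun x => by
  simp only [lp.coeFn_add, Pi.add_apply, Complex.add_im, (hf x).1, (hg x).1, add_zero, true_and]
  intro h
  rw [(hf x).2 h, (hg x).2 h, add_zero]

lemma smul_mem_realMomentum {K : Freq d} (r : ℝ) {f : L2 (Idx d)} (hf : f ∈ realMomentum K) :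
    (r : ℂ) • f ∈ realMomentum K := fun x => by
  simp only [lp.coeFn_smul, Pi.smul_apply, smul_eq_mul]
  refine ⟨by simp [(hf x).1], fun h => by rw [(hf x).2 h, mul_zero]⟩

lemma im_creW (w : Fin d → ℝ) (ε : ℝ) (lo hi : ℕ) (x : Idx d) : (creW w ε lo hi x).im = 0 := by
  unfold creW
  split
  · split_ifs <;> simp
  · rfl

lemma symOp_mem_realMomentum {K : Freq d} {f : L2 (Idx d)} (hf : f ∈ realMomentum K) :
    symOp f ∈ realMomentum K := fun ⟨n, k⟩ => by
  rw [symOp_apply]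
  constructor
  · have : ∀ σ : Equiv.Perm (Fin n), f ⟨n, k ∘ σ⟩ = ((f ⟨n, k ∘ σ⟩).re : ℂ) := fun σ =>
      Complex.ext rfl (by simpa using (hf _).1)
    simp only [symF, avg]
    rw [Finset.sum_congr rfl fun σ _ => this σ, ← Complex.ofReal_sum, ← Complex.ofReal_natCast,
      ← Complex.ofReal_inv, ← Complex.ofReal_mul, Complex.ofReal_im]
  · intro h
    exact avg_eq_zero fun σ => (hf _).2 (by simpa [tot_perm] using h)

lemma creOp_mem_realMomentum (hd : 3 ≤ d) (w : Fin d → ℝ) {ε : ℝ} (hε : 0 < ε) (lo hi : ℕ)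
    {K : Freq d} {f : L2 (Idx d)} (hf : f ∈ realMomentum K) :
    creOp w ε lo hi f ∈ realMomentum K := fun x => by
  rw [creOp_apply hd w hε]
  refine ⟨by simp [im_creW, (hf (mergeI x)).1], fun h => ?_⟩
  rcases x with ⟨_ | _ | n, k⟩
  · simp [creW]
  · simp [creW]
  · rw [(hf _).2, mul_zero]
    simpa [mergeI, tot_merge] using h

lemma annOp_mem_realMomentum (hd : 3 ≤ d) (w : Fin d → ℝ) {ε : ℝ} (hε : 0 < ε) (lo hi : ℕ)
    {K : Freq d} {f : L2 (Idx d)} (hf : f ∈ realMomentum K) :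
    annOp w ε lo hi f ∈ realMomentum K := fun x => by
  rw [annOp_apply hd w hε]
  constructor
  · have : ∀ l, creW w ε lo hi (splitI x l) * f (splitI x l) =
        (((creW w ε lo hi (splitI x l) * f (splitI x l)).re : ℝ) : ℂ) := fun l =>
      Complex.ext rfl (by simp [im_creW, (hf _).1])
    rw [tsum_congr this, ← Complex.ofReal_tsum, Complex.ofReal_im]
  · intro h
    rcases x with ⟨_ | n, p⟩
    · simp [creW, splitI]
    · have : ∀ l, creW w ε lo hi (splitI ⟨n + 1, p⟩ l) * f (splitI ⟨n + 1, p⟩ l) = 0 := fun l => by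
        rw [(hf _).2, mul_zero]
        simpa [splitI, tot_split] using h
      simp [this]

lemma genOp_mem_realMomentum (hd : 3 ≤ d) (w : Fin d → ℝ) {ε : ℝ} (hε : 0 < ε) (lo hi : ℕ)
    {K : Freq d} {f : L2 (Idx d)} (hf : f ∈ realMomentum K) :
    genOp w ε lo hi f ∈ realMomentum K := by
  have h := symOp_mem_realMomentum hf
  have h1 := symOp_mem_realMomentum (creOp_mem_realMomentum hd w hε lo hi h)
  have h2 := smul_mem_realMomentum (-1) (symOp_mem_realMomentum
    (annOp_mem_realMomentum hd w hε lo hi h))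
  have := add_mem_realMomentum h1 h2
  rw [genOp_apply]
  simpa [sub_eq_add_neg] using this

lemma src_mem_realMomentum (hd : 3 ≤ d) {ε : ℝ} (hε : 0 < ε) (K : Freq d) :
    src ε K ∈ realMomentum K := fun x => by
  rw [src_coe hd hε]
  constructor
  · unfold srcF
    split
    · split_ifs
      · exact Complex.ofReal_im _
      · rfl
    · rfl
  · intro h
    by_contra h0
    exact h (srcF_support h0).2.1

lemma resolvent_src_mem (hd : 3 ≤ d) (w : Fin d → ℝ) {ε : ℝ} (hε : 0 < ε) (lo hi : ℕ)
    (K : Freq d) : resolvent (genOp w ε lo hi) (src ε K) ∈ realMomentum K :=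
  resolvent_mem (adjoint_genOp w ε lo hi) (isClosed_realMomentum K)
    (fun _ hu _ hv => add_mem_realMomentum hu hv) (fun r _ hu => smul_mem_realMomentum r hu)
    (fun _ hu => genOp_mem_realMomentum hd w hε lo hi hu) (src_mem_realMomentum hd hε K)

lemma im_inner_realMomentum {K : Freq d} {f g : L2 (Idx d)} (hf : f ∈ realMomentum K)
    (hg : g ∈ realMomentum K) : (inner ℂ f g).im = 0 := by
  rw [lp.inner_eq_tsum]
  have : ∀ x, inner ℂ (f x) (g x) = (((inner ℂ (f x) (g x)).re : ℝ) : ℂ) := fun x =>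
    Complex.ext rfl (by simp [RCLike.inner_apply, (hf x).1, (hg x).1])
  rw [tsum_congr this, ← Complex.ofReal_tsum, Complex.ofReal_im]

/-! #### Lower bounds -/

/-- With `u = (1 - T)⁻¹ g`, skew-adjointness gives `Re ⟨g, u⟩ = ‖u‖²`, and `‖g‖ ≤ (1 + M) ‖u‖`. -/
lemma re_inner_resolvent_ge {E : Type*} [NormedAddCommGroup E] [InnerProductSpace ℂ E]
    [CompleteSpace E] {T : E →L[ℂ] E} (hT : ContinuousLinearMap.adjoint T = -T) {M : ℝ}
    (hM : ‖T‖ ≤ M) (g : E) : ‖g‖ ^ 2 / (1 + M) ^ 2 ≤ (inner ℂ g (resolvent T g)).re := by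
  have hM0 : 0 ≤ M := (norm_nonneg _).trans hM
  have h1 := resolvent_sub hT g
  set u := resolvent T g
  have h2 : (inner ℂ g u).re = ‖u‖ ^ 2 := by
    have h3 := re_inner_skew hT u
    rw [← inner_conj_symm, Complex.conj_re] at h3
    rw [← h1, inner_sub_left, Complex.sub_re, h3, sub_zero]
    exact inner_self_eq_norm_sq (𝕜 := ℂ) u
  have h3 : ‖g‖ ≤ (1 + M) * ‖u‖ := by
    rw [← h1]
    refine (norm_sub_le _ _).trans ?_
    have := (T.le_opNorm u).trans (mul_le_mul_of_nonneg_right hM (norm_nonneg u))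
    linarith
  rw [h2, div_le_iff₀ (by positivity), ← mul_pow, mul_comm]
  gcongr

/-- The norm of the source stays bounded below: a positive fraction of the `ε^{-d}` pairs `(l, m)`
has both frequencies of order `ε⁻¹`. -/
lemma eventually_norm_src_ge (hd : 3 ≤ d) : ∃ c > 0, ∀ K : Freq d, K ≠ 0 →
    ∀ᶠ ε in 𝓝[scales] 0, c ≤ ‖src ε K‖ ^ 2 := by
  have hc0 := c0_pos d
  have hdR : (0 : ℝ) < d := by exact_mod_cast (by omega : 0 < d)
  refine ⟨4 * c0 d ^ 2 / d * (1 / 2) ^ d, by positivity, fun K hK => ?_⟩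
  -- Any integer bounding the entries of `K` would do for `κ`.
  set κ : ℕ := ∑ a, (K a).natAbs
  have hκ : ∀ a, |K a| ≤ κ := fun a => by
    have := Finset.single_le_sum (f := fun a => (K a).natAbs) (fun _ _ => Nat.zero_le _)
      (Finset.mem_univ a)
    rw [Int.abs_eq_natAbs]
    exact_mod_cast this
  filter_upwards [eventually_scales,
    eventually_scales_lt (show (0 : ℝ) < 1 / (4 * κ + 4) by positivity)] with ε hε hlt
  have hε0 := scales_pos hε
  set N : ℕ := ⌊1 / ε⌋₊
  have hN1 : (N : ℝ) ≤ 1 / ε := Nat.floor_le (by positivity)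
  have hN2 : 1 / ε < N + 1 := Nat.lt_floor_add_one _
  have h4 : (4 * κ + 4 : ℝ) < 1 / ε := by
    rw [lt_div_iff₀ hε0]
    rw [lt_div_iff₀ (by positivity)] at hlt
    linarith
  have hNκ : 2 * κ ≤ N := by
    have : (4 * κ + 4 : ℝ) < N + 1 := h4.trans hN2
    have : 4 * κ + 4 < N + 1 := by exact_mod_cast this
    omega
  -- For `l` in this cube all entries of `l` and `K - l` are non-zero and at most `N` in absolute
  -- value, so that the cut-off equals one.
  set S : Finset (Freq d) := Fintype.piFinset fun _ => Finset.Icc ((κ : ℤ) + 1) (N - κ)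
  have hcard : (1 / 2) ^ d * (1 / ε) ^ d ≤ (S.card : ℝ) := by
    rw [Fintype.card_piFinset]
    simp only [Int.card_Icc, Finset.prod_const, Finset.card_univ, Fintype.card_fin]
    have : ((N : ℤ) - κ + 1 - (κ + 1)).toNat = N - 2 * κ := by omega
    rw [this]; push_cast
    rw [← mul_pow, Nat.cast_sub hNκ]
    push_cast
    gcongr
    linarith
  have hterm : ∀ l ∈ S, 4 * c0 d ^ 2 / d * ε ^ d ≤ ‖src ε K (pairIdx K l)‖ ^ 2 := by
    intro l hl
    have hl' : ∀ a, (κ : ℤ) + 1 ≤ l a ∧ l a ≤ N - κ := fun a =>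
      Finset.mem_Icc.1 (Fintype.mem_piFinset.1 hl a)
    have hK' : ∀ a, -(κ : ℤ) ≤ K a ∧ K a ≤ κ := fun a => abs_le.1 (hκ a)
    have a0 : Fin d := ⟨0, by omega⟩
    have hin : ∀ p : Freq d, (∀ a, |p a| ≤ N) → ε * ‖p‖ ≤ 1 := fun p hp => by
      have : ‖p‖ ≤ 1 / ε := by
        rw [pi_norm_le_iff_of_nonneg (by positivity)]
        intro a
        rw [Int.norm_eq_abs]
        exact le_trans (by exact_mod_cast hp a) hN1
      rw [le_div_iff₀ hε0] at this
      linarith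
    have hpos : ∀ p : Freq d, p ≠ 0 → 0 < ε * ‖p‖ := fun p hp => by
      have := norm_pos_iff.2 hp; positivity
    have hlN : ∀ a, |l a| ≤ (N : ℤ) := fun a =>
      abs_le.2 ⟨by have := hl' a; omega, by have := hl' a; omega⟩
    have hmN : ∀ a, |(K - l) a| ≤ (N : ℤ) := fun a => by
      have := hl' a; have := hK' a
      exact abs_le.2 ⟨by rw [Pi.sub_apply]; omega, by rw [Pi.sub_apply]; omega⟩
    have hcut : cutoff ε l (K - l) = 1 := by
      unfold cutoff
      rw [add_sub_cancel, if_pos]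
      refine ⟨⟨hpos l fun h => ?_, hin l hlN⟩, ⟨hpos _ fun h => ?_, hin _ hmN⟩, hpos K hK,
        hin K fun a => abs_le.2 ⟨by have := hK' a; omega, by have := hK' a; omega⟩⟩
      · have := hl' a0; rw [h, Pi.zero_apply] at this; omega
      · have := hl' a0; have := hK' a0; have h1 := congrFun h a0
        rw [Pi.sub_apply, Pi.zero_apply] at h1; omega
    have hE : energy (pairIdx K l).2 ≤ d * (1 / ε) ^ 2 := by
      have h1 : ∀ p : Freq d, (∀ a, |p a| ≤ (N : ℤ)) →
          ∑ a, ((p a : ℤ) : ℝ) ^ 2 ≤ d * (1 / ε) ^ 2 := by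
        intro p hp
        refine (Finset.sum_le_card_nsmul _ _ ((1 / ε) ^ 2) fun a _ => ?_).trans (by simp)
        rw [← sq_abs]
        gcongr
        exact le_trans (by exact_mod_cast hp a) hN1
      have h2 : energy (pairIdx K l).2 = 1 / 2 * (∑ a, ((l a : ℤ) : ℝ) ^ 2 +
          ∑ a, (((K - l) a : ℤ) : ℝ) ^ 2) := by
        unfold energy normSq pairIdx
        rw [Fin.sum_univ_two]; rfl
      rw [h2]
      linarith [h1 l hlN, h1 _ hmN]
    have hE0 : 0 < energy (pairIdx K l).2 := by
      refine energy_pos (j := (0 : Fin 2)) ?_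
      simp only [pairIdx, split_zero]
      intro h
      have := hl' a0; rw [h, Pi.zero_apply] at this; omega
    rw [src_coe hd hε0, srcF_pairIdx, Complex.norm_real, Real.norm_eq_abs, sq_abs, hcut, mul_one,
      div_pow, Real.sq_sqrt hE0.le, mul_pow, coupling_sq hε0 hd, mul_pow]
    rw [le_div_iff₀ hE0]
    calc 4 * c0 d ^ 2 / d * ε ^ d * energy (pairIdx K l).2
        ≤ 4 * c0 d ^ 2 / d * ε ^ d * (d * (1 / ε) ^ 2) := by gcongr
      _ = _ := by
          obtain ⟨e, rfl⟩ : ∃ e, d = e + 2 := ⟨d - 2, by omega⟩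
          rw [Nat.add_sub_cancel, pow_add]
          field_simp
          norm_num
  have hsum : (S.card : ℝ) * (4 * c0 d ^ 2 / d * ε ^ d) ≤ ‖src ε K‖ ^ 2 := by
    have h1 : ∑ l ∈ S, ‖src ε K (pairIdx K l)‖ ^ 2 ≤ ‖src ε K‖ ^ 2 := by
      have := lp.sum_rpow_le_norm_rpow (p := 2) (by norm_num) (src ε K)
        (S.map ⟨pairIdx K, pairIdx_injective K⟩)
      simpa using this
    refine le_trans ?_ h1
    rw [← nsmul_eq_mul]
    exact Finset.card_nsmul_le_sum _ _ _ hterm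
  refine le_trans ?_ hsum
  calc 4 * c0 d ^ 2 / d * (1 / 2) ^ d
      = ((1 / 2) ^ d * (1 / ε) ^ d) * (4 * c0 d ^ 2 / d * ε ^ d) := by
        field_simp
        rw [← mul_pow, one_div_mul_cancel hε0.ne', one_pow]
    _ ≤ _ := by gcongr

/-- The diffusivity of the system truncated at chaos `m`, as the limit of a matrix element of the
resolvent. It does not depend on the momentum. -/
theorem exists_diffusivity (hd : 3 ≤ d) (w : Fin d → ℝ) {m : ℕ} (hm : 2 ≤ m) :
    ∃ D : ℝ, 0 < D ∧ ∀ K : Freq d, K ≠ 0 →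
      Tendsto (fun ε => inner ℂ (src ε K) (resolvent (genOp w ε 2 m) (src ε K))) (𝓝[scales] 0)
        (𝓝 (D : ℂ)) := by
  obtain ⟨l, hl⟩ := ((approx_src hd hm).resolvent hd w (lo := 2) le_rfl (le_refl m)
    fun _ hε K => norm_src_le hd (scales_pos hε) K).tendsto_inner_src hd hm
    (fun ε hε K => (norm_resolvent_apply_le (adjoint_genOp w ε 2 m) _).trans
      (norm_src_le hd (scales_pos hε) K))
  obtain ⟨K₀, hK₀⟩ : ∃ K₀ : Freq d, K₀ ≠ 0 :=
    ⟨fun _ => 1, fun h0 => by simpa using congrFun h0 ⟨0, by omega⟩⟩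
  -- Source and generator have real matrix elements, so the limit is real.
  have him : l.im = 0 := by
    refine tendsto_nhds_unique ((Complex.continuous_im.tendsto _).comp (hl K₀ hK₀)) ?_
    refine tendsto_const_nhds.congr' ?_
    filter_upwards [eventually_scales] with ε hε
    exact (im_inner_realMomentum (src_mem_realMomentum hd (scales_pos hε) K₀)
      (resolvent_src_mem hd w (scales_pos hε) 2 m K₀)).symm
  obtain ⟨c, hc, hc'⟩ := eventually_norm_src_ge (d := d) hd
  have hM : 0 ≤ 2 * creBound w m := by unfold creBound; positivity
  -- Positivity survives in the limit because the lower bound is uniform in `ε`.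
  have hre : c / (1 + 2 * creBound w m) ^ 2 ≤ l.re := by
    refine ge_of_tendsto ((Complex.continuous_re.tendsto _).comp (hl K₀ hK₀)) ?_
    filter_upwards [eventually_scales, hc' K₀ hK₀] with ε hε h
    refine le_trans ?_ (re_inner_resolvent_ge (adjoint_genOp w ε 2 m)
      (norm_genOp_le hd w (scales_pos hε) 2 m) (src ε K₀))
    gcongr
  have : l = (l.re : ℂ) := Complex.ext rfl (by simpa using him)
  rw [this] at hl
  exact ⟨l.re, lt_of_lt_of_le (by positivity) hre, hl⟩

/-- The solution with source at fixed momentum lives at high energies. -/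
lemma tendsto_invSqrt_resolvent_src (hd : 3 ≤ d) (w : Fin d → ℝ) {m : ℕ} (hm : 2 ≤ m)
    {K : Freq d} (hK : K ≠ 0) :
    Tendsto (fun ε => ‖invSqrtOp d (resolvent (genOp w ε 2 m) (src ε K))‖) (𝓝[scales] 0) (𝓝 0) :=
  ((approx_src hd hm).resolvent hd w (lo := 2) le_rfl (le_refl m)
    fun _ hε K => norm_src_le hd (scales_pos hε) K).tendsto_invSqrt
    (fun ε hε K => (norm_resolvent_apply_le (adjoint_genOp w ε 2 m) _).trans
      (norm_src_le hd (scales_pos hε) K)) hK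

end Limit

section Combinatorics

variable {d : ℕ}

/-! ### Averages over permutations as sums over positions -/

/-- The permutation that sends `0` to `j` and permutes the remaining positions by `e`. -/
def headPerm {n : ℕ} (q : Fin (n + 1) × Equiv.Perm (Fin n)) : Equiv.Perm (Fin (n + 1)) :=
  (Equiv.Perm.decomposeFin.symm (0, q.2)).trans q.1.cycleRange.symm

lemma headPerm_zero {n : ℕ} (q : Fin (n + 1) × Equiv.Perm (Fin n)) : headPerm q 0 = q.1 := by
  simp [headPerm, Fin.cycleRange_symm_zero]

lemma headPerm_succ {n : ℕ} (q : Fin (n + 1) × Equiv.Perm (Fin n)) (a : Fin n) :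
    headPerm q a.succ = q.1.succAbove (q.2 a) := by
  simp [headPerm, Fin.cycleRange_symm_succ, Equiv.Perm.decomposeFin_symm_apply_succ]

lemma headPerm_bijective (n : ℕ) : Function.Bijective (headPerm (n := n)) := by
  rw [Fintype.bijective_iff_injective_and_card]
  constructor
  · rintro ⟨j, e⟩ ⟨j', e'⟩ h
    have h0 : j = j' := by
      have := DFunLike.congr_fun h 0
      rwa [headPerm_zero, headPerm_zero] at this
    subst h0
    have : e = e' := by
      ext1 a
      have := DFunLike.congr_fun h a.succ
      rw [headPerm_succ, headPerm_succ] at this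
      exact Fin.succAbove_right_injective this
    rw [this]
  · simp [Fintype.card_perm, Nat.factorial_succ]

lemma comp_headPerm {n : ℕ} (k : Fin (n + 1) → Freq d) (q : Fin (n + 1) × Equiv.Perm (Fin n)) :
    k ∘ headPerm q = Fin.cons (k q.1) ((fun a => k (q.1.succAbove a)) ∘ q.2) := by
  ext1 a
  refine Fin.cases ?_ (fun a => ?_) a
  · simp [headPerm_zero]
  · simp [headPerm_succ]

/-- To average over all permutations, choose the entry in the first place and average over the
rest. -/
lemma avg_succ {n : ℕ} (F : (Fin (n + 1) → Freq d) → ℂ) (k : Fin (n + 1) → Freq d) :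
    avg F k = ((n : ℂ) + 1)⁻¹ *
      ∑ j, avg (fun k' => F (Fin.cons (k j) k')) (fun a => k (j.succAbove a)) := by
  unfold avg
  rw [← (headPerm_bijective n).sum_comp, Fintype.sum_prod_type, Nat.factorial_succ,
    ← Finset.mul_sum]
  simp only [comp_headPerm]
  push_cast
  rw [mul_inv]; ring

lemma avg_head {n : ℕ} {F : (Fin (n + 1) → Freq d) → ℂ}
    (hF : ∀ (a : Freq d) (k : Fin n → Freq d) (σ : Equiv.Perm (Fin n)),
      F (Fin.cons a (k ∘ σ)) = F (Fin.cons a k)) (k : Fin (n + 1) → Freq d) :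
    avg F k = ((n : ℂ) + 1)⁻¹ * ∑ j, F (Fin.cons (k j) fun a => k (j.succAbove a)) := by
  rw [avg_succ]
  congr 1
  exact Finset.sum_congr rfl fun j _ => avg_of_symm fun σ => hF _ _ σ

lemma avg_pair {n : ℕ} {F : (Fin (n + 2) → Freq d) → ℂ}
    (hF : ∀ (a b : Freq d) (k : Fin n → Freq d) (σ : Equiv.Perm (Fin n)),
      F (Fin.cons a (Fin.cons b (k ∘ σ))) = F (Fin.cons a (Fin.cons b k)))
    (k : Fin (n + 2) → Freq d) :
    avg F k = (((n : ℂ) + 2) * (n + 1))⁻¹ * ∑ j, ∑ i, F (Fin.cons (k j)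
      (Fin.cons (k (j.succAbove i)) fun a => k (j.succAbove (i.succAbove a)))) := by
  have e : ((n + 1 : ℕ) : ℂ) + 1 = (n : ℂ) + 2 := by push_cast; ring
  rw [avg_succ, mul_inv, mul_assoc, e]
  congr 1
  rw [Finset.mul_sum]
  exact Finset.sum_congr rfl fun j _ =>
    avg_head (F := fun k' => F (Fin.cons (k j) k')) (fun b k' σ => hF _ b k' σ) _

lemma IsSymm.cons {h : Idx d → ℂ} (hh : IsSymm h) {n : ℕ} (a : Freq d) (k : Fin n → Freq d)
    (σ : Equiv.Perm (Fin n)) :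
    h ⟨n + 1, Fin.cons a (k ∘ σ)⟩ = h ⟨n + 1, Fin.cons a k⟩ := by
  have := hh (n + 1) (Equiv.Perm.decomposeFin.symm (0, σ)) (Fin.cons a k)
  rw [← this]
  congr 2
  ext1 j
  refine Fin.cases ?_ (fun a => ?_) j
  · simp
  · simp [Equiv.Perm.decomposeFin_symm_apply_succ]

lemma IsSymm.cons_cons {h : Idx d → ℂ} (hh : IsSymm h) {n : ℕ} (a b : Freq d)
    (k : Fin n → Freq d) (σ : Equiv.Perm (Fin n)) :
    h ⟨n + 2, Fin.cons a (Fin.cons b (k ∘ σ))⟩ = h ⟨n + 2, Fin.cons a (Fin.cons b k)⟩ := by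
  have := hh.cons a (Fin.cons b k) (Equiv.Perm.decomposeFin.symm (0, σ))
  rw [← this]
  congr 3
  ext1 j
  refine Fin.cases ?_ (fun a => ?_) j
  · simp
  · simp [Equiv.Perm.decomposeFin_symm_apply_succ]

lemma IsSymm.swap {h : Idx d → ℂ} (hh : IsSymm h) {n : ℕ} (a b : Freq d) (k : Fin n → Freq d) :
    h ⟨n + 2, Fin.cons a (Fin.cons b k)⟩ = h ⟨n + 2, Fin.cons b (Fin.cons a k)⟩ := by
  rw [← hh (n + 2) (Equiv.swap 0 1) (Fin.cons b (Fin.cons a k))]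
  congr 2
  ext1 j
  refine Fin.cases ?_ (fun j => Fin.cases ?_ (fun j => ?_) j) j
  · simp
  · simp
  · rw [Function.comp_apply, Equiv.swap_apply_of_ne_of_ne (Fin.succ_ne_zero _)]
    · simp
    · simp [Fin.ext_iff]

lemma IsSymm.rotate {h : Idx d → ℂ} (hh : IsSymm h) {n : ℕ} (a b c : Freq d)
    (k : Fin n → Freq d) : h ⟨n + 3, Fin.cons a (Fin.cons b (Fin.cons c k))⟩ =
      h ⟨n + 3, Fin.cons c (Fin.cons a (Fin.cons b k))⟩ := by
  rw [← hh.swap a c (Fin.cons b k)]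
  have h1 := hh.cons a (Fin.cons c (Fin.cons b k)) (Equiv.swap 0 1)
  rw [← h1]
  congr 3
  ext1 j
  refine Fin.cases ?_ (fun j => Fin.cases ?_ (fun j => ?_) j) j
  · simp
  · simp
  · rw [Function.comp_apply, Equiv.swap_apply_of_ne_of_ne (Fin.succ_ne_zero _)]
    · simp
    · simp [Fin.ext_iff]

/-- A sum over unordered pairs is half the sum over ordered pairs. -/
lemma sum_pairs_lt {n : ℕ} (G : Fin (n + 2) → Fin (n + 1) → ℂ)
    (hG : ∀ j i, G (j.succAbove i) (i.predAbove j) = G j i) :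
    2 * ∑ j, ∑ i, (if i.castSucc < j then G j i else 0) = ∑ j, ∑ i, G j i := by
  have h1 : ∀ j i, G j i = (if i.castSucc < j then G j i else 0) +
      (if i.castSucc < j then 0 else G j i) := fun j i => by split_ifs <;> simp
  have h2 : ∑ j, ∑ i, (if i.castSucc < j then 0 else G j i) =
      ∑ j, ∑ i, (if i.castSucc < j then G j i else 0) := by
    rw [← Fintype.sum_prod_type', ← Fintype.sum_prod_type']
    let φ : Fin (n + 2) × Fin (n + 1) → Fin (n + 2) × Fin (n + 1) :=
      fun q => (q.1.succAbove q.2, q.2.predAbove q.1)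
    have hφ : Function.Involutive φ := fun q => by
      simp only [φ, Fin.succAbove_succAbove_predAbove, Fin.predAbove_predAbove_succAbove]
    refine Fintype.sum_bijective φ hφ.bijective _ _ fun q => ?_
    simp only [φ]
    rw [hG]
    have e : (q.2.predAbove q.1).castSucc < q.1.succAbove q.2 ↔ ¬ q.2.castSucc < q.1 := by
      rw [← Fin.succAbove_lt_iff_castSucc_lt, Fin.succAbove_succAbove_predAbove,
        Fin.lt_succAbove_iff_le_castSucc, not_lt]
    by_cases h : q.2.castSucc < q.1
    · rw [if_pos h, if_neg (fun h' => (e.1 h') h)]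
    · rw [if_neg h, if_pos (e.2 h)]
  rw [Finset.sum_congr rfl fun j _ => Finset.sum_congr rfl fun i _ => h1 j i]
  simp only [Finset.sum_add_distrib]
  rw [h2]; ring

end Combinatorics

section Raw

variable {d : ℕ}

/-! ### The operators without the energy weights -/

/-- The matrix element of the creation operator in the coordinates `iⁿ √(n!) v_n`. -/
def rawWeight (w : Fin d → ℝ) (ε : ℝ) {n : ℕ} (k : Fin (n + 2) → Freq d) : ℝ :=
  c0 d * coupling d ε * (n + 1) * √(n + 2) * dot w (k 0 + k 1) * cutoff ε (k 0) (k 1)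

open Classical in
/-- `rawWeight` restricted to transitions between chaoses `lo, …, hi` and to non-zero
frequencies. -/
def rawW (w : Fin d → ℝ) (ε : ℝ) (lo hi : ℕ) : Idx d → ℂ
  | ⟨n + 2, k⟩ =>
      if (lo ≤ n + 1 ∧ n + 2 ≤ hi) ∧ ∀ a, k a ≠ 0 then (rawWeight w ε k : ℂ) else 0
  | _ => 0

lemma creW_eq_rawW (w : Fin d → ℝ) (ε : ℝ) (lo hi : ℕ) (x : Idx d) :
    creW w ε lo hi x = (((√(energy x.2))⁻¹ : ℝ) : ℂ) * rawW w ε lo hi x *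
      (((√(energy (mergeI x).2))⁻¹ : ℝ) : ℂ) := by
  rcases x with ⟨_ | _ | n, k⟩
  · simp [creW, rawW]
  · simp [creW, rawW]
  · simp only [creW, rawW, mergeI]
    split_ifs
    · rw [← Complex.ofReal_mul, ← Complex.ofReal_mul]
      congr 1
      simp only [creWeight, rawWeight, div_eq_mul_inv, mul_inv]
      ring
    · simp

lemma rawW_split (w : Fin d → ℝ) (ε : ℝ) (lo hi : ℕ) (x : Idx d) (hx : rawW w ε lo hi x ≠ 0) :
    ∃ l, splitI (mergeI x) l = x := by
  rcases x with ⟨_ | _ | n, k⟩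
  · simp [rawW] at hx
  · simp [rawW] at hx
  · exact ⟨k 0, by simp [mergeI, splitI]⟩

lemma rawW_mergeI (w : Fin d → ℝ) (ε : ℝ) (lo hi : ℕ) (y : Idx d) (l : Freq d)
    (hy : rawW w ε lo hi (splitI y l) ≠ 0) : mergeI (splitI y l) = y := by
  rcases y with ⟨_ | n, p⟩
  · simp [rawW, splitI] at hy
  · simp [mergeI, splitI]

lemma abs_dot_le (w : Fin d → ℝ) (p : Freq d) : |dot w p| ≤ (∑ a, |w a|) * ‖p‖ := by
  unfold dot
  refine (Finset.abs_sum_le_sum_abs _ _).trans ?_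
  rw [Finset.sum_mul]
  refine Finset.sum_le_sum fun a _ => ?_
  rw [abs_mul, ← Int.norm_eq_abs]
  gcongr
  exact norm_le_pi_norm p a

/-- At fixed `ε` the creation operator is bounded: the cut-off bounds the weights and the number of
ways to split a frequency. -/
lemma exists_fiberBound_rawW (w : Fin d → ℝ) {ε : ℝ} (hε : 0 < ε) (lo hi : ℕ) :
    ∃ C, FiberBound (rawW w ε lo hi) mergeI C := by
  have hcp := coupling_nonneg (d := d) hε
  have hc0 := c0_pos d
  have hw : 0 ≤ ∑ a, |w a| := Finset.sum_nonneg fun _ _ => abs_nonneg _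
  set B : ℝ := c0 d * coupling d ε * hi * √hi * ((∑ a, |w a|) * (1 / ε))
  have hB : 0 ≤ B := by positivity
  refine ⟨√(B ^ 2 * (2 * (1 / ε) + 1) ^ d), FiberBound.of_param (Real.sqrt_nonneg _) splitI
    (rawW_split w ε lo hi) ?_⟩
  rintro ⟨_ | n, p⟩
  · simp [splitI, rawW]
  rw [Real.sq_sqrt (by positivity)]
  have hz : ∀ l, rawW w ε lo hi (splitI ⟨n + 1, p⟩ l) ≠ 0 →
      cutoff ε l (p 0 - l) ≠ 0 ∧ n + 2 ≤ hi := by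
    intro l hl
    simp only [splitI, rawW] at hl
    split_ifs at hl with h
    · refine ⟨fun h0 => hl ?_, h.1.2⟩
      simp [rawWeight, h0]
    · exact absurd rfl hl
  refine tsum_enorm_sq_le_of_bdd (by positivity) (by positivity)
    (fun l hl => (of_cutoff_ne_zero hε (hz l hl).1).2.1) fun l => ?_
  by_cases hl : rawW w ε lo hi (splitI ⟨n + 1, p⟩ l) = 0
  · rw [hl, norm_zero, zero_pow two_ne_zero]; positivity
  obtain ⟨hc, hn⟩ := hz l hl
  have hp : ‖p 0‖ ≤ 1 / ε := by
    have := (of_cutoff_ne_zero hε hc).2.2.2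
    rwa [add_sub_cancel] at this
  have hn' : (n : ℝ) + 2 ≤ hi := by exact_mod_cast hn
  have h1 : rawW w ε lo hi (splitI ⟨n + 1, p⟩ l) = (rawWeight w ε (split p l) : ℂ) := by
    simp only [splitI, rawW] at hl ⊢
    split_ifs at hl ⊢ with h
    · rfl
    · exact absurd rfl hl
  rw [h1, Complex.norm_real, Real.norm_eq_abs]
  gcongr
  unfold rawWeight
  rw [split_zero, split_one, add_sub_cancel, abs_mul, abs_mul,
    abs_of_nonneg (cutoff_nonneg _ _ _), abs_of_nonneg (show
      0 ≤ c0 d * coupling d ε * (n + 1) * √(n + 2) by positivity)]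
  calc _ ≤ c0 d * coupling d ε * (n + 1) * √(n + 2) * ((∑ a, |w a|) * (1 / ε)) * 1 := by
        gcongr
        · exact cutoff_nonneg _ _ _
        · exact (abs_dot_le w (p 0)).trans (by gcongr)
        · exact cutoff_le_one _ _ _
    _ ≤ B := by
        rw [mul_one]
        refine mul_le_mul_of_nonneg_right ?_ (by positivity)
        gcongr
        linarith

/-- The creation operator in the coordinates `iⁿ √(n!) v_n`, before symmetrisation. -/
def rawOp (w : Fin d → ℝ) (ε : ℝ) (lo hi : ℕ) : L2 (Idx d) →L[ℂ] L2 (Idx d) :=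
  wcomp (rawW w ε lo hi) mergeI

/-- The adjoint of `rawOp`. -/
def rawAnn (w : Fin d → ℝ) (ε : ℝ) (lo hi : ℕ) : L2 (Idx d) →L[ℂ] L2 (Idx d) :=
  ContinuousLinearMap.adjoint (rawOp w ε lo hi)

lemma rawOp_apply (w : Fin d → ℝ) {ε : ℝ} (hε : 0 < ε) (lo hi : ℕ) (f : L2 (Idx d)) (x : Idx d) :
    rawOp w ε lo hi f x = rawW w ε lo hi x * f (mergeI x) :=
  wcomp_apply (exists_fiberBound_rawW w hε lo hi).choose_spec f x

lemma star_rawW (w : Fin d → ℝ) (ε : ℝ) (lo hi : ℕ) (x : Idx d) :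
    star (rawW w ε lo hi x) = rawW w ε lo hi x := by
  unfold rawW
  split
  · split_ifs <;> simp
  · simp

lemma rawAnn_apply (w : Fin d → ℝ) {ε : ℝ} (hε : 0 < ε) (lo hi : ℕ) (f : L2 (Idx d)) (y : Idx d) :
    rawAnn w ε lo hi f y = ∑' l, rawW w ε lo hi (splitI y l) * f (splitI y l) := by
  rw [rawAnn, rawOp, adjoint_wcomp_apply (exists_fiberBound_rawW w hε lo hi).choose_spec splitI
    (rawW_split w ε lo hi) (rawW_mergeI w ε lo hi) splitI_injective]
  simp only [star_rawW]

/-- The function underlying `rawOp`. -/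
def rawCreF (w : Fin d → ℝ) (ε : ℝ) (lo hi : ℕ) (h : Idx d → ℂ) (x : Idx d) : ℂ :=
  rawW w ε lo hi x * h (mergeI x)

/-- The function underlying `rawAnn`. -/
def rawAnnF (w : Fin d → ℝ) (ε : ℝ) (lo hi : ℕ) (h : Idx d → ℂ) (y : Idx d) : ℂ :=
  ∑' l, rawW w ε lo hi (splitI y l) * h (splitI y l)

lemma symF_rawCreF_zero (w : Fin d → ℝ) (ε : ℝ) (lo hi : ℕ) (h : Idx d → ℂ)
    (k : Fin 0 → Freq d) : symF (rawCreF w ε lo hi h) ⟨0, k⟩ = 0 :=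
  avg_eq_zero fun σ => by simp [rawCreF, rawW]

lemma symF_rawCreF_one (w : Fin d → ℝ) (ε : ℝ) (lo hi : ℕ) (h : Idx d → ℂ)
    (k : Fin 1 → Freq d) : symF (rawCreF w ε lo hi h) ⟨1, k⟩ = 0 :=
  avg_eq_zero fun σ => by simp [rawCreF, rawW]

lemma symF_rawAnnF_zero (w : Fin d → ℝ) (ε : ℝ) (lo hi : ℕ) (h : Idx d → ℂ)
    (k : Fin 0 → Freq d) : symF (rawAnnF w ε lo hi h) ⟨0, k⟩ = 0 :=
  avg_eq_zero fun σ => by simp [rawAnnF, rawW, splitI]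

open Classical in
/-- The symmetrised creation operator as a sum over ordered pairs of positions. -/
lemma symF_rawCreF (w : Fin d → ℝ) (ε : ℝ) (lo hi : ℕ) {h : Idx d → ℂ} (hh : IsSymm h) {n : ℕ}
    (k : Fin (n + 2) → Freq d) : symF (rawCreF w ε lo hi h) ⟨n + 2, k⟩ =
      if (lo ≤ n + 1 ∧ n + 2 ≤ hi) ∧ ∀ a, k a ≠ 0 then
        ((c0 d * coupling d ε * (√(n + 2))⁻¹ : ℝ) : ℂ) * ∑ j, ∑ i : Fin (n + 1),
          ((dot w (k j + k (j.succAbove i)) * cutoff ε (k j) (k (j.succAbove i)) : ℝ) : ℂ) *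
            h ⟨n + 1, Fin.cons (k j + k (j.succAbove i)) fun a => k (j.succAbove (i.succAbove a))⟩
      else 0 := by
  split_ifs with hc
  · have h1 : symF (rawCreF w ε lo hi h) ⟨n + 2, k⟩ =
        avg (fun q => ((c0 d * coupling d ε * (n + 1) * √(n + 2) : ℝ) : ℂ) *
          (((dot w (q 0 + q 1) * cutoff ε (q 0) (q 1) : ℝ) : ℂ) * h ⟨n + 1, merge q⟩)) k := by
      unfold symF avg
      congr 1
      refine Finset.sum_congr rfl fun σ _ => ?_
      simp only [rawCreF, rawW, mergeI]
      rw [if_pos ⟨hc.1, fun a => hc.2 _⟩, rawWeight]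
      push_cast; ring
    rw [h1, avg_const_mul, avg_pair]
    · rw [← mul_assoc]
      congr 1
      rw [← Complex.ofReal_natCast]
      have e : (((n : ℝ) : ℂ) + 2) * (((n : ℝ) : ℂ) + 1) = (((n + 2) * (n + 1) : ℝ) : ℂ) := by
        push_cast; ring
      rw [e, ← Complex.ofReal_inv, ← Complex.ofReal_mul]
      congr 1
      have : (√((n : ℝ) + 2)) ^ 2 = n + 2 := Real.sq_sqrt (by positivity)
      have h0 : √((n : ℝ) + 2) ≠ 0 := by positivity
      field_simp
      rw [this]
    · intro a b q σ
      congr 1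
      exact hh.cons _ q σ
  · refine avg_eq_zero fun σ => ?_
    have : ¬ ((lo ≤ n + 1 ∧ n + 2 ≤ hi) ∧ ∀ a, (k ∘ σ) a ≠ 0) := fun h' => hc
      ⟨h'.1, fun a => by simpa using h'.2 (σ.symm a)⟩
    simp only [rawCreF, rawW]
    rw [if_neg this, zero_mul]

open Classical in
/-- The symmetrised annihilation operator as a sum over positions. -/
lemma symF_rawAnnF (w : Fin d → ℝ) (ε : ℝ) (lo hi : ℕ) {h : Idx d → ℂ} (hh : IsSymm h) {n : ℕ}
    (k : Fin (n + 1) → Freq d) : symF (rawAnnF w ε lo hi h) ⟨n + 1, k⟩ =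
      if (lo ≤ n + 1 ∧ n + 2 ≤ hi) ∧ ∀ a, k a ≠ 0 then
        ((c0 d * coupling d ε * √(n + 2) : ℝ) : ℂ) * ∑ j, ((dot w (k j) : ℝ) : ℂ) *
          ∑' l, ((cutoff ε l (k j - l) : ℝ) : ℂ) *
            h ⟨n + 2, Fin.cons l (Fin.cons (k j - l) fun a => k (j.succAbove a))⟩
      else 0 := by
  have h0 : ∀ (q : Fin (n + 1) → Freq d) (l : Freq d), rawW w ε lo hi ⟨n + 2, split q l⟩ =
      if (lo ≤ n + 1 ∧ n + 2 ≤ hi) ∧ ∀ a, q a ≠ 0 then (rawWeight w ε (split q l) : ℂ) else 0 := by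
    intro q l
    simp only [rawW]
    by_cases hcut : cutoff ε l (q 0 - l) = 0
    · simp [rawWeight, hcut]
    have hcut' : l ≠ 0 ∧ q 0 - l ≠ 0 ∧ l + (q 0 - l) ≠ 0 := by
      unfold cutoff at hcut
      split_ifs at hcut with h'
      · refine ⟨?_, ?_, ?_⟩ <;> rintro h0
        · rw [h0] at h'; simp at h'
        · rw [h0] at h'; simp at h'
        · rw [h0] at h'; simp at h'
      · exact absurd rfl hcut
    rw [add_sub_cancel] at hcut'
    have : (∀ a, split q l a ≠ 0) ↔ ∀ a, q a ≠ 0 := by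
      constructor
      · intro h' a
        refine Fin.cases hcut'.2.2 (fun a => ?_) a
        simpa using h' a.succ.succ
      · intro h' a
        refine Fin.cases ?_ (fun a => Fin.cases ?_ (fun a => ?_) a) a
        · exact hcut'.1
        · exact hcut'.2.1
        · simpa using h' a.succ
    simp only [this]
  split_ifs with hc
  · have h1 : symF (rawAnnF w ε lo hi h) ⟨n + 1, k⟩ =
        avg (fun q => ((c0 d * coupling d ε * (n + 1) * √(n + 2) : ℝ) : ℂ) *
          (((dot w (q 0) : ℝ) : ℂ) *
            ∑' l, ((cutoff ε l (q 0 - l) : ℝ) : ℂ) * h ⟨n + 2, split q l⟩)) k := by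
      unfold symF avg
      congr 1
      refine Finset.sum_congr rfl fun σ _ => ?_
      simp only [rawAnnF, splitI, h0]
      rw [← tsum_mul_left, ← tsum_mul_left]
      refine tsum_congr fun l => ?_
      rw [if_pos ⟨hc.1, fun a => hc.2 _⟩, rawWeight, split_zero, split_one, add_sub_cancel]
      push_cast; ring
    rw [h1, avg_const_mul, avg_head]
    · rw [← mul_assoc]
      congr 1
      have hn : (n : ℂ) + 1 ≠ 0 := by exact_mod_cast Nat.succ_ne_zero n
      push_cast
      field_simp
    · intro a q σ
      congr 1
      refine tsum_congr fun l => ?_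
      congr 1
      exact hh.cons_cons _ _ q σ
  · refine avg_eq_zero fun σ => ?_
    have : ¬ ((lo ≤ n + 1 ∧ n + 2 ≤ hi) ∧ ∀ a, (k ∘ σ) a ≠ 0) := fun h' => hc
      ⟨h'.1, fun a => by simpa using h'.2 (σ.symm a)⟩
    simp only [rawAnnF, splitI, h0]
    simp only [if_neg this, zero_mul, tsum_zero]

end Raw

section Coordinates

variable {d : ℕ}

/-! ### Hilbert space coordinates of the Fock space -/

/-- The coordinates `iⁿ √(n!) f_n`, in which the Fock norm is the `ℓ²` norm and the creation
operator has real matrix elements. -/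
def coordF (f : Kernels d) (x : Idx d) : ℂ :=
  Complex.I ^ x.1 * ((√(x.1.factorial : ℝ) : ℝ) : ℂ) * f x.1 x.2

lemma coord_ne_zero (n : ℕ) : Complex.I ^ n * ((√(n.factorial : ℝ) : ℝ) : ℂ) ≠ 0 := by
  refine mul_ne_zero (pow_ne_zero _ Complex.I_ne_zero) ?_
  rw [Complex.ofReal_ne_zero]
  have : (0 : ℝ) < n.factorial := by exact_mod_cast Nat.factorial_pos n
  positivity

lemma coordF_injective : Function.Injective (coordF (d := d)) := fun f g h => by
  ext n k
  exact mul_left_cancel₀ (coord_ne_zero n) (congrFun h ⟨n, k⟩)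

lemma coordF_surjective : Function.Surjective (coordF (d := d)) := fun u =>
  ⟨fun n k => (Complex.I ^ n * ((√(n.factorial : ℝ) : ℝ) : ℂ))⁻¹ * u ⟨n, k⟩, funext fun x => by
    rw [coordF, mul_inv_cancel_left₀ (coord_ne_zero x.1)]⟩

lemma coordF_add (f g : Kernels d) (x : Idx d) : coordF (f + g) x = coordF f x + coordF g x :=
  mul_add _ _ _

lemma coordF_eq_zero_iff {f : Kernels d} {n : ℕ} {k : Fin n → Freq d} :
    coordF f ⟨n, k⟩ = 0 ↔ f n k = 0 := by
  rw [coordF, mul_eq_zero, or_iff_right (coord_ne_zero n)]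

lemma fockNorm_eq (f : Kernels d) : fockNorm f = sqENorm (coordF f) ^ (1 / 2 : ℝ) := by
  unfold fockNorm
  congr 1
  rw [sqENorm_sigma]
  refine tsum_congr fun n => ?_
  unfold sqENorm
  rw [← ENNReal.tsum_mul_left]
  refine tsum_congr fun k => ?_
  have e : coordF f ⟨n, k⟩ = Complex.I ^ n * ((√(n.factorial : ℝ) : ℝ) : ℂ) * f n k := rfl
  simp only [e]
  rw [enorm_mul, mul_pow]
  congr 1
  rw [← ofReal_norm, ← ENNReal.ofReal_pow (norm_nonneg _), norm_mul, norm_pow, Complex.norm_I,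
    one_pow, one_mul, Complex.norm_real, Real.norm_eq_abs, sq_abs, Real.sq_sqrt (by positivity)]
  simp

lemma fockNorm_ne_top_iff (f : Kernels d) : fockNorm f ≠ ⊤ ↔ sqENorm (coordF f) ≠ ⊤ := by
  rw [fockNorm_eq, Ne, ENNReal.rpow_eq_top_iff_of_pos (by norm_num)]

lemma fockNorm_eq_norm {f : Kernels d} {u : L2 (Idx d)} (h : ∀ x, ‖coordF f x‖ = ‖u x‖) :
    fockNorm f = ENNReal.ofReal ‖u‖ := by
  have h1 : sqENorm (coordF f) = sqENorm u := by
    unfold sqENorm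
    refine tsum_congr fun x => ?_
    rw [← ofReal_norm, h, ofReal_norm]
  rw [fockNorm_eq, h1, sqENorm_eq_ofReal, ENNReal.ofReal_rpow_of_nonneg (by positivity)
    (by norm_num), ← Real.sqrt_eq_rpow, Real.sqrt_sq (norm_nonneg _)]

lemma exists_coord {f : Kernels d} (h : fockNorm f ≠ ⊤) : ∃ u : L2 (Idx d), ∀ x, u x = coordF f x :=
  ⟨⟨coordF f, memLp_iff_sqENorm.2 ((fockNorm_ne_top_iff f).1 h)⟩, fun _ => rfl⟩

lemma isSymm_coordF {f : Kernels d} (h : ∀ (n : ℕ) (σ : Equiv.Perm (Fin n)) (k : Fin n → Freq d),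
    f n (k ∘ σ) = f n k) : IsSymm (coordF f) := fun n σ k => by
  simp only [coordF, h]

/-- The symmetrised creation operator in coordinates. -/
lemma coordF_Aplus (w : Fin d → ℝ) (ε : ℝ) (lo hi : ℕ) {f : Kernels d}
    (hs : ∀ (n : ℕ) (σ : Equiv.Perm (Fin n)) (k : Fin n → Freq d), f n (k ∘ σ) = f n k)
    (hz : ∀ (n : ℕ) (k : Fin n → Freq d), (∃ j, k j = 0) → f n k = 0) (n : ℕ)
    (k : Fin n → Freq d) : symF (rawCreF w ε lo hi (coordF f)) ⟨n, k⟩ =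
      if lo + 1 ≤ n ∧ n ≤ hi then coordF (Aplus w ε f) ⟨n, k⟩ else 0 := by
  classical
  match n, k with
  | 0, k => simp [symF_rawCreF_zero]
  | 1, k => simp [symF_rawCreF_one, coordF, Aplus]
  | n + 2, k =>
    have hf := isSymm_coordF hs
    rw [symF_rawCreF w ε lo hi hf]
    have h1 : ∑ j, ∑ i : Fin (n + 1),
          ((dot w (k j + k (j.succAbove i)) * cutoff ε (k j) (k (j.succAbove i)) : ℝ) : ℂ) *
            coordF f ⟨n + 1, Fin.cons (k j + k (j.succAbove i))
              fun a => k (j.succAbove (i.succAbove a))⟩ =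
        2 * ∑ j : Fin (n + 2), ∑ i : Fin (n + 1), if i.castSucc < j then
            ((dot w (k i.castSucc + k j) * cutoff ε (k i.castSucc) (k j) : ℝ) : ℂ) *
            coordF f ⟨n + 1, Fin.cons (k i.castSucc + k j)
              fun a => k (j.succAbove (i.succAbove a))⟩ else 0 := by
      rw [← sum_pairs_lt]
      · congr 1
        refine Finset.sum_congr rfl fun j _ => Finset.sum_congr rfl fun i _ => ?_
        split_ifs with h
        · rw [Fin.succAbove_of_castSucc_lt _ _ h, add_comm (k j), cutoff_comm]
        · rfl
      · intro j i
        simp only [Fin.succAbove_succAbove_predAbove, Fin.succAbove_succAbove_succAbove_predAbove]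
        rw [add_comm (k j), cutoff_comm]
    by_cases hk : ∀ a, k a ≠ 0
    · by_cases hw : lo ≤ n + 1 ∧ n + 2 ≤ hi
      · rw [if_pos ⟨hw, hk⟩, if_pos ⟨by omega, hw.2⟩, h1]
        simp only [coordF, Aplus]
        rw [Nat.factorial_succ (n + 1)]
        push_cast
        rw [Real.sqrt_mul (by positivity), c0]
        simp only [Finset.mul_sum]
        refine Finset.sum_congr rfl fun j _ => Finset.sum_congr rfl fun i _ => ?_
        split_ifs
        · have e : (n : ℝ) + 1 + 1 = n + 2 := by ring
          have h2 : ((√((n : ℝ) + 2) : ℝ) : ℂ) ≠ 0 := by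
            rw [Complex.ofReal_ne_zero]; positivity
          have h3 : ((√((n : ℝ) + 2) : ℝ) : ℂ) ^ 2 = (n : ℂ) + 2 := by
            rw [← Complex.ofReal_pow, Real.sq_sqrt (by positivity)]; push_cast; rfl
          have h4 : (n : ℂ) + 2 ≠ 0 := by rw [← h3]; exact pow_ne_zero _ h2
          have h5 : (((2 * Real.pi) ^ ((d : ℝ) / 2) : ℝ) : ℂ) ≠ 0 := by
            rw [Complex.ofReal_ne_zero]; positivity
          have h6 : Complex.I ^ (n + 2) * Complex.I = -Complex.I ^ (n + 1) := by
            rw [pow_succ, mul_assoc, Complex.I_mul_I]; ring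
          rw [e]
          push_cast
          field_simp
          rw [h3]
          linear_combination ((n + 2 : ℂ)) * ((((dot w (k i.castSucc + k j) : ℝ) : ℂ)) *
            (cutoff ε (k i.castSucc) (k j) : ℂ) * (coupling d ε : ℂ) *
            ((√((n + 1).factorial : ℝ) : ℝ) : ℂ) * f (n + 1) (Fin.cons (k i.castSucc + k j)
              fun a => k (j.succAbove (i.succAbove a)))) * h6
        · simp
      · rw [if_neg (fun h => hw h.1), if_neg (fun h => hw ⟨by omega, h.2⟩)]
    · rw [if_neg (fun h => hk h.2)]
      push Not at hk
      obtain ⟨b, hb⟩ := hk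
      have : Aplus w ε f (n + 2) k = 0 := by
        simp only [Aplus]
        refine mul_eq_zero_of_right _ (Finset.sum_eq_zero fun j _ => Finset.sum_eq_zero fun i _ => ?_)
        split_ifs with h
        · by_cases hj : b = j
          · subst hj; rw [hb]; simp [cutoff]
          obtain ⟨b', rfl⟩ := Fin.exists_succAbove_eq hj
          by_cases hi : b' = i
          · subst hi
            rw [Fin.succAbove_of_castSucc_lt _ _ h] at hb
            rw [hb]; simp [cutoff]
          obtain ⟨b'', rfl⟩ := Fin.exists_succAbove_eq hi
          rw [hz, mul_zero]
          exact ⟨b''.succ, by simpa using hb⟩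
        · rfl
      simp [coordF, this]

/-- The symmetrised annihilation operator in coordinates. -/
lemma coordF_Aminus (w : Fin d → ℝ) (ε : ℝ) (lo hi : ℕ) {f : Kernels d}
    (hs : ∀ (n : ℕ) (σ : Equiv.Perm (Fin n)) (k : Fin n → Freq d), f n (k ∘ σ) = f n k)
    (hz : ∀ (n : ℕ) (k : Fin n → Freq d), (∃ j, k j = 0) → f n k = 0) (n : ℕ)
    (k : Fin n → Freq d) : symF (rawAnnF w ε lo hi (coordF f)) ⟨n, k⟩ =
      if lo ≤ n ∧ n + 1 ≤ hi then -coordF (Aminus w ε f) ⟨n, k⟩ else 0 := by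
  classical
  match n, k with
  | 0, k => simp [symF_rawAnnF_zero, coordF, Aminus]
  | n + 1, k =>
    have hf := isSymm_coordF hs
    rw [symF_rawAnnF w ε lo hi hf]
    by_cases hk : ∀ a, k a ≠ 0
    · by_cases hw : lo ≤ n + 1 ∧ n + 2 ≤ hi
      · rw [if_pos ⟨hw, hk⟩, if_pos hw]
        simp only [coordF, Aminus]
        have h7 : ∀ j : Fin (n + 1), ∑' l, ((cutoff ε l (k j - l) : ℝ) : ℂ) *
            (Complex.I ^ (n + 2) * ((√((n + 2).factorial : ℝ) : ℝ) : ℂ) *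
              f (n + 2) (Fin.cons l (Fin.cons (k j - l) fun a => k (j.succAbove a)))) =
            Complex.I ^ (n + 2) * ((√((n + 2).factorial : ℝ) : ℝ) : ℂ) *
            ∑' l, ((cutoff ε l (k j - l) : ℝ) : ℂ) *
              f (n + 2) (Fin.cons l (Fin.cons (k j - l) fun a => k (j.succAbove a))) := fun j => by
          rw [← tsum_mul_left]
          exact tsum_congr fun l => by ring
        simp only [h7]
        rw [Nat.factorial_succ (n + 1)]
        push_cast
        rw [Real.sqrt_mul (by positivity), c0, ← mul_neg]
        simp only [Finset.mul_sum, ← Finset.sum_neg_distrib]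
        refine Finset.sum_congr rfl fun j _ => ?_
        have e : (n : ℝ) + 1 + 1 = n + 2 := by ring
        have h3 : ((√((n : ℝ) + 2) : ℝ) : ℂ) ^ 2 = (n : ℂ) + 2 := by
          rw [← Complex.ofReal_pow, Real.sq_sqrt (by positivity)]; push_cast; rfl
        have h5 : (((2 * Real.pi) ^ ((d : ℝ) / 2) : ℝ) : ℂ) ≠ 0 := by
          rw [Complex.ofReal_ne_zero]; positivity
        rw [e]
        push_cast
        field_simp
        rw [h3]
        ring
      · rw [if_neg (fun h => hw h.1), if_neg hw]
    · rw [if_neg (fun h => hk h.2)]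
      push Not at hk
      obtain ⟨b, hb⟩ := hk
      have : Aminus w ε f (n + 1) k = 0 := by
        simp only [Aminus]
        refine mul_eq_zero_of_right _ (Finset.sum_eq_zero fun j _ => ?_)
        by_cases hj : b = j
        · subst hj; rw [hb, dot_zero]; simp
        obtain ⟨b', rfl⟩ := Fin.exists_succAbove_eq hj
        refine mul_eq_zero_of_right _ ?_
        refine (tsum_congr fun l => ?_).trans tsum_zero
        rw [hz, mul_zero]
        exact ⟨b'.succ.succ, by simpa using hb⟩
      simp [coordF, this]

end Coordinates

section Solutions

variable {d : ℕ}

/-! ### Well-posedness of the truncated generator equation -/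

/-- Vanishing outside the chaoses `lo, …, hi` and on kernels with a zero mode. -/
def Supported (lo hi : ℕ) (f : Idx d → ℂ) : Prop :=
  ∀ x, (x.1 < lo ∨ hi < x.1 ∨ ∃ j, x.2 j = 0) → f x = 0

/-- The truncated generator without its diagonal part, in coordinates. -/
def rawGen (w : Fin d → ℝ) (ε : ℝ) (lo hi : ℕ) : L2 (Idx d) →L[ℂ] L2 (Idx d) :=
  symOp ∘L rawOp w ε lo hi ∘L symOp - symOp ∘L rawAnn w ε lo hi ∘L symOp

lemma symOp_rawOp_apply (w : Fin d → ℝ) {ε : ℝ} (hε : 0 < ε) (lo hi : ℕ) (f : L2 (Idx d))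
    (x : Idx d) : symOp (rawOp w ε lo hi f) x = symF (rawCreF w ε lo hi f) x := by
  rw [symOp_apply]
  congr 1
  exact funext fun y => rawOp_apply w hε lo hi f y

lemma symOp_rawAnn_apply (w : Fin d → ℝ) {ε : ℝ} (hε : 0 < ε) (lo hi : ℕ) (f : L2 (Idx d))
    (x : Idx d) : symOp (rawAnn w ε lo hi f) x = symF (rawAnnF w ε lo hi f) x := by
  rw [symOp_apply]
  congr 1
  exact funext fun y => rawAnn_apply w hε lo hi f y

lemma rawGen_apply (w : Fin d → ℝ) (ε : ℝ) (lo hi : ℕ) (f : L2 (Idx d)) :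
    rawGen w ε lo hi f =
      symOp (rawOp w ε lo hi (symOp f)) - symOp (rawAnn w ε lo hi (symOp f)) := rfl

lemma supported_rawCre (w : Fin d → ℝ) (ε : ℝ) (lo hi : ℕ) {h : Idx d → ℂ} (hh : IsSymm h) :
    Supported (lo + 1) hi (symF (rawCreF w ε lo hi h)) := by
  classical
  rintro ⟨n, k⟩ hx
  match n, k, hx with
  | 0, k, _ => exact symF_rawCreF_zero w ε lo hi h k
  | 1, k, _ => exact symF_rawCreF_one w ε lo hi h k
  | n + 2, k, hx =>
    rw [symF_rawCreF w ε lo hi hh, if_neg]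
    rintro ⟨⟨h1, h2⟩, h3⟩
    simp only at hx
    obtain h | h | ⟨j, hj⟩ := hx
    · omega
    · omega
    · exact h3 j hj

lemma supported_rawAnn (w : Fin d → ℝ) (ε : ℝ) (lo hi : ℕ) {h : Idx d → ℂ} (hh : IsSymm h) :
    Supported lo (hi - 1) (symF (rawAnnF w ε lo hi h)) := by
  classical
  rintro ⟨n, k⟩ hx
  match n, k, hx with
  | 0, k, _ => exact symF_rawAnnF_zero w ε lo hi h k
  | n + 1, k, hx =>
    rw [symF_rawAnnF w ε lo hi hh, if_neg]
    rintro ⟨⟨h1, h2⟩, h3⟩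
    simp only at hx
    obtain h | h | ⟨j, hj⟩ := hx
    · omega
    · omega
    · exact h3 j hj

lemma Supported.mono {lo hi lo' hi' : ℕ} {f : Idx d → ℂ} (h : Supported lo hi f) (h1 : lo' ≤ lo)
    (h2 : hi ≤ hi') : Supported lo' hi' f := fun x hx => h x (by
  obtain h | h | h := hx
  · left; omega
  · right; left; omega
  · exact Or.inr (Or.inr h))

lemma Supported.zero_of_energy {lo hi : ℕ} (hlo : 0 < lo) {f : Idx d → ℂ} (h : Supported lo hi f)
    {x : Idx d} (hx : energy x.2 = 0) : f x = 0 := by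
  refine h x ?_
  by_contra hne
  push Not at hne
  have hj := hne.2.2 ⟨0, lt_of_lt_of_le hlo hne.1⟩
  exact (energy_pos hj).ne' hx

lemma isSymm_rawGen (w : Fin d → ℝ) (ε : ℝ) (lo hi : ℕ) (f : L2 (Idx d)) :
    IsSymm (rawGen w ε lo hi f) := fun n σ k => by
  rw [rawGen_apply, lp.coeFn_sub, Pi.sub_apply, Pi.sub_apply, symOp_apply, symOp_apply,
    symOp_apply, symOp_apply, isSymm_symF _ n σ k, isSymm_symF _ n σ k]

lemma supported_rawGen (w : Fin d → ℝ) {ε : ℝ} (hε : 0 < ε) (lo hi : ℕ) (f : L2 (Idx d)) :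
    Supported lo hi (rawGen w ε lo hi f) := fun x hx => by
  have hs : IsSymm (symOp f) := isSymm_symF _
  rw [rawGen_apply, lp.coeFn_sub, Pi.sub_apply, symOp_rawOp_apply w hε, symOp_rawAnn_apply w hε,
    (supported_rawCre w ε lo hi hs).mono (Nat.le_succ lo) le_rfl x hx,
    (supported_rawAnn w ε lo hi hs).mono le_rfl (Nat.sub_le hi 1) x hx, sub_zero]

lemma symOp_diag (m : Idx d → ℂ) {C : ℝ} (hC : FiberBound m id C) (hm : IsSymm m)
    (f : L2 (Idx d)) : symOp (wcomp m id f) = wcomp m id (symOp f) := by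
  ext ⟨n, k⟩
  rw [wcomp_apply hC, symOp_apply, symOp_apply]
  unfold symF
  rw [id, ← avg_const_mul]
  simp only [avg]
  congr 1
  refine Finset.sum_congr rfl fun σ _ => ?_
  rw [wcomp_apply hC, hm n σ k]; rfl

lemma symOp_invSqrt (f : L2 (Idx d)) : symOp (invSqrtOp d f) = invSqrtOp d (symOp f) :=
  symOp_diag _ fiberBound_invSqrt (fun n σ k => by simp only [energy_perm]) f

lemma adjoint_invSqrt : ContinuousLinearMap.adjoint (invSqrtOp d) = invSqrtOp d := by
  ext f x
  rw [invSqrtOp_apply, invSqrtOp, adjoint_wcomp_apply (γ := Unit) fiberBound_invSqrt (fun y _ => y)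
    (fun x _ => ⟨(), rfl⟩) (fun y _ _ => rfl) (fun y a b _ => rfl)]
  simp

lemma creOp_eq (hd : 3 ≤ d) (w : Fin d → ℝ) {ε : ℝ} (hε : 0 < ε) (lo hi : ℕ) :
    creOp w ε lo hi = invSqrtOp d ∘L rawOp w ε lo hi ∘L invSqrtOp d := by
  ext f x
  simp only [ContinuousLinearMap.comp_apply]
  rw [creOp_apply hd w hε, invSqrtOp_apply, rawOp_apply w hε, invSqrtOp_apply, creW_eq_rawW]
  ring

lemma annOp_eq (hd : 3 ≤ d) (w : Fin d → ℝ) {ε : ℝ} (hε : 0 < ε) (lo hi : ℕ) :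
    annOp w ε lo hi = invSqrtOp d ∘L rawAnn w ε lo hi ∘L invSqrtOp d := by
  rw [annOp, creOp_eq hd w hε, rawAnn]
  simp only [ContinuousLinearMap.adjoint_comp, adjoint_invSqrt, ContinuousLinearMap.comp_assoc]

/-- The normalised generator is the generator conjugated by the square root of the energy. -/
lemma genOp_eq (hd : 3 ≤ d) (w : Fin d → ℝ) {ε : ℝ} (hε : 0 < ε) (lo hi : ℕ) (f : L2 (Idx d)) :
    genOp w ε lo hi f = invSqrtOp d (rawGen w ε lo hi (invSqrtOp d f)) := by
  rw [genOp_apply, rawGen_apply, creOp_eq hd w hε, annOp_eq hd w hε]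
  simp only [ContinuousLinearMap.comp_apply, map_sub, symOp_invSqrt]

/-- The source `𝒜_+ f` of the truncated generator equation, in coordinates, where `f` has
coordinates `g` in chaos `i`. -/
def rawSrc (w : Fin d → ℝ) (ε : ℝ) (i : ℕ) (g : L2 (Idx d)) : L2 (Idx d) :=
  symOp (rawOp w ε i (i + 1) g)

/-- The normalised solution `(-𝓛₀)^{1/2} v` of the truncated generator equation on the chaoses
`i + 1, …, m`, in coordinates. -/
def solOp (w : Fin d → ℝ) (ε : ℝ) (i m : ℕ) (g : L2 (Idx d)) : L2 (Idx d) :=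
  resolvent (genOp w ε (i + 1) m) (invSqrtOp d (rawSrc w ε i g))

/-- The fixed-point equation behind `solOp`. -/
lemma solOp_eqn (hd : 3 ≤ d) (w : Fin d → ℝ) {ε : ℝ} (hε : 0 < ε) (i m : ℕ) (g : L2 (Idx d)) :
    solOp w ε i m g = invSqrtOp d (rawGen w ε (i + 1) m (invSqrtOp d (solOp w ε i m g)) +
      rawSrc w ε i g) := by
  have := resolvent_sub (adjoint_genOp w ε (i + 1) m) (invSqrtOp d (rawSrc w ε i g))
  rw [map_add, ← genOp_eq hd w hε]
  exact sub_eq_iff_eq_add'.1 this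

lemma supported_rawSrc (w : Fin d → ℝ) {ε : ℝ} (hε : 0 < ε) (i : ℕ) {g : L2 (Idx d)}
    (hg : IsSymm g) : Supported (i + 1) (i + 1) (rawSrc w ε i g) := fun x hx => by
  rw [rawSrc, symOp_rawOp_apply w hε]
  exact supported_rawCre w ε i (i + 1) hg x hx

lemma Supported.add {lo hi : ℕ} {f g : L2 (Idx d)} (hf : Supported lo hi f)
    (hg : Supported lo hi g) : Supported lo hi (f + g : L2 (Idx d)) := fun x hx => by
  rw [lp.coeFn_add, Pi.add_apply, hf x hx, hg x hx, add_zero]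

lemma Supported.invSqrt {lo hi : ℕ} {f : L2 (Idx d)} (hf : Supported lo hi f) :
    Supported lo hi (invSqrtOp d f) := fun x hx => by
  rw [invSqrtOp_apply, hf x hx, mul_zero]

lemma isSymm_invSqrt {f : L2 (Idx d)} (hf : IsSymm f) : IsSymm (invSqrtOp d f) := fun n σ k => by
  rw [invSqrtOp_apply, invSqrtOp_apply, hf n σ k]
  simp only [energy_perm]

lemma isSymm_add {f g : L2 (Idx d)} (hf : IsSymm f) (hg : IsSymm g) :
    IsSymm (f + g : L2 (Idx d)) := fun n σ k => by
  rw [lp.coeFn_add, Pi.add_apply, Pi.add_apply, hf n σ k, hg n σ k]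

lemma supported_solOp (hd : 3 ≤ d) (w : Fin d → ℝ) {ε : ℝ} (hε : 0 < ε) {i m : ℕ} (him : i + 1 ≤ m)
    {g : L2 (Idx d)} (hg : IsSymm g) : Supported (i + 1) m (solOp w ε i m g) := by
  rw [solOp_eqn hd w hε]
  exact ((supported_rawGen w hε (i + 1) m _).add
    ((supported_rawSrc w hε i hg).mono le_rfl him)).invSqrt

lemma isSymm_solOp (hd : 3 ≤ d) (w : Fin d → ℝ) {ε : ℝ} (hε : 0 < ε) (i m : ℕ)
    (g : L2 (Idx d)) : IsSymm (solOp w ε i m g) := by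
  rw [solOp_eqn hd w hε]
  exact isSymm_invSqrt (isSymm_add (isSymm_rawGen w ε (i + 1) m _) (isSymm_symF _))

/-- Undoing the normalisation, `E^{-1/2} u` solves the original equation, at every index. -/
lemma energy_mul_invSqrt_solOp (hd : 3 ≤ d) (w : Fin d → ℝ) {ε : ℝ} (hε : 0 < ε) {i m : ℕ}
    (him : i + 1 ≤ m) {g : L2 (Idx d)} (hg : IsSymm g) (x : Idx d) :
    (energy x.2 : ℂ) * invSqrtOp d (solOp w ε i m g) x =
      (rawGen w ε (i + 1) m (invSqrtOp d (solOp w ε i m g)) + rawSrc w ε i g) x := by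
  by_cases hx : energy x.2 = 0
  · have h1 : Supported (i + 1) m (rawGen w ε (i + 1) m (invSqrtOp d (solOp w ε i m g)) +
        rawSrc w ε i g : L2 (Idx d)) := (supported_rawGen w hε (i + 1) m _).add
      ((supported_rawSrc w hε i hg).mono le_rfl him)
    rw [h1.zero_of_energy (Nat.succ_pos i) hx, hx]; simp
  · have hE : 0 < energy x.2 := lt_of_le_of_ne (energy_nonneg _) (Ne.symm hx)
    have h := congrArg (fun u : L2 (Idx d) => u x) (solOp_eqn hd w hε i m g)
    simp only at h
    rw [invSqrtOp_apply, h, invSqrtOp_apply, ← mul_assoc, ← mul_assoc, ← Complex.ofReal_mul,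
      ← Complex.ofReal_mul, mul_assoc, ← mul_inv, Real.mul_self_sqrt hE.le,
      mul_inv_cancel₀ hE.ne', Complex.ofReal_one, one_mul]

/-- An element of the Fock space that satisfies the truncated generator equation automatically has
finite energy, and is the resolvent of the source. -/
lemma eq_invSqrt_solOp (hd : 3 ≤ d) (w : Fin d → ℝ) {ε : ℝ} (hε : 0 < ε) {i m : ℕ}
    {g x : L2 (Idx d)} (hx : Supported (i + 1) m x)
    (h : ∀ k, (energy k.2 : ℂ) * x k = (rawGen w ε (i + 1) m x + rawSrc w ε i g) k) :
    x = invSqrtOp d (solOp w ε i m g) := by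
  set y := rawGen w ε (i + 1) m x + rawSrc w ε i g
  have hu : invSqrtOp d (invSqrtOp d y) = x := by
    ext k
    rw [invSqrtOp_apply, invSqrtOp_apply, ← h, ← mul_assoc, ← mul_assoc, ← Complex.ofReal_mul,
      ← Complex.ofReal_mul]
    by_cases hk : energy k.2 = 0
    · rw [hx.zero_of_energy (Nat.succ_pos i) hk, mul_zero]
    · have hE : 0 < energy k.2 := lt_of_le_of_ne (energy_nonneg _) (Ne.symm hk)
      rw [← mul_inv, Real.mul_self_sqrt hE.le, inv_mul_cancel₀ hE.ne', Complex.ofReal_one, one_mul]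
  have h1 : invSqrtOp d y = solOp w ε i m g := by
    refine eq_resolvent (adjoint_genOp w ε (i + 1) m) ?_
    rw [genOp_eq hd w hε, hu, ← map_sub]
    congr 1
    simp [y]
  rw [← h1, hu]

/-- The truncated generator equation for a general source in chaos `i`. -/
structure IsSol (w : Fin d → ℝ) (ε : ℝ) (i m : ℕ) (f v : Kernels d) : Prop where
  isFock : IsFock v
  proj_eq : proj (i + 1) m v = v
  eqn : -truncGen w ε (i + 1) m v = Aplus w ε f

lemma supported_coordF {lo hi : ℕ} {v : Kernels d} (hv : proj lo hi v = v)
    (hz : ∀ (n : ℕ) (k : Fin n → Freq d), (∃ j, k j = 0) → v n k = 0) :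
    Supported lo hi (coordF v) := by
  rintro ⟨n, k⟩ hx
  rw [coordF_eq_zero_iff]
  simp only at hx
  obtain h | h | h := hx
  · rw [← hv, proj, if_neg (by omega)]; rfl
  · rw [← hv, proj, if_neg (by omega)]; rfl
  · exact hz n k h

lemma coordF_rawGen (w : Fin d → ℝ) {ε : ℝ} (hε : 0 < ε) {lo hi : ℕ} {v : Kernels d}
    (hs : ∀ (n : ℕ) (σ : Equiv.Perm (Fin n)) (k : Fin n → Freq d), v n (k ∘ σ) = v n k)
    (hz : ∀ (n : ℕ) (k : Fin n → Freq d), (∃ j, k j = 0) → v n k = 0)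
    (hv : proj lo hi v = v) {x : L2 (Idx d)} (hx : ⇑x = coordF v) (k : Idx d) :
    rawGen w ε lo hi x k = coordF (proj lo hi (Aplus w ε v + Aminus w ε v)) k := by
  obtain ⟨n, k⟩ := k
  have hxs : symOp x = x := symOp_of_isSymm (by rw [hx]; exact isSymm_coordF hs)
  rw [rawGen_apply, lp.coeFn_sub, Pi.sub_apply, symOp_rawOp_apply w hε, symOp_rawAnn_apply w hε,
    hxs, hx, coordF_Aplus w ε lo hi hs hz, coordF_Aminus w ε lo hi hs hz]
  have hp : Aplus w ε v n k ≠ 0 → lo + 1 ≤ n ∧ n ≤ hi + 1 := by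
    intro h
    match n, k, h with
    | 0, k, h => exact absurd rfl h
    | 1, k, h => exact absurd rfl h
    | n + 2, k, h =>
      by_contra hn
      apply h
      have h0 : v (n + 1) = 0 := by
        rw [← hv, proj, if_neg (by omega)]
      simp [Aplus, h0]
  have hm : Aminus w ε v n k ≠ 0 → lo ≤ n + 1 ∧ n + 1 ≤ hi := by
    intro h
    match n, k, h with
    | 0, k, h => exact absurd rfl h
    | n + 1, k, h =>
      by_contra hn
      apply h
      have h0 : v (n + 2) = 0 := by
        rw [← hv, proj, if_neg (by omega)]
      simp [Aminus, h0]
  by_cases hn : lo ≤ n ∧ n ≤ hi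
  · have e : coordF (proj lo hi (Aplus w ε v + Aminus w ε v)) ⟨n, k⟩ =
        coordF (Aplus w ε v) ⟨n, k⟩ + coordF (Aminus w ε v) ⟨n, k⟩ := by
      rw [← coordF_add]
      simp only [coordF, proj, if_pos hn]
    rw [e]
    have e1 : (if lo + 1 ≤ n ∧ n ≤ hi then coordF (Aplus w ε v) ⟨n, k⟩ else 0) =
        coordF (Aplus w ε v) ⟨n, k⟩ := by
      split_ifs with h'
      · rfl
      · refine (coordF_eq_zero_iff.2 ?_).symm
        by_contra h0
        have := hp h0
        omega
    have e2 : (if lo ≤ n ∧ n + 1 ≤ hi then -coordF (Aminus w ε v) ⟨n, k⟩ else 0) =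
        -coordF (Aminus w ε v) ⟨n, k⟩ := by
      split_ifs with h'
      · rfl
      · rw [coordF_eq_zero_iff.2, neg_zero]
        by_contra h0
        have := hm h0
        omega
    rw [e1, e2, sub_neg_eq_add]
  · have e : coordF (proj lo hi (Aplus w ε v + Aminus w ε v)) ⟨n, k⟩ = 0 := by
      simp only [coordF, proj, if_neg hn, Pi.zero_apply, mul_zero]
    rw [e, if_neg (by omega), if_neg (by omega), sub_zero]

lemma coordF_rawSrc (w : Fin d → ℝ) {ε : ℝ} (hε : 0 < ε) {i : ℕ} {f : Kernels d}
    (hs : ∀ (n : ℕ) (σ : Equiv.Perm (Fin n)) (k : Fin n → Freq d), f n (k ∘ σ) = f n k)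
    (hz : ∀ (n : ℕ) (k : Fin n → Freq d), (∃ j, k j = 0) → f n k = 0)
    (hf : ∀ n, n ≠ i → f n = 0) {g : L2 (Idx d)} (hg : ⇑g = coordF f) (k : Idx d) :
    rawSrc w ε i g k = coordF (Aplus w ε f) k := by
  obtain ⟨n, k⟩ := k
  rw [rawSrc, symOp_rawOp_apply w hε, hg, coordF_Aplus w ε i (i + 1) hs hz]
  split_ifs with h
  · rfl
  · refine (coordF_eq_zero_iff.2 ?_).symm
    match n, k, h with
    | 0, k, h => rfl
    | 1, k, h => rfl
    | n + 2, k, h =>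
      have h0 : f (n + 1) = 0 := hf _ (by omega)
      simp [Aplus, h0]

lemma coordF_truncGen (w : Fin d → ℝ) {ε : ℝ} {lo hi : ℕ} {v : Kernels d}
    (hv : proj lo hi v = v) (k : Idx d) :
    coordF (-truncGen w ε lo hi v) k = (energy k.2 : ℂ) * coordF v k -
      coordF (proj lo hi (Aplus w ε v + Aminus w ε v)) k := by
  obtain ⟨n, k⟩ := k
  simp only [truncGen, hv, coordF, Pi.neg_apply, Pi.add_apply, L0, energy]
  push_cast
  ring

/-- The truncated equation has exactly one solution, and in coordinates it is the resolvent applied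
to the normalised source. -/
lemma isSol_iff (hd : 3 ≤ d) (w : Fin d → ℝ) {ε : ℝ} (hε : 0 < ε) {i m : ℕ} (him : i + 1 ≤ m)
    {f : Kernels d}
    (hs : ∀ (n : ℕ) (σ : Equiv.Perm (Fin n)) (k : Fin n → Freq d), f n (k ∘ σ) = f n k)
    (hz : ∀ (n : ℕ) (k : Fin n → Freq d), (∃ j, k j = 0) → f n k = 0)
    (hf : ∀ n, n ≠ i → f n = 0) {g : L2 (Idx d)} (hg : ⇑g = coordF f) (v : Kernels d) :
    IsSol w ε i m f v ↔ coordF v = invSqrtOp d (solOp w ε i m g) := by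
  have hgs : IsSymm g := by rw [hg]; exact isSymm_coordF hs
  constructor
  · rintro ⟨⟨h1, h2, h3⟩, h4, h5⟩
    obtain ⟨x, hx⟩ := exists_coord h3
    have hx : ⇑x = coordF v := funext hx
    rw [← hx]
    congr 1
    refine eq_invSqrt_solOp hd w hε (by rw [hx]; exact supported_coordF h4 h2) fun k => ?_
    have h6 : coordF (-truncGen w ε (i + 1) m v) k = coordF (Aplus w ε f) k := by rw [h5]
    rw [coordF_truncGen w h4] at h6
    rw [lp.coeFn_add, Pi.add_apply, coordF_rawGen w hε h1 h2 h4 hx, coordF_rawSrc w hε hs hz hf hg,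
      ← h6, hx]
    ring
  · intro hv
    have hsup := (supported_solOp hd w hε him hgs).invSqrt
    have hsym := isSymm_invSqrt (isSymm_solOp hd w hε i m g)
    rw [← hv] at hsup hsym
    have h1 : ∀ (n : ℕ) (σ : Equiv.Perm (Fin n)) (k : Fin n → Freq d), v n (k ∘ σ) = v n k :=
      fun n σ k => mul_left_cancel₀ (coord_ne_zero n) (hsym n σ k)
    have h2 : ∀ (n : ℕ) (k : Fin n → Freq d), (∃ j, k j = 0) → v n k = 0 := fun n k h =>
      coordF_eq_zero_iff.1 (hsup ⟨n, k⟩ (Or.inr (Or.inr h)))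
    have h4 : proj (i + 1) m v = v := by
      ext n k
      unfold proj
      split_ifs with h
      · rfl
      · refine (coordF_eq_zero_iff.1 (hsup ⟨n, k⟩ ?_)).symm
        rcases Nat.lt_or_ge n (i + 1) with h' | h'
        · exact Or.inl h'
        · exact Or.inr (Or.inl (show m < n by omega))
    refine ⟨⟨h1, h2, ?_⟩, h4, ?_⟩
    · rw [fockNorm_ne_top_iff, hv]
      exact sqENorm_ne_top _
    · refine coordF_injective (funext fun k => ?_)
      have h6 := energy_mul_invSqrt_solOp hd w hε him hgs k
      rw [lp.coeFn_add, Pi.add_apply, coordF_rawGen w hε h1 h2 h4 hv.symm,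
        coordF_rawSrc w hε hs hz hf hg, ← hv] at h6
      rw [coordF_truncGen w h4, h6]
      ring

end Solutions

section Effective

variable {d : ℕ}

/-! ### The effective operator and its limit in the first chaos -/

/-- The normalised solution as a function of the normalised source. -/
def resOp (w : Fin d → ℝ) (ε : ℝ) (i m : ℕ) : L2 (Idx d) →L[ℂ] L2 (Idx d) :=
  resolvent (genOp w ε (i + 1) m) ∘L symOp ∘L creOp w ε i (i + 1)

/-- The composition of creation, resolvent and annihilation, an effective operator in chaos `i`. -/
def effOp (w : Fin d → ℝ) (ε : ℝ) (i m : ℕ) : L2 (Idx d) →L[ℂ] L2 (Idx d) :=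
  symOp ∘L annOp w ε i (i + 1) ∘L resOp w ε i m

/-- The symbol of `𝓛₀^w 𝓛₀^{-1}`. -/
def wSymbol (w : Fin d → ℝ) {n : ℕ} (k : Fin n → Freq d) : ℝ :=
  1 / 2 * (∑ j, dot w (k j) ^ 2) / energy k

lemma wSymbol_nonneg (w : Fin d → ℝ) {n : ℕ} (k : Fin n → Freq d) : 0 ≤ wSymbol w k := by
  have := energy_nonneg k
  unfold wSymbol; positivity

lemma wSymbol_le (w : Fin d → ℝ) {n : ℕ} (k : Fin n → Freq d) : wSymbol w k ≤ wSq w := by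
  unfold wSymbol
  refine div_le_of_le_mul₀ (energy_nonneg k) (wSq_nonneg w) ?_
  unfold energy normSq
  have : ∑ j, dot w (k j) ^ 2 ≤ wSq w * ∑ j, ∑ a, ((k j a : ℤ) : ℝ) ^ 2 := by
    rw [Finset.mul_sum]
    exact Finset.sum_le_sum fun j _ => Finset.sum_mul_sq_le_sq_mul_sq _ _ _
  linarith

/-- Multiplication by the symbol of `𝓛₀^w 𝓛₀^{-1}`. -/
def wSymbolOp (w : Fin d → ℝ) : L2 (Idx d) →L[ℂ] L2 (Idx d) :=
  wcomp (fun x => ((wSymbol w x.2 : ℝ) : ℂ)) id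

lemma fiberBound_wSymbol (w : Fin d → ℝ) :
    FiberBound (fun x : Idx d => ((wSymbol w x.2 : ℝ) : ℂ)) id (wSq w) :=
  fiberBound_diag (wSq_nonneg w) fun x => by
    rw [Complex.norm_real, Real.norm_eq_abs, abs_of_nonneg (wSymbol_nonneg _ _)]
    exact wSymbol_le _ _

lemma wSymbolOp_apply (w : Fin d → ℝ) (f : L2 (Idx d)) (x : Idx d) :
    wSymbolOp w f x = ((wSymbol w x.2 : ℝ) : ℂ) * f x := wcomp_apply (fiberBound_wSymbol w) f x

/-- The difference between the effective operator and its limit. -/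
def defectOp (w : Fin d → ℝ) (D : ℝ) (ε : ℝ) (i m : ℕ) : L2 (Idx d) →L[ℂ] L2 (Idx d) :=
  effOp w ε i m - (D : ℂ) • wSymbolOp w

lemma norm_resOp_le (hd : 3 ≤ d) (w : Fin d → ℝ) {ε : ℝ} (hε : 0 < ε) (i m : ℕ) :
    ‖resOp w ε i m‖ ≤ creBound w (i + 1) := by
  refine ContinuousLinearMap.opNorm_le_bound _ (Real.sqrt_nonneg _) fun f => ?_
  simp only [resOp, ContinuousLinearMap.comp_apply]
  refine (norm_resolvent_apply_le (adjoint_genOp w ε (i + 1) m) _).trans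
    ((norm_symOp_apply_le _).trans (((creOp w ε i (i + 1)).le_opNorm f).trans ?_))
  gcongr
  exact norm_creOp_le hd w hε i (i + 1)

lemma norm_effOp_le (hd : 3 ≤ d) (w : Fin d → ℝ) {ε : ℝ} (hε : 0 < ε) (i m : ℕ) :
    ‖effOp w ε i m‖ ≤ creBound w (i + 1) * creBound w (i + 1) := by
  have h0 : 0 ≤ creBound w (i + 1) := Real.sqrt_nonneg _
  refine ContinuousLinearMap.opNorm_le_bound _ (by positivity) fun f => ?_
  simp only [effOp, ContinuousLinearMap.comp_apply]
  refine (norm_symOp_apply_le _).trans (((annOp w ε i (i + 1)).le_opNorm _).trans ?_)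
  rw [mul_assoc]
  gcongr
  · exact norm_annOp_le hd w hε i (i + 1)
  · refine ((resOp w ε i m).le_opNorm f).trans ?_
    gcongr
    exact norm_resOp_le hd w hε i m

lemma norm_defectOp_le (hd : 3 ≤ d) (w : Fin d → ℝ) (D : ℝ) {ε : ℝ} (hε : 0 < ε) (i m : ℕ) :
    ‖defectOp w D ε i m‖ ≤ creBound w (i + 1) * creBound w (i + 1) + |D| * wSq w := by
  refine (norm_sub_le _ _).trans ?_
  rw [norm_smul, Complex.norm_real, Real.norm_eq_abs]
  gcongr
  · exact norm_effOp_le hd w hε i m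
  · exact norm_wcomp_le (fiberBound_wSymbol w)

open Classical in
/-- Convergence to zero on symmetrised basis vectors extends to all symmetric vectors. -/
lemma tendsto_zero_of_basis {Y : ℝ → L2 (Idx d) →L[ℂ] L2 (Idx d)} {C : ℝ}
    (hY : ∀ ε ∈ scales, ‖Y ε‖ ≤ C) {i : ℕ}
    (hb : ∀ k : Fin i → Freq d, (∀ j, k j ≠ 0) →
      Tendsto (fun ε => ‖Y ε (symOp (lp.single 2 ⟨i, k⟩ (1 : ℂ)))‖) (𝓝[scales] 0) (𝓝 0))
    {g : L2 (Idx d)} (hs : IsSymm g) (hg : Supported i i g) :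
    Tendsto (fun ε => ‖Y ε g‖) (𝓝[scales] 0) (𝓝 0) := by
  have h1 : HasSum (fun x : Idx d => symOp (lp.single 2 x (g x))) g := by
    have := (lp.hasSum_single (p := 2) (by norm_num) g).mapL
      (symOp : L2 (Idx d) →L[ℂ] L2 (Idx d))
    rwa [symOp_of_isSymm hs] at this
  -- The uniform bound on the operators allows a term-by-term passage to the limit.
  refine tendsto_zero_of_hasSum Y (C := C) ?_ h1 fun x => ?_
  · filter_upwards [eventually_scales] with ε hε using hY ε hε
  have e : (lp.single 2 x (g x) : L2 (Idx d)) = g x • lp.single 2 x (1 : ℂ) := by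
    rw [← lp.single_smul, smul_eq_mul, mul_one]
  by_cases hx : g x = 0
  · rw [e, hx]; simp
  · have h2 : x.1 = i ∧ ∀ j, x.2 j ≠ 0 := by
      by_contra hne
      refine hx (hg x ?_)
      by_contra hn
      push Not at hn
      exact hne ⟨by omega, hn.2.2⟩
    obtain ⟨n, k⟩ := x
    obtain ⟨rfl, h3⟩ := h2
    have := (hb k h3).const_mul ‖g ⟨n, k⟩‖
    rw [mul_zero] at this
    refine this.congr fun ε => ?_
    rw [e, map_smul, map_smul, norm_smul]

/-- The ratio of the coefficient of `𝒜_+` at momentum `K` to the source `src`. -/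
def srcFactor (w : Fin d → ℝ) (K : Freq d) : ℝ :=
  dot w K / (√2 * √(energy fun _ : Fin 1 => K))

lemma energy_one_pos {K : Freq d} (hK : K ≠ 0) : 0 < energy fun _ : Fin 1 => K :=
  energy_pos (j := (0 : Fin 1)) hK

lemma srcFactor_sq (w : Fin d → ℝ) (K : Freq d) :
    srcFactor w K ^ 2 = wSymbol w fun _ : Fin 1 => K := by
  unfold srcFactor wSymbol
  rw [div_pow, mul_pow, Real.sq_sqrt zero_le_two, Real.sq_sqrt (energy_nonneg _)]
  simp only [Finset.univ_unique, Finset.sum_const, Finset.card_singleton, one_smul]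
  rw [div_mul_eq_div_div]
  ring

open Classical in
/-- The basis vector of momentum `K` in the first chaos. -/
def deltaOne (K : Freq d) : L2 (Idx d) := lp.single 2 ⟨1, fun _ => K⟩ (1 : ℂ)

open Classical in
lemma deltaOne_apply (K : Freq d) (x : Idx d) :
    deltaOne K x = if x = ⟨1, fun _ => K⟩ then 1 else 0 := by
  unfold deltaOne
  split_ifs with h
  · subst h; simp
  · rw [lp.single_apply_ne _ _ _ h]

lemma merge_two (k : Fin 2 → Freq d) : merge k = fun _ : Fin 1 => tot k := by
  ext1 j
  obtain rfl : j = 0 := Fin.fin_one_eq_zero j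
  rw [merge_zero, tot, Fin.sum_univ_two]

lemma creOp_deltaOne (hd : 3 ≤ d) (w : Fin d → ℝ) {ε : ℝ} (hε : 0 < ε) (K : Freq d) :
    creOp w ε 1 2 (deltaOne K) = (srcFactor w K : ℂ) • src ε K := by
  classical
  ext x
  rw [creOp_apply hd w hε, deltaOne_apply, lp.coeFn_smul, Pi.smul_apply, src_coe hd hε,
    smul_eq_mul]
  match x with
  | ⟨0, k⟩ => simp [creW, srcF]
  | ⟨1, k⟩ => simp [creW, srcF]
  | ⟨2, k⟩ =>
    have e0 : mergeI (⟨2, k⟩ : Idx d) = ⟨1, fun _ => tot k⟩ := by rw [← merge_two]; rfl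
    rw [e0]
    by_cases hK : tot k = K
    · rw [hK, if_pos rfl, mul_one]
      simp only [srcF, creW]
      rw [if_pos hK]
      by_cases hc : cutoff ε (k 0) (k 1) = 0
      · simp [creWeight, hc]
      · obtain ⟨⟨h0, h1, -⟩, -⟩ := of_cutoff_ne_zero hε hc
        have hk : ∀ a : Fin 2, k a ≠ 0 := fun a => by fin_cases a <;> assumption
        rw [if_pos ⟨by omega, hk⟩, ← Complex.ofReal_mul]
        congr 1
        have e : k 0 + k 1 = K := by rw [← hK, tot, Fin.sum_univ_two]
        have h2 : √(2 : ℝ) ^ 2 = 2 := Real.sq_sqrt zero_le_two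
        have h3 : √(2 : ℝ) ≠ 0 := by positivity
        rw [creWeight, merge_two, hK, srcFactor, e]
        simp only [Nat.cast_zero, zero_add, mul_one]
        field_simp
        rw [h2]
        ring
    · rw [if_neg, mul_zero]
      · simp only [srcF]
        rw [if_neg hK, mul_zero]
      · intro h
        exact hK (congrFun (eq_of_heq (Sigma.mk.inj h).2) 0)
  | ⟨n + 3, k⟩ =>
    simp [creW, srcF]

lemma isSymm_src (hd : 3 ≤ d) {ε : ℝ} (hε : 0 < ε) (K : Freq d) : IsSymm (src ε K) := by
  intro n σ k
  rw [src_coe hd hε]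
  match n, σ, k with
  | 0, σ, k => simp [srcF]
  | 1, σ, k => simp [srcF]
  | 2, σ, k =>
    simp only [srcF, tot_perm, energy_perm, Function.comp]
    have : cutoff ε (k (σ 0)) (k (σ 1)) = cutoff ε (k 0) (k 1) := by
      have h01 : σ 0 ≠ σ 1 := fun h => by simpa using σ.injective h
      obtain h | h : σ 0 = 0 ∨ σ 0 = 1 := by omega
      · have : σ 1 = 1 := by omega
        rw [h, this]
      · have : σ 1 = 0 := by omega
        rw [h, this, cutoff_comm]
    rw [this]
  | n + 3, σ, k => simp [srcF]

/-- Annihilation into the first chaos, for vectors of total momentum `K`. -/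
lemma symOp_annOp_one (hd : 3 ≤ d) (w : Fin d → ℝ) {ε : ℝ} (hε : 0 < ε) {K : Freq d}
    {u : L2 (Idx d)} (hu : u ∈ realMomentum K) :
    symOp (annOp w ε 1 2 u) = ((srcFactor w K : ℂ) * inner ℂ (src ε K) u) • deltaOne K := by
  classical
  have h1 : annOp w ε 1 2 u = ((srcFactor w K : ℂ) * inner ℂ (src ε K) u) • deltaOne K := by
    ext x
    rw [lp.coeFn_smul, Pi.smul_apply, deltaOne_apply, smul_eq_mul]
    split_ifs with hx
    · rw [hx, ← inner_single, annOp, ContinuousLinearMap.adjoint_inner_right]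
      change inner ℂ (creOp w ε 1 2 (deltaOne K)) u = _
      rw [creOp_deltaOne hd w hε, inner_smul_left, Complex.conj_ofReal, mul_one]
    · rw [mul_zero]
      match x, hx with
      | ⟨0, k⟩, _ => exact annOp_zero hd w hε 1 2 u k
      | ⟨1, k⟩, hx =>
        refine (annOp_mem_realMomentum hd w hε 1 2 hu ⟨1, k⟩).2 fun h => hx ?_
        congr 1
        ext1 j
        obtain rfl : j = 0 := Fin.fin_one_eq_zero j
        rw [← h]; simp [tot]
      | ⟨n + 2, k⟩, _ =>
        rw [annOp_succ hd w hε]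
        simp [creW]
  rw [h1, map_smul]
  congr 1
  refine symOp_of_isSymm fun n σ k => ?_
  rw [deltaOne_apply, deltaOne_apply]
  match n, σ, k with
  | 0, σ, k => simp
  | 1, σ, k => rw [Subsingleton.elim σ 1]; rfl
  | n + 2, σ, k => simp

lemma symOp_deltaOne (K : Freq d) : symOp (deltaOne K) = deltaOne K := by
  classical
  refine symOp_of_isSymm fun n σ k => ?_
  rw [deltaOne_apply, deltaOne_apply]
  match n, σ, k with
  | 0, σ, k => simp
  | 1, σ, k => rw [Subsingleton.elim σ 1]; rfl
  | n + 2, σ, k => simp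

lemma resOp_deltaOne (hd : 3 ≤ d) (w : Fin d → ℝ) {ε : ℝ} (hε : 0 < ε) (m : ℕ) (K : Freq d) :
    resOp w ε 1 m (deltaOne K) = (srcFactor w K : ℂ) • resolvent (genOp w ε 2 m) (src ε K) := by
  simp only [resOp, ContinuousLinearMap.comp_apply]
  rw [creOp_deltaOne hd w hε, map_smul, map_smul, symOp_of_isSymm (isSymm_src hd hε K)]

/-- Momentum conservation: the effective operator is diagonal on the modes of the first chaos, and
its eigenvalue is a matrix element of the resolvent. -/
lemma effOp_deltaOne (hd : 3 ≤ d) (w : Fin d → ℝ) {ε : ℝ} (hε : 0 < ε) (m : ℕ) (K : Freq d) :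
    effOp w ε 1 m (deltaOne K) = (((wSymbol w fun _ : Fin 1 => K : ℝ) : ℂ) *
      inner ℂ (src ε K) (resolvent (genOp w ε 2 m) (src ε K))) • deltaOne K := by
  simp only [effOp, ContinuousLinearMap.comp_apply]
  rw [resOp_deltaOne hd w hε, map_smul, map_smul,
    symOp_annOp_one hd w hε (resolvent_src_mem hd w hε 2 m K), smul_smul, ← mul_assoc,
    ← srcFactor_sq]
  push_cast
  ring_nf

lemma wSymbolOp_deltaOne (w : Fin d → ℝ) (K : Freq d) :
    wSymbolOp w (deltaOne K) = ((wSymbol w fun _ : Fin 1 => K : ℝ) : ℂ) • deltaOne K := by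
  classical
  ext x
  rw [wSymbolOp_apply, lp.coeFn_smul, Pi.smul_apply, smul_eq_mul, deltaOne_apply]
  split_ifs with h
  · rw [h]
  · simp

/-- The matrix element of the resolvent that converges to the diffusivity. -/
def diffusivity (w : Fin d → ℝ) (ε : ℝ) (m : ℕ) (K : Freq d) : ℂ :=
  inner ℂ (src ε K) (resolvent (genOp w ε 2 m) (src ε K))

/-- The limit of the effective operator on all sources in the first chaos. -/
lemma tendsto_defectOp_one (hd : 3 ≤ d) (w : Fin d → ℝ) {D : ℝ} {m : ℕ}
    (hD : ∀ K : Freq d, K ≠ 0 → Tendsto (fun ε => diffusivity w ε m K) (𝓝[scales] 0) (𝓝 (D : ℂ)))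
    {g : L2 (Idx d)} (hs : IsSymm g) (hg : Supported 1 1 g) :
    Tendsto (fun ε => ‖defectOp w D ε 1 m g‖) (𝓝[scales] 0) (𝓝 0) := by
  classical
  refine tendsto_zero_of_basis (fun ε hε => norm_defectOp_le hd w D (scales_pos hε) 1 m)
    (fun k hk => ?_) hs hg
  have hk' : (lp.single 2 ⟨1, k⟩ (1 : ℂ) : L2 (Idx d)) = deltaOne (k 0) := by
    unfold deltaOne
    congr 2
    ext1 j
    obtain rfl : j = 0 := Fin.fin_one_eq_zero j
    rfl
  have h1 := ((hD (k 0) (hk 0)).sub_const (D : ℂ)).norm.const_mul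
    (wSymbol w (fun _ : Fin 1 => k 0) * ‖deltaOne (k 0)‖)
  rw [sub_self, norm_zero, mul_zero] at h1
  refine h1.congr' ?_
  filter_upwards [eventually_scales] with ε hε
  rw [hk', symOp_deltaOne, defectOp, sub_apply, smul_apply, wSymbolOp_deltaOne,
    effOp_deltaOne hd w (scales_pos hε), smul_smul, ← sub_smul, norm_smul, ← diffusivity,
    mul_comm (D : ℂ), ← mul_sub, norm_mul, Complex.norm_real, Real.norm_eq_abs,
    abs_of_nonneg (wSymbol_nonneg _ _)]
  ring

/-- The solution vanishes in the norm without the energy weight. -/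
lemma tendsto_invSqrt_resOp_deltaOne (hd : 3 ≤ d) (w : Fin d → ℝ) {m : ℕ} (hm : 2 ≤ m)
    {K : Freq d} (hK : K ≠ 0) :
    Tendsto (fun ε => ‖invSqrtOp d (resOp w ε 1 m (deltaOne K))‖) (𝓝[scales] 0) (𝓝 0) := by
  have h1 := (tendsto_invSqrt_resolvent_src hd w hm hK).const_mul ‖(srcFactor w K : ℂ)‖
  rw [mul_zero] at h1
  refine h1.congr' ?_
  filter_upwards [eventually_scales] with ε hε
  rw [resOp_deltaOne hd w (scales_pos hε), map_smul, norm_smul]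

lemma norm_invSqrt_resOp_le (hd : 3 ≤ d) (w : Fin d → ℝ) {ε : ℝ} (hε : 0 < ε) (i m : ℕ) :
    ‖invSqrtOp d ∘L resOp w ε i m‖ ≤ 2 * creBound w (i + 1) :=
  (ContinuousLinearMap.opNorm_comp_le _ _).trans
    (mul_le_mul norm_invSqrtOp_le (norm_resOp_le hd w hε i m) (norm_nonneg _) zero_le_two)

lemma tendsto_invSqrt_resOp_one (hd : 3 ≤ d) (w : Fin d → ℝ) {m : ℕ} (hm : 2 ≤ m)
    {g : L2 (Idx d)} (hs : IsSymm g) (hg : Supported 1 1 g) :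
    Tendsto (fun ε => ‖invSqrtOp d (resOp w ε 1 m g)‖) (𝓝[scales] 0) (𝓝 0) := by
  classical
  refine tendsto_zero_of_basis (Y := fun ε => invSqrtOp d ∘L resOp w ε 1 m)
    (fun ε hε => norm_invSqrt_resOp_le hd w (scales_pos hε) 1 m) (fun k hk => ?_) hs hg
  have hk' : (lp.single 2 ⟨1, k⟩ (1 : ℂ) : L2 (Idx d)) = deltaOne (k 0) := by
    unfold deltaOne
    congr 2
    ext1 j
    obtain rfl : j = 0 := Fin.fin_one_eq_zero j
    rfl
  rw [hk', symOp_deltaOne]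
  exact tendsto_invSqrt_resOp_deltaOne hd w hm (hk 0)

end Effective

section Transfer

variable {d : ℕ}

/-! ### From the Fock space to coordinates -/

/-- `f` is a symmetric element of chaos `i` without zero modes, and `g` are the coordinates of
`(-𝓛₀)^{1/2} f`. -/
structure IsSource (i : ℕ) (f : Kernels d) (g : L2 (Idx d)) : Prop where
  symm : ∀ (n : ℕ) (σ : Equiv.Perm (Fin n)) (k : Fin n → Freq d), f n (k ∘ σ) = f n k
  zero_mode : ∀ (n : ℕ) (k : Fin n → Freq d), (∃ j, k j = 0) → f n k = 0
  chaos : ∀ n, n ≠ i → f n = 0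
  coord : ∀ x, g x = ((√(energy x.2) : ℝ) : ℂ) * coordF f x

variable {i m : ℕ} {f : Kernels d} {g : L2 (Idx d)}

lemma IsSource.isSymm (h : IsSource i f g) : IsSymm g := fun n σ k => by
  rw [h.coord, h.coord, isSymm_coordF h.symm n σ k]
  simp only [energy_perm]

lemma IsSource.supported (h : IsSource i f g) : Supported i i g := by
  rintro ⟨n, k⟩ hx
  have : f n k = 0 := by
    by_cases hn : n = i
    · obtain h' | h' | h' := hx
      · exact absurd h' (by simp [hn])
      · exact absurd h' (by simp [hn])
      · exact h.zero_mode n k h'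
    · rw [h.chaos n hn]; rfl
  rw [h.coord, coordF_eq_zero_iff.2 this, mul_zero]

lemma IsSource.invSqrt (h : IsSource i f g) (hi : 0 < i) : ⇑(invSqrtOp d g) = coordF f := by
  ext x
  rw [invSqrtOp_apply, h.coord, ← mul_assoc, ← Complex.ofReal_mul]
  by_cases hx : energy x.2 = 0
  · have h0 : Supported i i (coordF f) := by
      rintro ⟨n, k⟩ hx
      refine coordF_eq_zero_iff.2 ?_
      by_cases hn : n = i
      · obtain h' | h' | h' := hx
        · exact absurd h' (by simp [hn])
        · exact absurd h' (by simp [hn])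
        · exact h.zero_mode n k h'
      · rw [h.chaos n hn]; rfl
    rw [h0.zero_of_energy hi hx, mul_zero]
  · have hE : 0 < √(energy x.2) :=
      Real.sqrt_pos.2 (lt_of_le_of_ne (energy_nonneg _) (Ne.symm hx))
    rw [inv_mul_cancel₀ hE.ne', Complex.ofReal_one, one_mul]

lemma solOp_invSqrt (hd : 3 ≤ d) (w : Fin d → ℝ) {ε : ℝ} (hε : 0 < ε) (i m : ℕ) (g : L2 (Idx d)) :
    solOp w ε i m (invSqrtOp d g) = resOp w ε i m g := by
  simp only [solOp, resOp, ContinuousLinearMap.comp_apply, rawSrc, creOp_eq hd w hε,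
    symOp_invSqrt]

lemma IsSource.isSol_iff (hd : 3 ≤ d) (w : Fin d → ℝ) {ε : ℝ} (hε : 0 < ε) (hi : 0 < i)
    (him : i + 1 ≤ m) (h : IsSource i f g) (v : Kernels d) :
    IsSol w ε i m f v ↔ coordF v = invSqrtOp d (resOp w ε i m g) := by
  rw [BurgersFock.isSol_iff hd w hε him h.symm h.zero_mode h.chaos (h.invSqrt hi),
    solOp_invSqrt hd w hε]

lemma IsSource.existsUnique (hd : 3 ≤ d) (w : Fin d → ℝ) {ε : ℝ} (hε : 0 < ε) (hi : 0 < i)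
    (him : i + 1 ≤ m) (h : IsSource i f g) : ∃! v, IsSol w ε i m f v := by
  obtain ⟨v, hv⟩ := coordF_surjective (d := d) (invSqrtOp d (resOp w ε i m g))
  refine ⟨v, (h.isSol_iff hd w hε hi him v).2 hv, fun v' hv' => coordF_injective ?_⟩
  rw [hv, (h.isSol_iff hd w hε hi him v').1 hv']

lemma IsSource.fockNorm_sol (hd : 3 ≤ d) (w : Fin d → ℝ) {ε : ℝ} (hε : 0 < ε) (hi : 0 < i)
    (him : i + 1 ≤ m) (h : IsSource i f g) {v : Kernels d} (hv : IsSol w ε i m f v) :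
    fockNorm v = ENNReal.ofReal ‖invSqrtOp d (resOp w ε i m g)‖ :=
  fockNorm_eq_norm fun x => by rw [(h.isSol_iff hd w hε hi him v).1 hv]

lemma rpow_neg_half (t : ℝ) (ht : 0 ≤ t) : t ^ (-(1 / 2) : ℝ) = (√t)⁻¹ := by
  rw [Real.rpow_neg ht, Real.sqrt_eq_rpow]

lemma Aminus_component (w : Fin d → ℝ) (ε : ℝ) (i : ℕ) (v : Kernels d) (n : ℕ)
    (k : Fin n → Freq d) :
    Aminus w ε (component i v) n k = if n + 1 = i then Aminus w ε v n k else 0 := by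
  match n, k with
  | 0, k => simp [Aminus]
  | n + 1, k =>
    split_ifs with h
    · subst h; simp [Aminus, component]
    · have : component i v (n + 2) = 0 := by
        unfold component
        rw [Pi.single_eq_of_ne h]
      simp [Aminus, this]

/-- The quantity that has to tend to zero is the norm of `defectOp` applied to the coordinates of
the seed. -/
lemma IsSource.fockNorm_defect (hd : 3 ≤ d) (w : Fin d → ℝ) {ε : ℝ} (hε : 0 < ε) (hi : 0 < i)
    (him : i + 1 ≤ m) (h : IsSource i f g) {v : Kernels d} (hv : IsSol w ε i m f v) (c : ℝ) :
    fockNorm (negL0Pow (-(1 / 2)) (Aminus w ε (component (i + 1) v) - c • L0w w f)) =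
      ENNReal.ofReal ‖defectOp w c ε i m g‖ := by
  refine fockNorm_eq_norm fun x => ?_
  rw [← norm_neg]
  congr 1
  have hvc := (h.isSol_iff hd w hε hi him v).1 hv
  have hsym : symOp (invSqrtOp d (resOp w ε i m g)) = invSqrtOp d (resOp w ε i m g) :=
    symOp_of_isSymm (by rw [← hvc]; exact isSymm_coordF hv.isFock.symm)
  have h1 : effOp w ε i m g x = (((√(energy x.2))⁻¹ : ℝ) : ℂ) *
      (if i ≤ x.1 ∧ x.1 + 1 ≤ i + 1 then -coordF (Aminus w ε v) ⟨x.1, x.2⟩ else 0) := by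
    simp only [effOp, ContinuousLinearMap.comp_apply]
    rw [annOp_eq hd w hε]
    simp only [ContinuousLinearMap.comp_apply]
    rw [symOp_invSqrt, invSqrtOp_apply, symOp_rawAnn_apply w hε, ← hvc]
    congr 1
    exact coordF_Aminus w ε i (i + 1) hv.isFock.symm hv.isFock.zero_mode x.1 x.2
  rw [defectOp, sub_apply, lp.coeFn_sub, Pi.sub_apply, h1, smul_apply, lp.coeFn_smul, Pi.smul_apply,
    wSymbolOp_apply, h.coord, smul_eq_mul]
  obtain ⟨n, k⟩ := x
  have h2 : (negL0Pow (-(1 / 2)) (Aminus w ε (component (i + 1) v) - c • L0w w f)) n k =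
      (((√(energy k))⁻¹ : ℝ) : ℂ) * ((if i ≤ n ∧ n + 1 ≤ i + 1 then Aminus w ε v n k else 0) +
        (c : ℂ) * ((energy k * wSymbol w k : ℝ) : ℂ) * f n k) := by
    have e1 : energy k * wSymbol w k = 1 / 2 * ∑ j, dot w (k j) ^ 2 := by
      unfold wSymbol
      by_cases hE : energy k = 0
      · have : ∀ j, k j = 0 := fun j => by
          by_contra hj
          exact (energy_pos hj).ne' hE
        simp [this, dot_zero]
      · rw [mul_div_cancel₀ _ hE]
    have e2 : (n + 1 = i + 1) ↔ (i ≤ n ∧ n + 1 ≤ i + 1) := by omega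
    have e3 : (1 / 2 * normSq k) ^ (-(1 / 2) : ℝ) = (√(energy k))⁻¹ :=
      rpow_neg_half _ (energy_nonneg k)
    simp only [negL0Pow, Pi.sub_apply, Pi.smul_apply, L0w, Aminus_component, e3, e1, e2,
      Complex.real_smul]
    push_cast
    ring
  simp only [coordF, h2]
  have h3 : (((√(energy k))⁻¹ : ℝ) : ℂ) * ((energy k : ℝ) : ℂ) = ((√(energy k) : ℝ) : ℂ) := by
    rw [← Complex.ofReal_mul]
    congr 1
    by_cases hE : √(energy k) = 0
    · rw [hE]; simp
    · rw [inv_mul_eq_iff_eq_mul₀ hE, Real.mul_self_sqrt (energy_nonneg k)]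
  rw [← h3]
  split_ifs
  · push_cast; ring
  · push_cast; ring

end Transfer

section Spectator

variable {d : ℕ}

/-! ### Attaching a spectator particle -/

/-- The index of the configuration with an additional particle of momentum `q`. -/
def attIdx (q : Freq d) (x : Idx d) : Idx d := ⟨x.1 + 1, Fin.cons q x.2⟩

/-- The weight of the removal of a particle, cut off above chaos `M`. -/
def delW (d M : ℕ) (x : Idx d) : ℂ := if x.1 ≤ M then ((√((x.1 : ℝ) + 1) : ℝ) : ℂ) else 0

open Classical in
/-- The left inverse of `attIdx q`; where there is no particle of momentum `q` in front, it takes a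
value at which `delW` vanishes. -/
def detIdx (q : Freq d) (M : ℕ) : Idx d → Unit → Idx d
  | ⟨n + 1, k⟩, _ => if k 0 = q then ⟨n, fun a => k a.succ⟩ else ⟨M + 1, 0⟩
  | ⟨0, _⟩, _ => ⟨M + 1, 0⟩

lemma detIdx_attIdx (q : Freq d) (M : ℕ) (x : Idx d) : detIdx q M (attIdx q x) () = x := by
  simp [detIdx, attIdx]

lemma attIdx_detIdx {q : Freq d} {M : ℕ} {y : Idx d} (l : Unit)
    (h : delW d M (detIdx q M y l) ≠ 0) :
    attIdx q (detIdx q M y l) = y := by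
  have hM : delW d M ⟨M + 1, 0⟩ = 0 := by simp [delW]
  match y, h with
  | ⟨0, k⟩, h => exact absurd hM h
  | ⟨n + 1, k⟩, h =>
    simp only [detIdx] at h ⊢
    split_ifs at h ⊢ with h'
    · simp only [attIdx]
      congr 1
      rw [← h']
      exact Fin.cons_self_tail k
    · exact absurd hM h

lemma norm_delW_sq_le (M : ℕ) (x : Idx d) : ‖delW d M x‖ ^ 2 ≤ M + 1 := by
  unfold delW
  split_ifs with h
  · rw [Complex.norm_real, Real.norm_eq_abs, sq_abs, Real.sq_sqrt (by positivity)]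
    gcongr
  · rw [norm_zero, zero_pow two_ne_zero]; positivity

lemma enorm_sq_le_ofReal {z : ℂ} {C : ℝ} (h : ‖z‖ ^ 2 ≤ C) : ‖z‖ₑ ^ 2 ≤ ENNReal.ofReal C := by
  rw [← ofReal_norm, ← ENNReal.ofReal_pow (norm_nonneg _)]
  exact ENNReal.ofReal_le_ofReal h

lemma fiberBound_delW (q : Freq d) (M : ℕ) : FiberBound (delW d M) (attIdx q) (√((M : ℝ) + 1)) :=
  FiberBound.of_param (Real.sqrt_nonneg _) (detIdx q M) (fun x _ => ⟨(), detIdx_attIdx q M x⟩)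
    fun y => by
      rw [tsum_fintype, Real.sq_sqrt (by positivity)]
      simpa using enorm_sq_le_ofReal (norm_delW_sq_le M (detIdx q M y ()))

/-- Removal of a particle of momentum `q`. -/
def delOp (q : Freq d) (M : ℕ) : L2 (Idx d) →L[ℂ] L2 (Idx d) := wcomp (delW d M) (attIdx q)

lemma delOp_apply (q : Freq d) (M : ℕ) (f : L2 (Idx d)) (x : Idx d) :
    delOp q M f x = delW d M x * f (attIdx q x) := wcomp_apply (fiberBound_delW q M) f x

lemma norm_delOp_le (q : Freq d) (M : ℕ) : ‖delOp q M‖ ≤ √((M : ℝ) + 1) :=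
  norm_wcomp_le (fiberBound_delW q M)

/-- The creation operator of a particle of momentum `q`. -/
def attOp (q : Freq d) (M : ℕ) : L2 (Idx d) →L[ℂ] L2 (Idx d) :=
  symOp ∘L ContinuousLinearMap.adjoint (delOp q M)

lemma norm_attOp_le (q : Freq d) (M : ℕ) : ‖attOp q M‖ ≤ √((M : ℝ) + 1) := by
  refine (norm_symOp_comp_le _).trans ?_
  rw [LinearIsometryEquiv.norm_map]
  exact norm_delOp_le q M

lemma star_delW (M : ℕ) (x : Idx d) : star (delW d M x) = delW d M x := by
  unfold delW
  split_ifs <;> simp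

open Classical in
lemma adjoint_delOp_succ (q : Freq d) (M : ℕ) (f : L2 (Idx d)) {n : ℕ} (k : Fin (n + 1) → Freq d) :
    ContinuousLinearMap.adjoint (delOp q M) f ⟨n + 1, k⟩ =
      if k 0 = q then delW d M ⟨n, fun a => k a.succ⟩ * f ⟨n, fun a => k a.succ⟩ else 0 := by
  rw [delOp, adjoint_wcomp_apply (fiberBound_delW q M) (detIdx q M)
    (fun x _ => ⟨(), detIdx_attIdx q M x⟩) (fun y l h => attIdx_detIdx l h)
    (fun y a b _ => rfl), tsum_fintype]
  simp only [Finset.univ_unique, Finset.sum_singleton, star_delW, detIdx]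
  split_ifs
  · rfl
  · simp [delW]

lemma adjoint_delOp_zero (q : Freq d) (M : ℕ) (f : L2 (Idx d)) (k : Fin 0 → Freq d) :
    ContinuousLinearMap.adjoint (delOp q M) f ⟨0, k⟩ = 0 := by
  rw [delOp, adjoint_wcomp_apply (fiberBound_delW q M) (detIdx q M)
    (fun x _ => ⟨(), detIdx_attIdx q M x⟩) (fun y l h => attIdx_detIdx l h)
    (fun y a b _ => rfl), tsum_fintype]
  simp [detIdx, delW]

/-- The energy is additive under attaching a particle. -/
lemma energy_attOp (q : Freq d) (M : ℕ) {x y : L2 (Idx d)}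
    (h : ∀ k, (energy k.2 : ℂ) * x k = y k) (k : Idx d) :
    (energy k.2 : ℂ) * attOp q M x k =
      attOp q M y k + ((energy fun _ : Fin 1 => q : ℝ) : ℂ) * attOp q M x k := by
  classical
  simp only [attOp, ContinuousLinearMap.comp_apply, symOp_apply]
  obtain ⟨n, k⟩ := k
  match n, k with
  | 0, k => simp [symF, avg, adjoint_delOp_zero]
  | n + 1, k =>
    simp only [symF]
    rw [← avg_const_mul, ← avg_const_mul, ← avg_add]
    unfold avg
    congr 1
    refine Finset.sum_congr rfl fun σ _ => ?_
    beta_reduce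
    rw [adjoint_delOp_succ, adjoint_delOp_succ]
    split_ifs with hq
    · rw [← h, ← energy_perm σ k, energy_eq_head (k ∘ σ), hq]
      have : energy (fun _ : Fin 1 => q) = 1 / 2 * ∑ a, ((q a : ℤ) : ℝ) ^ 2 := by
        simp [energy, normSq]
      rw [this]
      push_cast
      ring
    · simp

lemma attOp_of_energy_zero {q : Freq d} (hq : q ≠ 0) (M : ℕ) (x : L2 (Idx d)) {k : Idx d}
    (hk : energy k.2 = 0) : attOp q M x k = 0 := by
  classical
  simp only [attOp, ContinuousLinearMap.comp_apply, symOp_apply]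
  obtain ⟨n, k⟩ := k
  refine avg_eq_zero fun σ => ?_
  match n, k, σ, hk with
  | 0, k, σ, _ => exact adjoint_delOp_zero q M x _
  | n + 1, k, σ, hk =>
    rw [adjoint_delOp_succ, if_neg]
    rintro rfl
    have h1 : k (σ 0) ≠ 0 := hq
    exact (energy_pos h1).ne' hk

lemma isSymm_attOp (q : Freq d) (M : ℕ) (x : L2 (Idx d)) : IsSymm (attOp q M x) :=
  isSymm_symF _

lemma isSymm_delOp (q : Freq d) (M : ℕ) {h : L2 (Idx d)} (hh : IsSymm h) :
    IsSymm (delOp q M h) := fun n σ k => by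
  rw [delOp_apply, delOp_apply]
  simp only [delW, attIdx]
  rw [hh.cons q k σ]

/-! #### Splitting and merging with the spectator -/

/-- Removal of the first two particles. -/
def dropTwo : Idx d → Idx d
  | ⟨n + 2, k⟩ => ⟨n, fun a => k a.succ.succ⟩
  | x => x

/-- Adds two particles in front, of total momentum `q`. -/
def splitAtt (q : Freq d) (x : Idx d) (l : Freq d) : Idx d :=
  ⟨x.1 + 2, Fin.cons l (Fin.cons (q - l) x.2)⟩

open Classical in
/-- The weight of the creation of the two fragments of a particle of momentum `q`. -/
def splitW (w : Fin d → ℝ) (ε : ℝ) (q : Freq d) (lo hi : ℕ) : Idx d → ℂ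
  | ⟨n + 3, k⟩ => if ((lo ≤ n + 1 ∧ n + 2 ≤ hi) ∧ ∀ a : Fin (n + 1), k a.succ.succ ≠ 0) ∧
        k 0 + k 1 = q then
      ((c0 d * coupling d ε * √(n + 2) * √(n + 3) * dot w q * cutoff ε (k 0) (k 1) : ℝ) : ℂ) else 0
  | _ => 0

lemma dropTwo_splitAtt (q : Freq d) (x : Idx d) (l : Freq d) : dropTwo (splitAtt q x l) = x := by
  simp [dropTwo, splitAtt]

lemma splitAtt_injective (q : Freq d) (x : Idx d) : Function.Injective (splitAtt q x) :=
  fun l l' h => by simpa using congrFun (eq_of_heq (Sigma.mk.inj h).2) 0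

lemma splitAtt_dropTwo {w : Fin d → ℝ} {ε : ℝ} {q : Freq d} {lo hi : ℕ} (x : Idx d)
    (hx : splitW w ε q lo hi x ≠ 0) : ∃ l, splitAtt q (dropTwo x) l = x := by
  match x, hx with
  | ⟨0, k⟩, h => exact absurd rfl h
  | ⟨1, k⟩, h => exact absurd rfl h
  | ⟨2, k⟩, h => exact absurd rfl h
  | ⟨n + 3, k⟩, h =>
    simp only [splitW] at h
    split_ifs at h with hc
    · refine ⟨k 0, ?_⟩
      simp only [splitAtt, dropTwo]
      congr 1
      ext1 j
      refine Fin.cases ?_ (fun j => Fin.cases ?_ (fun j => ?_) j) j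
      · simp
      · change q - k 0 = k 1
        rw [← hc.2, add_sub_cancel_left]
      · simp
    · exact absurd rfl h

lemma norm_splitW_sq_le (w : Fin d → ℝ) (ε : ℝ) (q : Freq d) (lo hi : ℕ) (x : Idx d) :
    ‖splitW w ε q lo hi x‖ ^ 2 ≤ (c0 d * (hi + 1) * dot w q) ^ 2 * coupling d ε ^ 2 := by
  have hR : 0 ≤ (c0 d * (hi + 1) * dot w q) ^ 2 * coupling d ε ^ 2 := by positivity
  match x with
  | ⟨0, k⟩ => simpa [splitW] using hR
  | ⟨1, k⟩ => simpa [splitW] using hR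
  | ⟨2, k⟩ => simpa [splitW] using hR
  | ⟨n + 3, k⟩ =>
    simp only [splitW]
    split_ifs with hc
    · have hn : (n : ℝ) + 2 ≤ hi := by exact_mod_cast hc.1.1.2
      have hJ : cutoff ε (k 0) (k 1) ^ 2 ≤ 1 := by
        have h1 := cutoff_nonneg ε (k 0) (k 1)
        have h2 := cutoff_le_one ε (k 0) (k 1)
        nlinarith
      have h2 : √((n : ℝ) + 2) ^ 2 = n + 2 := Real.sq_sqrt (by positivity)
      have h3 : √((n : ℝ) + 3) ^ 2 = n + 3 := Real.sq_sqrt (by positivity)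
      rw [Complex.norm_real, Real.norm_eq_abs, sq_abs]
      calc _ = (c0 d * dot w q) ^ 2 * coupling d ε ^ 2 *
            ((√((n : ℝ) + 2) ^ 2 * √((n : ℝ) + 3) ^ 2) * cutoff ε (k 0) (k 1) ^ 2) := by ring
        _ ≤ (c0 d * dot w q) ^ 2 * coupling d ε ^ 2 * (((hi + 1) * (hi + 1)) * 1) := by
            rw [h2, h3]
            have h5 : ((n : ℝ) + 2) * (n + 3) ≤ (hi + 1) * (hi + 1) :=
              mul_le_mul (by linarith) (by linarith) (by positivity) (by positivity)
            exact mul_le_mul_of_nonneg_left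
              (mul_le_mul h5 hJ (by positivity) (by positivity)) (by positivity)
        _ = _ := by ring
    · rw [norm_zero, zero_pow two_ne_zero]; exact hR

lemma splitW_cutoff {w : Fin d → ℝ} {ε : ℝ} {q : Freq d} {lo hi : ℕ} {y : Idx d} {l : Freq d}
    (h : splitW w ε q lo hi (splitAtt q y l) ≠ 0) : cutoff ε l (q - l) ≠ 0 := by
  obtain ⟨n, k⟩ := y
  match n, k, h with
  | 0, k, h => exact absurd rfl h
  | n + 1, k, h =>
    intro h0
    apply h
    have e : splitAtt q ⟨n + 1, k⟩ l = ⟨n + 3, Fin.cons l (Fin.cons (q - l) k)⟩ := rfl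
    rw [e]
    simp only [splitW]
    split_ifs with hc
    · have e1 : (Fin.cons l (Fin.cons (q - l) k) : Fin (n + 3) → Freq d) 0 = l := rfl
      have e2 : (Fin.cons l (Fin.cons (q - l) k) : Fin (n + 3) → Freq d) 1 = q - l := rfl
      rw [e1, e2, h0]; simp
    · rfl

lemma exists_fiberBound_splitW (w : Fin d → ℝ) {ε : ℝ} (hε : 0 < ε) (q : Freq d) (lo hi : ℕ) :
    ∃ C, FiberBound (splitW w ε q lo hi) dropTwo C := by
  refine ⟨√((c0 d * (hi + 1) * dot w q) ^ 2 * coupling d ε ^ 2 * (2 * (1 / ε) + 1) ^ d),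
    FiberBound.of_param (Real.sqrt_nonneg _) (splitAtt q) splitAtt_dropTwo fun y => ?_⟩
  rw [Real.sq_sqrt (by positivity)]
  exact tsum_enorm_sq_le_of_bdd (by positivity) (by positivity)
    (fun l hl => (of_cutoff_ne_zero hε (splitW_cutoff hl)).2.1)
    fun l => norm_splitW_sq_le w ε q lo hi _

/-- Creation of the two fragments of a particle of momentum `q`, before symmetrisation. -/
def splitOp (w : Fin d → ℝ) (ε : ℝ) (q : Freq d) (lo hi : ℕ) : L2 (Idx d) →L[ℂ] L2 (Idx d) :=
  wcomp (splitW w ε q lo hi) dropTwo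

lemma splitOp_apply (w : Fin d → ℝ) {ε : ℝ} (hε : 0 < ε) (q : Freq d) (lo hi : ℕ) (f : L2 (Idx d))
    (x : Idx d) : splitOp w ε q lo hi f x = splitW w ε q lo hi x * f (dropTwo x) :=
  wcomp_apply (exists_fiberBound_splitW w hε q lo hi).choose_spec f x

lemma star_splitW (w : Fin d → ℝ) (ε : ℝ) (q : Freq d) (lo hi : ℕ) (x : Idx d) :
    star (splitW w ε q lo hi x) = splitW w ε q lo hi x := by
  unfold splitW
  split
  · split_ifs <;> simp
  · simp

lemma adjoint_splitOp_apply (w : Fin d → ℝ) {ε : ℝ} (hε : 0 < ε) (q : Freq d) (lo hi : ℕ)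
    (f : L2 (Idx d)) (y : Idx d) : ContinuousLinearMap.adjoint (splitOp w ε q lo hi) f y =
      ∑' l, splitW w ε q lo hi (splitAtt q y l) * f (splitAtt q y l) := by
  rw [splitOp, adjoint_wcomp_apply (exists_fiberBound_splitW w hε q lo hi).choose_spec (splitAtt q)
    splitAtt_dropTwo (fun y l _ => dropTwo_splitAtt q y l) (splitAtt_injective q)]
  simp only [star_splitW]

/-- A bound for the normalised creation of two fragments. -/
def splitBound (w : Fin d → ℝ) (q : Freq d) (hi : ℕ) : ℝ :=
  √((c0 d * (hi + 1) * dot w q) ^ 2 * 2 * (2 * d * 3 ^ (d - 1)))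

lemma norm_invSqrt_splitOp_le (hd : 3 ≤ d) (w : Fin d → ℝ) {ε : ℝ} (hε : 0 < ε) (q : Freq d)
    (lo hi : ℕ) : ‖invSqrtOp d ∘L splitOp w ε q lo hi‖ ≤ splitBound w q hi := by
  have hfb : FiberBound (fun x => (((√(energy x.2))⁻¹ : ℝ) : ℂ) * splitW w ε q lo hi x) dropTwo
      (splitBound w q hi) := by
    refine FiberBound.of_param (Real.sqrt_nonneg _) (splitAtt q)
      (fun x hx => splitAtt_dropTwo x (right_ne_zero_of_mul hx)) fun y => ?_
    rw [splitBound, Real.sq_sqrt (by positivity)]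
    refine (tsum_enorm_sq_le_of_inv hd (A := (c0 d * (hi + 1) * dot w q) ^ 2 * 2 * coupling d ε ^ 2)
      (r := 1 / ε) (by positivity) (by positivity)
      (fun l hl => (of_cutoff_ne_zero hε (splitW_cutoff (right_ne_zero_of_mul hl))).2.1)
      fun l => ?_).trans (ENNReal.ofReal_le_ofReal (le_of_eq ?_))
    · by_cases h0 : splitW w ε q lo hi (splitAtt q y l) = 0
      · rw [h0, mul_zero, norm_zero, zero_pow two_ne_zero]; positivity
      have hl := (of_cutoff_ne_zero hε (splitW_cutoff h0)).1.1
      have hnl : 0 < ‖l‖ := norm_pos_iff.2 hl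
      have hE := norm_sq_le_energy (splitAtt q y l).2 (0 : Fin (y.1 + 2))
      have e1 : (splitAtt q y l).2 (0 : Fin (y.1 + 2)) = l := rfl
      rw [e1] at hE
      have hE0 : 0 < energy (splitAtt q y l).2 := by nlinarith
      have hE1 : (energy (splitAtt q y l).2)⁻¹ ≤ 2 * (‖l‖ ^ 2)⁻¹ := by
        rw [← div_eq_mul_inv, inv_le_iff_one_le_mul₀ hE0, div_mul_eq_mul_div,
          le_div_iff₀ (by positivity)]
        linarith
      rw [norm_mul, mul_pow, Complex.norm_real, Real.norm_eq_abs, sq_abs, inv_pow,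
        Real.sq_sqrt hE0.le]
      calc _ ≤ (2 * (‖l‖ ^ 2)⁻¹) * ((c0 d * (hi + 1) * dot w q) ^ 2 * coupling d ε ^ 2) := by
            gcongr
            exact norm_splitW_sq_le w ε q lo hi _
        _ = _ := by ring
    · rw [coupling_sq hε hd, one_div, inv_pow]
      field_simp
  have e : invSqrtOp d ∘L splitOp w ε q lo hi =
      wcomp (fun x => (((√(energy x.2))⁻¹ : ℝ) : ℂ) * splitW w ε q lo hi x) dropTwo := by
    ext f x
    rw [ContinuousLinearMap.comp_apply, invSqrtOp_apply, splitOp_apply w hε, wcomp_apply hfb]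
    ring
  rw [e]
  exact norm_wcomp_le hfb

/-- The index of the configuration whose first particle has absorbed the momentum `q`. -/
def shiftIdx (q : Freq d) : Idx d → Idx d
  | ⟨n + 1, k⟩ => ⟨n + 1, Fin.cons (q + k 0) fun a => k a.succ⟩
  | x => x

lemma shiftIdx_neg (q : Freq d) (x : Idx d) : shiftIdx (-q) (shiftIdx q x) = x := by
  match x with
  | ⟨0, k⟩ => rfl
  | ⟨n + 1, k⟩ =>
    simp only [shiftIdx, Fin.cons_zero, Fin.cons_succ, neg_add_cancel_left]
    congr 1
    exact Fin.cons_self_tail k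

open Classical in
/-- The weight of the annihilation of a particle of momentum `q` by merging it with the first
particle. -/
def mergeW (w : Fin d → ℝ) (ε : ℝ) (q : Freq d) (lo hi : ℕ) : Idx d → ℂ
  | ⟨n + 2, k⟩ => if (lo ≤ n + 1 ∧ n + 2 ≤ hi) ∧ ∀ a, k a ≠ 0 then
      ((2 * c0 d * coupling d ε * (n + 2) * dot w (q + k 0) * cutoff ε q (k 0) : ℝ) : ℂ) else 0
  | _ => 0

lemma norm_mergeW_le (w : Fin d → ℝ) {ε : ℝ} (hε : 0 < ε) (q : Freq d) (lo hi : ℕ) {n : ℕ}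
    (k : Fin (n + 2) → Freq d) : ‖mergeW w ε q lo hi ⟨n + 2, k⟩‖ ≤
      2 * c0 d * coupling d ε * hi * |dot w (q + k 0)| * cutoff ε q (k 0) := by
  have hcp := coupling_nonneg (d := d) hε
  have hc0 := c0_pos d
  have hJ := cutoff_nonneg ε q (k 0)
  simp only [mergeW]
  split_ifs with hc
  · have hn : (n : ℝ) + 2 ≤ hi := by exact_mod_cast hc.1.2
    rw [Complex.norm_real, Real.norm_eq_abs, abs_mul, abs_mul, abs_of_nonneg hJ,
      abs_of_nonneg (show 0 ≤ 2 * c0 d * coupling d ε * ((n : ℝ) + 2) by positivity)]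
    gcongr
  · rw [norm_zero]; positivity

lemma fiberBound_shift {m : Idx d → ℂ} (q : Freq d) {C : ℝ} (hC : 0 ≤ C) (h : ∀ x, ‖m x‖ ≤ C) :
    FiberBound m (shiftIdx q) C := by
  refine FiberBound.of_param (γ := Unit) hC (fun y _ => shiftIdx (-q) y)
    (fun x _ => ⟨(), shiftIdx_neg q x⟩) fun y => ?_
  rw [tsum_fintype]
  simp only [Finset.univ_unique, Finset.sum_singleton]
  exact enorm_sq_le_ofReal (by gcongr; exact h _)

lemma exists_fiberBound_mergeW (w : Fin d → ℝ) {ε : ℝ} (hε : 0 < ε) (q : Freq d) (lo hi : ℕ) :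
    ∃ C, FiberBound (mergeW w ε q lo hi) (shiftIdx q) C := by
  have hcp := coupling_nonneg (d := d) hε
  have hc0 := c0_pos d
  have hw : 0 ≤ ∑ a, |w a| := Finset.sum_nonneg fun _ _ => abs_nonneg _
  have hC : 0 ≤ 2 * c0 d * coupling d ε * hi * ((∑ a, |w a|) * (1 / ε)) := by positivity
  refine ⟨_, fiberBound_shift q hC fun x => ?_⟩
  match x with
  | ⟨0, k⟩ => simpa [mergeW] using hC
  | ⟨1, k⟩ => simpa [mergeW] using hC
  | ⟨n + 2, k⟩ =>
    refine (norm_mergeW_le w hε q lo hi k).trans ?_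
    by_cases h0 : cutoff ε q (k 0) = 0
    · rw [h0, mul_zero]; exact hC
    have h1 := (of_cutoff_ne_zero hε h0).2.2.2
    calc _ ≤ 2 * c0 d * coupling d ε * hi * ((∑ a, |w a|) * (1 / ε)) * 1 := by
          gcongr
          · exact cutoff_nonneg _ _ _
          · exact (abs_dot_le w _).trans (by gcongr)
          · exact cutoff_le_one _ _ _
      _ = _ := mul_one _

/-- The adjoint of the annihilation of a particle of momentum `q` by merging, before
symmetrisation. -/
def mergeOp (w : Fin d → ℝ) (ε : ℝ) (q : Freq d) (lo hi : ℕ) : L2 (Idx d) →L[ℂ] L2 (Idx d) :=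
  wcomp (mergeW w ε q lo hi) (shiftIdx q)

lemma mergeOp_apply (w : Fin d → ℝ) {ε : ℝ} (hε : 0 < ε) (q : Freq d) (lo hi : ℕ) (f : L2 (Idx d))
    (x : Idx d) : mergeOp w ε q lo hi f x = mergeW w ε q lo hi x * f (shiftIdx q x) :=
  wcomp_apply (exists_fiberBound_mergeW w hε q lo hi).choose_spec f x

/-- A bound for the normalised merging. -/
def mergeBound (w : Fin d → ℝ) (hi : ℕ) : ℝ :=
  2 * c0 d * coupling d 2 * hi * √(2 * wSq w)

lemma coupling_le_two (hd : 3 ≤ d) {ε : ℝ} (hε : ε ∈ scales) : coupling d ε ≤ coupling d 2 := by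
  refine Real.rpow_le_rpow (scales_pos hε).le (scales_le_two hε) ?_
  have : (3 : ℝ) ≤ d := by exact_mod_cast hd
  linarith

lemma norm_mergeOp_invSqrt_le (hd : 3 ≤ d) (w : Fin d → ℝ) {ε : ℝ} (hε : ε ∈ scales) (q : Freq d)
    (lo hi : ℕ) : ‖mergeOp w ε q lo hi ∘L invSqrtOp d‖ ≤ mergeBound w hi := by
  have hε0 := scales_pos hε
  have hcp := coupling_nonneg (d := d) hε0
  have hcp2 := coupling_nonneg (d := d) two_pos
  have hc0 := c0_pos d
  have hw := wSq_nonneg w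
  have hC : 0 ≤ mergeBound w hi := by unfold mergeBound; positivity
  have hfb : FiberBound (fun x => mergeW w ε q lo hi x *
      (((√(energy (shiftIdx q x).2))⁻¹ : ℝ) : ℂ)) (shiftIdx q) (mergeBound w hi) := by
    refine fiberBound_shift q hC fun x => ?_
    match x with
    | ⟨0, k⟩ => simpa [mergeW] using hC
    | ⟨1, k⟩ => simpa [mergeW] using hC
    | ⟨n + 2, k⟩ =>
      have h1 := dot_sq_le w (shiftIdx q ⟨n + 2, k⟩).2 (0 : Fin (n + 2))
      have e1 : (shiftIdx q ⟨n + 2, k⟩).2 (0 : Fin (n + 2)) = q + k 0 := rfl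
      rw [e1] at h1
      set E := energy (shiftIdx q ⟨n + 2, k⟩).2
      have hE : 0 ≤ E := energy_nonneg _
      have h2 : |dot w (q + k 0)| ≤ √(2 * wSq w) * √E := by
        rw [← Real.sqrt_mul (by positivity), ← Real.sqrt_sq_eq_abs]
        exact Real.sqrt_le_sqrt (by linarith)
      rw [norm_mul, Complex.norm_real, Real.norm_eq_abs, abs_of_nonneg (by positivity)]
      calc _ ≤ (2 * c0 d * coupling d ε * hi * |dot w (q + k 0)| * cutoff ε q (k 0)) * (√E)⁻¹ := by
            gcongr
            exact norm_mergeW_le w hε0 q lo hi k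
        _ ≤ (2 * c0 d * coupling d 2 * hi * (√(2 * wSq w) * √E) * 1) * (√E)⁻¹ := by
            gcongr
            · exact cutoff_nonneg _ _ _
            · exact coupling_le_two hd hε
            · exact cutoff_le_one _ _ _
        _ = mergeBound w hi * (√E * (√E)⁻¹) := by unfold mergeBound; ring
        _ ≤ mergeBound w hi * 1 := by
            gcongr
            exact mul_inv_le_one
        _ = _ := mul_one _
  have e : mergeOp w ε q lo hi ∘L invSqrtOp d = wcomp (fun x => mergeW w ε q lo hi x *
      (((√(energy (shiftIdx q x).2))⁻¹ : ℝ) : ℂ)) (shiftIdx q) := by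
    ext f x
    rw [ContinuousLinearMap.comp_apply, mergeOp_apply w hε0, invSqrtOp_apply, wcomp_apply hfb]
    ring
  rw [e]
  exact norm_wcomp_le hfb

end Spectator

section Commutators

variable {d : ℕ}

/-! ### Commutation of the generator with a spectator -/

lemma cons_succ_succAbove (q : Freq d) {n : ℕ} (k : Fin (n + 1) → Freq d) (j : Fin (n + 1)) :
    (fun a => (Fin.cons q k : Fin (n + 2) → Freq d) (j.succ.succAbove a)) =
      Fin.cons q fun a => k (j.succAbove a) := by
  ext1 a
  refine Fin.cases ?_ (fun a => ?_) a
  · simp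
  · simp [Fin.succ_succAbove_succ]

lemma cons_succ_succAbove_succAbove (q : Freq d) {n : ℕ} (k : Fin (n + 2) → Freq d)
    (j : Fin (n + 2)) (i : Fin (n + 1)) :
    (fun a => (Fin.cons q k : Fin (n + 3) → Freq d) (j.succ.succAbove (i.succ.succAbove a))) =
      Fin.cons q fun a => k (j.succAbove (i.succAbove a)) := by
  ext1 a
  refine Fin.cases ?_ (fun a => ?_) a
  · simp
  · simp [Fin.succ_succAbove_succ]

/-- Removing the spectator after an annihilation: either it was not involved, or it is the particle
in which the annihilated pair has merged, which is the adjoint of its splitting. -/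
lemma delOp_rawAnn (w : Fin d → ℝ) {ε : ℝ} (hε : 0 < ε) {q : Freq d} (hq : q ≠ 0) {lo hi M : ℕ}
    (hlo : 1 ≤ lo) (hM : hi ≤ M) {h : L2 (Idx d)} (hh : IsSymm h) :
    delOp q M (symOp (rawAnn w ε (lo + 1) (hi + 1) h)) =
      symOp (rawAnn w ε lo hi (delOp q M h)) +
        ContinuousLinearMap.adjoint (splitOp w ε q lo hi) h := by
  ext ⟨n, k⟩
  have hadd : (symOp (rawAnn w ε lo hi (delOp q M h)) +
        ContinuousLinearMap.adjoint (splitOp w ε q lo hi) h) ⟨n, k⟩ =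
      symOp (rawAnn w ε lo hi (delOp q M h)) ⟨n, k⟩ +
        ContinuousLinearMap.adjoint (splitOp w ε q lo hi) h ⟨n, k⟩ := rfl
  rw [hadd, delOp_apply, symOp_rawAnn_apply w hε, symOp_rawAnn_apply w hε,
    adjoint_splitOp_apply w hε]
  simp only [attIdx]
  rw [symF_rawAnnF w ε _ _ hh]
  match n, k with
  | 0, k =>
    have h0 : ∀ l, splitW w ε q lo hi (splitAtt q ⟨0, k⟩ l) = 0 := fun l => rfl
    rw [symF_rawAnnF_zero, if_neg (by omega)]
    simp [h0]
  | n + 1, k =>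
    have e1 : ∀ l, splitAtt q ⟨n + 1, k⟩ l = ⟨n + 3, Fin.cons l (Fin.cons (q - l) k)⟩ :=
      fun l => rfl
    have e2 : ∀ l, splitW w ε q lo hi (splitAtt q ⟨n + 1, k⟩ l) =
        if (lo ≤ n + 1 ∧ n + 2 ≤ hi) ∧ ∀ a, k a ≠ 0 then
          ((c0 d * coupling d ε * √(n + 2) * √(n + 3) * dot w q * cutoff ε l (q - l) : ℝ) : ℂ)
        else 0 := by
      intro l
      rw [e1]
      simp only [splitW]
      have a1 : (Fin.cons l (Fin.cons (q - l) k) : Fin (n + 3) → Freq d) 0 = l := rfl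
      have a2 : (Fin.cons l (Fin.cons (q - l) k) : Fin (n + 3) → Freq d) 1 = q - l := rfl
      simp only [a1, a2, Fin.cons_succ, add_sub_cancel, and_true]
    rw [symF_rawAnnF w ε _ _ (isSymm_delOp q M hh)]
    simp only [e2]
    by_cases hc : (lo ≤ n + 1 ∧ n + 2 ≤ hi) ∧ ∀ a, k a ≠ 0
    · have hc' : (lo + 1 ≤ n + 1 + 1 ∧ n + 1 + 2 ≤ hi + 1) ∧
          ∀ a, (Fin.cons q k : Fin (n + 2) → Freq d) a ≠ 0 := by
        refine ⟨by omega, fun a => ?_⟩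
        refine Fin.cases hq (fun a => ?_) a
        exact hc.2 a
      -- The summand at position `0` is the spectator as the particle produced by the annihilation.
      rw [if_pos hc', if_pos hc, Fin.sum_univ_succ]
      simp only [if_pos hc, Fin.cons_zero, Fin.cons_succ, delOp_apply, attIdx, delW, e1]
      have hd1 : n + 1 ≤ M := by omega
      have hd2 : n + 2 ≤ M := by omega
      simp only [if_pos hd1, if_pos hd2]
      have e3 : ∀ (j : Fin (n + 1)) (l : Freq d),
          h ⟨n + 1 + 2, Fin.cons l (Fin.cons (k j - l) fun a : Fin (n + 1) =>
            (Fin.cons q k : Fin (n + 2) → Freq d) (j.succ.succAbove a))⟩ =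
          h ⟨n + 2 + 1, Fin.cons q (Fin.cons l (Fin.cons (k j - l) fun a => k (j.succAbove a)))⟩ := by
        intro j l
        rw [← hh.rotate l (k j - l) q, cons_succ_succAbove]
      simp only [e3]
      have e4 : (fun a : Fin (n + 1) => (Fin.cons q k : Fin (n + 2) → Freq d)
          ((0 : Fin (n + 2)).succAbove a)) = k := by
        ext1 a; simp
      simp only [e4]
      have e5 : ∀ j : Fin (n + 1), ∑' l, ((cutoff ε l (k j - l) : ℝ) : ℂ) *
          (((√(((n + 2 : ℕ) : ℝ) + 1) : ℝ) : ℂ) * h ⟨n + 2 + 1, Fin.cons q (Fin.cons l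
            (Fin.cons (k j - l) fun a => k (j.succAbove a)))⟩) =
          ((√(((n + 2 : ℕ) : ℝ) + 1) : ℝ) : ℂ) * ∑' l, ((cutoff ε l (k j - l) : ℝ) : ℂ) *
            h ⟨n + 2 + 1, Fin.cons q (Fin.cons l
            (Fin.cons (k j - l) fun a => k (j.succAbove a)))⟩ := fun j => by
        rw [← tsum_mul_left]
        exact tsum_congr fun l => by ring
      simp only [e5]
      have e6 : ∑' l, ((c0 d * coupling d ε * √(n + 2) * √(n + 3) * dot w q *
            cutoff ε l (q - l) : ℝ) : ℂ) * h ⟨n + 3, Fin.cons l (Fin.cons (q - l) k)⟩ =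
          ((c0 d * coupling d ε * √(n + 2) * √(n + 3) * dot w q : ℝ) : ℂ) *
          ∑' l, ((cutoff ε l (q - l) : ℝ) : ℂ) * h ⟨n + 3, Fin.cons l (Fin.cons (q - l) k)⟩ := by
        rw [← tsum_mul_left]
        exact tsum_congr fun l => by push_cast; ring
      rw [e6]
      have a3 : ((n + 1 : ℕ) : ℝ) + 1 = n + 2 := by push_cast; ring
      have a4 : ((n + 1 : ℕ) : ℝ) + 2 = n + 3 := by push_cast; ring
      have a5 : ((n + 2 : ℕ) : ℝ) + 1 = n + 3 := by push_cast; ring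
      rw [a3, a4, a5]
      simp only [mul_left_comm _ ((√((n : ℝ) + 3) : ℝ) : ℂ) _, ← Finset.mul_sum]
      push_cast
      ring
    · have hc' : ¬((lo + 1 ≤ n + 1 + 1 ∧ n + 1 + 2 ≤ hi + 1) ∧
          ∀ a, (Fin.cons q k : Fin (n + 2) → Freq d) a ≠ 0) := by
        rintro ⟨h1, h2⟩
        exact hc ⟨by omega, fun a => h2 a.succ⟩
      rw [if_neg hc', if_neg hc]
      simp [if_neg hc]

/-- The symmetrised merging term as a sum over the position of the particle that merges with the
spectator. -/
lemma symOp_mergeOp (w : Fin d → ℝ) {ε : ℝ} (hε : 0 < ε) (q : Freq d) (lo hi : ℕ) {h : L2 (Idx d)}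
    (hh : IsSymm h) {n : ℕ} (k : Fin (n + 2) → Freq d) :
    symOp (mergeOp w ε q lo hi h) ⟨n + 2, k⟩ =
      if (lo ≤ n + 1 ∧ n + 2 ≤ hi) ∧ ∀ a, k a ≠ 0 then
        ((2 * c0 d * coupling d ε : ℝ) : ℂ) * ∑ i : Fin (n + 2),
          ((dot w (q + k i) * cutoff ε q (k i) : ℝ) : ℂ) *
            h ⟨n + 2, Fin.cons (q + k i) fun a => k (i.succAbove a)⟩ else 0 := by
  classical
  rw [symOp_apply]
  have hm : ∀ k' : Fin (n + 2) → Freq d, mergeOp w ε q lo hi h ⟨n + 2, k'⟩ =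
      if (lo ≤ n + 1 ∧ n + 2 ≤ hi) ∧ ∀ a, k' a ≠ 0 then
        ((2 * c0 d * coupling d ε * (n + 2) * dot w (q + k' 0) * cutoff ε q (k' 0) : ℝ) : ℂ) *
          h ⟨n + 2, Fin.cons (q + k' 0) fun a => k' a.succ⟩ else 0 := by
    intro k'
    rw [mergeOp_apply w hε]
    simp only [mergeW, shiftIdx]
    split_ifs <;> simp
  split_ifs with hc
  · have h1 : symF (mergeOp w ε q lo hi h) ⟨n + 2, k⟩ = avg (fun k' : Fin (n + 2) → Freq d =>
        ((2 * c0 d * coupling d ε * (n + 2) * dot w (q + k' 0) * cutoff ε q (k' 0) : ℝ) : ℂ) *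
          h ⟨n + 2, Fin.cons (q + k' 0) fun a => k' a.succ⟩) k := by
      unfold symF avg
      congr 1
      refine Finset.sum_congr rfl fun σ _ => ?_
      exact (hm _).trans (if_pos ⟨hc.1, fun a => hc.2 _⟩)
    rw [h1, avg_head, Finset.mul_sum, Finset.mul_sum]
    · refine Finset.sum_congr rfl fun i _ => ?_
      simp only [Fin.cons_zero, Fin.cons_succ]
      have : ((n + 1 : ℕ) : ℂ) + 1 ≠ 0 := Nat.cast_add_one_ne_zero _
      push_cast at this ⊢
      have e : (n : ℂ) + 1 + 1 = n + 2 := by ring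
      rw [e] at this ⊢
      field_simp
    · intro a k' σ
      simp only [Fin.cons_zero, Fin.cons_succ]
      rw [← hh.cons (q + a) k' σ]
  · refine avg_eq_zero fun σ => ?_
    beta_reduce
    rw [hm, if_neg]
    rintro ⟨h1, h2⟩
    refine hc ⟨h1, fun a => ?_⟩
    have := h2 (σ.symm a)
    simpa using this

/-- Removing the spectator after a creation: either it was not involved, or it is one of the two
products, which is the merging term. -/
lemma delOp_rawOp (w : Fin d → ℝ) {ε : ℝ} (hε : 0 < ε) {q : Freq d} (hq : q ≠ 0) {lo hi M : ℕ}
    (hlo : 1 ≤ lo) (hM : hi ≤ M) {h : L2 (Idx d)} (hh : IsSymm h) :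
    delOp q M (symOp (rawOp w ε (lo + 1) (hi + 1) h)) =
      symOp (rawOp w ε lo hi (delOp q M h)) + symOp (mergeOp w ε q lo hi h) := by
  classical
  ext ⟨n, k⟩
  have hadd : (symOp (rawOp w ε lo hi (delOp q M h)) + symOp (mergeOp w ε q lo hi h)) ⟨n, k⟩ =
      symOp (rawOp w ε lo hi (delOp q M h)) ⟨n, k⟩ + symOp (mergeOp w ε q lo hi h) ⟨n, k⟩ := rfl
  rw [hadd, delOp_apply, symOp_rawOp_apply w hε, symOp_rawOp_apply w hε]
  simp only [attIdx]
  match n, k with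
  | 0, k =>
    rw [symF_rawCreF_one, symF_rawCreF_zero, symOp_apply]
    have : symF (mergeOp w ε q lo hi h) ⟨0, k⟩ = 0 := avg_eq_zero fun σ => by
      rw [mergeOp_apply w hε]; simp [mergeW]
    rw [this]; simp
  | 1, k =>
    rw [symF_rawCreF w ε _ _ hh, if_neg (by omega), symF_rawCreF_one, symOp_apply]
    have : symF (mergeOp w ε q lo hi h) ⟨1, k⟩ = 0 := avg_eq_zero fun σ => by
      rw [mergeOp_apply w hε]; simp [mergeW]
    rw [this]; simp
  | n + 2, k =>
    rw [symOp_mergeOp w hε q lo hi hh, symF_rawCreF w ε _ _ hh,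
      symF_rawCreF w ε _ _ (isSymm_delOp q M hh)]
    by_cases hc : (lo ≤ n + 1 ∧ n + 2 ≤ hi) ∧ ∀ a, k a ≠ 0
    · have hc' : (lo + 1 ≤ n + 1 + 1 ∧ n + 1 + 2 ≤ hi + 1) ∧
          ∀ a, (Fin.cons q k : Fin (n + 3) → Freq d) a ≠ 0 := by
        refine ⟨by omega, fun a => ?_⟩
        refine Fin.cases hq (fun a => ?_) a
        exact hc.2 a
      have hd1 : n + 1 ≤ M := by omega
      have hd2 : n + 2 ≤ M := by omega
      rw [if_pos hc', if_pos hc, if_pos hc, Fin.sum_univ_succ]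
      simp only [delOp_apply, attIdx, delW, if_pos hd1, if_pos hd2]
      have e1 : ∀ j : Fin (n + 2), ∑ i : Fin (n + 1 + 1),
          ((dot w ((Fin.cons q k : Fin (n + 3) → Freq d) j.succ +
            (Fin.cons q k : Fin (n + 3) → Freq d) (j.succ.succAbove i)) *
            cutoff ε ((Fin.cons q k : Fin (n + 3) → Freq d) j.succ)
              ((Fin.cons q k : Fin (n + 3) → Freq d) (j.succ.succAbove i)) : ℝ) : ℂ) *
            h ⟨n + 1 + 1, Fin.cons ((Fin.cons q k : Fin (n + 3) → Freq d) j.succ +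
              (Fin.cons q k : Fin (n + 3) → Freq d) (j.succ.succAbove i))
              fun a => (Fin.cons q k : Fin (n + 3) → Freq d) (j.succ.succAbove (i.succAbove a))⟩ =
          ((dot w (q + k j) * cutoff ε q (k j) : ℝ) : ℂ) *
            h ⟨n + 2, Fin.cons (q + k j) fun a => k (j.succAbove a)⟩ +
          ∑ i : Fin (n + 1), ((dot w (k j + k (j.succAbove i)) *
            cutoff ε (k j) (k (j.succAbove i)) : ℝ) : ℂ) *
            h ⟨n + 1 + 1, Fin.cons q (Fin.cons (k j + k (j.succAbove i))
              fun a => k (j.succAbove (i.succAbove a)))⟩ := by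
        intro j
        rw [Fin.sum_univ_succ]
        congr 1
        · have a1 : (fun a : Fin (n + 1) => (Fin.cons q k : Fin (n + 3) → Freq d)
              (j.succ.succAbove ((0 : Fin (n + 2)).succAbove a))) =
              fun a => k (j.succAbove a) := by
            ext1 a
            simp [Fin.succ_succAbove_succ]
          rw [a1]
          simp only [Fin.succ_succAbove_zero, Fin.cons_succ, Fin.cons_zero]
          rw [add_comm (k j) q, cutoff_comm]
        · refine Finset.sum_congr rfl fun i _ => ?_
          simp only [Fin.succ_succAbove_succ, Fin.cons_succ]
          rw [hh.swap q, cons_succ_succAbove_succAbove]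
      have e2 : ∑ i : Fin (n + 1 + 1),
          ((dot w ((Fin.cons q k : Fin (n + 3) → Freq d) 0 +
            (Fin.cons q k : Fin (n + 3) → Freq d) ((0 : Fin (n + 3)).succAbove i)) *
            cutoff ε ((Fin.cons q k : Fin (n + 3) → Freq d) 0)
              ((Fin.cons q k : Fin (n + 3) → Freq d) ((0 : Fin (n + 3)).succAbove i)) : ℝ) : ℂ) *
            h ⟨n + 1 + 1, Fin.cons ((Fin.cons q k : Fin (n + 3) → Freq d) 0 +
              (Fin.cons q k : Fin (n + 3) → Freq d) ((0 : Fin (n + 3)).succAbove i))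
              fun a => (Fin.cons q k : Fin (n + 3) → Freq d)
                ((0 : Fin (n + 3)).succAbove (i.succAbove a))⟩ =
          ∑ j : Fin (n + 2), ((dot w (q + k j) * cutoff ε q (k j) : ℝ) : ℂ) *
            h ⟨n + 2, Fin.cons (q + k j) fun a => k (j.succAbove a)⟩ := by
        refine Finset.sum_congr rfl fun j _ => ?_
        simp only [Fin.zero_succAbove, Fin.cons_succ, Fin.cons_zero]
      simp only [e1, e2, Finset.sum_add_distrib]
      have a3 : ((n + 2 : ℕ) : ℝ) + 1 = n + 3 := by push_cast; ring
      have a4 : ((n + 1 : ℕ) : ℝ) + 2 = n + 3 := by push_cast; ring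
      have a5 : ((n + 1 : ℕ) : ℝ) + 1 = n + 2 := by push_cast; ring
      rw [a3, a4, a5]
      simp only [mul_left_comm _ ((√((n : ℝ) + 2) : ℝ) : ℂ) _, ← Finset.mul_sum]
      have b2 : ((√((n : ℝ) + 2) : ℝ) : ℂ) ≠ 0 := by
        exact_mod_cast (Real.sqrt_pos.2 (by positivity)).ne'
      have b3 : ((√((n : ℝ) + 3) : ℝ) : ℂ) ≠ 0 := by
        exact_mod_cast (Real.sqrt_pos.2 (by positivity)).ne'
      push_cast
      field_simp
      ring
    · have hc' : ¬((lo + 1 ≤ n + 1 + 1 ∧ n + 1 + 2 ≤ hi + 1) ∧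
          ∀ a, (Fin.cons q k : Fin (n + 3) → Freq d) a ≠ 0) := by
        rintro ⟨h1, h2⟩
        exact hc ⟨by omega, fun a => h2 a.succ⟩
      rw [if_neg hc', if_neg hc, if_neg hc]
      simp

end Commutators

section Spectators

variable {d : ℕ}

/-! ### The equation with a spectator -/

lemma attOp_symOp (q : Freq d) (M : ℕ) (x : L2 (Idx d)) : attOp q M (symOp x) = attOp q M x := by
  have h : symOp ∘L delOp q M ∘L symOp = delOp q M ∘L symOp := by
    ext1 f
    exact symOp_of_isSymm (isSymm_delOp q M (isSymm_symF f))
  have h' := congrArg ContinuousLinearMap.adjoint h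
  simp only [ContinuousLinearMap.adjoint_comp, adjoint_symOp, ContinuousLinearMap.comp_assoc] at h'
  exact DFunLike.congr_fun h' x

lemma symOp_attOp (q : Freq d) (M : ℕ) (x : L2 (Idx d)) : symOp (attOp q M x) = attOp q M x :=
  symOp_of_isSymm (isSymm_attOp q M x)

lemma attOp_apply (q : Freq d) (M : ℕ) (x : L2 (Idx d)) :
    attOp q M x = symOp (ContinuousLinearMap.adjoint (delOp q M) x) := rfl

/-- The adjoint of a commutation relation between symmetrised operators. -/
lemma adjoint_commutator {S δ A A' R : L2 (Idx d) →L[ℂ] L2 (Idx d)}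
    (hS : ContinuousLinearMap.adjoint S = S)
    (h : ∀ f, δ (S (A' (S f))) = S (A (S (δ (S f)))) + R f) (x : L2 (Idx d)) :
    S (ContinuousLinearMap.adjoint A' (S (ContinuousLinearMap.adjoint δ x))) =
      S (ContinuousLinearMap.adjoint δ (S (ContinuousLinearMap.adjoint A (S x)))) +
        ContinuousLinearMap.adjoint R x := by
  refine ext_inner_left ℂ fun f => ?_
  have hS' : ∀ u v, inner ℂ u (S v) = inner ℂ (S u) v := fun u v => by
    conv_lhs => rw [← hS, ContinuousLinearMap.adjoint_inner_right]
  simp only [inner_add_right, hS', ContinuousLinearMap.adjoint_inner_right]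
  rw [h f, inner_add_left]

/-- Creation commutes with a spectator of momentum `q`, up to the splitting of the spectator. -/
lemma rawOp_attOp (w : Fin d → ℝ) {ε : ℝ} (hε : 0 < ε) {q : Freq d} (hq : q ≠ 0) {lo hi M : ℕ}
    (hlo : 1 ≤ lo) (hM : hi ≤ M) (x : L2 (Idx d)) :
    symOp (rawOp w ε (lo + 1) (hi + 1) (attOp q M x)) =
      attOp q M (symOp (rawOp w ε lo hi (symOp x))) + symOp (splitOp w ε q lo hi x) := by
  have h := adjoint_commutator (S := symOp) (δ := delOp q M)
    (A := rawAnn w ε lo hi) (A' := rawAnn w ε (lo + 1) (hi + 1))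
    (R := ContinuousLinearMap.adjoint (splitOp w ε q lo hi) ∘L symOp) adjoint_symOp (fun f => by
      rw [symOp_of_isSymm (isSymm_delOp q M (isSymm_symF f)),
        delOp_rawAnn w hε hq hlo hM (isSymm_symF f), ContinuousLinearMap.comp_apply]) x
  rw [rawAnn, rawAnn, ContinuousLinearMap.adjoint_adjoint, ContinuousLinearMap.adjoint_adjoint,
    ContinuousLinearMap.adjoint_comp, ContinuousLinearMap.adjoint_adjoint, adjoint_symOp,
    ContinuousLinearMap.comp_apply] at h
  rw [attOp_apply, attOp_apply, h]

/-- Annihilation commutes with a spectator of momentum `q`, up to the merging of the spectator with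
another particle. -/
lemma rawAnn_attOp (w : Fin d → ℝ) {ε : ℝ} (hε : 0 < ε) {q : Freq d} (hq : q ≠ 0) {lo hi M : ℕ}
    (hlo : 1 ≤ lo) (hM : hi ≤ M) (x : L2 (Idx d)) :
    symOp (rawAnn w ε (lo + 1) (hi + 1) (attOp q M x)) =
      attOp q M (symOp (rawAnn w ε lo hi (symOp x))) +
        symOp (ContinuousLinearMap.adjoint (mergeOp w ε q lo hi) (symOp x)) := by
  have h := adjoint_commutator (S := symOp) (δ := delOp q M)
    (A := rawOp w ε lo hi) (A' := rawOp w ε (lo + 1) (hi + 1))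
    (R := symOp ∘L mergeOp w ε q lo hi ∘L symOp) adjoint_symOp (fun f => by
      rw [symOp_of_isSymm (isSymm_delOp q M (isSymm_symF f)),
        delOp_rawOp w hε hq hlo hM (isSymm_symF f), ContinuousLinearMap.comp_apply,
        ContinuousLinearMap.comp_apply]) x
  rw [ContinuousLinearMap.adjoint_comp, ContinuousLinearMap.adjoint_comp, adjoint_symOp,
    ContinuousLinearMap.comp_apply, ContinuousLinearMap.comp_apply] at h
  rw [attOp_apply, attOp_apply, rawAnn, rawAnn, h]

/-- The generator commutes with attaching a spectator, up to the spectator splitting or merging. -/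
lemma rawGen_attOp (w : Fin d → ℝ) {ε : ℝ} (hε : 0 < ε) {q : Freq d} (hq : q ≠ 0) {lo hi M : ℕ}
    (hlo : 1 ≤ lo) (hM : hi ≤ M) (x : L2 (Idx d)) :
    rawGen w ε (lo + 1) (hi + 1) (attOp q M x) = attOp q M (rawGen w ε lo hi x) +
      symOp (splitOp w ε q lo hi x) -
        symOp (ContinuousLinearMap.adjoint (mergeOp w ε q lo hi) (symOp x)) := by
  rw [rawGen_apply, rawGen_apply, symOp_attOp, rawOp_attOp w hε hq hlo hM,
    rawAnn_attOp w hε hq hlo hM, map_sub]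
  abel

lemma isSymm_deltaOne (p : Freq d) : IsSymm (deltaOne p) := by
  have := symOp_deltaOne p
  rw [← this]
  exact isSymm_symF _

open Classical in
lemma deltaOne_one (K a : Freq d) : deltaOne K ⟨1, fun _ => a⟩ = if a = K then 1 else 0 := by
  rw [deltaOne_apply]
  by_cases h : a = K
  · rw [h, if_pos rfl, if_pos rfl]
  · rw [if_neg h, if_neg fun h' => h (congrFun (eq_of_heq (Sigma.mk.inj h').2) 0)]

/-- The splitting of the spectator is the creation out of the first chaos with the roles of the two
particles exchanged. -/
lemma symOp_splitOp_deltaOne (w : Fin d → ℝ) {ε : ℝ} (hε : 0 < ε) {p : Freq d} (hp : p ≠ 0)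
    (q : Freq d) {M : ℕ} (hM : 2 ≤ M) :
    symOp (splitOp w ε q 1 2 (deltaOne p)) = attOp p M (rawSrc w ε 1 (deltaOne q)) := by
  classical
  rw [rawSrc, attOp_symOp]
  ext ⟨n, k⟩
  simp only [attOp, ContinuousLinearMap.comp_apply, symOp_apply]
  have hs : ∀ n, n ≠ 3 → ∀ k' : Fin n → Freq d,
      splitOp w ε q 1 2 (deltaOne p) ⟨n, k'⟩ = 0 := by
    intro n hn k'
    rw [splitOp_apply w hε]
    match n, k' with
    | 0, k' => simp [splitW]
    | 1, k' => simp [splitW]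
    | 2, k' => simp [splitW]
    | n + 3, k' =>
      simp only [splitW]
      rw [if_neg (by omega), zero_mul]
  have ha : ∀ n, n ≠ 3 → ∀ k' : Fin n → Freq d, ContinuousLinearMap.adjoint (delOp p M)
      (rawOp w ε 1 (1 + 1) (deltaOne q)) ⟨n, k'⟩ = 0 := by
    intro n hn k'
    match n, k' with
    | 0, k' => exact adjoint_delOp_zero p M _ k'
    | 1, k' => rw [adjoint_delOp_succ, rawOp_apply w hε]; simp [rawW]
    | 2, k' => rw [adjoint_delOp_succ, rawOp_apply w hε]; simp [rawW]
    | n + 3, k' =>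
      rw [adjoint_delOp_succ, rawOp_apply w hε]
      simp only [rawW]
      rw [if_neg (c := (_ ∧ _)) (by omega)]
      simp
  by_cases hn : n = 3
  · subst hn
    unfold symF
    rw [← avg_comp_perm (fun k' : Fin 3 → Freq d =>
      splitOp w ε q 1 2 (deltaOne p) ⟨3, k'⟩) (finRotate 3)]
    unfold avg
    congr 1
    refine Finset.sum_congr rfl fun σ _ => ?_
    beta_reduce
    generalize k ∘ σ = k'
    rw [splitOp_apply w hε, adjoint_delOp_succ, rawOp_apply w hε]
    have r0 : (k' ∘ finRotate 3) 0 = k' 1 := rfl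
    have r1 : (k' ∘ finRotate 3) 1 = k' 2 := rfl
    have r2 : (k' ∘ finRotate 3) 2 = k' 0 := rfl
    have e1 : dropTwo (⟨3, k' ∘ finRotate 3⟩ : Idx d) = ⟨1, fun _ => k' 0⟩ := by
      simp only [dropTwo]
      congr 1
      ext1 j
      obtain rfl : j = 0 := Fin.fin_one_eq_zero j
      exact r2
    have e2 : mergeI (⟨2, fun a : Fin 2 => k' a.succ⟩ : Idx d) = ⟨1, fun _ => k' 1 + k' 2⟩ := by
      have : mergeI (⟨2, fun a : Fin 2 => k' a.succ⟩ : Idx d) =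
        ⟨1, merge fun a : Fin 2 => k' a.succ⟩ := rfl
      rw [this, merge_two, tot, Fin.sum_univ_two]
      rfl
    rw [e1, e2, deltaOne_one, deltaOne_one]
    by_cases hk : k' 0 = p
    · rw [if_pos hk, if_pos hk, mul_one]
      have hd : delW d M ⟨2, fun a : Fin 2 => k' a.succ⟩ = ((√3 : ℝ) : ℂ) := by
        simp only [delW, if_pos hM]
        norm_num
      rw [hd]
      by_cases hcut : cutoff ε (k' 1) (k' 2) = 0
      · have h1 : splitW w ε q 1 2 ⟨3, k' ∘ finRotate 3⟩ = 0 := by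
          simp only [splitW, r0, r1, hcut]
          simp
        have h2 : rawW w ε 1 (1 + 1) ⟨2, fun a : Fin 2 => k' a.succ⟩ = 0 := by
          have : cutoff ε (k' (0 : Fin 2).succ) (k' (1 : Fin 2).succ) = 0 := hcut
          simp only [rawW, rawWeight, this]
          simp
        rw [h1, h2]; simp
      · obtain ⟨⟨h1, h2, -⟩, -⟩ := of_cutoff_ne_zero hε hcut
        have hr : rawW w ε 1 (1 + 1) ⟨2, fun a : Fin 2 => k' a.succ⟩ =
            ((c0 d * coupling d ε * √2 * dot w (k' 1 + k' 2) * cutoff ε (k' 1) (k' 2) : ℝ) : ℂ) := by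
          simp only [rawW]
          rw [if_pos]
          · simp only [rawWeight]
            norm_num
          · refine ⟨by omega, fun a => ?_⟩
            fin_cases a
            · exact h1
            · exact h2
        rw [hr]
        by_cases hq : k' 1 + k' 2 = q
        · rw [if_pos hq]
          simp only [splitW]
          rw [if_pos]
          · rw [r0, r1, hq]
            push_cast
            norm_num
            ring
          · refine ⟨⟨by omega, fun a => ?_⟩, by rw [r0, r1, hq]⟩
            obtain rfl : a = 0 := Fin.fin_one_eq_zero a
            change (k' ∘ finRotate 3) 2 ≠ 0
            rw [r2, hk]
            exact hp
        · rw [if_neg hq]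
          simp only [splitW]
          rw [if_neg]
          · simp
          · rintro ⟨-, h⟩
            exact hq h
    · rw [if_neg hk, if_neg hk, mul_zero]
  · have h1 : symF (splitOp w ε q 1 2 (deltaOne p)) ⟨n, k⟩ = 0 :=
      avg_eq_zero fun σ => hs n hn _
    have h2 : symF (ContinuousLinearMap.adjoint (delOp p M)
      (rawOp w ε 1 (1 + 1) (deltaOne q))) ⟨n, k⟩ = 0 := avg_eq_zero fun σ => ha n hn _
    rw [h1, h2]

end Spectators

section SecondChaos

variable {d : ℕ}

/-! ### The limit in the second chaos -/

/-- An approximate solution of the truncated generator equation is close to the solution. -/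
lemma norm_solOp_sub_le (hd : 3 ≤ d) (w : Fin d → ℝ) {ε : ℝ} (hε : 0 < ε) (i m : ℕ)
    (x W r : L2 (Idx d)) (h0 : ∀ k : Idx d, energy k.2 = 0 → W k = 0)
    (hW : ∀ k : Idx d, (energy k.2 : ℂ) * W k =
      (rawGen w ε (i + 1) m W + rawSrc w ε i x + r) k) :
    ∃ u : L2 (Idx d), invSqrtOp d u = W ∧ ‖solOp w ε i m x - u‖ ≤ ‖invSqrtOp d r‖ := by
  set z := rawGen w ε (i + 1) m W + rawSrc w ε i x + r
  have hu : invSqrtOp d (invSqrtOp d z) = W := by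
    ext k
    rw [invSqrtOp_apply, invSqrtOp_apply, ← hW]
    by_cases hk : energy k.2 = 0
    · rw [h0 k hk]; simp
    · have hE : 0 < energy k.2 := lt_of_le_of_ne (energy_nonneg _) (Ne.symm hk)
      rw [← mul_assoc, ← mul_assoc, ← Complex.ofReal_mul, ← Complex.ofReal_mul, ← mul_inv,
        Real.mul_self_sqrt hE.le, inv_mul_cancel₀ hE.ne', Complex.ofReal_one, one_mul]
  refine ⟨invSqrtOp d z, hu, ?_⟩
  have hT := adjoint_genOp w ε (i + 1) m
  refine (norm_le_norm_sub_skew hT _).trans (le_of_eq ?_)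
  have h1 : genOp w ε (i + 1) m (invSqrtOp d z) = invSqrtOp d (rawGen w ε (i + 1) m W) := by
    rw [genOp_eq hd w hε, hu]
  have h2 : solOp w ε i m x - genOp w ε (i + 1) m (solOp w ε i m x) =
      invSqrtOp d (rawSrc w ε i x) := resolvent_sub hT _
  rw [map_sub, h1, ← norm_neg]
  congr 1
  have h3 : invSqrtOp d z = invSqrtOp d (rawGen w ε (i + 1) m W) +
      invSqrtOp d (rawSrc w ε i x) + invSqrtOp d r := by rw [← map_add, ← map_add]
  rw [h3, ← h2]
  abel

/-- The solution with source `deltaOne p` in the first chaos. -/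
def solOne (w : Fin d → ℝ) (ε : ℝ) (m : ℕ) (p : Freq d) : L2 (Idx d) :=
  invSqrtOp d (solOp w ε 1 m (deltaOne p))

lemma isSymm_solOne (hd : 3 ≤ d) (w : Fin d → ℝ) {ε : ℝ} (hε : 0 < ε) (m : ℕ) (p : Freq d) :
    IsSymm (solOne w ε m p) := isSymm_invSqrt (isSymm_solOp hd w hε 1 m _)

/-- The error made when a spectator of momentum `q` is attached to `x`. -/
def attErr (w : Fin d → ℝ) (ε : ℝ) (m : ℕ) (q : Freq d) (x : L2 (Idx d)) : L2 (Idx d) :=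
  ((energy fun _ : Fin 1 => q : ℝ) : ℂ) • attOp q m x - symOp (splitOp w ε q 2 m x) +
    symOp (ContinuousLinearMap.adjoint (mergeOp w ε q 2 m) (symOp x))

/-- Attaching a spectator to the first-chaos solution gives an approximate solution in the presence
of the spectator. -/
lemma energy_mul_attOp_solOne (hd : 3 ≤ d) (w : Fin d → ℝ) {ε : ℝ} (hε : 0 < ε) {m : ℕ}
    (hm : 2 ≤ m) (p : Freq d) {q : Freq d} (hq : q ≠ 0) (k : Idx d) :
    (energy k.2 : ℂ) * attOp q m (solOne w ε m p) k =
      (rawGen w ε 3 (m + 1) (attOp q m (solOne w ε m p)) +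
        attOp q m (rawSrc w ε 1 (deltaOne p)) + attErr w ε m q (solOne w ε m p)) k := by
  have h1 := energy_attOp q m (x := solOne w ε m p)
    (energy_mul_invSqrt_solOp hd w hε hm (isSymm_deltaOne p)) k
  have h2 : rawGen w ε 3 (m + 1) (attOp q m (solOne w ε m p)) =
      attOp q m (rawGen w ε 2 m (solOne w ε m p)) + symOp (splitOp w ε q 2 m (solOne w ε m p)) -
        symOp (ContinuousLinearMap.adjoint (mergeOp w ε q 2 m) (symOp (solOne w ε m p))) :=
    rawGen_attOp w hε hq one_le_two le_rfl _
  have h3 : rawGen w ε 3 (m + 1) (attOp q m (solOne w ε m p)) +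
        attOp q m (rawSrc w ε 1 (deltaOne p)) + attErr w ε m q (solOne w ε m p) =
      attOp q m (rawGen w ε 2 m (solOne w ε m p) + rawSrc w ε 1 (deltaOne p)) +
        ((energy fun _ : Fin 1 => q : ℝ) : ℂ) • attOp q m (solOne w ε m p) := by
    rw [h2, attErr, map_add]
    abel
  rw [h3, h1]
  rfl

lemma norm_invSqrt_apply_le (x : L2 (Idx d)) : ‖invSqrtOp d x‖ ≤ 2 * ‖x‖ :=
  ((invSqrtOp d).le_opNorm x).trans (by gcongr; exact norm_invSqrtOp_le)

lemma norm_invSqrt_symOp_adjoint_mergeOp_le (hd : 3 ≤ d) (w : Fin d → ℝ) {ε : ℝ} (hε : ε ∈ scales)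
    (q : Freq d) (lo hi : ℕ) (x : L2 (Idx d)) :
    ‖invSqrtOp d (symOp (ContinuousLinearMap.adjoint (mergeOp w ε q lo hi) (symOp x)))‖ ≤
      mergeBound w hi * ‖x‖ := by
  have h1 : invSqrtOp d ∘L ContinuousLinearMap.adjoint (mergeOp w ε q lo hi) =
      ContinuousLinearMap.adjoint (mergeOp w ε q lo hi ∘L invSqrtOp d) := by
    rw [ContinuousLinearMap.adjoint_comp, adjoint_invSqrt]
  have h2 : ‖invSqrtOp d ∘L ContinuousLinearMap.adjoint (mergeOp w ε q lo hi)‖ ≤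
      mergeBound w hi := by
    rw [h1, LinearIsometryEquiv.norm_map]
    exact norm_mergeOp_invSqrt_le hd w hε q lo hi
  rw [← symOp_invSqrt]
  refine (norm_symOp_apply_le _).trans ?_
  refine ((invSqrtOp d ∘L ContinuousLinearMap.adjoint (mergeOp w ε q lo hi)).le_opNorm
    (symOp x)).trans ?_
  exact mul_le_mul h2 (norm_symOp_apply_le x) (norm_nonneg _) ((norm_nonneg _).trans h2)

/-- A bound for `attErr`. -/
def attErrBound (w : Fin d → ℝ) (m : ℕ) (q : Freq d) : ℝ :=
  2 * (energy (fun _ : Fin 1 => q) * √((m : ℝ) + 1)) + splitBound w q m + mergeBound w m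

/-- The error is controlled by the norm of `x` without the energy weight, which for the first-chaos
solution tends to zero. -/
lemma norm_invSqrt_attErr_le (hd : 3 ≤ d) (w : Fin d → ℝ) {ε : ℝ} (hε : ε ∈ scales) (m : ℕ)
    (q : Freq d) (x : L2 (Idx d)) :
    ‖invSqrtOp d (attErr w ε m q x)‖ ≤ attErrBound w m q * ‖x‖ := by
  have hE := energy_nonneg fun _ : Fin 1 => q
  have h1 : ‖invSqrtOp d (((energy fun _ : Fin 1 => q : ℝ) : ℂ) • attOp q m x)‖ ≤
      2 * (energy (fun _ : Fin 1 => q) * √((m : ℝ) + 1)) * ‖x‖ := by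
    refine (norm_invSqrt_apply_le _).trans ?_
    rw [norm_smul, Complex.norm_real, Real.norm_eq_abs, abs_of_nonneg hE, mul_assoc, mul_assoc]
    gcongr
    exact ((attOp q m).le_opNorm x).trans (by gcongr; exact norm_attOp_le q m)
  have h2 : ‖invSqrtOp d (symOp (splitOp w ε q 2 m x))‖ ≤ splitBound w q m * ‖x‖ := by
    rw [← symOp_invSqrt]
    refine (norm_symOp_apply_le _).trans
      (((invSqrtOp d ∘L splitOp w ε q 2 m).le_opNorm x).trans ?_)
    gcongr
    exact norm_invSqrt_splitOp_le hd w (scales_pos hε) q 2 m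
  have h3 := norm_invSqrt_symOp_adjoint_mergeOp_le hd w hε q 2 m x
  rw [attErr, map_add, map_sub, attErrBound, add_mul, add_mul]
  exact (norm_add_le _ _).trans (add_le_add ((norm_sub_le _ _).trans (add_le_add h1 h2)) h3)

/-- The two-particle vector with momenta `q` and `p`. -/
def pairVec (m : ℕ) (p q : Freq d) : L2 (Idx d) := attOp q m (deltaOne p)

open Classical in
lemma pairVec_eq {m : ℕ} (hm : 1 ≤ m) (p q : Freq d) :
    pairVec m p q = ((√2 : ℝ) : ℂ) • symOp (lp.single 2 ⟨2, ![q, p]⟩ (1 : ℂ)) := by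
  rw [pairVec, attOp_apply, ← map_smul]
  congr 1
  ext ⟨n, k⟩
  rw [lp.coeFn_smul, Pi.smul_apply, smul_eq_mul]
  match n, k with
  | 0, k =>
    rw [adjoint_delOp_zero, lp.single_apply_ne, mul_zero]
    intro h; simpa using congrArg Sigma.fst h
  | n + 1, k =>
    rw [adjoint_delOp_succ]
    by_cases hk : (⟨n + 1, k⟩ : Idx d) = ⟨2, ![q, p]⟩
    · have hn : n = 1 := by simpa using congrArg Sigma.fst hk
      subst hn
      have hk' : k = ![q, p] := by simpa using hk
      subst hk'
      have h1 : deltaOne p ⟨1, fun a : Fin 1 => (![q, p] : Fin 2 → Freq d) a.succ⟩ = 1 := by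
        rw [deltaOne_apply, if_pos]
        congr 1
        ext1 j
        obtain rfl : j = 0 := Fin.fin_one_eq_zero j
        rfl
      have h2 : delW d m ⟨1, fun a : Fin 1 => (![q, p] : Fin 2 → Freq d) a.succ⟩ =
          ((√2 : ℝ) : ℂ) := by
        simp only [delW, if_pos hm]
        norm_num
      rw [if_pos (show (![q, p] : Fin 2 → Freq d) 0 = q from rfl), h1, h2]
      have h3 : (lp.single 2 (⟨2, ![q, p]⟩ : Idx d) (1 : ℂ) : L2 (Idx d)) ⟨2, ![q, p]⟩ = 1 := by simp
      exact congrArg _ h3.symm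
    · rw [lp.single_apply_ne _ _ _ hk, mul_zero]
      split_ifs with h0
      · rw [deltaOne_apply, if_neg, mul_zero]
        intro h
        apply hk
        have hn : n = 1 := congrArg Sigma.fst h
        subst hn
        congr 1
        ext1 j
        refine Fin.cases h0 (fun j => ?_) j
        obtain rfl : j = 0 := Fin.fin_one_eq_zero j
        exact congrFun (eq_of_heq (Sigma.mk.inj h).2) 0
      · rfl

open Classical in
lemma symOp_single_swap (p q : Freq d) : symOp (lp.single 2 ⟨2, ![q, p]⟩ (1 : ℂ)) =
    symOp (lp.single 2 (⟨2, ![p, q]⟩ : Idx d) (1 : ℂ)) := by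
  rw [symOp_single, symOp_single]
  congr 1
  refine Fintype.sum_equiv (Equiv.mulLeft (Equiv.swap 0 1)) _ _ fun σ => ?_
  congr 2
  ext1 j
  simp only [Function.comp_apply, Equiv.coe_mulLeft, Equiv.Perm.coe_mul]
  generalize σ j = i
  fin_cases i <;> rfl

lemma pairVec_comm {m : ℕ} (hm : 1 ≤ m) (p q : Freq d) : pairVec m p q = pairVec m q p := by
  rw [pairVec_eq hm, pairVec_eq hm, symOp_single_swap]

open Classical in
lemma wcomp_symOp_single {f : Idx d → ℂ} {C : ℝ} (hC : FiberBound f id C) (hf : IsSymm f)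
    (x : Idx d) : wcomp f id (symOp (lp.single 2 x (1 : ℂ))) = f x • symOp (lp.single 2 x (1 : ℂ)) := by
  rw [← symOp_diag f hC hf, ← map_smul]
  congr 1
  ext y
  rw [wcomp_apply hC, lp.coeFn_smul, Pi.smul_apply, smul_eq_mul, id]
  by_cases h : y = x
  · rw [h]
  · rw [lp.single_apply_ne _ _ _ h, mul_zero, mul_zero]

lemma invSqrt_pairVec {m : ℕ} (hm : 1 ≤ m) (p q : Freq d) : invSqrtOp d (pairVec m p q) =
    (((√(energy ![q, p]))⁻¹ : ℝ) : ℂ) • pairVec m p q := by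
  classical
  rw [pairVec_eq hm, map_smul, invSqrtOp, wcomp_symOp_single fiberBound_invSqrt
    (fun n σ k => by simp only [energy_perm]), smul_comm]

lemma wSymbol_perm (w : Fin d → ℝ) {n : ℕ} (σ : Equiv.Perm (Fin n)) (k : Fin n → Freq d) :
    wSymbol w (k ∘ σ) = wSymbol w k := by
  unfold wSymbol
  rw [energy_perm]
  congr 2
  exact Equiv.sum_comp σ fun j => dot w (k j) ^ 2

lemma wSymbolOp_pairVec (w : Fin d → ℝ) {m : ℕ} (hm : 1 ≤ m) (p q : Freq d) :
    wSymbolOp w (pairVec m p q) = ((wSymbol w ![q, p] : ℝ) : ℂ) • pairVec m p q := by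
  classical
  rw [pairVec_eq hm, map_smul, wSymbolOp, wcomp_symOp_single (fiberBound_wSymbol w)
    (fun n σ k => by simp only [wSymbol_perm]), smul_comm]

lemma solOp_smul (w : Fin d → ℝ) (ε : ℝ) (i m : ℕ) (c : ℂ) (g : L2 (Idx d)) :
    solOp w ε i m (c • g) = c • solOp w ε i m g := by
  simp only [solOp, rawSrc, map_smul]

lemma invSqrt_deltaOne (p : Freq d) : invSqrtOp d (deltaOne p) =
    (((√(energy fun _ : Fin 1 => p))⁻¹ : ℝ) : ℂ) • deltaOne p := by
  classical
  rw [← symOp_deltaOne, deltaOne, invSqrtOp, wcomp_symOp_single fiberBound_invSqrt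
    (fun n σ k => by simp only [energy_perm])]

lemma solOp_deltaOne (hd : 3 ≤ d) (w : Fin d → ℝ) {ε : ℝ} (hε : 0 < ε) (m : ℕ) {p : Freq d}
    (hp : p ≠ 0) : solOp w ε 1 m (deltaOne p) =
      ((√(energy fun _ : Fin 1 => p) : ℝ) : ℂ) • resOp w ε 1 m (deltaOne p) := by
  have hE := Real.sqrt_pos.2 (energy_one_pos hp)
  rw [← solOp_invSqrt hd w hε, invSqrt_deltaOne, solOp_smul, smul_smul, ← Complex.ofReal_mul,
    mul_inv_cancel₀ hE.ne', Complex.ofReal_one, one_smul]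

lemma tendsto_solOne (hd : 3 ≤ d) (w : Fin d → ℝ) {m : ℕ} (hm : 2 ≤ m) {p : Freq d} (hp : p ≠ 0) :
    Tendsto (fun ε => ‖solOne w ε m p‖) (𝓝[scales] 0) (𝓝 0) := by
  have h := (tendsto_invSqrt_resOp_deltaOne hd w hm hp).const_mul
    ‖((√(energy fun _ : Fin 1 => p) : ℝ) : ℂ)‖
  rw [mul_zero] at h
  refine h.congr' ?_
  filter_upwards [eventually_scales] with ε hε
  rw [solOne, solOp_deltaOne hd w (scales_pos hε) m hp, map_smul, norm_smul]

/-- Annihilating the first-chaos solution gives back the mode, times the effective eigenvalue. -/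
lemma symOp_rawAnn_solOne (hd : 3 ≤ d) (w : Fin d → ℝ) {ε : ℝ} (hε : 0 < ε) (m : ℕ) {p : Freq d}
    (hp : p ≠ 0) : symOp (rawAnn w ε 1 2 (solOne w ε m p)) =
      (((1 / 2 * dot w p ^ 2 : ℝ) : ℂ) * diffusivity w ε m p) • deltaOne p := by
  have hE := energy_one_pos hp
  set a := symOp (rawAnn w ε 1 2 (solOne w ε m p)) with ha
  have h1 : invSqrtOp d a = ((√(energy fun _ : Fin 1 => p) : ℝ) : ℂ) •
      effOp w ε 1 m (deltaOne p) := by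
    have : invSqrtOp d a = symOp (annOp w ε 1 2 (solOp w ε 1 m (deltaOne p))) := by
      rw [annOp_eq hd w hε, ContinuousLinearMap.comp_apply, ContinuousLinearMap.comp_apply,
        symOp_invSqrt, ha, solOne]
    rw [this, solOp_deltaOne hd w hε m hp, map_smul, map_smul]
    rfl
  rw [effOp_deltaOne hd w hε, ← diffusivity, smul_smul] at h1
  have hsupp : Supported 1 1 a := fun x hx => by
    rw [ha, symOp_rawAnn_apply w hε]
    exact supported_rawAnn w ε 1 2 (isSymm_solOne hd w hε m p) x hx
  ext x
  by_cases hx : energy x.2 = 0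
  · rw [hsupp.zero_of_energy one_pos hx, lp.coeFn_smul, Pi.smul_apply, deltaOne_apply, if_neg]
    · simp
    · rintro rfl
      exact hE.ne' hx
  · have hx' : 0 < √(energy x.2) :=
      Real.sqrt_pos.2 (lt_of_le_of_ne (energy_nonneg _) (Ne.symm hx))
    have h2 := congrFun (congrArg (fun z : L2 (Idx d) => (z : Idx d → ℂ)) h1) x
    beta_reduce at h2
    rw [invSqrtOp_apply] at h2
    have h3 : a x = ((√(energy x.2) : ℝ) : ℂ) * ((((√(energy x.2))⁻¹ : ℝ) : ℂ) * a x) := by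
      rw [← mul_assoc, ← Complex.ofReal_mul, mul_inv_cancel₀ hx'.ne', Complex.ofReal_one, one_mul]
    rw [h3, h2, lp.coeFn_smul, Pi.smul_apply, lp.coeFn_smul, Pi.smul_apply, deltaOne_apply]
    split_ifs with h4
    · subst h4
      simp only [smul_eq_mul, mul_one]
      rw [← mul_assoc, ← mul_assoc, ← Complex.ofReal_mul, Real.mul_self_sqrt hE.le,
        ← Complex.ofReal_mul]
      congr 2
      unfold wSymbol
      rw [mul_div_cancel₀ _ hE.ne']
      simp
    · simp

end SecondChaos

section SecondChaosLimit

variable {d : ℕ}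

/-- The sum of the solutions in the first chaos with the respective other particle attached. -/
def pairSol (w : Fin d → ℝ) (ε : ℝ) (m : ℕ) (p q : Freq d) : L2 (Idx d) :=
  attOp q m (solOne w ε m p) + attOp p m (solOne w ε m q)

/-- A bound for the distance of `pairSol` to the solution with source `pairVec`. -/
def pairErr (w : Fin d → ℝ) (ε : ℝ) (m : ℕ) (p q : Freq d) : ℝ :=
  attErrBound w m q * ‖solOne w ε m p‖ + attErrBound w m p * ‖solOne w ε m q‖

lemma rawSrc_pairVec (w : Fin d → ℝ) {ε : ℝ} (hε : 0 < ε) {m : ℕ} (hm : 2 ≤ m) {p q : Freq d}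
    (hp : p ≠ 0) (hq : q ≠ 0) : rawSrc w ε 2 (pairVec m p q) =
      attOp q m (rawSrc w ε 1 (deltaOne p)) + attOp p m (rawSrc w ε 1 (deltaOne q)) := by
  have h : symOp (rawOp w ε (1 + 1) (2 + 1) (attOp q m (deltaOne p))) =
      attOp q m (symOp (rawOp w ε 1 2 (symOp (deltaOne p)))) +
        symOp (splitOp w ε q 1 2 (deltaOne p)) := rawOp_attOp w hε hq le_rfl hm (deltaOne p)
  rw [symOp_deltaOne, symOp_splitOp_deltaOne w hε hp q hm] at h
  exact h

/-- The sum of the two attached solutions is close, in the energy norm, to the solution generated by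
the pair. -/
lemma exists_near_solOp_pairVec (hd : 3 ≤ d) (w : Fin d → ℝ) {ε : ℝ} (hε : ε ∈ scales) {m : ℕ}
    (hm : 2 ≤ m) {p q : Freq d} (hp : p ≠ 0) (hq : q ≠ 0) :
    ∃ u : L2 (Idx d), invSqrtOp d u = pairSol w ε m p q ∧
      ‖solOp w ε 2 (m + 1) (pairVec m p q) - u‖ ≤ pairErr w ε m p q := by
  have hε0 := scales_pos hε
  obtain ⟨u, hu, h⟩ := norm_solOp_sub_le hd w hε0 2 (m + 1) (pairVec m p q) (pairSol w ε m p q)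
    (attErr w ε m q (solOne w ε m p) + attErr w ε m p (solOne w ε m q))
    (fun k hk => by
      rw [pairSol, lp.coeFn_add, Pi.add_apply, attOp_of_energy_zero hq m _ hk,
        attOp_of_energy_zero hp m _ hk, add_zero])
    (fun k => by
      have h1 := energy_mul_attOp_solOne hd w hε0 hm p hq k
      have h2 := energy_mul_attOp_solOne hd w hε0 hm q hp k
      have h3 : rawGen w ε (2 + 1) (m + 1) (pairSol w ε m p q) + rawSrc w ε 2 (pairVec m p q) +
          (attErr w ε m q (solOne w ε m p) + attErr w ε m p (solOne w ε m q)) =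
          (rawGen w ε 3 (m + 1) (attOp q m (solOne w ε m p)) +
            attOp q m (rawSrc w ε 1 (deltaOne p)) + attErr w ε m q (solOne w ε m p)) +
          (rawGen w ε 3 (m + 1) (attOp p m (solOne w ε m q)) +
            attOp p m (rawSrc w ε 1 (deltaOne q)) + attErr w ε m p (solOne w ε m q)) := by
        rw [rawSrc_pairVec w hε0 hm hp hq, pairSol, map_add]
        abel
      rw [h3, lp.coeFn_add, Pi.add_apply, ← h1, ← h2, pairSol, lp.coeFn_add, Pi.add_apply, mul_add])
  refine ⟨u, hu, h.trans ?_⟩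
  rw [map_add]
  exact (norm_add_le _ _).trans (add_le_add (norm_invSqrt_attErr_le hd w hε m q _)
    (norm_invSqrt_attErr_le hd w hε m p _))

lemma tendsto_pairErr (hd : 3 ≤ d) (w : Fin d → ℝ) {m : ℕ} (hm : 2 ≤ m) {p q : Freq d}
    (hp : p ≠ 0) (hq : q ≠ 0) :
    Tendsto (fun ε => pairErr w ε m p q) (𝓝[scales] 0) (𝓝 0) := by
  unfold pairErr
  simpa using ((tendsto_solOne hd w hm hp).const_mul (attErrBound w m q)).add
    ((tendsto_solOne hd w hm hq).const_mul (attErrBound w m p))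

lemma resOp_pairVec (hd : 3 ≤ d) (w : Fin d → ℝ) {ε : ℝ} (hε : 0 < ε) {m : ℕ} (hm : 1 ≤ m) (M : ℕ)
    (p q : Freq d) : resOp w ε 2 M (pairVec m p q) =
      (((√(energy ![q, p]))⁻¹ : ℝ) : ℂ) • solOp w ε 2 M (pairVec m p q) := by
  rw [← solOp_invSqrt hd w hε, invSqrt_pairVec hm, solOp_smul]

lemma norm_attOp_apply_le (q : Freq d) (m : ℕ) (x : L2 (Idx d)) :
    ‖attOp q m x‖ ≤ √((m : ℝ) + 1) * ‖x‖ :=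
  ((attOp q m).le_opNorm x).trans (by gcongr; exact norm_attOp_le q m)

/-- Annihilation of `pairSol` into the second chaos. -/
lemma symOp_rawAnn_pairSol (hd : 3 ≤ d) (w : Fin d → ℝ) {ε : ℝ} (hε : 0 < ε) {m : ℕ} (hm : 2 ≤ m)
    {p q : Freq d} (hp : p ≠ 0) (hq : q ≠ 0) :
    symOp (rawAnn w ε 2 3 (pairSol w ε m p q)) =
      (((1 / 2 * dot w p ^ 2 : ℝ) : ℂ) * diffusivity w ε m p +
        ((1 / 2 * dot w q ^ 2 : ℝ) : ℂ) * diffusivity w ε m q) • pairVec m p q +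
      (symOp (ContinuousLinearMap.adjoint (mergeOp w ε q 1 2) (symOp (solOne w ε m p))) +
        symOp (ContinuousLinearMap.adjoint (mergeOp w ε p 1 2) (symOp (solOne w ε m q)))) := by
  have h : ∀ p q : Freq d, p ≠ 0 → q ≠ 0 → symOp (rawAnn w ε 2 3 (attOp q m (solOne w ε m p))) =
      (((1 / 2 * dot w p ^ 2 : ℝ) : ℂ) * diffusivity w ε m p) • pairVec m p q +
      symOp (ContinuousLinearMap.adjoint (mergeOp w ε q 1 2) (symOp (solOne w ε m p))) := by
    intro p q hp hq
    have h1 : symOp (rawAnn w ε 2 3 (attOp q m (solOne w ε m p))) =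
      attOp q m (symOp (rawAnn w ε 1 2 (symOp (solOne w ε m p)))) +
        symOp (ContinuousLinearMap.adjoint (mergeOp w ε q 1 2) (symOp (solOne w ε m p))) :=
      rawAnn_attOp w hε hq le_rfl hm _
    rw [h1, symOp_of_isSymm (isSymm_solOne hd w hε m p), symOp_rawAnn_solOne hd w hε m hp, map_smul]
    rfl
  rw [pairSol, map_add, map_add, h p q hp hq, h q p hq hp, pairVec_comm (by omega) q p, add_smul]
  abel

lemma wSymbol_pair (w : Fin d → ℝ) (p q : Freq d) : wSymbol w ![q, p] =
    (1 / 2 * dot w p ^ 2 + 1 / 2 * dot w q ^ 2) / energy ![q, p] := by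
  unfold wSymbol
  congr 1
  simp [Fin.sum_univ_two]
  ring

lemma energy_pair_pos {p q : Freq d} (hq : q ≠ 0) : 0 < energy ![q, p] :=
  energy_pos (j := (0 : Fin 2)) hq

/-- On a pair of modes the effective operator acts as the sum of the two one-particle operators. -/
lemma tendsto_defectOp_pairVec (hd : 3 ≤ d) (w : Fin d → ℝ) {D : ℝ} {m : ℕ} (hm : 2 ≤ m)
    (hD : ∀ K : Freq d, K ≠ 0 → Tendsto (fun ε => diffusivity w ε m K) (𝓝[scales] 0) (𝓝 (D : ℂ)))
    {p q : Freq d} (hp : p ≠ 0) (hq : q ≠ 0) :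
    Tendsto (fun ε => ‖defectOp w D ε 2 (m + 1) (pairVec m p q)‖) (𝓝[scales] 0) (𝓝 0) := by
  set s : ℝ := (√(energy ![q, p]))⁻¹ with hs
  have hE : 0 < energy ![q, p] := energy_pair_pos hq
  have hs0 : 0 ≤ s := by positivity
  have hs2 : s * s = (energy ![q, p])⁻¹ := by rw [hs, ← mul_inv, Real.mul_self_sqrt hE.le]
  set a : ℝ := 1 / 2 * dot w p ^ 2
  set b : ℝ := 1 / 2 * dot w q ^ 2
  -- The three sources of error: the solution is only approximated, the spectator merges when the
  -- approximate solution is annihilated, and the two eigenvalues differ from their limits.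
  set B : ℝ → ℝ := fun ε => s * (creBound w 3 * pairErr w ε m p q +
      (mergeBound w 2 * ‖solOne w ε m p‖ + mergeBound w 2 * ‖solOne w ε m q‖)) +
    s * s * (a * ‖diffusivity w ε m p - D‖ + b * ‖diffusivity w ε m q - D‖) * ‖pairVec m p q‖
  have hB : Tendsto B (𝓝[scales] 0) (𝓝 0) := by
    have h1 := (tendsto_pairErr hd w hm hp hq).const_mul (creBound w 3)
    have h2 := (tendsto_solOne hd w hm hp).const_mul (mergeBound w 2)
    have h3 := (tendsto_solOne hd w hm hq).const_mul (mergeBound w 2)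
    have h4 := ((hD p hp).sub_const (D : ℂ)).norm.const_mul a
    have h5 := ((hD q hq).sub_const (D : ℂ)).norm.const_mul b
    have := ((h1.add (h2.add h3)).const_mul s).add
      (((h4.add h5).const_mul (s * s)).mul_const ‖pairVec m p q‖)
    simpa using this
  refine squeeze_zero' (Eventually.of_forall fun ε => norm_nonneg _) ?_ hB
  filter_upwards [eventually_scales] with ε hε
  have hε0 := scales_pos hε
  obtain ⟨u, hu, herr⟩ := exists_near_solOp_pairVec hd w hε hm hp hq
  set v := solOp w ε 2 (m + 1) (pairVec m p q) with hv
  set R := symOp (ContinuousLinearMap.adjoint (mergeOp w ε q 1 2) (symOp (solOne w ε m p))) with hR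
  set R' := symOp (ContinuousLinearMap.adjoint (mergeOp w ε p 1 2) (symOp (solOne w ε m q))) with hR'
  have h1 : symOp (annOp w ε 2 3 u) = (s : ℂ) • ((a : ℂ) * diffusivity w ε m p +
      (b : ℂ) * diffusivity w ε m q) • pairVec m p q + (invSqrtOp d R + invSqrtOp d R') := by
    rw [annOp_eq hd w hε0, ContinuousLinearMap.comp_apply, ContinuousLinearMap.comp_apply,
      symOp_invSqrt, hu, symOp_rawAnn_pairSol hd w hε0 hm hp hq, map_add, map_add, map_smul,
      invSqrt_pairVec (by omega), smul_comm]
  have h2 : effOp w ε 2 (m + 1) (pairVec m p q) = (s : ℂ) • symOp (annOp w ε 2 3 v) := by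
    simp only [effOp, ContinuousLinearMap.comp_apply]
    rw [resOp_pairVec hd w hε0 (by omega), map_smul, map_smul]
  have h3 : defectOp w D ε 2 (m + 1) (pairVec m p q) =
      (s : ℂ) • (symOp (annOp w ε 2 3 (v - u)) + (invSqrtOp d R + invSqrtOp d R')) +
      (((s * s : ℝ) : ℂ) * ((a : ℂ) * (diffusivity w ε m p - D) +
        (b : ℂ) * (diffusivity w ε m q - D))) • pairVec m p q := by
    have h4 : symOp (annOp w ε 2 3 v) = symOp (annOp w ε 2 3 (v - u)) +
        symOp (annOp w ε 2 3 u) := by rw [← map_add, ← map_add, sub_add_cancel]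
    rw [defectOp, sub_apply, smul_apply, h2, h4, h1, wSymbolOp_pairVec w (by omega), wSymbol_pair,
      div_eq_mul_inv, ← hs2]
    simp only [smul_add, smul_smul]
    have h6 : ((s * s : ℝ) : ℂ) * ((a : ℂ) * (diffusivity w ε m p - D) +
        (b : ℂ) * (diffusivity w ε m q - D)) = (s : ℂ) * ((s : ℂ) * ((a : ℂ) * diffusivity w ε m p +
      (b : ℂ) * diffusivity w ε m q)) - (D : ℂ) * (((a + b) * (s * s) : ℝ) : ℂ) := by
      push_cast; ring
    rw [h6, sub_smul]
    abel
  rw [h3]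
  refine (norm_add_le _ _).trans (add_le_add ?_ ?_)
  · rw [norm_smul, Complex.norm_real, Real.norm_eq_abs, abs_of_nonneg hs0]
    gcongr
    refine (norm_add_le _ _).trans (add_le_add ?_ ((norm_add_le _ _).trans (add_le_add ?_ ?_)))
    · refine (norm_symOp_apply_le _).trans (((annOp w ε 2 3).le_opNorm _).trans ?_)
      exact mul_le_mul (norm_annOp_le hd w hε0 2 3) herr (norm_nonneg _) (Real.sqrt_nonneg _)
    · exact norm_invSqrt_symOp_adjoint_mergeOp_le hd w hε q 1 2 _
    · exact norm_invSqrt_symOp_adjoint_mergeOp_le hd w hε p 1 2 _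
  · rw [norm_smul, norm_mul, Complex.norm_real, Real.norm_eq_abs, abs_of_nonneg (by positivity)]
    gcongr
    refine (norm_add_le _ _).trans (le_of_eq ?_)
    rw [norm_mul, norm_mul, Complex.norm_real, Complex.norm_real, Real.norm_eq_abs,
      Real.norm_eq_abs, abs_of_nonneg (by positivity : 0 ≤ a), abs_of_nonneg (by positivity : 0 ≤ b)]

lemma tendsto_invSqrt_resOp_pairVec (hd : 3 ≤ d) (w : Fin d → ℝ) {m : ℕ} (hm : 2 ≤ m)
    {p q : Freq d} (hp : p ≠ 0) (hq : q ≠ 0) :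
    Tendsto (fun ε => ‖invSqrtOp d (resOp w ε 2 (m + 1) (pairVec m p q))‖)
      (𝓝[scales] 0) (𝓝 0) := by
  set s : ℝ := (√(energy ![q, p]))⁻¹ with hs
  have hs0 : 0 ≤ s := by positivity
  have hB : Tendsto (fun ε => s * (2 * pairErr w ε m p q + (√((m : ℝ) + 1) * ‖solOne w ε m p‖ +
      √((m : ℝ) + 1) * ‖solOne w ε m q‖))) (𝓝[scales] 0) (𝓝 0) := by
    simpa using (((tendsto_pairErr hd w hm hp hq).const_mul 2).add
      (((tendsto_solOne hd w hm hp).const_mul √((m : ℝ) + 1)).add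
        ((tendsto_solOne hd w hm hq).const_mul √((m : ℝ) + 1)))).const_mul s
  refine squeeze_zero' (Eventually.of_forall fun ε => norm_nonneg _) ?_ hB
  filter_upwards [eventually_scales] with ε hε
  have hε0 := scales_pos hε
  obtain ⟨u, hu, herr⟩ := exists_near_solOp_pairVec hd w hε hm hp hq
  rw [resOp_pairVec hd w hε0 (by omega), map_smul, norm_smul, Complex.norm_real, Real.norm_eq_abs,
    abs_of_nonneg hs0]
  gcongr
  rw [← sub_add_cancel (solOp w ε 2 (m + 1) (pairVec m p q)) u, map_add, hu, pairSol]
  refine (norm_add_le _ _).trans (add_le_add ((norm_invSqrt_apply_le _).trans (by gcongr))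
    ((norm_add_le _ _).trans (add_le_add (norm_attOp_apply_le q m _) (norm_attOp_apply_le p m _))))

open Classical in
lemma symOp_single_two {m : ℕ} (hm : 1 ≤ m) (k : Fin 2 → Freq d) :
    symOp (lp.single 2 ⟨2, k⟩ (1 : ℂ)) = (((√2)⁻¹ : ℝ) : ℂ) • pairVec m (k 1) (k 0) := by
  have hk : k = ![k 0, k 1] := by
    ext1 j
    fin_cases j <;> rfl
  rw [pairVec_eq hm, smul_smul, ← Complex.ofReal_mul, inv_mul_cancel₀ (by positivity),
    Complex.ofReal_one, one_smul, ← hk]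

/-- The limit of the effective operator on all sources in the second chaos. -/
lemma tendsto_defectOp_two (hd : 3 ≤ d) (w : Fin d → ℝ) {D : ℝ} {m : ℕ} (hm : 2 ≤ m)
    (hD : ∀ K : Freq d, K ≠ 0 → Tendsto (fun ε => diffusivity w ε m K) (𝓝[scales] 0) (𝓝 (D : ℂ)))
    {g : L2 (Idx d)} (hs : IsSymm g) (hg : Supported 2 2 g) :
    Tendsto (fun ε => ‖defectOp w D ε 2 (m + 1) g‖) (𝓝[scales] 0) (𝓝 0) := by
  classical
  refine tendsto_zero_of_basis (fun ε hε => norm_defectOp_le hd w D (scales_pos hε) 2 (m + 1))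
    (fun k hk => ?_) hs hg
  rw [symOp_single_two (m := m) (by omega)]
  simp only [map_smul, norm_smul]
  simpa using (tendsto_defectOp_pairVec hd w hm hD (hk 1) (hk 0)).const_mul
    ‖(((√2)⁻¹ : ℝ) : ℂ)‖

lemma tendsto_invSqrt_resOp_two (hd : 3 ≤ d) (w : Fin d → ℝ) {m : ℕ} (hm : 2 ≤ m)
    {g : L2 (Idx d)} (hs : IsSymm g) (hg : Supported 2 2 g) :
    Tendsto (fun ε => ‖invSqrtOp d (resOp w ε 2 (m + 1) g)‖) (𝓝[scales] 0) (𝓝 0) := by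
  classical
  refine tendsto_zero_of_basis (Y := fun ε => invSqrtOp d ∘L resOp w ε 2 (m + 1))
    (fun ε hε => norm_invSqrt_resOp_le hd w (scales_pos hε) 2 (m + 1)) (fun k hk => ?_) hs hg
  rw [symOp_single_two (m := m) (by omega)]
  simp only [map_smul, norm_smul]
  simpa using (tendsto_invSqrt_resOp_pairVec hd w hm (hk 1) (hk 0)).const_mul
    ‖(((√2)⁻¹ : ℝ) : ℂ)‖

end SecondChaosLimit

section TestFunctions

variable {d : ℕ}

/-! ### Fourier coefficients of test functions -/

/-- The fundamental domain of the torus. -/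
def cube (d : ℕ) : Set (Fin d → ℝ) := Set.univ.pi fun _ : Fin d => Set.Ioc 0 (2 * Real.pi)

/-- The Fourier coefficient of a function of one torus variable. -/
def coeffOne (φ : (Fin d → ℝ) → ℂ) (k : Freq d) : ℂ := ∫ x in cube d, φ x * fourierBasis (-k) x

lemma cube_ae_eq : cube d =ᵐ[volume] Set.Icc (fun _ => 0) fun _ => 2 * Real.pi := by
  rw [cube, volume_pi]
  exact Measure.univ_pi_Ioc_ae_eq_Icc

lemma volume_cube : volume (cube d) = ENNReal.ofReal (2 * Real.pi) ^ d := by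
  simp [cube, volume_pi_pi]

lemma integrableOn_cube {φ : (Fin d → ℝ) → ℂ} (h : Continuous φ) : IntegrableOn φ (cube d) :=
  (integrableOn_congr_set_ae cube_ae_eq).2 (h.continuousOn.integrableOn_compact isCompact_Icc)

lemma contDiff_fourierBasis (k : Freq d) : ContDiff ℝ ∞ (fourierBasis k) := by
  unfold fourierBasis
  refine contDiff_const.mul (Complex.contDiff_exp.comp ?_)
  have h : ContDiff ℝ ∞ fun x : Fin d → ℝ => ∑ a, (k a : ℝ) * x a := by fun_prop
  exact contDiff_const.mul (Complex.ofRealCLM.contDiff.comp h)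

lemma isTorusTest_fourierBasis (k : Freq d) : IsTorusTest (fourierBasis k) := by
  refine ⟨contDiff_fourierBasis k, fun x m => ?_⟩
  unfold fourierBasis
  congr 1
  have h : ((∑ a, (k a : ℝ) * (x a + 2 * Real.pi * (m a : ℝ)) : ℝ) : ℂ) =
      ((∑ a, (k a : ℝ) * x a : ℝ) : ℂ) + ((∑ a, k a * m a : ℤ) : ℂ) * (2 * Real.pi) := by
    rw [← Complex.ofReal_intCast]
    push_cast
    rw [Finset.sum_mul, ← Finset.sum_add_distrib]
    exact Finset.sum_congr rfl fun a _ => by ring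
  rw [h, mul_add, Complex.exp_add]
  have h2 : Complex.I * (((∑ a, k a * m a : ℤ) : ℂ) * (2 * Real.pi)) =
      ((∑ a, k a * m a : ℤ) : ℂ) * (2 * Real.pi * Complex.I) := by ring
  rw [h2, Complex.exp_int_mul_two_pi_mul_I, mul_one]

lemma norm_fourierBasis (k : Freq d) (x : Fin d → ℝ) :
    ‖fourierBasis k x‖ = (2 * Real.pi) ^ (-(d : ℝ) / 2) := by
  unfold fourierBasis
  rw [norm_mul, mul_comm Complex.I, Complex.norm_exp_ofReal_mul_I, mul_one, Complex.norm_real,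
    Real.norm_eq_abs, abs_of_nonneg (by positivity)]

lemma fderiv_fourierBasis (k : Freq d) (x : Fin d → ℝ) (a : Fin d) :
    fderiv ℝ (fourierBasis k) x (Pi.single a 1) = Complex.I * (k a : ℂ) * fourierBasis k x := by
  have h0 : HasFDerivAt (fun x : Fin d → ℝ => ∑ b, (k b : ℝ) * x b)
      (∑ b, (k b : ℝ) • ContinuousLinearMap.proj (R := ℝ) b) x :=
    HasFDerivAt.fun_sum fun b _ => (hasFDerivAt_apply b x).const_mul (k b : ℝ)
  have h1 := ((((Complex.ofRealCLM.hasFDerivAt (x := ∑ b, (k b : ℝ) * x b)).comp x h0).const_mul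
    Complex.I).cexp).const_mul ((((2 * Real.pi) ^ (-(d : ℝ) / 2) : ℝ) : ℂ))
  have h2 : HasFDerivAt (fourierBasis k) _ x := h1
  rw [h2.fderiv]
  simp [fourierBasis, Pi.single_apply]
  ring

/-- A smooth periodic function has a smooth periodic partial derivative. -/
lemma IsTorusTest.deriv {φ : (Fin d → ℝ) → ℂ} (h : IsTorusTest φ) (a : Fin d) :
    IsTorusTest fun x => fderiv ℝ φ x (Pi.single a 1) := by
  refine ⟨(h.1.fderiv_right (m := ∞) (by simp)).clm_apply contDiff_const, fun x m => ?_⟩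
  have e : φ = fun x => φ (x + fun a => 2 * Real.pi * (m a : ℝ)) := funext fun x => (h.2 x m).symm
  change fderiv ℝ φ (x + fun a => 2 * Real.pi * (m a : ℝ)) _ = fderiv ℝ φ x _
  conv_rhs => rw [e]
  rw [fderiv_comp_add_right]

lemma IsTorusTest.mul {φ ψ : (Fin d → ℝ) → ℂ} (h : IsTorusTest φ) (h' : IsTorusTest ψ) :
    IsTorusTest fun x => φ x * ψ x :=
  ⟨h.1.mul h'.1, fun x m => by beta_reduce; rw [h.2, h'.2]⟩

/-- The integral of a derivative over the torus vanishes. -/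
lemma IsTorusTest.integral_deriv {φ : (Fin d → ℝ) → ℂ} (h : IsTorusTest φ) (a : Fin d) :
    ∫ x in cube d, fderiv ℝ φ x (Pi.single a 1) = 0 := by
  classical
  rw [setIntegral_congr_set cube_ae_eq]
  match d, a with
  | n + 1, a =>
    have hc : Continuous fun x => fderiv ℝ φ x (Pi.single a 1) := (h.deriv a).1.continuous
    have hdf : Differentiable ℝ φ := h.1.differentiable (by simp)
    -- The divergence theorem for the field `φ e_a`; opposite faces cancel by periodicity.
    have key := integral_divergence_of_hasFDerivAt_off_countable' (E := ℂ)
      (fun _ : Fin (n + 1) => (0 : ℝ)) (fun _ => 2 * Real.pi) (fun _ => by positivity)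
      (fun i x => if i = a then φ x else 0) (fun i x => if i = a then fderiv ℝ φ x else 0) ∅
      Set.countable_empty (fun i => ?_) (fun x _ i => ?_) ?_
    · have e : ∀ x : Fin (n + 1) → ℝ,
          ∑ i, (if i = a then fderiv ℝ φ x else 0) (Pi.single i 1) =
            fderiv ℝ φ x (Pi.single a 1) := fun x => by
        rw [Finset.sum_eq_single a]
        · rw [if_pos rfl]
        · intro b _ hb
          rw [if_neg hb]; rfl
        · simp
      simp only [e] at key
      rw [key]
      refine Finset.sum_eq_zero fun i _ => ?_
      by_cases hi : i = a
      · simp only [if_pos hi]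
        rw [sub_eq_zero]
        congr 1
        ext1 x
        rw [← h.2 (i.insertNth 0 x) (Pi.single i 1)]
        congr 1
        ext1 j
        refine Fin.succAboveCases i ?_ (fun j => ?_) j
        · simp
        · simp
      · simp [if_neg hi]
    · split_ifs
      · exact h.1.continuous.continuousOn
      · exact continuousOn_const
    · split_ifs
      · exact (hdf x).hasFDerivAt
      · exact hasFDerivAt_const 0 x
    · have e : (fun x : Fin (n + 1) → ℝ =>
          ∑ i, (if i = a then fderiv ℝ φ x else 0) (Pi.single i 1)) =
            fun x => fderiv ℝ φ x (Pi.single a 1) := by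
        ext1 x
        rw [Finset.sum_eq_single a]
        · rw [if_pos rfl]
        · intro b _ hb
          rw [if_neg hb]; rfl
        · simp
      rw [e]
      exact hc.continuousOn.integrableOn_compact isCompact_Icc

/-- Differentiation becomes multiplication by the frequency. -/
lemma IsTorusTest.coeffOne_deriv {φ : (Fin d → ℝ) → ℂ} (h : IsTorusTest φ) (a : Fin d)
    (k : Freq d) :
    coeffOne (fun x => fderiv ℝ φ x (Pi.single a 1)) k = Complex.I * (k a : ℂ) * coeffOne φ k := by
  have hb := isTorusTest_fourierBasis (-k)
  have h1 := (h.mul hb).integral_deriv a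
  have h2 : ∀ x, fderiv ℝ (fun x => φ x * fourierBasis (-k) x) x (Pi.single a 1) =
      fderiv ℝ φ x (Pi.single a 1) * fourierBasis (-k) x -
        Complex.I * (k a : ℂ) * (φ x * fourierBasis (-k) x) := fun x => by
    rw [fderiv_fun_mul (h.1.differentiable (by simp) x) (hb.1.differentiable (by simp) x)]
    simp only [add_apply, smul_apply, fderiv_fourierBasis, smul_eq_mul, Pi.neg_apply]
    push_cast
    ring
  simp only [h2] at h1
  rw [integral_sub, integral_const_mul, sub_eq_zero] at h1
  · exact h1
  · exact integrableOn_cube ((h.deriv a).mul hb).1.continuous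
  · exact (integrableOn_cube (h.mul hb).1.continuous).const_mul _

lemma exists_coeffOne_le (φ : (Fin d → ℝ) → ℂ) :
    ∃ C, ∀ k, ‖coeffOne φ k‖ ≤ C := by
  refine ⟨∫ x in cube d, ‖φ x‖ * (2 * Real.pi) ^ (-(d : ℝ) / 2), fun k => ?_⟩
  refine (norm_integral_le_integral_norm _).trans (le_of_eq ?_)
  simp only [norm_mul, norm_fourierBasis]

lemma IsTorusTest.exists_pow_mul_coeffOne_le (a : Fin d) (N : ℕ) {φ : (Fin d → ℝ) → ℂ}
    (h : IsTorusTest φ) : ∃ C, ∀ k : Freq d, |(k a : ℝ)| ^ N * ‖coeffOne φ k‖ ≤ C := by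
  induction N generalizing φ with
  | zero => simpa using exists_coeffOne_le φ
  | succ N ih =>
    obtain ⟨C, hC⟩ := ih (h.deriv a)
    refine ⟨C, fun k => ?_⟩
    have := hC k
    rw [h.coeffOne_deriv, norm_mul, norm_mul, Complex.norm_I, one_mul, Complex.norm_intCast] at this
    rwa [pow_succ, mul_assoc]

/-- The Fourier coefficients of a test function decay faster than every power. -/
lemma IsTorusTest.exists_decay (N : ℕ) {φ : (Fin d → ℝ) → ℂ} (h : IsTorusTest φ) :
    ∃ C, ∀ k : Freq d, (1 + ‖k‖) ^ N * ‖coeffOne φ k‖ ≤ C := by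
  obtain ⟨C0, hC0⟩ := exists_coeffOne_le φ
  choose C hC using fun a => h.exists_pow_mul_coeffOne_le a N
  have hC' : ∀ a, 0 ≤ C a := fun a => le_trans (by positivity) (hC a 0)
  refine ⟨2 ^ N * (C0 + ∑ a, C a), fun k => ?_⟩
  have hs : ∀ a, C a ≤ ∑ a, C a := fun a =>
    Finset.single_le_sum (fun a _ => hC' a) (Finset.mem_univ a)
  have hs0 : 0 ≤ ∑ a, C a := Finset.sum_nonneg fun a _ => hC' a
  have h0 : 0 ≤ C0 := (norm_nonneg _).trans (hC0 0)
  by_cases hk : ‖k‖ ≤ 1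
  · calc _ ≤ 2 ^ N * C0 := by
          gcongr
          · linarith
          · exact hC0 k
      _ ≤ _ := by gcongr; linarith
  · push Not at hk
    obtain ⟨a, ha⟩ : ∃ a, ‖k‖ = |(k a : ℝ)| := by
      have : Nonempty (Fin d) := by
        by_contra hne
        rw [not_nonempty_iff] at hne
        have : k = 0 := Subsingleton.elim _ _
        rw [this, norm_zero] at hk
        linarith
      obtain ⟨a, ha⟩ := Finite.exists_max fun a => ‖k a‖
      refine ⟨a, le_antisymm ?_ ?_⟩
      · rw [pi_norm_le_iff_of_nonneg (abs_nonneg _)]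
        intro b
        rw [← Int.norm_eq_abs]
        exact ha b
      · rw [← Int.norm_eq_abs]
        exact norm_le_pi_norm k a
    calc (1 + ‖k‖) ^ N * ‖coeffOne φ k‖ ≤ (2 * ‖k‖) ^ N * ‖coeffOne φ k‖ := by
          gcongr; linarith
      _ = 2 ^ N * (|(k a : ℝ)| ^ N * ‖coeffOne φ k‖) := by rw [mul_pow, ha, mul_assoc]
      _ ≤ 2 ^ N * (C0 + ∑ a, C a) := by
          gcongr
          exact (hC a k).trans ((hs a).trans (by linarith))

/-! ### Summability on lattices -/

/-- Fubini for products over finitely many lattice variables. -/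
lemma tsum_pi_prod {α : Type*} (H : α → ℝ≥0∞) (n : ℕ) :
    ∑' k : Fin n → α, ∏ j, H (k j) = (∑' a, H a) ^ n := by
  induction n with
  | zero =>
    rw [tsum_eq_single (fun a => a.elim0 : Fin 0 → α) fun b hb => absurd (Subsingleton.elim _ _) hb]
    simp
  | succ n ih =>
    rw [← (Fin.consEquiv fun _ : Fin (n + 1) => α).tsum_eq, ENNReal.tsum_prod', pow_succ', ← ih,
      ← ENNReal.tsum_mul_right]
    refine tsum_congr fun a => ?_
    rw [← ENNReal.tsum_mul_left]
    refine tsum_congr fun k => ?_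
    simp [Fin.prod_univ_succ, Fin.consEquiv]

/-- A summable weight on the frequencies. -/
def decay (k : Freq d) : ℝ := ∏ a, (1 + (k a : ℝ) ^ 2)⁻¹

lemma decay_pos (k : Freq d) : 0 < decay k := Finset.prod_pos fun a _ => by positivity

lemma summable_inv_one_add_sq : Summable fun n : ℤ => (1 + (n : ℝ) ^ 2)⁻¹ := by
  classical
  have h : Summable fun n : ℤ => 1 / (n : ℝ) ^ 2 + if n = 0 then (1 : ℝ) else 0 :=
    (Real.summable_one_div_int_pow.2 one_lt_two).add
      (summable_of_ne_finset_zero (s := {0}) fun n hn => if_neg (by simpa using hn))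
  refine h.of_nonneg_of_le (fun n => by positivity) fun n => ?_
  by_cases hn : n = 0
  · simp [hn]
  · have : (0 : ℝ) < (n : ℝ) ^ 2 := by positivity
    rw [if_neg hn, add_zero, one_div]
    gcongr
    linarith

lemma tsum_decay_ne_top : ∑' k : Freq d, ENNReal.ofReal (decay k) ≠ ⊤ := by
  have h : ∀ k : Freq d, ENNReal.ofReal (decay k) =
      ∏ a, ENNReal.ofReal ((1 + (k a : ℝ) ^ 2)⁻¹) := fun k =>
    ENNReal.ofReal_prod_of_nonneg fun a _ => by positivity
  simp_rw [h]
  rw [tsum_pi_prod (fun n : ℤ => ENNReal.ofReal ((1 + (n : ℝ) ^ 2)⁻¹)) d]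
  exact ENNReal.pow_ne_top summable_inv_one_add_sq.tsum_ofReal_ne_top

lemma one_le_mul_decay (k : Freq d) : 1 ≤ (1 + ‖k‖) ^ (2 * d) * decay k := by
  have h : ∏ _a : Fin d, (1 + ‖k‖) ^ 2 = (1 + ‖k‖) ^ (2 * d) := by
    rw [Finset.prod_const, Finset.card_fin, pow_mul]
  rw [← h, decay, ← Finset.prod_mul_distrib]
  refine Finset.one_le_prod fun a _ => ?_
  have h1 : |(k a : ℝ)| ≤ ‖k‖ := by
    rw [← Int.norm_eq_abs]
    exact norm_le_pi_norm k a
  have h2 : (k a : ℝ) ^ 2 ≤ ‖k‖ ^ 2 := by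
    rw [← sq_abs]
    gcongr
  rw [← div_eq_mul_inv, le_div_iff₀ (by positivity)]
  nlinarith [norm_nonneg k]

/-- The Fourier coefficients of a test function decay faster than the summable weight `decay`, with
room for one power of the energy. -/
lemma IsTorusTest.exists_decay_le {φ : (Fin d → ℝ) → ℂ} (h : IsTorusTest φ) :
    ∃ C, 0 ≤ C ∧ ∀ k : Freq d, (1 + ‖k‖ ^ 2) * ‖coeffOne φ k‖ ^ 2 ≤ C * decay k := by
  obtain ⟨C, hC⟩ := h.exists_decay (d + 1)
  have hC0 : 0 ≤ C := le_trans (by positivity) (hC 0)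
  refine ⟨C ^ 2, by positivity, fun k => ?_⟩
  have h1 : 1 + ‖k‖ ^ 2 ≤ (1 + ‖k‖) ^ 2 := by nlinarith [norm_nonneg k]
  have h2 := one_le_mul_decay k
  have h3 := decay_pos k
  calc (1 + ‖k‖ ^ 2) * ‖coeffOne φ k‖ ^ 2
      ≤ ((1 + ‖k‖) ^ 2 * ‖coeffOne φ k‖ ^ 2) * ((1 + ‖k‖) ^ (2 * d) * decay k) := by
        refine (mul_le_mul_of_nonneg_right h1 (by positivity)).trans ?_
        exact le_mul_of_one_le_right (by positivity) h2
    _ = ((1 + ‖k‖) ^ (d + 1) * ‖coeffOne φ k‖) ^ 2 * decay k := by ring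
    _ ≤ C ^ 2 * decay k := by
        gcongr
        exact hC k

end TestFunctions

section Seeds

variable {d : ℕ}

/-! ### The seeds as elements of the Fock space -/

lemma one_add_sum_le_prod {n : ℕ} {x : Fin n → ℝ} (hx : ∀ j, 0 ≤ x j) :
    1 + ∑ j, x j ≤ ∏ j, (1 + x j) := by
  induction n with
  | zero => simp
  | succ n ih =>
    have h0 : 0 ≤ ∑ j : Fin n, x j.succ := Finset.sum_nonneg fun j _ => hx _
    have h1 := mul_nonneg (hx 0) h0
    have h2 := mul_le_mul_of_nonneg_left (ih fun j => hx j.succ)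
      (show 0 ≤ 1 + x 0 by linarith [hx 0])
    rw [Fin.sum_univ_succ, Fin.prod_univ_succ]
    linarith

lemma energy_le_prod {n : ℕ} (k : Fin n → Freq d) : energy k ≤ d * ∏ j, (1 + ‖k j‖ ^ 2) := by
  have h1 : ∀ j, ∑ a, ((k j a : ℤ) : ℝ) ^ 2 ≤ d * ‖k j‖ ^ 2 := fun j => by
    refine (Finset.sum_le_card_nsmul _ _ (‖k j‖ ^ 2) fun a _ => ?_).trans_eq (by simp)
    rw [← sq_abs, ← Int.norm_eq_abs]
    gcongr
    exact norm_le_pi_norm (k j) a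
  have h2 : 1 + ∑ j, ‖k j‖ ^ 2 ≤ ∏ j, (1 + ‖k j‖ ^ 2) :=
    one_add_sum_le_prod fun j => by positivity
  have h3 : ∑ j, ∑ a, ((k j a : ℤ) : ℝ) ^ 2 ≤ d * ∏ j, (1 + ‖k j‖ ^ 2) := by
    refine (Finset.sum_le_sum fun j _ => h1 j).trans ?_
    rw [← Finset.mul_sum]
    gcongr
    linarith
  have h4 : 0 ≤ ∑ j, ∑ a, ((k j a : ℤ) : ℝ) ^ 2 := by positivity
  unfold energy normSq
  linarith

/-- A rapidly decaying symmetric kernel is a source. -/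
lemma exists_isSource {i : ℕ} {f : Kernels d}
    (symm : ∀ (n : ℕ) (σ : Equiv.Perm (Fin n)) (k : Fin n → Freq d), f n (k ∘ σ) = f n k)
    (zero_mode : ∀ (n : ℕ) (k : Fin n → Freq d), (∃ j, k j = 0) → f n k = 0)
    (chaos : ∀ n, n ≠ i → f n = 0) {C : ℝ}
    (hC : ∀ k : Fin i → Freq d,
      (∏ j, (1 + ‖k j‖ ^ 2)) * ‖f i k‖ ^ 2 ≤ C * ∏ j, decay (k j)) :
    ∃ g : L2 (Idx d), IsSource i f g := by
  have hmem : Memℓp (E := fun _ : Idx d => ℂ)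
      (fun x : Idx d => ((√(energy x.2) : ℝ) : ℂ) * coordF f x) 2 := by
    rw [memLp_iff_sqENorm, sqENorm_sigma, tsum_eq_single i]
    · have h1 : ∀ k : Fin i → Freq d, ‖((√(energy k) : ℝ) : ℂ) * coordF f ⟨i, k⟩‖ₑ ^ 2 ≤
          ENNReal.ofReal (d * i.factorial * C) * ∏ j, ENNReal.ofReal (decay (k j)) := by
        intro k
        have hp : 0 ≤ ∏ j, decay (k j) := Finset.prod_nonneg fun j _ => (decay_pos _).le
        rw [← ENNReal.ofReal_prod_of_nonneg fun j _ => (decay_pos _).le,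
          ← ENNReal.ofReal_mul' hp, ← ofReal_norm, ← ENNReal.ofReal_pow (norm_nonneg _)]
        refine ENNReal.ofReal_le_ofReal ?_
        have e : ‖((√(energy k) : ℝ) : ℂ) * coordF f ⟨i, k⟩‖ ^ 2 =
            energy k * (i.factorial * ‖f i k‖ ^ 2) := by
          simp only [coordF]
          rw [norm_mul, norm_mul, norm_mul, norm_pow, Complex.norm_I, one_pow, one_mul,
            Complex.norm_real, Complex.norm_real, Real.norm_eq_abs, Real.norm_eq_abs,
            abs_of_nonneg (Real.sqrt_nonneg _), abs_of_nonneg (Real.sqrt_nonneg _), mul_pow,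
            mul_pow, Real.sq_sqrt (energy_nonneg _), Real.sq_sqrt (by positivity)]
        rw [e]
        calc energy k * (i.factorial * ‖f i k‖ ^ 2)
            ≤ (d * ∏ j, (1 + ‖k j‖ ^ 2)) * (i.factorial * ‖f i k‖ ^ 2) := by
              gcongr
              exact energy_le_prod k
          _ = d * i.factorial * ((∏ j, (1 + ‖k j‖ ^ 2)) * ‖f i k‖ ^ 2) := by ring
          _ ≤ d * i.factorial * (C * ∏ j, decay (k j)) := by
              exact mul_le_mul_of_nonneg_left (hC k) (by positivity)
          _ = _ := by ring
      refine ne_top_of_le_ne_top ?_ (ENNReal.tsum_le_tsum h1)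
      rw [ENNReal.tsum_mul_left, tsum_pi_prod (fun k : Freq d => ENNReal.ofReal (decay k)) i]
      exact ENNReal.mul_ne_top ENNReal.ofReal_ne_top (ENNReal.pow_ne_top tsum_decay_ne_top)
    · intro n hn
      have : ∀ k : Fin n → Freq d, ((√(energy k) : ℝ) : ℂ) * coordF f ⟨n, k⟩ = 0 := fun k => by
        rw [coordF_eq_zero_iff.2, mul_zero]
        rw [chaos n hn]; rfl
      simp [sqENorm, this]
  exact ⟨⟨_, hmem⟩, symm, zero_mode, chaos, fun x => rfl⟩

lemma ofKernel_apply (n : ℕ) (F : (Fin n → Fin d → ℝ) → ℂ) (k : Fin n → Freq d)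
    [Decidable (∃ j, k j = 0)] :
    ofKernel n F n k = if ∃ j, k j = 0 then 0 else fourierCoeffs F k := by
  unfold ofKernel
  rw [Pi.single_eq_same]
  congr

lemma ofKernel_of_ne {n m : ℕ} (h : m ≠ n) (F : (Fin n → Fin d → ℝ) → ℂ) : ofKernel n F m = 0 := by
  unfold ofKernel
  rw [Pi.single_eq_of_ne h]

/-- A kernel whose Fourier coefficients are symmetric and decay rapidly is a source. -/
lemma exists_isSource_ofKernel {n : ℕ} {F : (Fin n → Fin d → ℝ) → ℂ}
    (hs : ∀ (σ : Equiv.Perm (Fin n)) (k : Fin n → Freq d),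
      fourierCoeffs F (k ∘ σ) = fourierCoeffs F k) {C : ℝ}
    (hC : ∀ k : Fin n → Freq d,
      (∏ j, (1 + ‖k j‖ ^ 2)) * ‖fourierCoeffs F k‖ ^ 2 ≤ C * ∏ j, decay (k j)) :
    ∃ g : L2 (Idx d), IsSource n (ofKernel n F) g := by
  classical
  refine exists_isSource (C := C) (fun m σ k => ?_) (fun m k hk => ?_)
    (fun m hm => ofKernel_of_ne hm F) fun k => ?_
  · by_cases hm : m = n
    · subst hm
      rw [ofKernel_apply, ofKernel_apply, hs]
      have : (∃ j, (k ∘ σ) j = 0) ↔ ∃ j, k j = 0 :=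
        ⟨fun ⟨j, hj⟩ => ⟨σ j, hj⟩, fun ⟨j, hj⟩ => ⟨σ.symm j, by simpa using hj⟩⟩
      simp only [this]
    · rw [ofKernel_of_ne hm]; rfl
  · by_cases hm : m = n
    · subst hm
      rw [ofKernel_apply, if_pos hk]
    · rw [ofKernel_of_ne hm]; rfl
  · rw [ofKernel_apply]
    split_ifs with hk
    · rw [norm_zero, zero_pow two_ne_zero, mul_zero]
      refine le_trans ?_ (hC k)
      exact mul_nonneg (Finset.prod_nonneg fun j _ => by positivity) (sq_nonneg _)
    · exact hC k

/-- The Fourier coefficients of a tensor product. -/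
lemma integral_cube_prod {n : ℕ} (F : Fin n → (Fin d → ℝ) → ℂ) :
    ∫ x in Set.univ.pi (fun _ : Fin n => cube d), ∏ j, F j (x j) = ∏ j, ∫ x in cube d, F j x := by
  rw [volume_pi, Measure.restrict_pi_pi, integral_fintype_prod_eq_prod]

lemma fourierCoeffs_one (φ : (Fin d → ℝ) → ℂ) (k : Fin 1 → Freq d) :
    fourierCoeffs (fun x => φ (x 0)) k = coeffOne φ (k 0) := by
  have h := integral_cube_prod fun (j : Fin 1) x => φ x * fourierBasis (-(k j)) x
  simp only [Fin.prod_univ_one] at h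
  unfold fourierCoeffs coeffOne
  simp only [Fin.prod_univ_one]
  exact h

/-- The two-variable Fourier coefficients of a symmetrised product are the symmetrised product of
the one-variable ones. -/
lemma fourierCoeffs_two {φ ψ : (Fin d → ℝ) → ℂ} (hφ : IsTorusTest φ) (hψ : IsTorusTest ψ)
    (k : Fin 2 → Freq d) :
    fourierCoeffs (fun x => (φ (x 0) * ψ (x 1) + ψ (x 0) * φ (x 1)) / 2) k =
      (coeffOne φ (k 0) * coeffOne ψ (k 1) + coeffOne ψ (k 0) * coeffOne φ (k 1)) / 2 := by
  have h : ∀ φ ψ : (Fin d → ℝ) → ℂ, ∫ x in Set.univ.pi (fun _ : Fin 2 => cube d),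
      (φ (x 0) * fourierBasis (-(k 0)) (x 0)) * (ψ (x 1) * fourierBasis (-(k 1)) (x 1)) =
      coeffOne φ (k 0) * coeffOne ψ (k 1) := fun φ ψ => by
    have := integral_cube_prod fun (j : Fin 2) x => (![φ, ψ] j) x * fourierBasis (-(k j)) x
    simp only [Fin.prod_univ_two, Matrix.cons_val_zero, Matrix.cons_val_one] at this
    exact this
  have hint : ∀ φ ψ : (Fin d → ℝ) → ℂ, IsTorusTest φ → IsTorusTest ψ → IntegrableOn
      (fun x : Fin 2 → Fin d → ℝ =>
        (φ (x 0) * fourierBasis (-(k 0)) (x 0)) * (ψ (x 1) * fourierBasis (-(k 1)) (x 1)))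
      (Set.univ.pi fun _ : Fin 2 => cube d) := fun φ ψ hφ hψ => by
    have hc : Continuous (fun x : Fin 2 → Fin d → ℝ =>
        (φ (x 0) * fourierBasis (-(k 0)) (x 0)) * (ψ (x 1) * fourierBasis (-(k 1)) (x 1))) := by
      have h1 := hφ.1.continuous
      have h2 := hψ.1.continuous
      have h3 := (contDiff_fourierBasis (-(k 0))).continuous
      have h4 := (contDiff_fourierBasis (-(k 1))).continuous
      fun_prop
    have hK : IsCompact (Set.univ.pi fun _ : Fin 2 =>
        Set.Icc (fun _ : Fin d => (0 : ℝ)) fun _ => 2 * Real.pi) :=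
      isCompact_univ_pi fun _ => isCompact_Icc
    refine (hc.continuousOn.integrableOn_compact hK).mono_set (Set.pi_mono fun j _ x hx => ?_)
    exact ⟨fun a => (hx a (Set.mem_univ a)).1.le, fun a => (hx a (Set.mem_univ a)).2⟩
  have e : ∀ x : Fin 2 → Fin d → ℝ, (φ (x 0) * ψ (x 1) + ψ (x 0) * φ (x 1)) / 2 *
      ∏ j, fourierBasis (-(k j)) (x j) =
      ((φ (x 0) * fourierBasis (-(k 0)) (x 0)) * (ψ (x 1) * fourierBasis (-(k 1)) (x 1)) +
        (ψ (x 0) * fourierBasis (-(k 0)) (x 0)) * (φ (x 1) * fourierBasis (-(k 1)) (x 1))) / 2 := by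
    intro x
    rw [Fin.prod_univ_two]
    ring
  unfold fourierCoeffs
  simp only [e]
  rw [integral_div]
  change (∫ x in Set.univ.pi (fun _ : Fin 2 => cube d), _) / 2 = _
  rw [integral_add (hint φ ψ hφ hψ) (hint ψ φ hψ hφ), h, h]

lemma exists_isSource_one {φ : (Fin d → ℝ) → ℂ} (hφ : IsTorusTest φ) (ψ : (Fin d → ℝ) → ℂ) :
    ∃ g : L2 (Idx d), IsSource 1 (seed φ ψ 1) g := by
  obtain ⟨C, -, hC⟩ := hφ.exists_decay_le
  refine exists_isSource_ofKernel (C := C) (fun σ k => ?_) fun k => ?_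
  · rw [Subsingleton.elim σ 1]; rfl
  · rw [fourierCoeffs_one, Fin.prod_univ_one, Fin.prod_univ_one]
    exact hC (k 0)

lemma exists_isSource_two {φ ψ : (Fin d → ℝ) → ℂ} (hφ : IsTorusTest φ) (hψ : IsTorusTest ψ) :
    ∃ g : L2 (Idx d), IsSource 2 (seed φ ψ 2) g := by
  obtain ⟨C, hC0, hC⟩ := hφ.exists_decay_le
  obtain ⟨C', hC0', hC'⟩ := hψ.exists_decay_le
  refine exists_isSource_ofKernel (C := C * C') (fun σ k => ?_) fun k => ?_
  · rw [fourierCoeffs_two hφ hψ, fourierCoeffs_two hφ hψ]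
    have h01 : σ 0 ≠ σ 1 := fun h => by simpa using σ.injective h
    simp only [Function.comp_apply]
    obtain h | h : σ 0 = 0 ∨ σ 0 = 1 := by omega
    · have : σ 1 = 1 := by omega
      rw [h, this]
    · have : σ 1 = 0 := by omega
      rw [h, this]; ring
  · rw [fourierCoeffs_two hφ hψ, Fin.prod_univ_two, Fin.prod_univ_two]
    set a := ‖coeffOne φ (k 0)‖
    set a' := ‖coeffOne φ (k 1)‖
    set b := ‖coeffOne ψ (k 0)‖
    set b' := ‖coeffOne ψ (k 1)‖
    have h1 : ‖(coeffOne φ (k 0) * coeffOne ψ (k 1) + coeffOne ψ (k 0) * coeffOne φ (k 1)) / 2‖ ≤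
        (a * b' + b * a') / 2 := by
      rw [norm_div, Complex.norm_ofNat]
      gcongr
      exact (norm_add_le _ _).trans (by rw [norm_mul, norm_mul])
    have h2 : ‖(coeffOne φ (k 0) * coeffOne ψ (k 1) + coeffOne ψ (k 0) * coeffOne φ (k 1)) / 2‖ ^ 2 ≤
        ((a * b') ^ 2 + (b * a') ^ 2) / 2 := by
      refine (pow_le_pow_left₀ (norm_nonneg _) h1 2).trans ?_
      nlinarith [sq_nonneg (a * b' - b * a')]
    have p0 : 0 ≤ 1 + ‖k 0‖ ^ 2 := by positivity
    have p1 : 0 ≤ 1 + ‖k 1‖ ^ 2 := by positivity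
    have m1 := mul_le_mul (hC (k 0)) (hC' (k 1)) (by positivity)
      (mul_nonneg hC0 (decay_pos _).le)
    have m2 := mul_le_mul (hC' (k 0)) (hC (k 1)) (by positivity)
      (mul_nonneg hC0' (decay_pos _).le)
    calc _ ≤ ((1 + ‖k 0‖ ^ 2) * (1 + ‖k 1‖ ^ 2)) * (((a * b') ^ 2 + (b * a') ^ 2) / 2) := by
          gcongr
      _ = ((1 + ‖k 0‖ ^ 2) * a ^ 2 * ((1 + ‖k 1‖ ^ 2) * b' ^ 2) +
          (1 + ‖k 0‖ ^ 2) * b ^ 2 * ((1 + ‖k 1‖ ^ 2) * a' ^ 2)) / 2 := by ring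
      _ ≤ (C * decay (k 0) * (C' * decay (k 1)) + C' * decay (k 0) * (C * decay (k 1))) / 2 := by
          gcongr
      _ = _ := by ring

/-- A Fourier mode has coefficient one at its own frequency. -/
lemma coeffOne_fourierBasis (K : Freq d) : coeffOne (fourierBasis K) K = 1 := by
  have h : ∀ x : Fin d → ℝ, fourierBasis K x * fourierBasis (-K) x =
      ((((2 * Real.pi) ^ d)⁻¹ : ℝ) : ℂ) := by
    intro x
    unfold fourierBasis
    rw [mul_mul_mul_comm, ← Complex.exp_add, ← Complex.ofReal_mul, ← Real.rpow_add (by positivity)]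
    have e1 : (-(d : ℝ) / 2 + -(d : ℝ) / 2) = -(d : ℝ) := by ring
    have e2 : Complex.I * ((∑ a, (K a : ℝ) * x a : ℝ) : ℂ) +
        Complex.I * ((∑ a, ((-K) a : ℝ) * x a : ℝ) : ℂ) = 0 := by
      rw [← mul_add, ← Complex.ofReal_add, ← Finset.sum_add_distrib]
      simp
    rw [e1, e2, Complex.exp_zero, mul_one, Real.rpow_neg (by positivity), Real.rpow_natCast]
  unfold coeffOne
  simp only [h]
  rw [setIntegral_const, measureReal_def, volume_cube, ENNReal.toReal_pow,
    ENNReal.toReal_ofReal (by positivity), Complex.real_smul, ← Complex.ofReal_mul,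
    mul_inv_cancel₀ (by positivity), Complex.ofReal_one]

end Seeds

section Conclusion

variable {d : ℕ}

/-! ### Existence, limits and uniqueness of the diffusivities -/

lemma isTruncSol_iff (w : Fin d → ℝ) (ε : ℝ) (i n : ℕ) (φ ψ : (Fin d → ℝ) → ℂ) (v : Kernels d) :
    IsTruncSol w ε (i + 1) n φ ψ v ↔ IsSol w ε i n (seed φ ψ i) v :=
  ⟨fun h => ⟨h.isFock, h.proj_eq, h.eqn⟩, fun h => ⟨h.isFock, h.proj_eq, h.eqn⟩⟩

lemma exists_isSource_seed {i : ℕ} (hi : i = 1 ∨ i = 2) {φ ψ : (Fin d → ℝ) → ℂ}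
    (hφ : IsTorusTest φ) (hψ : IsTorusTest ψ) :
    ∃ g : L2 (Idx d), IsSource i (seed φ ψ i) g := by
  obtain rfl | rfl := hi
  · exact exists_isSource_one hφ ψ
  · exact exists_isSource_two hφ hψ

lemma tendsto_defectOp (hd : 3 ≤ d) (w : Fin d → ℝ) {D : ℕ → ℝ}
    (hD : ∀ m, 2 ≤ m → ∀ K : Freq d, K ≠ 0 →
      Tendsto (fun ε => diffusivity w ε m K) (𝓝[scales] 0) (𝓝 (D m : ℂ)))
    {i n : ℕ} (hi : i = 1 ∨ i = 2) (hn : i + 1 ≤ n) {f : Kernels d} {g : L2 (Idx d)}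
    (hg : IsSource i f g) :
    Tendsto (fun ε => ‖defectOp w (D (n - (i + 1) + 2)) ε i n g‖) (𝓝[scales] 0) (𝓝 0) := by
  obtain rfl | rfl := hi
  · rw [show n - (1 + 1) + 2 = n by omega]
    exact tendsto_defectOp_one hd w (hD n hn) hg.isSymm hg.supported
  · obtain ⟨m, rfl⟩ : ∃ m, n = m + 1 := ⟨n - 1, by omega⟩
    rw [show m + 1 - (2 + 1) + 2 = m by omega]
    exact tendsto_defectOp_two hd w (by omega) (hD m (by omega)) hg.isSymm hg.supported

lemma tendsto_invSqrt_resOp (hd : 3 ≤ d) (w : Fin d → ℝ) {i n : ℕ} (hi : i = 1 ∨ i = 2)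
    (hn : i + 1 ≤ n) {f : Kernels d} {g : L2 (Idx d)} (hg : IsSource i f g) :
    Tendsto (fun ε => ‖invSqrtOp d (resOp w ε i n g)‖) (𝓝[scales] 0) (𝓝 0) := by
  obtain rfl | rfl := hi
  · exact tendsto_invSqrt_resOp_one hd w hn hg.isSymm hg.supported
  · obtain ⟨m, rfl⟩ : ∃ m, n = m + 1 := ⟨n - 1, by omega⟩
    exact tendsto_invSqrt_resOp_two hd w (by omega) hg.isSymm hg.supported

lemma tendsto_ofReal_zero {u : ℝ → ℝ} {l : Filter ℝ} (h : Tendsto u l (𝓝 0)) :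
    Tendsto (fun ε => ENNReal.ofReal (u ε)) l (𝓝 0) := by
  simpa using ENNReal.tendsto_ofReal h

lemma hasDiffusivity (hd : 3 ≤ d) (w : Fin d → ℝ) {D : ℕ → ℝ}
    (hD : ∀ m, 2 ≤ m → ∀ K : Freq d, K ≠ 0 →
      Tendsto (fun ε => diffusivity w ε m K) (𝓝[scales] 0) (𝓝 (D m : ℂ)))
    {i n : ℕ} (hi : i = 1 ∨ i = 2) (hn : i + 1 ≤ n) :
    HasDiffusivity w (i + 1) n (D (n - (i + 1) + 2)) := by
  intro φ ψ hφ hψ v hv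
  obtain ⟨g, hg⟩ := exists_isSource_seed hi hφ hψ
  refine (tendsto_ofReal_zero (tendsto_defectOp hd w hD hi hn hg)).congr' ?_
  filter_upwards [eventually_scales] with ε hε
  exact (hg.fockNorm_defect hd w (scales_pos hε) (by omega) hn
    ((isTruncSol_iff w ε i n φ ψ (v ε)).1 (hv ε hε)) _).symm

lemma existsUnique_isTruncSol (hd : 3 ≤ d) (w : Fin d → ℝ) {i n : ℕ} (hi : i = 1 ∨ i = 2)
    (hn : i + 1 ≤ n) {φ ψ : (Fin d → ℝ) → ℂ} (hφ : IsTorusTest φ) (hψ : IsTorusTest ψ) {ε : ℝ}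
    (hε : ε ∈ scales) : ∃! v : Kernels d, IsTruncSol w ε (i + 1) n φ ψ v := by
  obtain ⟨g, hg⟩ := exists_isSource_seed hi hφ hψ
  simp only [isTruncSol_iff]
  exact hg.existsUnique hd w (scales_pos hε) (by omega) hn

lemma tendsto_fockNorm_sol (hd : 3 ≤ d) (w : Fin d → ℝ) {i n : ℕ} (hi : i = 1 ∨ i = 2)
    (hn : i + 1 ≤ n) {φ ψ : (Fin d → ℝ) → ℂ} (hφ : IsTorusTest φ) (hψ : IsTorusTest ψ)
    {v : ℝ → Kernels d} (hv : ∀ ε ∈ scales, IsTruncSol w ε (i + 1) n φ ψ (v ε)) :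
    Tendsto (fun ε => fockNorm (v ε)) (𝓝[scales] 0) (𝓝 0) := by
  obtain ⟨g, hg⟩ := exists_isSource_seed hi hφ hψ
  refine (tendsto_ofReal_zero (tendsto_invSqrt_resOp hd w hi hn hg)).congr' ?_
  filter_upwards [eventually_scales] with ε hε
  exact (hg.fockNorm_sol hd w (scales_pos hε) (by omega) hn
    ((isTruncSol_iff w ε i n φ ψ (v ε)).1 (hv ε hε))).symm

lemma exists_dot_ne_zero {w : Fin d → ℝ} (hw : w ≠ 0) : ∃ K : Freq d, dot w K ≠ 0 := by
  obtain ⟨a, ha⟩ := Function.ne_iff.1 hw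
  refine ⟨Pi.single a 1, ?_⟩
  have : dot w (Pi.single a 1) = w a := by
    unfold dot
    rw [Finset.sum_eq_single a]
    · simp
    · intro b _ hb
      simp [hb]
    · simp
  rw [this]
  exact ha

lemma seed_fourierBasis_ne_zero {i : ℕ} (hi : i = 1 ∨ i = 2) {K : Freq d} (hK : K ≠ 0) :
    seed (fourierBasis K) (fourierBasis K) i i (fun _ => K) ≠ 0 := by
  classical
  have h1 := coeffOne_fourierBasis K
  obtain rfl | rfl := hi
  · have : seed (fourierBasis K) (fourierBasis K) 1 1 (fun _ => K) = 1 := by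
      rw [seed, ofKernel_apply, if_neg (by simpa using hK), fourierCoeffs_one, h1]
    rw [this]
    exact one_ne_zero
  · have : seed (fourierBasis K) (fourierBasis K) 2 2 (fun _ => K) = 1 := by
      rw [seed, ofKernel_apply, if_neg (by simpa using hK),
        fourierCoeffs_two (isTorusTest_fourierBasis K) (isTorusTest_fourierBasis K), h1]
      norm_num
    rw [this]
    exact one_ne_zero

/-- The diffusivity is determined by the limit, by testing with a Fourier mode `K` such that
`w · K ≠ 0`. -/
lemma HasDiffusivity.eq (hd : 3 ≤ d) {w : Fin d → ℝ} (hw : w ≠ 0) {i n : ℕ} (hi : i = 1 ∨ i = 2)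
    (hn : i + 1 ≤ n) {c c' : ℝ} (h : HasDiffusivity w (i + 1) n c)
    (h' : HasDiffusivity w (i + 1) n c') : c = c' := by
  obtain ⟨K, hwK⟩ := exists_dot_ne_zero hw
  have hK : K ≠ 0 := by
    rintro rfl
    exact hwK (dot_zero w)
  have hφ := isTorusTest_fourierBasis K
  obtain ⟨g, hg⟩ := exists_isSource_seed hi hφ hφ
  choose! v hv using fun (ε : ℝ) (hε : ε ∈ scales) =>
    (existsUnique_isTruncSol hd w hi hn hφ hφ hε).exists
  have key : ∀ c, HasDiffusivity w (i + 1) n c →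
      Tendsto (fun ε => ‖defectOp w c ε i n g‖) (𝓝[scales] 0) (𝓝 0) := by
    intro c hc
    have h1 := (ENNReal.tendsto_toReal ENNReal.zero_ne_top).comp (hc _ _ hφ hφ v hv)
    rw [ENNReal.toReal_zero] at h1
    refine h1.congr' ?_
    filter_upwards [eventually_scales] with ε hε
    have h2 := hg.fockNorm_defect hd w (scales_pos hε) (by omega) hn
      ((isTruncSol_iff w ε i n _ _ (v ε)).1 (hv ε hε)) c
    have h3 : fockNorm (negL0Pow (-(1 / 2)) (Aminus w ε (component (i + 1) (v ε)) -
        c • L0w w (seed (fourierBasis K) (fourierBasis K) (i + 1 - 1)))) =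
        ENNReal.ofReal ‖defectOp w c ε i n g‖ := h2
    rw [Function.comp_apply, h3, ENNReal.toReal_ofReal (norm_nonneg _)]
  have hle : ∀ ε, ‖((c - c' : ℝ) : ℂ) • wSymbolOp w g‖ ≤
      ‖defectOp w c' ε i n g‖ + ‖defectOp w c ε i n g‖ := fun ε => by
    have e : ((c - c' : ℝ) : ℂ) • wSymbolOp w g =
        defectOp w c' ε i n g - defectOp w c ε i n g := by
      simp only [defectOp, sub_apply, smul_apply]
      rw [Complex.ofReal_sub, sub_smul]
      abel
    rw [e]
    exact norm_sub_le _ _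
  have h0 : ‖((c - c' : ℝ) : ℂ) • wSymbolOp w g‖ ≤ 0 := by
    have := neBot_scales
    refine ge_of_tendsto (f := fun ε => ‖defectOp w c' ε i n g‖ + ‖defectOp w c ε i n g‖)
      (x := 𝓝[scales] 0) ?_ (Eventually.of_forall hle)
    simpa using (key c' h').add (key c h)
  rw [norm_le_zero_iff, smul_eq_zero] at h0
  -- The coordinate of the seed at `(K, …, K)` does not vanish, nor does the symbol there.
  have hne : wSymbolOp w g ≠ 0 := by
    intro h0
    have h1 : wSymbolOp w g ⟨i, fun _ => K⟩ = 0 := by rw [h0]; rfl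
    have hpos : 0 < energy (fun _ : Fin i => K) := energy_pos (j := (⟨0, by omega⟩ : Fin i)) hK
    rw [wSymbolOp_apply, hg.coord, mul_eq_zero, mul_eq_zero, coordF_eq_zero_iff] at h1
    obtain h1 | h1 | h1 := h1
    · have h2 : 0 < wSymbol w (fun _ : Fin i => K) := by
        have : 0 < dot w K ^ 2 := by positivity
        have hi0 : (0 : ℝ) < i := by exact_mod_cast (show 0 < i by omega)
        unfold wSymbol
        rw [Finset.sum_const, Finset.card_fin, nsmul_eq_mul]
        positivity
      exact h2.ne' (Complex.ofReal_eq_zero.1 h1)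
    · exact (Real.sqrt_pos.2 hpos).ne' (Complex.ofReal_eq_zero.1 h1)
    · exact seed_fourierBasis_ne_zero hi hK h1
  have := Complex.ofReal_eq_zero.1 (h0.resolve_right hne)
  linarith

end Conclusion

end BurgersFock

end

theorem proposition2p13 (d : ℕ) (hd : 3 ≤ d) (w : Fin d → ℝ) (hw : w ≠ 0) :
    -- the truncated generator equation is well posed
    (∀ i n : ℕ, (i = 2 ∨ i = 3) → i ≤ n → ∀ φ ψ : (Fin d → ℝ) → ℂ,
      BurgersFock.IsTorusTest φ → BurgersFock.IsTorusTest ψ → ∀ ε ∈ BurgersFock.scales,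
        ∃! v : BurgersFock.Kernels d, BurgersFock.IsTruncSol w ε i n φ ψ v) ∧
    -- the limiting diffusivities exist, are positive and unique
    (∃ D : ℕ → ℝ, (∀ m : ℕ, 2 ≤ m → 0 < D m) ∧
      ∀ i n : ℕ, (i = 2 ∨ i = 3) → i ≤ n →
        BurgersFock.HasDiffusivity w i n (D (n - i + 2)) ∧
        ∀ c : ℝ, BurgersFock.HasDiffusivity w i n c → c = D (n - i + 2)) ∧
    -- the solutions vanish in the limit
    (∀ i n : ℕ, (i = 2 ∨ i = 3) → i ≤ n → ∀ φ ψ : (Fin d → ℝ) → ℂ,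
      BurgersFock.IsTorusTest φ → BurgersFock.IsTorusTest ψ →
      ∀ v : ℝ → BurgersFock.Kernels d,
        (∀ ε ∈ BurgersFock.scales, BurgersFock.IsTruncSol w ε i n φ ψ (v ε)) →
        Filter.Tendsto (fun ε => BurgersFock.fockNorm (v ε))
          (nhdsWithin 0 BurgersFock.scales) (nhds 0)) := by
  have shift : ∀ i : ℕ, i = 2 ∨ i = 3 → ∃ j, (j = 1 ∨ j = 2) ∧ i = j + 1 := fun i hi =>
    ⟨i - 1, by omega, by omega⟩
  refine ⟨fun i n hi hn φ ψ hφ hψ ε hε => ?_, ?_, fun i n hi hn φ ψ hφ hψ v hv => ?_⟩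
  · obtain ⟨j, hj, rfl⟩ := shift i hi
    exact BurgersFock.existsUnique_isTruncSol hd w hj hn hφ hψ hε
  · choose! D hD0 hD using fun (m : ℕ) (hm : 2 ≤ m) => BurgersFock.exists_diffusivity hd w hm
    refine ⟨D, hD0, fun i n hi hn => ?_⟩
    obtain ⟨j, hj, rfl⟩ := shift i hi
    have h := BurgersFock.hasDiffusivity hd w hD hj hn
    exact ⟨h, fun c hc => hc.eq hd hw hj hn h⟩
  · obtain ⟨j, hj, rfl⟩ := shift i hi
    exact BurgersFock.tendsto_fockNorm_sol hd w hj hn hφ hψ hv
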